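/- Let $d\ge 2$ and let $\mathcal A$ be a finite alphabet with at least two elements. Local interactions are functions $\gamma:\mathcal A\to(0,\infty)$ and $\beta_i:\mathcal A\times\mathcal A\to[0,\infty)$, $i=1,\dots,d$. For finite $S\subset\mathbb Z^d$ and $w\in\mathcal A^S$ put $I(w)=\prod_{v\in S}\gamma(w_v)\prod_{i=1}^d\prod_{v\in S,\,v+e_i\in S}\beta_i(w_v,w_{v+e_i})$. Let $\partial V$ be the set of sites outside $V$ that are adjacent to $V$. A configuration $\delta\in\mathcal A^{\partial V}$ is $V$-admissible if $I(w\delta)>0$ for some $w\in\mathcal A^V$, and then $\Lambda^\delta(w)=I(w\delta)/\sum_{x\in\mathcal A^V}I(x\delta)$ defines a probability measure on $\mathcal A^V$, regarded also as one on the configurations on $V\cup\partial V$ that agree with $\delta$ on $\partial V$. The specification $\{\Lambda^\delta\}$ satisfies strong spatial mixing (SSM) if there are $C,\alpha>0$ such that for all finite $V\subset\mathbb Z^d$, $u\in V$, $\partial V\subseteq T\subseteq V\cup\partial V$, $x\in\mathcal A^{\{u\}}$ and $y,z\in\mathcal A^T$ for which $\delta=y|_{\partial V}$, $\eta=z|_{\partial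 V}$ are $V$-admissible and $\Lambda^\delta(y),\Lambda^\eta(z)>0$, one has $|\Lambda^\delta(x\mid y)-\Lambda^\eta(x\mid z)|\le Ce^{-\alpha\, d(\{u\},D(y,z))}$, where $D(y,z)=\{v: y_v\ne z_v\}$ and $d$ is the $L^1$ distance. A stationary Gibbs measure for the specification is a translation-invariant Borel probability measure $\mu$ on $\mathcal A^{\mathbb Z^d}$ that is a nearest-neighbour Markov random field and such that, for every finite $V$ and every $\delta\in\mathcal A^{\partial V}$ with $\mu(\delta)>0$, $\delta$ is $V$-admissible and $\mu(x\mid\delta)=\Lambda^\delta(x)$ for all $x\in\mathcal A^V$. Its entropy is $$h(\mu)=\lim_{j_1,\dots,j_d\to\infty}\frac1{j_1\cdots j_d}\sum_{w}-\mu(w)\log\mu(w),$$ with $w$ ranging over the configurations on $\prod_{i=1}^d[1,j_i]$. Algorithms compute with natural numbers, time is counted in bit operations (up to polynomial factors, oracle Turing machine time), and the only access to the real numbers $\gamma(a),\beta_i(a,b)$ is through a supply of approximations: asked for a parameter $p$ and a precision $k\in\mathbb N$, it returns some $m\in\mathbb N$ with $|m/2^k-p|\le 2^{-k}$. The cost of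 computing these approximations is not counted (only that of writing the question and the answer). Fix $d\ge2$, $\mathcal A$, and the set $Z$ of triples $(i,a,b)$ at which $\beta_i(a,b)=0$. There are algorithms $M$ and $M'$, depending only on $d,\mathcal A,Z$, such that for all local interactions with this zero set whose specification satisfies SSM, and for every stationary Gibbs measure $\mu$ for that specification, the limit defining $h(\mu)$ exists and: 1. There are $c>0$, $K$ and $N$ such that, for every supply of approximations and every $n\in\mathbb N$, $M$ halts on input $n$ with rational numbers $\ell_n\le h(\mu)\le u_n$, and for $n\ge N$ one has $u_n-\ell_n\le e^{-cn}$ and the running time is at most $e^{Kn^{(d-1)^2}}$. That is, $M$ computes upper and lower bounds to $h(\mu)$ within tolerance $e^{-\Omega(n)}$ in time $e^{O(n^{(d-1)^2})}$. 2. If $d=2$, there are $K,r\in\mathbb N$ such that, for every supply of approximations and every integer $k\ge1$, $M'$ halts on input $k$ after at most $Kk^r$ steps with rational numbers $\ell\le h(\mu)\le u$ with $u-\ell\le 1/k$. That is, $h(\mu)$ can be approximated to within $\epsilon=1/k$ in time polynomial in $1/\epsilon$. -/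

import Mathlib

universe u

namespace GibbsEntropy

/-! ### The lattice, configurations, measures -/

/-- Sites of the `d`-dimensional cubic lattice. -/
abbrev Site (d : ℕ) : Type := Fin d → ℤ

/-- The `L¹` distance; two sites are adjacent when it equals `1`. -/
def dist1 {d : ℕ} (v w : Site d) : ℕ := ∑ i, (v i - w i).natAbs

/-- The `i`-th standard basis vector. -/
def unitVec {d : ℕ} (i : Fin d) : Site d := Pi.single i 1

/-- The boundary `∂S`: the sites outside `S` that are adjacent to a site of `S`
(the union of cubes only serves to make the set finite, see `mem_boundary`). -/
noncomputable def boundary {d : ℕ} (S : Finset (Site d)) : Finset (Site d) :=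
  (S.biUnion fun v => Finset.Icc (v - 1) (v + 1)).filter
    fun v => v ∉ S ∧ ∃ w ∈ S, dist1 v w = 1

theorem mem_boundary {d : ℕ} (S : Finset (Site d)) (v : Site d) :
    v ∈ boundary S ↔ v ∉ S ∧ ∃ w ∈ S, dist1 v w = 1 := by
  simp only [boundary, Finset.mem_filter, Finset.mem_biUnion, Finset.mem_Icc,
    and_iff_right_iff_imp]
  rintro ⟨-, w, hw, h⟩
  have key : ∀ i, (v i - w i).natAbs ≤ 1 := fun i => by
    rw [← h]
    exact Finset.single_le_sum (f := fun i => (v i - w i).natAbs)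
      (fun _ _ => Nat.zero_le _) (Finset.mem_univ i)
  refine ⟨w, hw, fun i => ?_, fun i => ?_⟩ <;>
  · have := key i
    simp only [Pi.sub_apply, Pi.add_apply, Pi.one_apply]
    omega

/-- A configuration with finite shape `S`. -/
abbrev Config {d : ℕ} (A : Type u) (S : Finset (Site d)) : Type u := S → A

/-- Concatenation of two configurations (used for disjoint shapes). -/
def concat {d : ℕ} {A : Type u} {S T : Finset (Site d)} (x : Config A S) (y : Config A T) :
    Config A (S ∪ T) :=
  fun v => if h : v.1 ∈ S then x ⟨v.1, h⟩
    else y ⟨v.1, (Finset.mem_union.mp v.2).resolve_left h⟩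

/-- The cylinder set `[w]`. -/
def cyl {d : ℕ} {A : Type u} {S : Finset (Site d)} (w : Config A S) : Set (Site d → A) :=
  {x | ∀ v : S, x v.1 = w v}

/-- The shift `σ_v`. -/
def shift {d : ℕ} {A : Type u} (v : Site d) (x : Site d → A) : Site d → A := fun w => x (w + v)

section Measures

variable {d : ℕ} {A : Type u} [MeasurableSpace A]

/-- Translation invariance. -/
def IsStationary (μ : MeasureTheory.Measure (Site d → A)) : Prop :=
  ∀ v : Site d, MeasureTheory.MeasurePreserving (shift v) μ μ

open ProbabilityTheory in
/-- The (nearest-neighbour) Markov random field property. -/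
def IsMRF (μ : MeasureTheory.Measure (Site d → A)) : Prop :=
  ∀ (S T : Finset (Site d)) (hT : boundary S ⊆ T), Disjoint S T →
    ∀ (η : Config A S) (δ : Config A T), 0 < μ (cyl δ) →
      μ[cyl η | cyl (Finset.restrict₂ (π := fun _ => A) hT δ)] = μ[cyl η | cyl δ]

/-- The entropy `H_μ(S)` of `μ` on a finite set `S` (`Real.negMulLog p = -p log p`, which is `0`
at `p = 0`). -/
noncomputable def shapeEntropy [Fintype A] (μ : MeasureTheory.Measure (Site d → A))
    (S : Finset (Site d)) : ℝ :=
  ∑ w : Config A S, Real.negMulLog (μ.real (cyl w))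

/-- The box `[1, j₁] × ⋯ × [1, j_d]`. -/
noncomputable def box (j : Fin d → ℕ) : Finset (Site d) := Finset.Icc (fun _ => 1) (fun i => (j i : ℤ))

/-- `h` is the measure-theoretic entropy of `μ`: the normalised entropies of the boxes converge
to `h` as all side lengths tend to infinity (at arbitrary rates). -/
def HasEntropy [Fintype A] (μ : MeasureTheory.Measure (Site d → A)) (h : ℝ) : Prop :=
  Filter.Tendsto (fun j : Fin d → ℕ => shapeEntropy μ (box j) / ∏ i, (j i : ℝ))
    Filter.atTop (nhds h)

end Measures

/-! ### Gibbs specifications -/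

/-- Local interactions `γ : A → (0, ∞)` and `β_i : A × A → [0, ∞)`, `i = 1, …, d`. -/
structure Interactions (d : ℕ) (A : Type u) where
  γ : A → ℝ
  β : Fin d → A → A → ℝ
  γ_pos : ∀ a, 0 < γ a
  β_nonneg : ∀ i a b, 0 ≤ β i a b

namespace Interactions

variable {d : ℕ} {A : Type u} (G : Interactions d A)

/-- The weight `I(w)` of a configuration of finite shape. -/
def weight {S : Finset (Site d)} (w : Config A S) : ℝ :=
  (∏ v : S, G.γ (w v)) *
    ∏ i : Fin d, ∏ v : S,
      if h : v.1 + unitVec i ∈ S then G.β i (w v) (w ⟨v.1 + unitVec i, h⟩) else 1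

/-- `V`-admissibility of a configuration on `∂V`. -/
def Admissible {V : Finset (Site d)} (δ : Config A (boundary V)) : Prop :=
  ∃ w : Config A V, 0 < G.weight (concat w δ)

variable [Fintype A]

/-- The specification: `Λ^δ(w)` for `δ` on `∂V` and `w` on `V`. -/
noncomputable def spec {V : Finset (Site d)} (δ : Config A (boundary V)) (w : Config A V) : ℝ :=
  G.weight (concat w δ) / ∑ x : Config A V, G.weight (concat x δ)

open scoped Classical in
/-- `Λ^δ` regarded as a probability on configurations on `V ∪ ∂V` that agree with `δ` on `∂V`:
the probability of the event `E`. -/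
noncomputable def specProb {V : Finset (Site d)} (δ : Config A (boundary V))
    (E : Set (Config A (V ∪ boundary V))) : ℝ :=
  ∑ w : Config A V, if concat w δ ∈ E then G.spec δ w else 0

end Interactions

/-- The event, inside the configurations on `S`, of agreeing with `y` on `T ⊆ S`. -/
def agree {d : ℕ} {A : Type u} {S T : Finset (Site d)} (h : T ⊆ S) (y : Config A T) :
    Set (Config A S) :=
  {c | Finset.restrict₂ (π := fun _ => A) h c = y}

/-- The distance from `v` to the set `D(y, z)` of sites at which `y` and `z` differ. (The value
is `0` if `y = z`; it is only used to bound a quantity that then vanishes.) -/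
noncomputable def diffDist {d : ℕ} {A : Type u} {T : Finset (Site d)} (v : Site d)
    (y z : Config A T) : ℕ :=
  sInf {k | ∃ w : T, y w ≠ z w ∧ k = dist1 v w.1}

/-- Strong spatial mixing of the specification: with `δ = y|_{∂V}` and `η = z|_{∂V}`,
`|Λ^δ(x | y) - Λ^η(x | z)| ≤ C e^{-α d({u}, D(y, z))}` for every symbol `x` at every `u ∈ V`. -/
def Interactions.SSM {d : ℕ} {A : Type u} [Fintype A] (G : Interactions d A) : Prop :=
  ∃ C > (0 : ℝ), ∃ α > (0 : ℝ),
    ∀ (V T : Finset (Site d)) (h₁ : boundary V ⊆ T) (h₂ : T ⊆ V ∪ boundary V)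
      (u : Site d) (hu : u ∈ V) (x : A) (y z : Config A T)
      (δ η : Config A (boundary V)),
      δ = Finset.restrict₂ (π := fun _ => A) h₁ y →
      η = Finset.restrict₂ (π := fun _ => A) h₁ z →
      G.Admissible δ → G.Admissible η →
      0 < G.specProb δ (agree h₂ y) → 0 < G.specProb η (agree h₂ z) →
      |G.specProb δ ({c | c ⟨u, Finset.mem_union_left _ hu⟩ = x} ∩ agree h₂ y)
            / G.specProb δ (agree h₂ y)
          - G.specProb η ({c | c ⟨u, Finset.mem_union_left _ hu⟩ = x} ∩ agree h₂ z)
            / G.specProb η (agree h₂ z)|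
        ≤ C * Real.exp (-α * diffDist u y z)

open ProbabilityTheory in
/-- `μ` is a stationary Gibbs measure for the specification defined by `G`. -/
structure Interactions.IsGibbs {d : ℕ} {A : Type u} [Fintype A] [MeasurableSpace A]
    (G : Interactions d A) (μ : MeasureTheory.Measure (Site d → A)) : Prop where
  isProbability : MeasureTheory.IsProbabilityMeasure μ
  stationary : IsStationary μ
  isMRF : IsMRF μ
  admissible : ∀ (V : Finset (Site d)) (δ : Config A (boundary V)),
    0 < μ (cyl δ) → G.Admissible δ
  cond_eq : ∀ (V : Finset (Site d)) (δ : Config A (boundary V)), 0 < μ (cyl δ) →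
    ∀ x : Config A V, μ[|cyl δ].real (cyl x) = G.spec δ x

/-! ### Algorithms and running time -/

/-- Programs with `n` inputs in `ℕ` and one output in `ℕ`: Kleene's recursive functions with
binary arithmetic as primitives and with query instructions for the
external functions named by `P`. A program is a finite object, and its only constants are natural
numbers. -/
inductive Prog (P : Type u) : ℕ → Type u
  | const {n : ℕ} (k : ℕ) : Prog P n
  | proj {n : ℕ} (i : Fin n) : Prog P n
  | add : Prog P 2
  | sub : Prog P 2
  | mul : Prog P 2
  | div : Prog P 2
  | query (p : P) : Prog P 1
  | comp {m n : ℕ} (f : Prog P m) (g : Fin m → Prog P n) : Prog P n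
  | prec {n : ℕ} (f : Prog P n) (g : Prog P (n + 2)) : Prog P (n + 1)
  | search {n : ℕ} (f : Prog P (n + 1)) : Prog P n

/-- `Runs φ f x v t`: with external functions `φ`, the program `f` halts on input `x` with output
`v` after `t` elementary steps. Steps are counted at the level of bits (`Nat.size` is the length
in binary): an arithmetic operation costs the square of the total length of its arguments
(plus one), copying a number costs its length, a query costs the length of the question and of
the answer, and control costs a step, plus the length of the loop counter, each time. Up to a
polynomial this is the running time of an oracle Turing machine.

`prec f g` on `(k, x)` is the for-loop `r := f x; for i < k do r := g (i, r, x)`;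
`search f` on `x` tries `k = 0, 1, 2, …` until `f (k, x) = 0` and returns this `k`. -/
inductive Runs {P : Type u} (φ : P → ℕ → ℕ) :
    {n : ℕ} → Prog P n → (Fin n → ℕ) → ℕ → ℕ → Prop
  | const {n : ℕ} (k : ℕ) (x : Fin n → ℕ) : Runs φ (.const k) x k (1 + k.size)
  | proj {n : ℕ} (i : Fin n) (x : Fin n → ℕ) : Runs φ (.proj i) x (x i) (1 + (x i).size)
  | add (x : Fin 2 → ℕ) :
      Runs φ .add x (x 0 + x 1) ((1 + (x 0).size + (x 1).size) ^ 2)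
  | sub (x : Fin 2 → ℕ) :
      Runs φ .sub x (x 0 - x 1) ((1 + (x 0).size + (x 1).size) ^ 2)
  | mul (x : Fin 2 → ℕ) :
      Runs φ .mul x (x 0 * x 1) ((1 + (x 0).size + (x 1).size) ^ 2)
  | div (x : Fin 2 → ℕ) :
      Runs φ .div x (x 0 / x 1) ((1 + (x 0).size + (x 1).size) ^ 2)
  | query (p : P) (x : Fin 1 → ℕ) :
      Runs φ (.query p) x (φ p (x 0)) (1 + (x 0).size + (φ p (x 0)).size)
  | comp {m n : ℕ} (f : Prog P m) (g : Fin m → Prog P n) (x : Fin n → ℕ)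
      (y t : Fin m → ℕ) (v s : ℕ) (hg : ∀ i, Runs φ (g i) x (y i) (t i))
      (hf : Runs φ f y v s) :
      Runs φ (.comp f g) x v (1 + s + ∑ i, t i)
  | prec {n : ℕ} (f : Prog P n) (g : Prog P (n + 2)) (k : ℕ) (x : Fin n → ℕ) (r t : ℕ → ℕ)
      (hf : Runs φ f x (r 0) (t 0))
      (hg : ∀ i < k, Runs φ g (Fin.cons i (Fin.cons (r i) x)) (r (i + 1)) (t (i + 1))) :
      Runs φ (.prec f g) (Fin.cons k x) (r k) (∑ i ∈ Finset.range (k + 1), (1 + i.size + t i))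
  | search {n : ℕ} (f : Prog P (n + 1)) (k : ℕ) (x : Fin n → ℕ) (w t : ℕ → ℕ)
      (hf : ∀ i ≤ k, Runs φ f (Fin.cons i x) (w i) (t i))
      (hne : ∀ i < k, w i ≠ 0) (hz : w k = 0) :
      Runs φ (.search f) x k (∑ i ∈ Finset.range (k + 1), (1 + i.size + t i))

/-- An algorithm that takes one natural number and returns a lower and an upper bound, as two
fractions `lo / den` and `hi / den`. -/
structure BoundAlg (P : Type u) where
  lo : Prog P 1
  hi : Prog P 1
  den : Prog P 1

/-- On input `n` the algorithm halts after `t` steps in all with the output `a / q`, `b / q`. -/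
def BoundAlg.Outputs {P : Type u} (M : BoundAlg P) (φ : P → ℕ → ℕ) (n a b q t : ℕ) : Prop :=
  ∃ t₁ t₂ t₃ : ℕ, Runs φ M.lo ![n] a t₁ ∧ Runs φ M.hi ![n] b t₂ ∧ Runs φ M.den ![n] q t₃ ∧
    t = t₁ + t₂ + t₃

/-- Names of the parameters of the local interactions: `γ(a)` and `β_i(a, b)`. -/
abbrev Param (d : ℕ) (A : Type u) : Type u := A ⊕ (Fin d × A × A)

/-- The value of a parameter. -/
def Interactions.val {d : ℕ} {A : Type u} (G : Interactions d A) : Param d A → ℝ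
  | .inl a => G.γ a
  | .inr (i, a, b) => G.β i a b

/-- `φ` supplies approximations of the parameters with arbitrarily good precision: asked for the
parameter `p` and the precision `k`, it returns an `m` with `|m / 2^k - p| ≤ 1 / 2^k`. -/
def Interactions.Approximates {d : ℕ} {A : Type u} (G : Interactions d A)
    (φ : Param d A → ℕ → ℕ) : Prop :=
  ∀ p k, |(φ p k : ℝ) / 2 ^ k - G.val p| ≤ 1 / 2 ^ k

end GibbsEntropy

open GibbsEntropy

universe v w

set_option linter.unusedSectionVars false

namespace GibbsEntropy
open Finset

/-! ### Polynomially bounded families -/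

/-! Order the sites lexicographically. By the chain rule the entropy is that of the symbol at 0
given its past, and the task is to enclose it by finite computations although `μ` is not given.
Consider the cube of radius n + 1, its faces, and the near past: the interior sites whose numbers
precede that of 0 by at most one layer. Faces and near past contain the boundary of the set of
interior sites that do not precede 0 (`boundary_futureSites_subset`). By the Markov property L_n =
H(x_0 | faces, near past) is therefore unchanged when more past sites are added, and so is at most
H(x_0 | B) for every finite set B of past sites (`Interactions.IsGibbs.le_siteEnt`). If B contains
the whole past inside the cube, then H(x_0 | B) ≤ H(x_0 | near past) ≤ L_n + 2q√ε, where q is the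
number of symbols and ε the greatest change of a conditional probability of x_0 when the faces vary
and the near past is fixed (`Interactions.IsGibbs.siteEnt_le`). Mixing makes ε exponentially small,
so these bounds prove at once that the limit exists and that L_n ≤ h ≤ L_n + 2q√ε
(`HasEntropy.exists_of_bounds`).

L_n involves `μ` only through the law of the faces: it is a mean of the entropies `faceEnt` with
fixed faces (`condEnt_codes`), and these are made of ratios of partition functions. The least and
the greatest `faceEnt`, over faces of positive weight, thus bound L_n. They are close to each other:
mixing makes the law of the near past inside a cube of radius n/2 almost independent of the faces,
and the conditional law of x_0 almost independent of everything prescribed outside that cube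
(`Interactions.Mixing.abs_faceEnt_sub_le`). The mixing constants are not known to the algorithm; it
computes ε and the extreme entropies themselves, so its bounds are valid unconditionally and mixing
only makes them narrow.

The partition functions come from a transfer matrix. Sites are read in the order of their numbers,
and the state records the last few layers, the symbols on the faces and those of the near past
(`table_eq`, `wt_eq_codeWt`). Each of the three codes is below E = `cap`, which is exp(O(n^(d-1))),
and everything runs in time polynomial in E. Weights are computed with relative error E^(-2) and
logarithms with E terms of a series, which costs O(q/E) in the entropy, and E ≥ 2^n
(`approximate_wt`, `Approximate.upperBd_sub_lowerBd_le`). The zero set `Z` is what makes relative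
precision possible: zeros are entered exactly, and the precision is raised until all other
parameters are seen to be positive. If d = 2 then E is only exponential in n, hence polynomial in
the accuracy; the second algorithm tries n = 0, 1, … until its own two bounds are within 1/k.

Running times are handled by a calculus: `Ctx.Feas` is closed under arithmetic, bounded loops and
search, so programs are never written down. They are uniform because a single context comprises all
supplies and all inputs (`exists_prog`). -/

theorem size_mul_le (a b : ℕ) : (a * b).size ≤ a.size + b.size := by
  rw [Nat.size_le, pow_add]
  exact Nat.mul_lt_mul'' (Nat.lt_size_self a) (Nat.lt_size_self b)

theorem size_le_self (a : ℕ) : a.size ≤ a := Nat.size_le.2 Nat.lt_two_pow_self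

theorem size_add_le (a b : ℕ) : (a + b).size ≤ a.size + b.size + 1 := by
  rw [Nat.size_le, pow_succ, pow_add]
  have ha := Nat.lt_size_self a
  have hb := Nat.lt_size_self b
  nlinarith [Nat.one_le_two_pow (n := a.size), Nat.one_le_two_pow (n := b.size)]

/-- Every instruction is charged at least the length of what it writes. This is why a value computed
in polynomial time has polynomial length, with no separate estimate (`Ctx.Feas.polyBd_size`). -/
theorem Runs.size_le {P : Type u} {φ : P → ℕ → ℕ} {n : ℕ} {p : Prog P n} {x : Fin n → ℕ}
    {v t : ℕ} (h : Runs φ p x v t) : v.size ≤ t := by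
  induction h with
  | const k x => omega
  | proj i x => omega
  | add x => have := size_add_le (x 0) (x 1); nlinarith
  | sub x =>
    have := Nat.size_le_size (Nat.sub_le (x 0) (x 1)); nlinarith [Nat.zero_le (x 1).size]
  | mul x => have := size_mul_le (x 0) (x 1); nlinarith
  | div x =>
    have := Nat.size_le_size (Nat.div_le_self (x 0) (x 1)); nlinarith [Nat.zero_le (x 1).size]
  | query p x => omega
  | comp f g x y t v s hg hf ihg ihf => omega
  | prec f g k x r t hf hg ihf ihg =>
    have h1 : (r k).size ≤ t k := by
      cases k with
      | zero => exact ihf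
      | succ k => exact ihg k (Nat.lt_succ_self k)
    have h2 := Finset.single_le_sum (f := fun i => 1 + i.size + t i) (fun _ _ => Nat.zero_le _)
      (Finset.self_mem_range_succ k)
    omega
  | search f k x w t hf hne hz ih =>
    have h2 := Finset.single_le_sum (f := fun i => 1 + i.size + t i) (fun _ _ => Nat.zero_le _)
      (Finset.self_mem_range_succ k)
    omega

/-- `f` is bounded by a polynomial in the resource parameter `M`. -/
def PolyBd {Ω : Type v} (M f : Ω → ℕ) : Prop := ∃ c : ℕ, ∀ ω, f ω ≤ (M ω + 2) ^ c

namespace PolyBd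

variable {Ω : Type v} {Ω' : Type w} {M f g : Ω → ℕ}

theorem mono (hf : PolyBd M f) (h : ∀ ω, g ω ≤ f ω) : PolyBd M g :=
  hf.imp fun _ hc ω => (h ω).trans (hc ω)

/-- The base `M ω + 2` is at least 2 even if `M ω = 0`, so constants can be absorbed into the
exponent and a single number `c` describes the bound. -/
theorem const (a : ℕ) : PolyBd M fun _ => a :=
  ⟨a, fun ω => Nat.lt_two_pow_self.le.trans (Nat.pow_le_pow_left (by omega) a)⟩

theorem self : PolyBd M M := ⟨1, fun ω => by simp⟩

theorem mul (hf : PolyBd M f) (hg : PolyBd M g) : PolyBd M fun ω => f ω * g ω := by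
  obtain ⟨a, ha⟩ := hf
  obtain ⟨b, hb⟩ := hg
  exact ⟨a + b, fun ω => by rw [pow_add]; exact Nat.mul_le_mul (ha ω) (hb ω)⟩

theorem add (hf : PolyBd M f) (hg : PolyBd M g) : PolyBd M fun ω => f ω + g ω := by
  obtain ⟨a, ha⟩ := hf
  obtain ⟨b, hb⟩ := hg
  -- The additional power pays for the factor 2 in the sum of two equal bounds.
  refine ⟨a + b + 1, fun ω => ?_⟩
  have h1 : (M ω + 2) ^ a ≤ (M ω + 2) ^ (a + b) := Nat.pow_le_pow_right (by omega) (by omega)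
  have h2 : (M ω + 2) ^ b ≤ (M ω + 2) ^ (a + b) := Nat.pow_le_pow_right (by omega) (by omega)
  rw [pow_succ]
  have := ha ω
  have := hb ω
  nlinarith

theorem pow (hf : PolyBd M f) (k : ℕ) : PolyBd M fun ω => f ω ^ k := by
  obtain ⟨a, ha⟩ := hf
  exact ⟨a * k, fun ω => by rw [pow_mul]; exact Nat.pow_le_pow_left (ha ω) k⟩

theorem size (hf : PolyBd M f) : PolyBd M fun ω => (f ω).size := hf.mono fun _ => size_le_self _

theorem reindex (hf : PolyBd M f) (g : Ω' → Ω) :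
    PolyBd (fun ω => M (g ω)) fun ω => f (g ω) :=
  hf.imp fun _ hc ω => hc (g ω)

theorem finsetSum {ι : Type*} (s : Finset ι) {F : ι → Ω → ℕ} (h : ∀ i, PolyBd M (F i)) :
    PolyBd M fun ω => ∑ i ∈ s, F i ω := by
  classical
  induction s using Finset.induction_on with
  | empty => simpa using const 0
  | insert a s ha ih => simpa [Finset.sum_insert ha] using (h a).add ih

/-- One exponent has to serve all passes of the loop. Indexing the hypothesis by pairs of a
parameter and a loop counter expresses this uniformity. -/
theorem sumRange {k : Ω → ℕ} {h : Ω → ℕ → ℕ} (hk : PolyBd M k)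
    (hh : PolyBd (fun p : Σ ω, Fin (k ω) => M p.1) fun p => h p.1 p.2) :
    PolyBd M fun ω => ∑ i ∈ range (k ω), h ω i := by
  obtain ⟨c, hc⟩ := hh
  have : PolyBd M fun ω => k ω * (M ω + 2) ^ c := hk.mul ⟨c, fun _ => le_rfl⟩
  refine this.mono fun ω => ?_
  refine (Finset.sum_le_card_nsmul _ _ ((M ω + 2) ^ c) fun i hi => ?_).trans (by simp)
  exact hc ⟨ω, ⟨i, Finset.mem_range.1 hi⟩⟩

end PolyBd

/-! ### Feasible families of numbers -/

/-- A family of inputs `env ω` for programs, with external functions `orc ω` and resource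
parameter `M ω` in which the length of the inputs is polynomially bounded. -/
structure Ctx (P : Type u) (Ω : Type v) where
  orc : Ω → P → ℕ → ℕ
  M : Ω → ℕ
  n : ℕ
  env : Ω → Fin n → ℕ
  bd : ∀ i, PolyBd M fun ω => (env ω i).size

namespace Ctx

variable {P : Type u} {Ω : Type v} {Ω' : Type w}

/-- The number `f ω` is computed from the inputs of the context by one program, in time
polynomial in the resource parameter. -/
def Feas (Γ : Ctx P Ω) (f : Ω → ℕ) : Prop :=
  ∃ (p : Prog P Γ.n) (τ : Ω → ℕ), PolyBd Γ.M τ ∧ ∀ ω, Runs (Γ.orc ω) p (Γ.env ω) (f ω) (τ ω)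

/-- Pullback of a context. -/
def reindex (Γ : Ctx P Ω) (g : Ω' → Ω) : Ctx P Ω' where
  orc ω := Γ.orc (g ω)
  M ω := Γ.M (g ω)
  n := Γ.n
  env ω := Γ.env (g ω)
  bd i := (Γ.bd i).reindex g

/-- Extension of a context by an input. -/
def bind (Γ : Ctx P Ω) (v : Ω → ℕ) (hv : PolyBd Γ.M fun ω => (v ω).size) : Ctx P Ω where
  orc := Γ.orc
  M := Γ.M
  n := Γ.n + 1
  env ω := Fin.cons (v ω) (Γ.env ω)
  bd i := by
    refine Fin.cases ?_ (fun i => ?_) i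
    · simpa using hv
    · simpa using Γ.bd i

theorem polyBd_index {M k : Ω → ℕ} (hk : PolyBd M k) :
    PolyBd (fun p : Σ ω, Fin (k ω) => M p.1) fun p => (p.2 : ℕ) :=
  (hk.reindex (Sigma.fst : (Σ ω, Fin (k ω)) → Ω)).mono fun p => p.2.2.le

/-- The context of the body of a loop that runs `k` times. -/
def loop (Γ : Ctx P Ω) (k : Ω → ℕ) (hk : PolyBd Γ.M k) : Ctx P (Σ ω, Fin (k ω)) :=
  (Γ.reindex Sigma.fst).bind (fun p => p.2) (polyBd_index hk).size

variable {Γ Δ : Ctx P Ω} {f g : Ω → ℕ}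

namespace Feas

theorem congr (hf : Γ.Feas f) (h : ∀ ω, f ω = g ω) : Γ.Feas g := by
  rwa [← funext h]

theorem polyBd_size (hf : Γ.Feas f) : PolyBd Γ.M fun ω => (f ω).size := by
  obtain ⟨p, τ, hτ, h⟩ := hf
  exact hτ.mono fun ω => (h ω).size_le

theorem env (Γ : Ctx P Ω) (i : Fin Γ.n) : Γ.Feas fun ω => Γ.env ω i :=
  ⟨.proj i, _, (PolyBd.const 1).add (Γ.bd i), fun ω => .proj i _⟩

theorem const (a : ℕ) : Γ.Feas fun _ => a :=
  ⟨.const a, _, PolyBd.const (1 + a.size), fun ω => .const a _⟩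

theorem comp {m : ℕ} (p : Prog P m) {y : Ω → Fin m → ℕ} (hy : ∀ i, Γ.Feas fun ω => y ω i)
    {τ : Ω → ℕ} (hτ : PolyBd Γ.M τ) (h : ∀ ω, Runs (Γ.orc ω) p (y ω) (f ω) (τ ω)) :
    Γ.Feas f := by
  choose g t ht hg using hy
  exact ⟨.comp p g, _, ((PolyBd.const 1).add hτ).add (PolyBd.finsetSum univ ht),
    fun ω => .comp p g _ _ (fun i => t i ω) _ _ (fun i => hg i ω) (h ω)⟩

/-- Weakening and exchange of variables in one rule: the program for `Δ` is composed with programs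
that produce the inputs of `Δ` from those of `Γ`. -/
theorem subst (hf : Δ.Feas f) (ho : Δ.orc = Γ.orc) (hM : Δ.M = Γ.M)
    (he : ∀ i, Γ.Feas fun ω => Δ.env ω i) : Γ.Feas f := by
  obtain ⟨p, τ, hτ, h⟩ := hf
  exact comp p he (hM ▸ hτ) (ho ▸ h)

theorem reindex (hf : Γ.Feas f) (g : Ω' → Ω) : (Γ.reindex g).Feas fun ω => f (g ω) := by
  obtain ⟨p, τ, hτ, h⟩ := hf
  exact ⟨p, fun ω => τ (g ω), hτ.reindex g, fun ω => h (g ω)⟩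

theorem bind (hf : Γ.Feas f) {v : Ω → ℕ} (hv : PolyBd Γ.M fun ω => (v ω).size) :
    (Γ.bind v hv).Feas f :=
  hf.subst rfl rfl fun i => (env (Γ.bind v hv) i.succ).congr fun ω => by simp [Ctx.bind]

theorem bound {v : Ω → ℕ} (hv : PolyBd Γ.M fun ω => (v ω).size) : (Γ.bind v hv).Feas v :=
  (env (Γ.bind v hv) (0 : Fin (Γ.n + 1))).congr fun ω => by simp [Ctx.bind]

theorem lift (hf : Γ.Feas f) {k : Ω → ℕ} {hk : PolyBd Γ.M k} :
    (Γ.loop k hk).Feas fun p => f p.1 :=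
  (hf.reindex _).bind _

theorem index {k : Ω → ℕ} {hk : PolyBd Γ.M k} : (Γ.loop k hk).Feas fun p => p.2 :=
  bound (polyBd_index hk).size

theorem op2 (p : Prog P 2) {F : ℕ → ℕ → ℕ}
    (hp : ∀ (φ : P → ℕ → ℕ) (x : Fin 2 → ℕ),
      Runs φ p x (F (x 0) (x 1)) ((1 + (x 0).size + (x 1).size) ^ 2))
    (hf : Γ.Feas f) (hg : Γ.Feas g) : Γ.Feas fun ω => F (f ω) (g ω) := by
  refine comp p (y := fun ω => ![f ω, g ω]) (fun i => ?_)
    ((((PolyBd.const 1).add hf.polyBd_size).add hg.polyBd_size).pow 2)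
    fun ω => hp _ _
  fin_cases i
  · exact hf
  · exact hg

theorem add (hf : Γ.Feas f) (hg : Γ.Feas g) : Γ.Feas fun ω => f ω + g ω :=
  op2 .add (F := fun a b => a + b) (fun _ x => .add x) hf hg

theorem sub (hf : Γ.Feas f) (hg : Γ.Feas g) : Γ.Feas fun ω => f ω - g ω :=
  op2 .sub (F := fun a b => a - b) (fun _ x => .sub x) hf hg

theorem mul (hf : Γ.Feas f) (hg : Γ.Feas g) : Γ.Feas fun ω => f ω * g ω :=
  op2 .mul (F := fun a b => a * b) (fun _ x => .mul x) hf hg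

theorem div (hf : Γ.Feas f) (hg : Γ.Feas g) : Γ.Feas fun ω => f ω / g ω :=
  op2 .div (F := fun a b => a / b) (fun _ x => .div x) hf hg

theorem mod (hf : Γ.Feas f) (hg : Γ.Feas g) : Γ.Feas fun ω => f ω % g ω :=
  (hf.sub (hg.mul (hf.div hg))).congr fun ω => (Nat.mod_eq_sub_mul_div).symm

/-- With truncated subtraction `1 - c` is the indicator of `c = 0`, so branching is arithmetic. Both
branches are evaluated, hence both must be feasible. -/
theorem ite_zero {c : Ω → ℕ} (hc : Γ.Feas c) (hf : Γ.Feas f) (hg : Γ.Feas g) :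
    Γ.Feas fun ω => if c ω = 0 then f ω else g ω := by
  refine ((((const 1).sub hc).mul hf).add (((const 1).sub ((const 1).sub hc)).mul hg)).congr
    fun ω => ?_
  split_ifs with h
  · simp [h]
  · have : 1 - c ω = 0 := by omega
    simp [this]

theorem ite_le {a b : Ω → ℕ} (ha : Γ.Feas a) (hb : Γ.Feas b) (hf : Γ.Feas f) (hg : Γ.Feas g) :
    Γ.Feas fun ω => if a ω ≤ b ω then f ω else g ω :=
  (ite_zero (ha.sub hb) hf hg).congr fun ω => by simp [Nat.sub_eq_zero_iff_le]

theorem ite_lt {a b : Ω → ℕ} (ha : Γ.Feas a) (hb : Γ.Feas b) (hf : Γ.Feas f) (hg : Γ.Feas g) :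
    Γ.Feas fun ω => if a ω < b ω then f ω else g ω :=
  (ite_le hb ha hg hf).congr fun ω => by simp only [← not_lt, ite_not]

theorem ite_eq {a b : Ω → ℕ} (ha : Γ.Feas a) (hb : Γ.Feas b) (hf : Γ.Feas f) (hg : Γ.Feas g) :
    Γ.Feas fun ω => if a ω = b ω then f ω else g ω :=
  (ite_zero ((ha.sub hb).add (hb.sub ha)) hf hg).congr fun ω => by
    have : a ω - b ω + (b ω - a ω) = 0 ↔ a ω = b ω := by omega
    simp only [this]

theorem max (hf : Γ.Feas f) (hg : Γ.Feas g) : Γ.Feas fun ω => max (f ω) (g ω) :=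
  (hf.add (hg.sub hf)).congr fun ω => by omega

theorem query (p : P) (hf : Γ.Feas f) (h : PolyBd Γ.M fun ω => (Γ.orc ω p (f ω)).size) :
    Γ.Feas fun ω => Γ.orc ω p (f ω) :=
  comp (.query p) (y := fun ω => ![f ω]) (fun i => by fin_cases i; exact hf)
    (((PolyBd.const 1).add hf.polyBd_size).add h) fun ω => .query p ![f ω]

theorem finsetSum {ι : Type*} (s : Finset ι) {F : ι → Ω → ℕ} (h : ∀ i ∈ s, Γ.Feas (F i)) :
    Γ.Feas fun ω => ∑ i ∈ s, F i ω := by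
  classical
  induction s using Finset.induction_on with
  | empty => simpa using const 0
  | insert a s ha ih =>
    simpa [Finset.sum_insert ha] using
      (h a (by simp)).add (ih fun i hi => h i (by simp [hi]))

theorem finsetProd {ι : Type*} (s : Finset ι) {F : ι → Ω → ℕ} (h : ∀ i ∈ s, Γ.Feas (F i)) :
    Γ.Feas fun ω => ∏ i ∈ s, F i ω := by
  classical
  induction s using Finset.induction_on with
  | empty => simpa using const 1
  | insert a s ha ih =>
    simpa [Finset.prod_insert ha] using
      (h a (by simp)).mul (ih fun i hi => h i (by simp [hi]))

/-- A loop whose intermediate results have polynomially bounded length is feasible. -/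
theorem recursion {k : Ω → ℕ} (hk : Γ.Feas k) (hkb : PolyBd Γ.M k) {r : Ω → ℕ → ℕ}
    (h0 : Γ.Feas fun ω => r ω 0)
    (hr : PolyBd (fun p : Σ ω, Fin (k ω) => Γ.M p.1) fun p => (r p.1 p.2).size)
    (hs : (((Γ.reindex Sigma.fst).bind (fun p : Σ ω, Fin (k ω) => r p.1 p.2) hr).bind
      (fun p => p.2) (polyBd_index hkb).size).Feas fun p => r p.1 (p.2 + 1)) :
    Γ.Feas fun ω => r ω (k ω) := by
  classical
  obtain ⟨p0, τ0, hτ0, h0⟩ := h0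
  obtain ⟨p1, τ1, hτ1, h1⟩ := hs
  -- Cost of the successive passes: the initialisation at 0, then the body. Values after the end of
  -- the loop never enter the sum.
  let t : Ω → ℕ → ℕ := fun ω i => match i with
    | 0 => τ0 ω
    | i + 1 => if h : i < k ω then τ1 ⟨ω, ⟨i, h⟩⟩ else 0
  refine comp (.prec p0 p1) (y := fun ω => Fin.cons (k ω) (Γ.env ω)) (fun i => ?_)
    (τ := fun ω => ∑ i ∈ range (k ω + 1), (1 + i.size + t ω i)) ?_ fun ω => ?_
  · refine Fin.cases ?_ (fun i => ?_) i
    · simpa using hk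
    · simpa using env Γ i
  · have e : (fun ω => ∑ i ∈ range (k ω + 1), (1 + i.size + t ω i)) =
        fun ω => (∑ i ∈ range (k ω), (1 + (i + 1).size + t ω (i + 1))) + (1 + τ0 ω) := by
      funext ω
      rw [Finset.sum_range_succ']
      simp [t]
    rw [e]
    refine (hkb.sumRange ?_).add ((PolyBd.const 1).add hτ0)
    refine (((PolyBd.const 1).add (((polyBd_index hkb).add (PolyBd.const 1)).size)).add
      hτ1).mono fun p => ?_
    simp [t]
  · refine Runs.prec p0 p1 (k ω) (Γ.env ω) (r ω) (t ω) (h0 ω) fun i hi => ?_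
    have := h1 ⟨ω, ⟨i, hi⟩⟩
    simp only [t, hi, dif_pos]
    exact this

/-- Common pattern of iterated sums, products and suprema. The new term does not see the running
total, so it is assumed feasible in the plain loop context and then transported past the extra
input. -/
theorem accumulate {k : Ω → ℕ} (hk : Γ.Feas k) (hkb : PolyBd Γ.M k) {r h : Ω → ℕ → ℕ}
    (op : ℕ → ℕ → ℕ) (h0 : Γ.Feas fun ω => r ω 0)
    (hop : ∀ (Δ : Ctx P (Σ ω, Fin (k ω))) (f g : (Σ ω, Fin (k ω)) → ℕ), Δ.Feas f → Δ.Feas g →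
      Δ.Feas fun p => op (f p) (g p))
    (hrs : ∀ ω i, r ω (i + 1) = op (r ω i) (h ω i))
    (hr : PolyBd (fun p : Σ ω, Fin (k ω) => Γ.M p.1) fun p => (r p.1 p.2).size)
    (hh : (Γ.loop k hkb).Feas fun p => h p.1 p.2) :
    Γ.Feas fun ω => r ω (k ω) := by
  refine recursion hk hkb h0 hr ?_
  refine (hop _ (fun p => r p.1 p.2) (fun p => h p.1 p.2) ((bound hr).bind _) ?_).congr
    fun p => (hrs _ _).symm
  refine hh.subst rfl rfl fun i => ?_
  refine Fin.cases ?_ (fun i => ?_) i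
  · exact (bound (polyBd_index hkb).size).congr fun p => by simp [Ctx.loop, Ctx.bind]
  · exact (((env (Γ.reindex (Sigma.fst : (Σ ω, Fin (k ω)) → Ω)) i).bind hr).bind
      (polyBd_index hkb).size).congr fun p => by simp [Ctx.loop, Ctx.bind]

/-- Lengths of accumulated values grow at most additively, by the length of each term and one carry,
so polynomially many polynomially long terms stay polynomially long. -/
theorem polyBd_partial {k : Ω → ℕ} {M : Ω → ℕ} (hkb : PolyBd M k) {r s : Ω → ℕ → ℕ}
    (hs : PolyBd (fun p : Σ ω, Fin (k ω) => M p.1) fun p => s p.1 p.2)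
    (h : ∀ ω i, (r ω i).size ≤ 1 + ∑ j ∈ range i, (s ω j + 1)) :
    PolyBd (fun p : Σ ω, Fin (k ω) => M p.1) fun p => (r p.1 p.2).size := by
  have := (((PolyBd.const 1).add (hkb.sumRange (h := fun ω i => s ω i + 1)
    (hs.add (PolyBd.const 1)))).reindex (Sigma.fst : (Σ ω, Fin (k ω)) → Ω))
  refine this.mono fun p => (h _ _).trans ?_
  exact Nat.add_le_add_left (Finset.sum_le_sum_of_subset
    (Finset.range_mono p.2.2.le)) 1

theorem sum {k : Ω → ℕ} (hk : Γ.Feas k) (hkb : PolyBd Γ.M k) {h : Ω → ℕ → ℕ}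
    (hh : (Γ.loop k hkb).Feas fun p => h p.1 p.2) :
    Γ.Feas fun ω => ∑ i ∈ range (k ω), h ω i := by
  refine accumulate hk hkb (r := fun ω j => ∑ i ∈ range j, h ω i) (h := h) (· + ·)
    (by simpa using const 0) (fun _ _ _ => add) (fun ω i => Finset.sum_range_succ _ _)
    (polyBd_partial hkb (r := fun ω i => ∑ l ∈ range i, h ω l) (s := fun ω i => (h ω i).size)
      hh.polyBd_size fun ω i => ?_) hh
  induction i with
  | zero => simp
  | succ i ih =>
    rw [Finset.sum_range_succ, Finset.sum_range_succ _ i]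
    have := size_add_le (∑ j ∈ range i, h ω j) (h ω i)
    omega

theorem prod {k : Ω → ℕ} (hk : Γ.Feas k) (hkb : PolyBd Γ.M k) {h : Ω → ℕ → ℕ}
    (hh : (Γ.loop k hkb).Feas fun p => h p.1 p.2) :
    Γ.Feas fun ω => ∏ i ∈ range (k ω), h ω i := by
  refine accumulate hk hkb (r := fun ω j => ∏ i ∈ range j, h ω i) (h := h) (· * ·)
    (by simpa using const 1) (fun _ _ _ => mul) (fun ω i => Finset.prod_range_succ _ _)
    (polyBd_partial hkb (r := fun ω i => ∏ l ∈ range i, h ω l) (s := fun ω i => (h ω i).size)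
      hh.polyBd_size fun ω i => ?_) hh
  induction i with
  | zero => simp
  | succ i ih =>
    rw [Finset.prod_range_succ, Finset.sum_range_succ _ i]
    have := size_mul_le (∏ j ∈ range i, h ω j) (h ω i)
    omega

theorem sup {k : Ω → ℕ} (hk : Γ.Feas k) (hkb : PolyBd Γ.M k) {h : Ω → ℕ → ℕ}
    (hh : (Γ.loop k hkb).Feas fun p => h p.1 p.2) :
    Γ.Feas fun ω => (range (k ω)).sup (h ω) := by
  refine accumulate hk hkb (r := fun ω j => (range j).sup (h ω)) (h := h)
    (fun a b => Max.max a b)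
    (by simpa using const 0) (fun _ _ _ => max)
    (fun ω i => by rw [Finset.range_add_one, Finset.sup_insert, max_comm])
    (polyBd_partial hkb (r := fun ω i => (range i).sup (h ω)) (s := fun ω i => (h ω i).size)
      hh.polyBd_size fun ω i => ?_) hh
  induction i with
  | zero => simp
  | succ i ih =>
    rw [Finset.range_add_one, Finset.sup_insert, ← Finset.range_add_one,
      Finset.sum_range_succ]
    rcases max_cases (h ω i) ((range i).sup (h ω)) with ⟨h1, _⟩ | ⟨h1, _⟩ <;>
    · rw [h1]; omega

theorem pow (hf : Γ.Feas f) {k : Ω → ℕ} (hk : Γ.Feas k) (hkb : PolyBd Γ.M k) :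
    Γ.Feas fun ω => f ω ^ k ω :=
  (prod hk hkb (h := fun ω _ => f ω) hf.lift).congr fun ω => by simp

/-- Unbounded search whose result is polynomially bounded. -/
theorem search {k : Ω → ℕ} (hkb : PolyBd Γ.M k) {h : Ω → ℕ → ℕ}
    (hh : (Γ.loop (fun ω => k ω + 1) (hkb.add (PolyBd.const 1))).Feas fun p => h p.1 p.2)
    (hne : ∀ ω, ∀ i < k ω, h ω i ≠ 0) (hz : ∀ ω, h ω (k ω) = 0) : Γ.Feas k := by
  obtain ⟨p, τ, hτ, hp⟩ := hh
  let t : Ω → ℕ → ℕ := fun ω i => if h : i < k ω + 1 then τ ⟨ω, ⟨i, h⟩⟩ else 0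
  refine ⟨.search p, fun ω => ∑ i ∈ range (k ω + 1), (1 + i.size + t ω i), ?_, fun ω => ?_⟩
  · refine (hkb.add (PolyBd.const 1)).sumRange ?_
    refine (((PolyBd.const 1).add (polyBd_index (hkb.add (PolyBd.const 1))).size).add
      hτ).mono fun p => ?_
    simp only [t, p.2.2, dif_pos]
    exact le_rfl
  · refine Runs.search p (k ω) (Γ.env ω) (h ω) (t ω) (fun i hi => ?_) (hne ω) (hz ω)
    have := hp ⟨ω, ⟨i, Nat.lt_succ_of_le hi⟩⟩
    simp only [t, Nat.lt_succ_of_le hi, dif_pos]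
    exact this

end Feas

end Ctx

end GibbsEntropy

namespace GibbsEntropy
open Finset

/-! ### The algorithm -/

section Algorithm

variable {d : ℕ} {A : Type u} [Fintype A]

/-- Side length of the cube with centre `0` that the algorithm looks at. -/
def side (n : ℕ) : ℕ := 2 * n + 3

/-- Number of sites of a layer of the cube. -/
def layer (d n : ℕ) : ℕ := side n ^ (d - 1)

/-- Bound for the codes of configurations on a few layers. -/
def cap (d q n : ℕ) : ℕ := q ^ ((2 * d + 2) * layer d n)

/-- Coordinates of the site with number `t`. -/
def digit (n i t : ℕ) : ℕ := t / side n ^ i % side n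

/-- Zero exactly at the numbers of sites on the faces of the cube. -/
def interior (d n t : ℕ) : ℕ := ∏ i : Fin d, digit n i t * (side n - 1 - digit n i t)

/-- Number of the centre. -/
def mid (d n : ℕ) : ℕ := ∑ i : Fin d, (n + 1) * side n ^ (i : ℕ)

/-- Nonzero exactly at the centre and the interior sites that precede it by at most one layer. -/
def nearPast (d n t : ℕ) : ℕ :=
  if t ≤ mid d n then if mid d n ≤ t + layer d n then interior d n t else 0 else 0

/-- The parameters that do not vanish. -/
def Nonvanishing (Z : Fin d → A → A → Prop) : Param d A → Prop
  | .inl _ => True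
  | .inr (i, a, b) => ¬ Z i a b

variable (Z : Fin d → A → A → Prop) (φ : Param d A → ℕ → ℕ) (n : ℕ)

open Classical in
/-- The number of nonvanishing parameters that are not seen to be positive with precision `k`. -/
noncomputable def deficit (k : ℕ) : ℕ :=
  ∑ p : Param d A, if Nonvanishing Z p then (if 2 ≤ φ p k then 0 else 1) else 0

/-- An answer of at least 2 at precision k forces 2^k p ≥ 1, as the error is at most 1. From this
precision on, additional bits of precision are bits of relative precision. -/
noncomputable def basePrec : ℕ := sInf {k | deficit Z φ k = 0}

/-- A weight on the cube has at most (d + 1) · `side n ^ d` factors. With r extra bits each has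
relative error 2^(-r), and since 2^r > r this choice of r keeps the error of the product below 1/E²,
E = `cap`. -/
noncomputable def precision : ℕ :=
  basePrec Z φ + 8 * (d + 1) * side n ^ d * cap d (Fintype.card A) n ^ 2

open Classical in
noncomputable def pval (p : Param d A) : ℕ :=
  if Nonvanishing Z p then φ p (precision Z φ n) else 0

noncomputable def code (a : A) : ℕ := Fintype.equivFin A a

noncomputable def gamN (a : ℕ) : ℕ :=
  ∑ a' : A, if a = code a' then pval Z φ n (.inl a') else 0

noncomputable def betN (i : Fin d) (a b : ℕ) : ℕ :=
  ∑ a' : A, ∑ b' : A,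
    if a = code a' then (if b = code b' then pval Z φ n (.inr (i, a', b')) else 0) else 0

/-- A crude common bound for the factors contributed by single sites (`fac_le_topN`), needed only to
choose a base for the tables. -/
noncomputable def topN : ℕ := ∏ p : Param d A, (1 + pval Z φ n p)

/-- The base in which tables are written. -/
noncomputable def tableBase : ℕ := (Fintype.card A * topN Z φ n) ^ side n ^ d + 1

/-- Factor contributed to the weight of a configuration by the symbol `a` at the site `t`, when
`s` is the code of the preceding symbols. -/
noncomputable def fac (t s a : ℕ) : ℕ :=
  -- The neighbour in direction -e_i was read `side n ^ i` symbols ago. The last symbol is digit 0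
  -- of the window, so that neighbour is digit `side n ^ i - 1`. If the coordinate is 0 there is no
  -- such neighbour in the cube.
  gamN Z φ n a * ∏ i : Fin d, if digit n i t = 0 then 1 else
    betN Z φ n i (s / Fintype.card A ^ (side n ^ (i : ℕ) - 1) % Fintype.card A) a

/-- Append `a` to the code `s` unless `c = 0`. -/
def push (q E c s a : ℕ) : ℕ := if c = 0 then s else (q * s + a) % E

/-- Update of the code of the window, the faces, and the near past. -/
def upd (d q n t κ a : ℕ) : ℕ :=
  -- A state has three digits in base `cap`. The window receives every symbol and forgets old ones
  -- by reduction modulo `cap`; the other two codes never overflow.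
  push q (cap d q n) 1 (κ % cap d q n) a + cap d q n *
    (push q (cap d q n) (1 - interior d n t) (κ / cap d q n % cap d q n) a + cap d q n *
      push q (cap d q n) (nearPast d n t) (κ / cap d q n ^ 2) a)

/-- Table of the weights of the configurations of the first `t` sites with given codes. -/
noncomputable def table : ℕ → ℕ
  | 0 => 1
  -- The whole array is a single integer: its digit at place `κ` is the weight of the state `κ`.
  | t + 1 => ∑ κ ∈ range (cap d (Fintype.card A) n ^ 3), ∑ a ∈ range (Fintype.card A),
      table t / tableBase Z φ n ^ κ % tableBase Z φ n *
        fac Z φ n t (κ % cap d (Fintype.card A) n) a *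
        tableBase Z φ n ^ upd d (Fintype.card A) n t κ a

/-- Weight of the faces `e` and the near past with centre `g`. -/
noncomputable def wt (e g : ℕ) : ℕ :=
  ∑ s ∈ range (cap d (Fintype.card A) n),
    table Z φ n (side n ^ d) / tableBase Z φ n ^
      (s + cap d (Fintype.card A) n * (e + cap d (Fintype.card A) n * g)) % tableBase Z φ n

/-- Scaled lower approximation of `-p log p` for `p = a / b`. -/
def entTerm (S a b : ℕ) : ℕ :=
  -- From -p log p = ∑ p (1 - p)^(k+1) / (k+1): the first S terms, scaled by S², each rounded down.
  ∑ k ∈ range S, S ^ 2 * a * (b - a) ^ (k + 1) / (b ^ (k + 2) * (k + 1))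

end Algorithm

/-! ### Integer estimates of entropies and discrepancies -/

section Estimates

variable (q E : ℕ) (W : ℕ → ℕ → ℕ)

/-- The code of near past and centre is q f + x with x the symbol at the centre, which is summed out
here. The values are general so that the integer tables and the exact real weights are treated
alike. -/
def wtPast {R : Type*} [AddCommMonoid R] (q : ℕ) (W : ℕ → ℕ → R) (e f : ℕ) : R :=
  ∑ x ∈ range q, W e (q * f + x)

def wtFace {R : Type*} [AddCommMonoid R] (q E : ℕ) (W : ℕ → ℕ → R) (e : ℕ) : R :=
  ∑ f ∈ range E, wtPast q W e f

/-- Scaled conditional entropy of the centre given the near past, with the faces fixed. -/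
def entFace (e : ℕ) : ℕ :=
  (∑ f ∈ range E, wtPast q W e f *
    ∑ x ∈ range q, entTerm E (W e (q * f + x)) (wtPast q W e f)) / wtFace q E W e

/-- One of the two truncated differences vanishes, so their sum is an absolute value. Near pasts
that are impossible for one of the faces are ignored. -/
def discrepancy (e e' f x : ℕ) : ℕ :=
  if wtPast q W e f = 0 then 0 else if wtPast q W e' f = 0 then 0 else
    (E ^ 2 * W e (q * f + x) / wtPast q W e f - E ^ 2 * W e' (q * f + x) / wtPast q W e' f) +
    (E ^ 2 * W e' (q * f + x) / wtPast q W e' f - E ^ 2 * W e (q * f + x) / wtPast q W e f)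

def maxDiscrepancy : ℕ :=
  (range E).sup fun e => (range E).sup fun e' => (range E).sup fun f =>
    (range q).sup fun x => discrepancy q E W e e' f x

def maxEnt : ℕ := (range E).sup fun e => if wtFace q E W e = 0 then 0 else entFace q E W e

/-- The minimum is taken as the complement of a supremum: the value 0 assigned to faces of weight
zero is harmless in a supremum and would spoil a minimum. No entropy exceeds q E² on this scale. -/
def minEnt : ℕ := q * E ^ 2 -
  (range E).sup fun e => if wtFace q E W e = 0 then 0 else q * E ^ 2 - entFace q E W e

/-- The square root, rounded up. -/
def ceilSqrt (y : ℕ) : ℕ := ∑ i ∈ range y, if i ^ 2 < y then 1 else 0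

/-- On the scale E² the errors of weights, series and divisions amount to at most 3q + 6qE + 1,
which 10qE covers. -/
def lowerBd : ℕ := minEnt q E W - 10 * q * E

/-- The middle term is E² · 2q√ε for the oscillation ε of the conditional probabilities, whose
scaled value E²ε may exceed the computed discrepancy by 7. -/
def upperBd : ℕ := maxEnt q E W + 2 * q * E * ceilSqrt (maxDiscrepancy q E W + 7) + 10 * q * E

end Estimates

/-! ### Feasibility of the algorithm -/

theorem pos_of_mem_range_prod {q f x : ℕ} {h : ℕ → ℕ} (hx : x ∈ range q) :
    h (q * f + x) ≤ ∑ x ∈ range q, h (q * f + x) :=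
  Finset.single_le_sum (f := fun x => h (q * f + x)) (fun _ _ => Nat.zero_le _) hx

theorem discrepancy_le (q E : ℕ) (W : ℕ → ℕ → ℕ) {e e' f x : ℕ} (hx : x ∈ range q) :
    discrepancy q E W e e' f x ≤ E ^ 2 := by
  have key : ∀ e, E ^ 2 * W e (q * f + x) / wtPast q W e f ≤ E ^ 2 := fun e =>
    Nat.div_le_of_le_mul (by
      rw [mul_comm]
      exact Nat.mul_le_mul_right _ (pos_of_mem_range_prod hx))
  have h1 := key e
  have h2 := key e'
  unfold discrepancy
  generalize E ^ 2 * W e (q * f + x) / wtPast q W e f = u at *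
  generalize E ^ 2 * W e' (q * f + x) / wtPast q W e' f = v at *
  split_ifs <;> omega

theorem maxDiscrepancy_le (q E : ℕ) (W : ℕ → ℕ → ℕ) : maxDiscrepancy q E W ≤ E ^ 2 :=
  Finset.sup_le fun _ _ => Finset.sup_le fun _ _ => Finset.sup_le fun _ _ =>
    Finset.sup_le fun _ hx => discrepancy_le q E W hx

theorem push_lt {q E c s a : ℕ} (hs : s < E) : push q E c s a < E := by
  unfold push
  split_ifs
  exacts [hs, Nat.mod_lt _ (by omega)]

theorem cap_pos {d q n : ℕ} (hq : 0 < q) : 0 < cap d q n := pow_pos hq _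

theorem add_mul_lt {E a b c : ℕ} (ha : a < E) (hb : b < c) : a + E * b < E * c :=
  calc a + E * b < E + E * b := by omega
    _ = E * (b + 1) := by ring
    _ ≤ E * c := Nat.mul_le_mul_left _ hb

theorem upd_lt {A : Type u} [Fintype A] [Nonempty A] {d n t κ a : ℕ}
    (h : κ < cap d (Fintype.card A) n ^ 3) :
    upd d (Fintype.card A) n t κ a < cap d (Fintype.card A) n ^ 3 := by
  have hE : 0 < cap d (Fintype.card A) n := cap_pos Fintype.card_pos
  unfold upd
  generalize cap d (Fintype.card A) n = E at *
  rw [show E ^ 3 = E * (E * E) by ring]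
  refine add_mul_lt (push_lt (Nat.mod_lt _ hE)) (add_mul_lt (push_lt (Nat.mod_lt _ hE))
    (push_lt ?_))
  rw [Nat.div_lt_iff_lt_mul (by positivity)]
  linarith [show E ^ 3 = E * E ^ 2 by ring]

open Ctx

section

variable {d : ℕ} {A : Type u} [Fintype A] {Z : Fin d → A → A → Prop} {Ω : Type v}

/-- Contexts in which the algorithm can be run with parameter `n`. -/
structure Runnable (Z : Fin d → A → A → Prop) (Γ : Ctx (Param d A) Ω) (n : Ω → ℕ) : Prop where
  feas : Γ.Feas n
  side : PolyBd Γ.M fun ω => side (n ω)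
  cap : PolyBd Γ.M fun ω => cap d (Fintype.card A) (n ω)
  query : ∃ C : Ω → ℕ, PolyBd Γ.M C ∧ ∀ ω p k, Γ.orc ω p k ≤ 2 ^ k * C ω
  base : PolyBd Γ.M fun ω => basePrec Z (Γ.orc ω)
  base_spec : ∀ ω, deficit Z (Γ.orc ω) (basePrec Z (Γ.orc ω)) = 0

namespace Runnable

variable {Γ : Ctx (Param d A) Ω} {n t κ s a : Ω → ℕ}

theorem lift (h : Runnable Z Γ n) {k : Ω → ℕ} (hk : PolyBd Γ.M k) :
    Runnable Z (Γ.loop k hk) fun p => n p.1 where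
  feas := h.feas.lift
  side := h.side.reindex _
  cap := h.cap.reindex _
  query := by
    obtain ⟨C, hC, H⟩ := h.query
    exact ⟨_, hC.reindex _, fun ω p k => H ω.1 p k⟩
  base := h.base.reindex _
  base_spec ω := h.base_spec ω.1

omit [Fintype A] in
theorem powConst {P : Type u} {Γ : Ctx P Ω} {a : Ω → ℕ} (hf : Γ.Feas a) (k : ℕ) : Γ.Feas fun ω => a ω ^ k :=
  hf.pow (.const k) (.const k)

theorem feas_side (h : Runnable Z Γ n) : Γ.Feas fun ω => GibbsEntropy.side (n ω) :=
  ((Feas.const 2).mul h.feas).add (.const 3)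

theorem polyBd_layer (h : Runnable Z Γ n) : PolyBd Γ.M fun ω => layer d (n ω) :=
  h.side.pow (d - 1)

theorem feas_layer (h : Runnable Z Γ n) : Γ.Feas fun ω => layer d (n ω) := powConst h.feas_side _

theorem feas_cap (h : Runnable Z Γ n) :
    Γ.Feas fun ω => GibbsEntropy.cap d (Fintype.card A) (n ω) :=
  (Feas.const _).pow ((Feas.const _).mul h.feas_layer) ((PolyBd.const _).mul h.polyBd_layer)

theorem feas_digit (h : Runnable Z Γ n) (ht : Γ.Feas t) (i : ℕ) :
    Γ.Feas fun ω => digit (n ω) i (t ω) :=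
  (ht.div (powConst h.feas_side i)).mod h.feas_side

theorem feas_interior (h : Runnable Z Γ n) (ht : Γ.Feas t) :
    Γ.Feas fun ω => interior d (n ω) (t ω) :=
  Feas.finsetProd univ fun i _ => (h.feas_digit ht i).mul
    ((h.feas_side.sub (.const 1)).sub (h.feas_digit ht i))

theorem feas_mid (h : Runnable Z Γ n) : Γ.Feas fun ω => mid d (n ω) :=
  Feas.finsetSum univ fun i _ => (h.feas.add (.const 1)).mul (powConst h.feas_side i)

theorem feas_nearPast (h : Runnable Z Γ n) (ht : Γ.Feas t) :
    Γ.Feas fun ω => nearPast d (n ω) (t ω) :=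
  .ite_le ht h.feas_mid (.ite_le h.feas_mid (ht.add h.feas_layer) (h.feas_interior ht)
    (.const 0)) (.const 0)

theorem polyBd_precision (h : Runnable Z Γ n) :
    PolyBd Γ.M fun ω => precision Z (Γ.orc ω) (n ω) :=
  h.base.add (((PolyBd.const _).mul (h.side.pow d)).mul (h.cap.pow 2))

/-- An answer at precision k has about k bits, so it is the precision itself, and not its length,
that must be polynomially bounded. -/
theorem polyBd_query (h : Runnable Z Γ n) (hk : PolyBd Γ.M a) (p : Param d A) :
    PolyBd Γ.M fun ω => (Γ.orc ω p (a ω)).size := by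
  obtain ⟨C, hC, H⟩ := h.query
  refine ((hk.add (PolyBd.const 1)).add hC).mono fun ω => ?_
  refine (Nat.size_le_size (H ω p (a ω))).trans ((size_mul_le _ _).trans ?_)
  rw [Nat.size_pow]
  exact Nat.add_le_add_left (size_le_self _) _

theorem feas_query (h : Runnable Z Γ n) (hf : Γ.Feas a) (hk : PolyBd Γ.M a) (p : Param d A) :
    Γ.Feas fun ω => Γ.orc ω p (a ω) :=
  hf.query p (h.polyBd_query hk p)

theorem feas_deficit (h : Runnable Z Γ n) (hf : Γ.Feas a) (hk : PolyBd Γ.M a) :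
    Γ.Feas fun ω => deficit Z (Γ.orc ω) (a ω) := by
  refine Feas.finsetSum univ fun p _ => ?_
  by_cases hp : Nonvanishing Z p
  · simp only [hp, if_true]
    exact .ite_le (.const 2) (h.feas_query hf hk p) (.const 0) (.const 1)
  · simp only [hp, if_false]
    exact .const 0

theorem feas_basePrec (h : Runnable Z Γ n) : Γ.Feas fun ω => basePrec Z (Γ.orc ω) := by
  refine Feas.search h.base (h := fun ω k => deficit Z (Γ.orc ω) k) ?_ (fun ω i hi => ?_)
    h.base_spec
  · have hb := h.base.add (.const 1)
    have hi : PolyBd (Γ.loop _ hb).M fun p => (p.2 : ℕ) := polyBd_index hb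
    exact (h.lift hb).feas_deficit .index hi
  · exact Nat.notMem_of_lt_sInf (s := {k | deficit Z (Γ.orc ω) k = 0}) hi

theorem feas_precision (h : Runnable Z Γ n) :
    Γ.Feas fun ω => precision Z (Γ.orc ω) (n ω) :=
  h.feas_basePrec.add (((Feas.const _).mul (powConst h.feas_side d)).mul
    (powConst h.feas_cap 2))

theorem feas_pval (h : Runnable Z Γ n) (p : Param d A) :
    Γ.Feas fun ω => pval Z (Γ.orc ω) (n ω) p := by
  unfold pval
  by_cases hp : Nonvanishing Z p
  · simp only [hp, if_true]
    exact h.feas_query h.feas_precision h.polyBd_precision p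
  · simp only [hp, if_false]
    exact .const 0

theorem feas_gamN (h : Runnable Z Γ n) (ha : Γ.Feas a) :
    Γ.Feas fun ω => gamN Z (Γ.orc ω) (n ω) (a ω) :=
  Feas.finsetSum univ fun _ _ => .ite_eq ha (.const _) (h.feas_pval _) (.const 0)

theorem feas_betN (h : Runnable Z Γ n) (i : Fin d) (hs : Γ.Feas s) (ha : Γ.Feas a) :
    Γ.Feas fun ω => betN Z (Γ.orc ω) (n ω) i (s ω) (a ω) :=
  Feas.finsetSum univ fun _ _ => Feas.finsetSum univ fun _ _ =>
    .ite_eq hs (.const _) (.ite_eq ha (.const _) (h.feas_pval _) (.const 0)) (.const 0)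

theorem feas_topN (h : Runnable Z Γ n) : Γ.Feas fun ω => topN Z (Γ.orc ω) (n ω) :=
  Feas.finsetProd univ fun p _ => (Feas.const 1).add (h.feas_pval p)

theorem feas_tableBase (h : Runnable Z Γ n) : Γ.Feas fun ω => tableBase Z (Γ.orc ω) (n ω) :=
  (((Feas.const _).mul h.feas_topN).pow (powConst h.feas_side d) (h.side.pow d)).add (.const 1)

theorem feas_fac (h : Runnable Z Γ n) (ht : Γ.Feas t) (hs : Γ.Feas s) (ha : Γ.Feas a) :
    Γ.Feas fun ω => fac Z (Γ.orc ω) (n ω) (t ω) (s ω) (a ω) :=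
  (h.feas_gamN ha).mul <| Feas.finsetProd univ fun i _ =>
    .ite_eq (h.feas_digit ht i) (.const 0) (.const 1) <| h.feas_betN i ((hs.div
      ((Feas.const _).pow ((powConst h.feas_side i).sub (.const 1))
        ((h.side.pow i).mono fun _ => Nat.sub_le _ _))).mod (.const _)) ha

theorem feas_push (h : Runnable Z Γ n) {c : Ω → ℕ} (hc : Γ.Feas c) (hs : Γ.Feas s)
    (ha : Γ.Feas a) :
    Γ.Feas fun ω => push (Fintype.card A) (GibbsEntropy.cap d (Fintype.card A) (n ω)) (c ω)
      (s ω) (a ω) :=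
  .ite_zero hc hs ((((Feas.const _).mul hs).add ha).mod h.feas_cap)

theorem feas_upd (h : Runnable Z Γ n) (ht : Γ.Feas t) (hκ : Γ.Feas κ) (ha : Γ.Feas a) :
    Γ.Feas fun ω => upd d (Fintype.card A) (n ω) (t ω) (κ ω) (a ω) :=
  (h.feas_push (.const 1) (hκ.mod h.feas_cap) ha).add <| h.feas_cap.mul <|
    (h.feas_push ((Feas.const 1).sub (h.feas_interior ht))
      ((hκ.div h.feas_cap).mod h.feas_cap) ha).add <| h.feas_cap.mul <|
    h.feas_push (h.feas_nearPast ht) (hκ.div (powConst h.feas_cap 2)) ha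

theorem polyBd_upd [Nonempty A] {M n t κ a : Ω → ℕ}
    (hE : PolyBd M fun ω => GibbsEntropy.cap d (Fintype.card A) (n ω))
    (h : ∀ ω, κ ω < GibbsEntropy.cap d (Fintype.card A) (n ω) ^ 3) :
    PolyBd M fun ω => upd d (Fintype.card A) (n ω) (t ω) (κ ω) (a ω) :=
  (hE.pow 3).mono fun ω => (upd_lt (h ω)).le

/-- The summand in the recursion for the table. -/
theorem feas_summand [Nonempty A] (h : Runnable Z Γ n) {b : Ω → ℕ} (hb : Γ.Feas b)
    (ht : Γ.Feas t) (hκ : Γ.Feas κ)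
    (ha : Γ.Feas a) (hlt : ∀ ω, κ ω < GibbsEntropy.cap d (Fintype.card A) (n ω) ^ 3) :
    Γ.Feas fun ω => b ω *
        fac Z (Γ.orc ω) (n ω) (t ω) (κ ω % GibbsEntropy.cap d (Fintype.card A) (n ω)) (a ω) *
        tableBase Z (Γ.orc ω) (n ω) ^ upd d (Fintype.card A) (n ω) (t ω) (κ ω) (a ω) :=
  (hb.mul (h.feas_fac ht (hκ.mod h.feas_cap) ha)).mul
    (h.feas_tableBase.pow (h.feas_upd ht hκ ha) (polyBd_upd h.cap hlt))

theorem feas_lookup [Nonempty A] (h : Runnable Z Γ n) {b : Ω → ℕ} (hb : Γ.Feas b)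
    (hκ : Γ.Feas κ) (hk : PolyBd Γ.M κ) :
    Γ.Feas fun ω => b ω / tableBase Z (Γ.orc ω) (n ω) ^ κ ω % tableBase Z (Γ.orc ω) (n ω) :=
  (hb.div (h.feas_tableBase.pow hκ hk)).mod h.feas_tableBase

theorem feas_step [Nonempty A] (h : Runnable Z Γ n) {b : Ω → ℕ} (hb : Γ.Feas b)
    (ht : Γ.Feas t) :
    Γ.Feas fun ω => ∑ κ ∈ range (GibbsEntropy.cap d (Fintype.card A) (n ω) ^ 3),
      ∑ a ∈ range (Fintype.card A),
      b ω / tableBase Z (Γ.orc ω) (n ω) ^ κ % tableBase Z (Γ.orc ω) (n ω) *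
        fac Z (Γ.orc ω) (n ω) (t ω) (κ % GibbsEntropy.cap d (Fintype.card A) (n ω)) a *
        tableBase Z (Γ.orc ω) (n ω) ^ upd d (Fintype.card A) (n ω) (t ω) κ a := by
  refine .sum (powConst h.feas_cap 3) (h.cap.pow 3) (.sum (.const _) (.const _) ?_)
  exact feas_summand ((h.lift (h.cap.pow 3)).lift (.const _))
    (feas_lookup ((h.lift (h.cap.pow 3)).lift (.const _)) hb.lift.lift Feas.index.lift
      ((polyBd_index (h.cap.pow 3)).reindex _)) ht.lift.lift Feas.index.lift .index
    fun ω => ω.1.2.2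

theorem feas_table [Nonempty A] (h : Runnable Z Γ n) :
    Γ.Feas fun ω => table Z (Γ.orc ω) (n ω) (GibbsEntropy.side (n ω) ^ d) := by
  have hT := h.side.pow d
  refine Feas.recursion (r := fun ω t => table Z (Γ.orc ω) (n ω) t) (powConst h.feas_side d) hT
    (.const 1) ?_ ?_
  -- The loop rule asks for a bound on the length of all intermediate tables. Replacing every digit
  -- by the base gives a larger number that is evidently feasible, hence of polynomial length. The
  -- shift `p.2 - 1` matches the recursion, and the summand 1 covers the initial table.
  · have H : (Γ.loop _ hT).Feas fun p =>
        (∑ κ ∈ range (GibbsEntropy.cap d (Fintype.card A) (n p.1) ^ 3),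
        ∑ a ∈ range (Fintype.card A), tableBase Z (Γ.orc p.1) (n p.1) *
          fac Z (Γ.orc p.1) (n p.1) (p.2 - 1)
            (κ % GibbsEntropy.cap d (Fintype.card A) (n p.1)) a *
          tableBase Z (Γ.orc p.1) (n p.1) ^
            upd d (Fintype.card A) (n p.1) (p.2 - 1) κ a) + 1 := by
      have h' := h.lift hT
      refine .add (.sum (powConst h'.feas_cap 3) (h'.cap.pow 3) (.sum (.const _) (.const _) ?_))
        (.const 1)
      exact feas_summand ((h'.lift (h'.cap.pow 3)).lift (.const _))
        h'.feas_tableBase.lift.lift (Feas.index.sub (.const 1)).lift.lift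
        Feas.index.lift .index fun ω => ω.1.2.2
    refine H.polyBd_size.mono fun p => Nat.size_le_size ?_
    rcases p with ⟨ω, i, hi⟩
    cases i with
    | zero => simp [table]
    | succ i =>
      refine le_add_right ?_
      rw [table]
      simp only [Nat.add_sub_cancel]
      gcongr with κ _ a _
      exact (Nat.mod_lt _ (Nat.succ_pos _)).le
  · let k : Ω → ℕ := fun ω => GibbsEntropy.side (n ω) ^ d
    refine feas_step (n := fun p : Σ ω, Fin (k ω) => n p.1) (t := fun p => p.2) ?_
      (Feas.bind (Feas.bound _) _) (Feas.bound _)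
    exact ⟨((h.feas.reindex _).bind _).bind _, h.side.reindex _, h.cap.reindex _,
      (h.lift hT).query, h.base.reindex _, fun ω => h.base_spec ω.1⟩

theorem feas_wt [Nonempty A] (h : Runnable Z Γ n) {e g : Ω → ℕ} (he : Γ.Feas e)
    (hg : Γ.Feas g) (heb : PolyBd Γ.M e) (hgb : PolyBd Γ.M g) :
    Γ.Feas fun ω => wt Z (Γ.orc ω) (n ω) (e ω) (g ω) := by
  refine .sum h.feas_cap h.cap (feas_lookup (h.lift h.cap) h.feas_table.lift ?_ ?_)
  · exact Feas.index.add (h.feas_cap.mul (he.add (h.feas_cap.mul hg))).lift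
  · exact (polyBd_index h.cap).add ((h.cap.mul (heb.add (h.cap.mul hgb))).reindex _)

end Runnable

end

end GibbsEntropy

/-! ### Feasibility of the bounds for the entropy -/

namespace GibbsEntropy
open Finset Ctx

section

variable {d : ℕ} {A : Type u} [Fintype A] {Z : Fin d → A → A → Prop} {Ω : Type v}

/-- Feasible and polynomially bounded. -/
structure Unary {P : Type u} (Γ : Ctx P Ω) (f : Ω → ℕ) : Prop where
  feas : Γ.Feas f
  bd : PolyBd Γ.M f

namespace Unary

variable {P : Type u} {Γ : Ctx P Ω} {f g : Ω → ℕ}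

theorem lift (hf : Unary Γ f) {k : Ω → ℕ} {hk : PolyBd Γ.M k} :
    Unary (Γ.loop k hk) fun p => f p.1 :=
  ⟨hf.feas.lift, hf.bd.reindex _⟩

theorem index {k : Ω → ℕ} {hk : PolyBd Γ.M k} : Unary (Γ.loop k hk) fun p => p.2 :=
  ⟨.index, polyBd_index hk⟩

theorem const (a : ℕ) : Unary Γ fun _ => a := ⟨.const a, .const a⟩

theorem add (hf : Unary Γ f) (hg : Unary Γ g) : Unary Γ fun ω => f ω + g ω :=
  ⟨hf.feas.add hg.feas, hf.bd.add hg.bd⟩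

theorem mul (hf : Unary Γ f) (hg : Unary Γ g) : Unary Γ fun ω => f ω * g ω :=
  ⟨hf.feas.mul hg.feas, hf.bd.mul hg.bd⟩

end Unary

theorem feas_entTerm {P : Type u} {Γ : Ctx P Ω} {S a b : Ω → ℕ} (hS : Unary Γ S)
    (ha : Γ.Feas a) (hb : Γ.Feas b) : Γ.Feas fun ω => entTerm (S ω) (a ω) (b ω) := by
  have hi : Unary (Γ.loop S hS.bd) fun p => (p.2 : ℕ) := .index
  refine .sum hS.feas hS.bd (.div (.mul ((Runnable.powConst hS.feas 2).mul ha).lift ?_) (.mul ?_ ?_))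
  · exact (hb.sub ha).lift.pow (hi.add (.const 1)).feas (hi.add (.const 1)).bd
  · exact hb.lift.pow (hi.add (.const 2)).feas (hi.add (.const 2)).bd
  · exact (hi.add (.const 1)).feas

theorem feas_ceilSqrt {P : Type u} {Γ : Ctx P Ω} {y : Ω → ℕ} (hy : Unary Γ y) :
    Γ.Feas fun ω => ceilSqrt (y ω) :=
  .sum hy.feas hy.bd (.ite_lt (Runnable.powConst .index 2) hy.feas.lift (.const 1) (.const 0))

namespace Runnable

variable {Γ : Ctx (Param d A) Ω} {n e e' f g x : Ω → ℕ} [Nonempty A]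

omit [Nonempty A] in
theorem unary_cap (h : Runnable Z Γ n) :
    Unary Γ fun ω => GibbsEntropy.cap d (Fintype.card A) (n ω) :=
  ⟨h.feas_cap, h.cap⟩

theorem feas_wtPast (h : Runnable Z Γ n) (he : Unary Γ e) (hf : Unary Γ f) :
    Γ.Feas fun ω => wtPast (Fintype.card A) (wt Z (Γ.orc ω) (n ω)) (e ω) (f ω) := by
  have hg : Unary (Γ.loop (fun _ => Fintype.card A) (.const _))
    fun p => Fintype.card A * f p.1 + p.2 := ((Unary.const _).mul hf.lift).add .index
  exact .sum (.const _) (.const _) ((h.lift _).feas_wt he.lift.feas hg.feas he.lift.bd hg.bd)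

theorem feas_wtFace (h : Runnable Z Γ n) (he : Unary Γ e) :
    Γ.Feas fun ω => wtFace (Fintype.card A) (GibbsEntropy.cap d (Fintype.card A) (n ω))
      (wt Z (Γ.orc ω) (n ω)) (e ω) :=
  .sum h.feas_cap h.cap ((h.lift h.cap).feas_wtPast he.lift .index)

theorem feas_entFace (h : Runnable Z Γ n) (he : Unary Γ e) :
    Γ.Feas fun ω => entFace (Fintype.card A) (GibbsEntropy.cap d (Fintype.card A) (n ω))
      (wt Z (Γ.orc ω) (n ω)) (e ω) := by
  refine .div (.sum h.feas_cap h.cap (.mul ((h.lift h.cap).feas_wtPast he.lift .index)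
    (.sum (.const _) (.const _) ?_))) (h.feas_wtFace he)
  have h' := (h.lift h.cap).lift (.const (Fintype.card A))
  refine feas_entTerm h.unary_cap.lift.lift ?_ (h'.feas_wtPast he.lift.lift Unary.index.lift)
  have hg := ((Unary.const (Fintype.card A)).mul Unary.index.lift).add
    (Unary.index (Γ := Γ.loop _ h.cap) (k := fun _ => Fintype.card A) (hk := .const _))
  exact h'.feas_wt he.lift.lift.feas hg.feas he.lift.lift.bd hg.bd

theorem feas_discrepancy (h : Runnable Z Γ n) (he : Unary Γ e) (he' : Unary Γ e')
    (hf : Unary Γ f) (hx : Unary Γ x) :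
    Γ.Feas fun ω => discrepancy (Fintype.card A) (GibbsEntropy.cap d (Fintype.card A) (n ω))
      (wt Z (Γ.orc ω) (n ω)) (e ω) (e' ω) (f ω) (x ω) := by
  have hg := ((Unary.const (Fintype.card A)).mul hf).add hx
  have h1 := ((powConst h.feas_cap 2).mul (h.feas_wt he.feas hg.feas he.bd hg.bd)).div
    (h.feas_wtPast he hf)
  have h2 := ((powConst h.feas_cap 2).mul (h.feas_wt he'.feas hg.feas he'.bd hg.bd)).div
    (h.feas_wtPast he' hf)
  exact .ite_zero (h.feas_wtPast he hf) (.const 0) (.ite_zero (h.feas_wtPast he' hf) (.const 0)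
    ((h1.sub h2).add (h2.sub h1)))

theorem unary_maxDiscrepancy (h : Runnable Z Γ n) :
    Unary Γ fun ω => maxDiscrepancy (Fintype.card A)
      (GibbsEntropy.cap d (Fintype.card A) (n ω)) (wt Z (Γ.orc ω) (n ω)) := by
  refine ⟨?_, (h.cap.pow 2).mono fun ω => maxDiscrepancy_le _ _ _⟩
  have h1 := h.lift h.cap
  have h2 := h1.lift h1.cap
  have h3 := h2.lift h2.cap
  have h4 := h3.lift (.const (Fintype.card A))
  refine .sup h.feas_cap h.cap <| .sup h1.feas_cap h1.cap <| .sup h2.feas_cap h2.cap <|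
    .sup (.const _) (.const _) ?_
  exact h4.feas_discrepancy Unary.index.lift.lift.lift Unary.index.lift.lift Unary.index.lift
    .index

theorem feas_maxEnt (h : Runnable Z Γ n) :
    Γ.Feas fun ω => maxEnt (Fintype.card A)
      (GibbsEntropy.cap d (Fintype.card A) (n ω)) (wt Z (Γ.orc ω) (n ω)) :=
  .sup h.feas_cap h.cap <| .ite_zero ((h.lift h.cap).feas_wtFace .index) (.const 0)
    ((h.lift h.cap).feas_entFace .index)

theorem feas_minEnt (h : Runnable Z Γ n) :
    Γ.Feas fun ω => minEnt (Fintype.card A)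
      (GibbsEntropy.cap d (Fintype.card A) (n ω)) (wt Z (Γ.orc ω) (n ω)) := by
  have hq : Γ.Feas fun ω => Fintype.card A * GibbsEntropy.cap d (Fintype.card A) (n ω) ^ 2 :=
    (Feas.const _).mul (powConst h.feas_cap 2)
  exact hq.sub <| .sup h.feas_cap h.cap <| .ite_zero ((h.lift h.cap).feas_wtFace .index)
    (.const 0) (hq.lift.sub ((h.lift h.cap).feas_entFace .index))

theorem feas_lowerBd (h : Runnable Z Γ n) :
    Γ.Feas fun ω => lowerBd (Fintype.card A)
      (GibbsEntropy.cap d (Fintype.card A) (n ω)) (wt Z (Γ.orc ω) (n ω)) :=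
  h.feas_minEnt.sub ((Feas.const _).mul h.feas_cap)

theorem feas_upperBd (h : Runnable Z Γ n) :
    Γ.Feas fun ω => upperBd (Fintype.card A)
      (GibbsEntropy.cap d (Fintype.card A) (n ω)) (wt Z (Γ.orc ω) (n ω)) :=
  (h.feas_maxEnt.add (((Feas.const _).mul h.feas_cap).mul (feas_ceilSqrt
    (h.unary_maxDiscrepancy.add (.const 7))))).add ((Feas.const _).mul h.feas_cap)

end Runnable

end

end GibbsEntropy

/-! ### Uniform programs -/

namespace GibbsEntropy
open Finset Ctx

section

variable {d : ℕ} {A : Type u} [Fintype A] {Z : Fin d → A → A → Prop}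

/-- External functions on which the algorithm can be run with resources controlled by `C`. -/
structure Supply (Z : Fin d → A → A → Prop) (φ : Param d A → ℕ → ℕ) (C : ℕ) : Prop where
  le : ∀ p k, φ p k ≤ 2 ^ k * C
  base : basePrec Z φ ≤ C
  base_spec : deficit Z φ (basePrec Z φ) = 0

theorem side_le_cap (hd : 2 ≤ d) {q : ℕ} (hq : 2 ≤ q) (n : ℕ) : side n ≤ cap d q n := by
  have h1 : side n ≤ layer d n :=
    Nat.le_self_pow (by omega) _
  calc side n ≤ layer d n := h1
    _ ≤ (2 * d + 2) * layer d n := Nat.le_mul_of_pos_left _ (by omega)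
    _ ≤ 2 ^ ((2 * d + 2) * layer d n) := Nat.lt_two_pow_self.le
    _ ≤ cap d q n := Nat.pow_le_pow_left hq _

theorem cap_mono {q : ℕ} (hq : 1 ≤ q) {m n : ℕ} (h : m ≤ n) : cap d q m ≤ cap d q n := by
  unfold cap layer side
  exact Nat.pow_le_pow_right hq (Nat.mul_le_mul_left _ (Nat.pow_le_pow_left (by omega) _))

/-- A number that is feasible in all contexts in which the algorithm can be run is computed by
one program. -/
theorem exists_prog [Nontrivial A] (hd : 2 ≤ d) (F : (Param d A → ℕ → ℕ) → ℕ → ℕ)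
    (hF : ∀ (Ω : Type u) (Γ : Ctx (Param d A) Ω) (n : Ω → ℕ), Runnable Z Γ n →
      Γ.Feas fun ω => F (Γ.orc ω) (n ω)) :
    ∃ (p : Prog (Param d A) 1) (c : ℕ), ∀ φ C n, Supply Z φ C →
      ∃ t ≤ (C + cap d (Fintype.card A) n + 2) ^ c, Runs φ p ![n] (F φ n) t := by
  -- All supplies, resource bounds and inputs form one family, so feasibility yields a program and
  -- an exponent that depend on none of them. The bound `C` controls the time but is not an input.
  let Ω := {x : (Param d A → ℕ → ℕ) × ℕ × ℕ // Supply Z x.1 x.2.1}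
  have hn : ∀ n, side n ≤ cap d (Fintype.card A) n :=
    side_le_cap hd (Fintype.one_lt_card (α := A))
  have hn' : ∀ n : ℕ, n ≤ side n := fun n => by unfold side; omega
  let Γ : Ctx (Param d A) Ω :=
    { orc := fun x => x.1.1
      M := fun x => x.1.2.1 + cap d (Fintype.card A) x.1.2.2
      n := 1
      env := fun x => ![x.1.2.2]
      bd := fun i => PolyBd.size (PolyBd.self.mono fun x => by
        have := hn x.1.2.2
        have := hn' x.1.2.2
        simp only [Matrix.cons_val_fin_one]
        omega) }
  have hΓ : Runnable Z Γ fun x => x.1.2.2 :=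
    { feas := Feas.env Γ (0 : Fin 1)
      side := PolyBd.self.mono fun x => (hn x.1.2.2).trans (Nat.le_add_left _ _)
      cap := PolyBd.self.mono fun x => Nat.le_add_left _ _
      query := ⟨fun x => x.1.2.1, PolyBd.self.mono fun x => Nat.le_add_right _ _,
        fun x => x.2.le⟩
      base := PolyBd.self.mono fun x => x.2.base.trans (Nat.le_add_right _ _)
      base_spec := fun x => x.2.base_spec }
  obtain ⟨p, τ, ⟨c, hc⟩, hp⟩ := hF Ω Γ _ hΓ
  exact ⟨p, c, fun φ C n h => ⟨_, hc ⟨(φ, C, n), h⟩, hp ⟨(φ, C, n), h⟩⟩⟩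

/-- The least parameter at which a test succeeds. -/
noncomputable def firstGood (T : (Param d A → ℕ → ℕ) → ℕ → ℕ → ℕ) (φ : Param d A → ℕ → ℕ)
    (k : ℕ) : ℕ := sInf {n | T φ k n = 0}

/-- The search never goes beyond the first success, and `cap` is monotone, so all its costs are
controlled by any `n` that passes the test. Such an `n` enters the time bound only; the program does
not receive it. -/
theorem exists_search_prog [Nontrivial A] (hd : 2 ≤ d)
    (T : (Param d A → ℕ → ℕ) → ℕ → ℕ → ℕ)
    (hT : ∀ (Ω : Type u) (Γ : Ctx (Param d A) Ω) (k n : Ω → ℕ), Runnable Z Γ n → Γ.Feas k →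
      Γ.Feas fun ω => T (Γ.orc ω) (k ω) (n ω))
    (F : (Param d A → ℕ → ℕ) → ℕ → ℕ)
    (hF : ∀ (Ω : Type u) (Γ : Ctx (Param d A) Ω) (n : Ω → ℕ), Runnable Z Γ n →
      Γ.Feas fun ω => F (Γ.orc ω) (n ω)) :
    ∃ (p : Prog (Param d A) 1) (c : ℕ), ∀ φ C k n, Supply Z φ C → T φ k n = 0 →
      ∃ t ≤ (C + cap d (Fintype.card A) n + k + 2) ^ c,
        Runs φ p ![k] (F φ (firstGood T φ k)) t := by
  let Ω := {x : (Param d A → ℕ → ℕ) × ℕ × ℕ × ℕ // Supply Z x.1 x.2.1 ∧ T x.1 x.2.2.1 x.2.2.2 = 0}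
  have hq : 2 ≤ Fintype.card A := Fintype.one_lt_card (α := A)
  have hn : ∀ n, side n ≤ cap d (Fintype.card A) n := side_le_cap hd hq
  have hn' : ∀ n : ℕ, n ≤ side n := fun n => by unfold side; omega
  let Γ : Ctx (Param d A) Ω :=
    { orc := fun x => x.1.1
      M := fun x => x.1.2.1 + cap d (Fintype.card A) x.1.2.2.2 + x.1.2.2.1
      n := 1
      env := fun x => ![x.1.2.2.1]
      bd := fun i => PolyBd.size (PolyBd.self.mono fun x => by
        simp only [Matrix.cons_val_fin_one]
        omega) }
  let m : Ω → ℕ := fun x => firstGood T x.1.1 x.1.2.2.1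
  have hm : ∀ x : Ω, m x ≤ x.1.2.2.2 := fun x => Nat.sInf_le x.2.2
  have hmC : ∀ (x : Ω) (i : ℕ), i ≤ m x → cap d (Fintype.card A) i ≤ Γ.M x := fun x i hi =>
    (cap_mono (by omega) (hi.trans (hm x))).trans
      ((Nat.le_add_left _ _).trans (Nat.le_add_right _ _))
  have hmb : PolyBd Γ.M m := PolyBd.self.mono fun x =>
    ((hn' _).trans (hn _)).trans (hmC x _ le_rfl)
  -- Serves twice: for the parameters tried during the search, and for the final computation at the
  -- parameter found.
  have hrun : ∀ {Ω' : Type u} (Δ : Ctx (Param d A) Ω') (g : Ω' → Ω) (n : Ω' → ℕ),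
      Δ.Feas n → (∀ x, n x ≤ m (g x)) → (Δ.M = fun x => Γ.M (g x)) →
      (Δ.orc = fun x => Γ.orc (g x)) → Runnable Z Δ n := by
    intro Ω' Δ g n hn1 hn2 hM ho
    refine
    { feas := hn1
      side := PolyBd.self.mono fun x => ?_
      cap := PolyBd.self.mono fun x => ?_
      query := ⟨fun x => (g x).1.2.1, PolyBd.self.mono fun x => ?_, fun x => ?_⟩
      base := PolyBd.self.mono fun x => ?_
      base_spec := fun x => ?_ }
    · rw [hM]; exact (hn _).trans (hmC _ _ (hn2 x))
    · rw [hM]; exact hmC _ _ (hn2 x)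
    · rw [hM]; exact (Nat.le_add_right _ _).trans (Nat.le_add_right _ _)
    · rw [ho]; exact (g x).2.1.le
    · rw [hM, ho]
      exact ((g x).2.1.base.trans (Nat.le_add_right _ _)).trans (Nat.le_add_right _ _)
    · rw [ho]; exact (g x).2.1.base_spec
  have hk : Γ.Feas fun x => x.1.2.2.1 := Feas.env Γ (0 : Fin 1)
  have hmf : Γ.Feas m := by
    refine Feas.search hmb (h := fun x i => T x.1.1 x.1.2.2.1 i) ?_ (fun x i hi => ?_)
      (fun x => ?_)
    · refine hT _ _ (fun p : Σ x, Fin (m x + 1) => p.1.1.2.2.1) (fun p => (p.2 : ℕ)) (hrun _ Sigma.fst _ .index (fun p => ?_)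
        rfl rfl) hk.lift
      exact Nat.le_of_lt_succ p.2.2
    · exact Nat.notMem_of_lt_sInf (s := {n | T x.1.1 x.1.2.2.1 n = 0}) hi
    · exact Nat.sInf_mem (s := {n | T x.1.1 x.1.2.2.1 n = 0}) ⟨_, x.2.2⟩
  obtain ⟨p, τ, ⟨c, hc⟩, hp⟩ := hF Ω Γ m (hrun Γ id m hmf (fun _ => le_rfl) rfl rfl)
  exact ⟨p, c, fun φ C k n h h' => ⟨_, hc ⟨(φ, C, k, n), h, h'⟩, hp ⟨(φ, C, k, n), h, h'⟩⟩⟩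

end

/-! ### The two algorithms -/

section

variable {d : ℕ} {A : Type u} [Fintype A]

noncomputable def lowerOut (Z : Fin d → A → A → Prop) (φ : Param d A → ℕ → ℕ) (n : ℕ) : ℕ :=
  lowerBd (Fintype.card A) (cap d (Fintype.card A) n) (wt Z φ n)

noncomputable def upperOut (Z : Fin d → A → A → Prop) (φ : Param d A → ℕ → ℕ) (n : ℕ) : ℕ :=
  upperBd (Fintype.card A) (cap d (Fintype.card A) n) (wt Z φ n)

def denOut (d : ℕ) (A : Type u) [Fintype A] (n : ℕ) : ℕ := cap d (Fintype.card A) n ^ 2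

/-- Zero if the bounds computed with parameter `n` are within `1 / k`. -/
noncomputable def gapTest (Z : Fin d → A → A → Prop) (φ : Param d A → ℕ → ℕ) (k n : ℕ) : ℕ :=
  (upperOut Z φ n - lowerOut Z φ n) * k - denOut d A n

theorem exists_algorithms [Nontrivial A] (hd : 2 ≤ d) (Z : Fin d → A → A → Prop) :
    ∃ (M M' : BoundAlg (Param d A)) (c : ℕ),
      (∀ φ C n, Supply Z φ C → ∃ t ≤ (C + cap d (Fintype.card A) n + 2) ^ c,
        M.Outputs φ n (lowerOut Z φ n) (upperOut Z φ n) (denOut d A n) t) ∧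
      ∀ φ C k n, Supply Z φ C → gapTest Z φ k n = 0 →
        ∃ t ≤ (C + cap d (Fintype.card A) n + k + 2) ^ c,
        M'.Outputs φ k (lowerOut Z φ (firstGood (gapTest Z) φ k))
          (upperOut Z φ (firstGood (gapTest Z) φ k))
          (denOut d A (firstGood (gapTest Z) φ k)) t := by
  have hden : ∀ (Ω : Type u) (Γ : Ctx (Param d A) Ω) (n : Ω → ℕ), Runnable Z Γ n →
      Γ.Feas fun ω => denOut d A (n ω) := fun Ω Γ n h => Runnable.powConst h.feas_cap 2
  have hlo : ∀ (Ω : Type u) (Γ : Ctx (Param d A) Ω) (n : Ω → ℕ), Runnable Z Γ n →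
      Γ.Feas fun ω => lowerOut Z (Γ.orc ω) (n ω) := fun Ω Γ n h => h.feas_lowerBd
  have hhi : ∀ (Ω : Type u) (Γ : Ctx (Param d A) Ω) (n : Ω → ℕ), Runnable Z Γ n →
      Γ.Feas fun ω => upperOut Z (Γ.orc ω) (n ω) := fun Ω Γ n h => h.feas_upperBd
  have hgap : ∀ (Ω : Type u) (Γ : Ctx (Param d A) Ω) (k n : Ω → ℕ), Runnable Z Γ n → Γ.Feas k →
      Γ.Feas fun ω => gapTest Z (Γ.orc ω) (k ω) (n ω) := fun Ω Γ k n h hk =>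
    (((hhi _ _ _ h).sub (hlo _ _ _ h)).mul hk).sub (hden _ _ _ h)
  have hpow : ∀ (x a b c t₁ t₂ t₃ : ℕ), t₁ ≤ (x + 2) ^ a → t₂ ≤ (x + 2) ^ b →
      t₃ ≤ (x + 2) ^ c → t₁ + t₂ + t₃ ≤ (x + 2) ^ (a + b + c + 2) := by
    intro x a b c t₁ t₂ t₃ h1 h2 h3
    have e1 : (x + 2) ^ a ≤ (x + 2) ^ (a + b + c) := Nat.pow_le_pow_right (by omega) (by omega)
    have e2 : (x + 2) ^ b ≤ (x + 2) ^ (a + b + c) := Nat.pow_le_pow_right (by omega) (by omega)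
    have e3 : (x + 2) ^ c ≤ (x + 2) ^ (a + b + c) := Nat.pow_le_pow_right (by omega) (by omega)
    have e4 : 4 ≤ (x + 2) ^ 2 := by nlinarith [Nat.zero_le x]
    calc t₁ + t₂ + t₃ ≤ (x + 2) ^ (a + b + c) * 4 := by omega
      _ ≤ (x + 2) ^ (a + b + c) * (x + 2) ^ 2 := Nat.mul_le_mul_left _ e4
      _ = _ := (pow_add _ _ _).symm
  obtain ⟨p1, c1, h1⟩ := exists_prog hd _ hlo
  obtain ⟨p2, c2, h2⟩ := exists_prog hd _ hhi
  obtain ⟨p3, c3, h3⟩ := exists_prog (Z := Z) hd (fun _ n => denOut d A n) hden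
  obtain ⟨p4, c4, h4⟩ := exists_search_prog hd _ hgap _ hlo
  obtain ⟨p5, c5, h5⟩ := exists_search_prog hd _ hgap _ hhi
  obtain ⟨p6, c6, h6⟩ := exists_search_prog (Z := Z) hd _ hgap (fun _ n => denOut d A n) hden
  have hmono : ∀ (x a b : ℕ), (x + 2) ^ a ≤ (x + 2) ^ (a + b) := fun x a b =>
    Nat.pow_le_pow_right (by omega) (by omega)
  refine ⟨⟨p1, p2, p3⟩, ⟨p4, p5, p6⟩, (c1 + c2 + c3 + 2) + (c4 + c5 + c6 + 2),
    fun φ C n h => ?_, fun φ C k n h h' => ?_⟩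
  · obtain ⟨t1, ht1, r1⟩ := h1 φ C n h
    obtain ⟨t2, ht2, r2⟩ := h2 φ C n h
    obtain ⟨t3, ht3, r3⟩ := h3 φ C n h
    exact ⟨_, (hpow _ _ _ _ _ _ _ ht1 ht2 ht3).trans (hmono _ _ _), t1, t2, t3, r1, r2, r3, rfl⟩
  · obtain ⟨t1, ht1, r1⟩ := h4 φ C k n h h'
    obtain ⟨t2, ht2, r2⟩ := h5 φ C k n h h'
    obtain ⟨t3, ht3, r3⟩ := h6 φ C k n h h'
    exact ⟨_, (hpow _ _ _ _ _ _ _ ht1 ht2 ht3).trans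
      (by rw [add_comm (c1 + c2 + c3 + 2)]; exact hmono _ _ _), t1, t2, t3, r1, r2, r3, rfl⟩

end

end GibbsEntropy

namespace GibbsEntropy
open Finset

/-! ### Correctness of the table -/

section Digits

/-- Positional notation with digits `D κ < B`. -/
theorem positional_digit {B : ℕ} {D : ℕ → ℕ} (hD : ∀ κ, D κ < B) (K j : ℕ) :
    (∑ κ ∈ range K, D κ * B ^ κ) / B ^ j % B = if j < K then D j else 0 := by
  have hB : 0 < B := (Nat.zero_le _).trans_lt (hD 0)
  induction j generalizing K D with
  | zero =>
    cases K with
    | zero => simp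
    | succ K =>
      have : B ∣ ∑ κ ∈ range K, D (κ + 1) * B ^ (κ + 1) :=
        Finset.dvd_sum fun κ _ => (dvd_pow_self B (Nat.succ_ne_zero κ)).mul_left _
      obtain ⟨c, hc⟩ := this
      rw [Finset.sum_range_succ', hc]
      simp [Nat.add_mod, Nat.mod_eq_of_lt (hD 0)]
  | succ j ih =>
    cases K with
    | zero => simp
    | succ K =>
      have := ih (D := fun κ => D (κ + 1)) (fun κ => hD _) K
      rw [Finset.sum_range_succ', pow_succ', ← Nat.div_div_eq_div_mul]
      have e : (∑ κ ∈ range K, D (κ + 1) * B ^ (κ + 1) + D 0 * B ^ 0) / B =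
          ∑ κ ∈ range K, D (κ + 1) * B ^ κ := by
        have : ∑ κ ∈ range K, D (κ + 1) * B ^ (κ + 1) =
            B * ∑ κ ∈ range K, D (κ + 1) * B ^ κ := by
          rw [Finset.mul_sum]
          exact Finset.sum_congr rfl fun κ _ => by ring
        rw [this, pow_zero, mul_one, Nat.mul_add_div hB, Nat.div_eq_of_lt (hD 0), add_zero]
      rw [e, this]
      simp

end Digits

/-- A word as a sequence. -/
def seqOf {q t : ℕ} (w : Fin t → Fin q) (i : ℕ) : ℕ := if h : i < t then w ⟨i, h⟩ else 0

theorem seqOf_snoc_lt {q t : ℕ} (w : Fin t → Fin q) (a : Fin q) {i : ℕ} (h : i < t) :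
    seqOf (Fin.snoc (α := fun _ => Fin q) w a) i = seqOf w i := by
  simp [seqOf, Nat.lt_succ_of_lt h, h, Fin.snoc]

theorem seqOf_snoc_self {q t : ℕ} (w : Fin t → Fin q) (a : Fin q) :
    seqOf (Fin.snoc (α := fun _ => Fin q) w a) t = a := by
  simp [seqOf, Fin.snoc]

theorem sum_words_succ {q t : ℕ} {R : Type*} [AddCommMonoid R]
    (f : (Fin (t + 1) → Fin q) → R) :
    ∑ w, f w = ∑ a : Fin q, ∑ w : Fin t → Fin q, f (Fin.snoc (α := fun _ => Fin q) w a) := by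
  rw [← (Fin.snocEquiv fun _ => Fin q).sum_comp, Fintype.sum_prod_type]
  rfl

section

variable {d : ℕ} {A : Type u} [Fintype A]

/-- State of the algorithm after reading `t` symbols. -/
def state (d q n : ℕ) (w : ℕ → ℕ) : ℕ → ℕ
  | 0 => 0
  | t + 1 => upd d q n t (state d q n w t) (w t)

theorem state_congr {q n : ℕ} {w w' : ℕ → ℕ} {t : ℕ} (h : ∀ i < t, w i = w' i) :
    state d q n w t = state d q n w' t := by
  induction t with
  | zero => rfl
  | succ t ih =>
    rw [state, state, ih fun i hi => h i (Nat.lt_succ_of_lt hi), h t (Nat.lt_succ_self t)]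

variable (Z : Fin d → A → A → Prop) (φ : Param d A → ℕ → ℕ) (n : ℕ)

/-- Weight of the first `t` symbols of a word. -/
noncomputable def wordWt (w : ℕ → ℕ) (t : ℕ) : ℕ :=
  ∏ j ∈ range t, fac Z φ n j
    (state d (Fintype.card A) n w j % cap d (Fintype.card A) n) (w j)

variable {Z φ n}

theorem wordWt_congr {w w' : ℕ → ℕ} {t : ℕ} (h : ∀ i < t, w i = w' i) :
    wordWt Z φ n w t = wordWt Z φ n w' t := by
  refine Finset.prod_congr rfl fun j hj => ?_
  rw [Finset.mem_range] at hj
  rw [h j hj, state_congr fun i hi => h i (hi.trans hj)]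

theorem sum_le_prod_one_add' {ι : Type*} (s : Finset ι) (f : ι → ℕ) :
    ∑ i ∈ s, f i ≤ ∏ i ∈ s, (1 + f i) := by
  classical
  have : 1 + ∑ i ∈ s, f i ≤ ∏ i ∈ s, (1 + f i) := by
    induction s using Finset.induction_on with
    | empty => simp
    | insert a s ha ih =>
      rw [Finset.sum_insert ha, Finset.prod_insert ha]
      have := Nat.mul_le_mul_left (f a) ih
      rw [add_mul, one_mul]
      nlinarith [Nat.zero_le (f a * ∑ i ∈ s, f i)]
  omega

/-- The product defining `topN` splits into one block for the γ and one for each direction. A block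
dominates the sum of its parameters, hence each of them, and it also dominates the factor 1 used
when there is no neighbour. -/
theorem fac_le_topN (t s a : ℕ) : fac Z φ n t s a ≤ topN Z φ n := by
  unfold fac topN
  rw [Fintype.prod_sum_type]
  refine Nat.mul_le_mul ?_ ?_
  · refine le_trans ?_ (sum_le_prod_one_add' univ _)
    refine Finset.sum_le_sum fun a' _ => ?_
    split_ifs <;> simp
  · rw [Fintype.prod_prod_type]
    refine Finset.prod_le_prod' fun i _ => ?_
    split_ifs
    · exact Nat.one_le_iff_ne_zero.2 (Finset.prod_ne_zero_iff.2 fun x _ => by omega)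
    · refine le_trans ?_ (sum_le_prod_one_add' univ _)
      rw [Fintype.sum_prod_type]
      refine Finset.sum_le_sum fun a' _ => Finset.sum_le_sum fun b' _ => ?_
      split_ifs <;> simp

variable [Nonempty A]

theorem state_lt {w : ℕ → ℕ} (t : ℕ) :
    state d (Fintype.card A) n w t < cap d (Fintype.card A) n ^ 3 := by
  induction t with
  | zero => exact pow_pos (cap_pos Fintype.card_pos) _
  | succ t ih => exact upd_lt ih

omit [Nonempty A] in
theorem topN_pos : 0 < topN Z φ n := Finset.prod_pos fun _ _ => by omega

/-- There are q^t words of weight at most `topN ^ t`, so no group of words has a total reaching the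
base: the digits of a table never carry. -/
theorem sum_wordWt_lt {t : ℕ} (ht : t ≤ side n ^ d)
    (P : (Fin t → Fin (Fintype.card A)) → Prop) [DecidablePred P] :
    ∑ w : Fin t → Fin (Fintype.card A), (if P w then wordWt Z φ n (seqOf w) t else 0)
      < tableBase Z φ n := by
  unfold tableBase
  rw [Nat.lt_succ_iff]
  calc _ ≤ ∑ w : Fin t → Fin (Fintype.card A), topN Z φ n ^ t := by
        refine Finset.sum_le_sum fun w _ => ?_
        split_ifs
        · exact (Finset.prod_le_pow_card _ _ _ fun j _ => fac_le_topN _ _ _).trans (by simp)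
        · exact Nat.zero_le _
    _ = (Fintype.card A * topN Z φ n) ^ t := by simp [mul_pow]
    _ ≤ _ := Nat.pow_le_pow_right (Nat.mul_pos Fintype.card_pos topN_pos) ht

/-- Total weight of the words that lead to the state `κ`. -/
noncomputable def stateWt (Z : Fin d → A → A → Prop) (φ : Param d A → ℕ → ℕ) (n t κ : ℕ) : ℕ :=
  ∑ w : Fin t → Fin (Fintype.card A),
    if state d (Fintype.card A) n (seqOf w) t = κ then wordWt Z φ n (seqOf w) t else 0

theorem sum_stateWt (t : ℕ) (f : ℕ → ℕ) :
    ∑ κ ∈ range (cap d (Fintype.card A) n ^ 3), stateWt Z φ n t κ * f κ =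
      ∑ w : Fin t → Fin (Fintype.card A), wordWt Z φ n (seqOf w) t *
        f (state d (Fintype.card A) n (seqOf w) t) := by
  simp only [stateWt, Finset.sum_mul]
  rw [Finset.sum_comm]
  refine Finset.sum_congr rfl fun w _ => ?_
  simp only [ite_mul, zero_mul]
  rw [Finset.sum_ite_eq, if_pos (Finset.mem_range.2 (state_lt t))]

theorem lookup_eq {t : ℕ} (ht : t ≤ side n ^ d) (κ : ℕ) :
    (∑ κ ∈ range (cap d (Fintype.card A) n ^ 3), stateWt Z φ n t κ * tableBase Z φ n ^ κ) /
      tableBase Z φ n ^ κ % tableBase Z φ n = stateWt Z φ n t κ := by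
  have h : ∀ κ, stateWt Z φ n t κ < tableBase Z φ n := fun κ => sum_wordWt_lt ht _
  rw [positional_digit h]
  split_ifs with h
  · rfl
  · refine (Finset.sum_eq_zero fun w _ => if_neg ?_).symm
    have := state_lt (A := A) (d := d) (n := n) (w := seqOf w) t
    omega

/-- The next factor and the next state depend on the word read so far only through its state, so
words with equal states can be merged. Digits can be read off again because there are no carries. -/
theorem table_eq {t : ℕ} (ht : t ≤ side n ^ d) :
    table Z φ n t = ∑ κ ∈ range (cap d (Fintype.card A) n ^ 3),
      stateWt Z φ n t κ * tableBase Z φ n ^ κ := by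
  induction t with
  | zero =>
    rw [sum_stateWt]
    simp [table, wordWt, state]
  | succ t ih =>
    have ht' : t ≤ side n ^ d := (Nat.le_succ t).trans ht
    rw [table, ih ht', sum_stateWt (t + 1)]
    simp only [lookup_eq ht']
    rw [Finset.sum_comm, sum_words_succ,
      ← Fin.sum_univ_eq_sum_range (fun a => ∑ κ ∈ range (cap d (Fintype.card A) n ^ 3),
        stateWt Z φ n t κ * fac Z φ n t (κ % cap d (Fintype.card A) n) a *
          tableBase Z φ n ^ upd d (Fintype.card A) n t κ a)]
    refine Finset.sum_congr rfl fun a _ => ?_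
    simp only [mul_assoc]
    rw [sum_stateWt t fun κ => fac Z φ n t (κ % cap d (Fintype.card A) n) a *
      tableBase Z φ n ^ upd d (Fintype.card A) n t κ a]
    refine Finset.sum_congr rfl fun w _ => ?_
    have h1 : state d (Fintype.card A) n (seqOf (Fin.snoc (α := fun _ => Fin _) w a)) t =
      state d (Fintype.card A) n (seqOf w) t := state_congr fun i hi => seqOf_snoc_lt w a hi
    have h2 : wordWt Z φ n (seqOf (Fin.snoc (α := fun _ => Fin _) w a)) t =
      wordWt Z φ n (seqOf w) t := wordWt_congr fun i hi => seqOf_snoc_lt w a hi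
    have h3 : ∀ v : ℕ → ℕ, wordWt Z φ n v (t + 1) = wordWt Z φ n v t * fac Z φ n t
        (state d (Fintype.card A) n v t % cap d (Fintype.card A) n) (v t) :=
      fun v => Finset.prod_range_succ _ _
    rw [h3, h1, h2, state, h1, seqOf_snoc_self, mul_assoc]

/-- Code of the symbols on the faces. -/
def faceCode (d q n : ℕ) (w : ℕ → ℕ) (t : ℕ) : ℕ := state d q n w t / cap d q n % cap d q n

/-- Code of the symbols in the near past. -/
def pastCode (d q n : ℕ) (w : ℕ → ℕ) (t : ℕ) : ℕ := state d q n w t / cap d q n ^ 2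

theorem wt_eq {e : ℕ} (he : e < cap d (Fintype.card A) n) (g : ℕ) :
    wt Z φ n e g = ∑ w : Fin (side n ^ d) → Fin (Fintype.card A),
      if faceCode d (Fintype.card A) n (seqOf w) (side n ^ d) = e ∧
        pastCode d (Fintype.card A) n (seqOf w) (side n ^ d) = g
      then wordWt Z φ n (seqOf w) (side n ^ d) else 0 := by
  unfold wt
  rw [table_eq le_rfl]
  simp only [lookup_eq le_rfl]
  simp only [stateWt]
  rw [Finset.sum_comm]
  refine Finset.sum_congr rfl fun w _ => ?_
  unfold faceCode pastCode
  generalize state d (Fintype.card A) n (seqOf w) (side n ^ d) = κ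
  generalize wordWt Z φ n (seqOf w) (side n ^ d) = y
  have hE : 0 < cap d (Fintype.card A) n := cap_pos Fintype.card_pos
  generalize cap d (Fintype.card A) n = E at *
  have key : ∀ s ∈ range E, (κ = s + E * (e + E * g)) ↔
      (κ % E = s ∧ (κ / E % E = e ∧ κ / E ^ 2 = g)) := by
    intro s hs
    rw [Finset.mem_range] at hs
    rw [pow_two, ← Nat.div_div_eq_div_mul]
    constructor
    · rintro rfl
      have h1 : (s + E * (e + E * g)) / E = e + E * g := by
        rw [Nat.add_mul_div_left _ _ hE, Nat.div_eq_of_lt hs, zero_add]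
      refine ⟨by rw [Nat.add_mul_mod_self_left, Nat.mod_eq_of_lt hs], ?_, ?_⟩
      · rw [h1, Nat.add_mul_mod_self_left, Nat.mod_eq_of_lt he]
      · rw [h1, Nat.add_mul_div_left _ _ hE, Nat.div_eq_of_lt he, zero_add]
    · rintro ⟨rfl, rfl, rfl⟩
      rw [Nat.mod_add_div, Nat.mod_add_div]
  rw [Finset.sum_congr rfl fun s hs => if_congr (key s hs) rfl rfl]
  simp only [ite_and]
  rw [Finset.sum_ite_eq, if_pos (Finset.mem_range.2 (Nat.mod_lt _ hE))]

/-! ### Codes of sets of symbols -/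

theorem window_succ (w : ℕ → ℕ) (t : ℕ) :
    state d (Fintype.card A) n w (t + 1) % cap d (Fintype.card A) n =
      (Fintype.card A * (state d (Fintype.card A) n w t % cap d (Fintype.card A) n) + w t) %
        cap d (Fintype.card A) n := by
  rw [state, upd, Nat.add_mul_mod_self_left]
  simp [push]

theorem faceCode_succ (w : ℕ → ℕ) (t : ℕ) :
    faceCode d (Fintype.card A) n w (t + 1) =
      push (Fintype.card A) (cap d (Fintype.card A) n) (1 - interior d n t)
        (faceCode d (Fintype.card A) n w t) (w t) := by
  have hE : 0 < cap d (Fintype.card A) n := cap_pos Fintype.card_pos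
  rw [faceCode, state, upd, Nat.add_mul_div_left _ _ hE,
    Nat.div_eq_of_lt (push_lt (Nat.mod_lt _ hE)), zero_add, Nat.add_mul_mod_self_left,
    Nat.mod_eq_of_lt (push_lt (Nat.mod_lt _ hE))]
  rfl

theorem pastCode_succ (w : ℕ → ℕ) (t : ℕ) :
    pastCode d (Fintype.card A) n w (t + 1) =
      push (Fintype.card A) (cap d (Fintype.card A) n) (nearPast d n t)
        (pastCode d (Fintype.card A) n w t) (w t) := by
  have hE : 0 < cap d (Fintype.card A) n := cap_pos Fintype.card_pos
  rw [pastCode, state, upd, pow_two, ← Nat.div_div_eq_div_mul, Nat.add_mul_div_left _ _ hE,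
    Nat.div_eq_of_lt (push_lt (Nat.mod_lt _ hE)), zero_add, Nat.add_mul_div_left _ _ hE,
    Nat.div_eq_of_lt (push_lt (Nat.mod_lt _ hE)), zero_add, pastCode, pow_two]

/-- Appending a symbol shifts the digits by one place, and reduction modulo q^R leaves the lowest R
digits alone. -/
theorem window_digit {q R : ℕ} (hq : 0 < q) {s w : ℕ → ℕ}
    (hs : ∀ t, s (t + 1) = (q * s t + w t) % q ^ R) {T : ℕ} (hw : ∀ t < T, w t < q) {t r : ℕ}
    (ht : t ≤ T) (hrt : r < t) (hrR : r < R) : s t / q ^ r % q = w (t - 1 - r) := by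
  induction r generalizing t with
  | zero =>
    obtain ⟨t, rfl⟩ : ∃ t', t = t' + 1 := ⟨t - 1, by omega⟩
    rw [hs, pow_zero, Nat.div_one, Nat.mod_mod_of_dvd _ (dvd_pow_self q (by omega)),
      Nat.mul_add_mod, Nat.mod_eq_of_lt (hw t (by omega))]
    simp
  | succ r ih =>
    obtain ⟨t, rfl⟩ : ∃ t', t = t' + 1 := ⟨t - 1, by omega⟩
    have h1 : ∀ x, x % q ^ R / q ^ (r + 1) % q = x / q ^ (r + 1) % q := by
      intro x
      obtain ⟨c, rfl⟩ : ∃ c, R = (r + 1) + 1 + c := ⟨R - (r + 2), by omega⟩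
      rw [pow_add, pow_succ q (r + 1), mul_assoc, Nat.mod_mul_right_div_self,
        Nat.mod_mod_of_dvd _ (dvd_mul_right q _)]
    rw [hs, h1, pow_succ', ← Nat.div_div_eq_div_mul, Nat.mul_add_div hq,
      Nat.div_eq_of_lt (hw t (by omega)), add_zero, ih (by omega) (by omega) (by omega)]
    congr 1
    omega

/-- Codes are injective as long as they do not overflow. -/
theorem code_spec {q E : ℕ} (hq : 0 < q) {c : ℕ → ℕ} {T : ℕ}
    (hE : q ^ #{j ∈ range T | c j ≠ 0} ≤ E) {k k' w w' : ℕ → ℕ} (h0 : k 0 = 0) (h0' : k' 0 = 0)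
    (hk : ∀ t, k (t + 1) = push q E (c t) (k t) (w t))
    (hk' : ∀ t, k' (t + 1) = push q E (c t) (k' t) (w' t))
    (hw : ∀ t < T, w t < q) (hw' : ∀ t < T, w' t < q) {t : ℕ} (ht : t ≤ T) :
    k t < q ^ #{j ∈ range t | c j ≠ 0} ∧ k' t < q ^ #{j ∈ range t | c j ≠ 0} ∧
      (k t = k' t ↔ ∀ j < t, c j ≠ 0 → w j = w' j) := by
  induction t with
  | zero => simp [h0, h0']
  | succ t ih =>
    obtain ⟨ih1, ih2, ih3⟩ := ih (by omega)
    have hcard : #{j ∈ range (t + 1) | c j ≠ 0} ≤ #{j ∈ range T | c j ≠ 0} :=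
      Finset.card_le_card (Finset.filter_subset_filter _ (Finset.range_mono ht))
    have hforall : (∀ j < t + 1, c j ≠ 0 → w j = w' j) ↔
        (∀ j < t, c j ≠ 0 → w j = w' j) ∧ (c t ≠ 0 → w t = w' t) := by
      constructor
      · exact fun h => ⟨fun j hj => h j (by omega), h t (by omega)⟩
      · rintro ⟨h1, h2⟩ j hj
        rcases Nat.lt_succ_iff_lt_or_eq.1 hj with h | rfl
        exacts [h1 j h, h2]
    rw [hforall, hk, hk']
    unfold push
    rw [Finset.range_add_one, Finset.filter_insert] at hcard ⊢
    by_cases hc : c t = 0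
    · simp only [hc, if_true, ne_eq, not_true_eq_false, if_false, false_implies, and_true]
      exact ⟨ih1, ih2, ih3⟩
    · simp only [hc, if_false, ne_eq, not_false_eq_true, if_true] at hcard ⊢
      rw [Finset.card_insert_of_notMem (by simp)] at hcard ⊢
      have b1 : q * k t + w t < q ^ (#{j ∈ range t | ¬ c j = 0} + 1) := by
        rw [pow_succ', add_comm]
        exact add_mul_lt (hw t (by omega)) ih1
      have b2 : q * k' t + w' t < q ^ (#{j ∈ range t | ¬ c j = 0} + 1) := by
        rw [pow_succ', add_comm]
        exact add_mul_lt (hw' t (by omega)) ih2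
      have hpow := (Nat.pow_le_pow_right hq hcard).trans hE
      rw [Nat.mod_eq_of_lt (b1.trans_le hpow), Nat.mod_eq_of_lt (b2.trans_le hpow)]
      refine ⟨b1, b2, ?_⟩
      rw [← ih3]
      have l1 := hw t (by omega)
      have l2 := hw' t (by omega)
      constructor
      · intro h
        have e1 : k t = k' t := by
          have := congrArg (· / q) h
          simpa [Nat.mul_add_div hq, Nat.div_eq_of_lt l1, Nat.div_eq_of_lt l2] using this
        rw [e1] at h
        exact ⟨e1, fun _ => by omega⟩
      · rintro ⟨h1, h2⟩
        rw [h1, h2 trivial]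

end

end GibbsEntropy

namespace GibbsEntropy
open Finset

/-! ### Numbering the sites of a cube -/

section

variable {d : ℕ}

/-- The cube `[-k, k]^d`. -/
noncomputable def cube (d : ℕ) (k : ℕ) : Finset (Site d) :=
  Finset.Icc (fun _ => -(k : ℤ)) (fun _ => (k : ℤ))

theorem mem_cube {k : ℕ} {v : Site d} : v ∈ cube d k ↔ ∀ i, -(k : ℤ) ≤ v i ∧ v i ≤ k := by
  simp [cube, Finset.mem_Icc, Pi.le_def, forall_and]

theorem cube_mono {k l : ℕ} (h : k ≤ l) : cube d k ⊆ cube d l := fun v hv => by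
  rw [mem_cube] at *
  exact fun i => by have := hv i; omega

/-- The site with number `t`. -/
def siteOf (d n t : ℕ) : Site d := fun i => (digit n i t : ℤ) - (n + 1)

/-- The number of a site. -/
def numOf (n : ℕ) (v : Site d) : ℕ := ∑ i : Fin d, (v i + (n + 1)).toNat * side n ^ (i : ℕ)

theorem siteOf_mem (n t : ℕ) : siteOf d n t ∈ cube d (n + 1) := by
  rw [mem_cube]
  intro i
  have : digit n i t < side n := Nat.mod_lt _ (by unfold side; omega)
  unfold siteOf
  unfold side at this
  push_cast
  omega

/-- Identifies the numbering with `finFunctionFinEquiv` in base `side n`, which supplies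
bijectivity. -/
theorem numOf_eq {n : ℕ} {v : Site d} (hv : v ∈ cube d (n + 1)) :
    ∃ c : Fin d → Fin (side n), (∀ i, ((c i : ℕ) : ℤ) = v i + (n + 1)) ∧
      numOf n v = finFunctionFinEquiv c := by
  rw [mem_cube] at hv
  refine ⟨fun i => ⟨(v i + (n + 1)).toNat, ?_⟩, fun i => ?_, ?_⟩
  · have := hv i
    unfold side
    push_cast at this
    omega
  · have := hv i
    push_cast at this
    simp only
    omega
  · rw [finFunctionFinEquiv_apply]
    rfl

theorem numOf_lt {n : ℕ} {v : Site d} (hv : v ∈ cube d (n + 1)) : numOf n v < side n ^ d := by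
  obtain ⟨c, -, h⟩ := numOf_eq hv
  rw [h]
  exact Fin.is_lt _

theorem digit_numOf {n : ℕ} {v : Site d} (hv : v ∈ cube d (n + 1)) (i : Fin d) :
    (digit n i (numOf n v) : ℤ) = v i + (n + 1) := by
  obtain ⟨c, hc, h⟩ := numOf_eq hv
  have : digit n i (numOf n v) = (finFunctionFinEquiv.symm (finFunctionFinEquiv c) i : ℕ) := by
    rw [h]
    rfl
  rw [this, Equiv.symm_apply_apply, hc]

theorem siteOf_numOf {n : ℕ} {v : Site d} (hv : v ∈ cube d (n + 1)) :
    siteOf d n (numOf n v) = v := by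
  funext i
  rw [siteOf, digit_numOf hv]
  ring

theorem numOf_siteOf {n t : ℕ} (ht : t < side n ^ d) : numOf n (siteOf d n t) = t := by
  have : numOf n (siteOf d n t) =
      (finFunctionFinEquiv (finFunctionFinEquiv.symm (⟨t, ht⟩ : Fin (side n ^ d))) : ℕ) := by
    rw [finFunctionFinEquiv_apply]
    refine Finset.sum_congr rfl fun i _ => ?_
    simp only [siteOf, sub_add_cancel, Int.toNat_natCast]
    rfl
  rw [this, Equiv.apply_symm_apply]

/-- Evaluation of the coordinates in base `M`. -/
def lin (M : ℤ) (v : Site d) : ℤ := ∑ i : Fin d, v i * M ^ (i : ℕ)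

theorem lin_add (M : ℤ) (v w : Site d) : lin M (v + w) = lin M v + lin M w := by
  simp [lin, add_mul, Finset.sum_add_distrib]

theorem lin_neg (M : ℤ) (v : Site d) : lin M (-v) = -lin M v := by
  simp [lin]

theorem lin_sub (M : ℤ) (v w : Site d) : lin M (v - w) = lin M v - lin M w := by
  rw [sub_eq_add_neg, lin_add, lin_neg, sub_eq_add_neg]

theorem numOf_eq_lin {n : ℕ} {v : Site d} (hv : v ∈ cube d (n + 1)) :
    (numOf n v : ℤ) = mid d n + lin (side n) v := by
  rw [mem_cube] at hv
  unfold numOf mid lin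
  push_cast
  rw [← Finset.sum_add_distrib]
  refine Finset.sum_congr rfl fun i _ => ?_
  rw [Int.toNat_of_nonneg (by have := hv i; push_cast at this; omega)]
  ring

/-- The lexicographic past of the origin. -/
def IsPast (v : Site d) : Prop := ∃ i, v i < 0 ∧ ∀ j, i < j → v j = 0

/-- The last nonzero coordinate decides: the lower ones contribute at most ∑_{j<i} (M-1) M^j = M^i -
1, less than the M^i that is subtracted. Thus one linear functional realises the lexicographic order
on bounded regions. -/
theorem lin_neg_of_isPast {M : ℤ} {v : Site d} (hv : ∀ i, |v i| < M) (h : IsPast v) :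
    lin M v < 0 := by
  obtain ⟨i, hi, h0⟩ := h
  have hM : 0 < M := (abs_nonneg _).trans_lt (hv i)
  have key : ∀ k : ℕ, ∑ j ∈ range k, (M - 1) * M ^ j = M ^ k - 1 := fun k => by
    rw [← Finset.mul_sum, mul_comm, geom_sum_mul]
  have h1 : lin M v ≤ ∑ j : Fin d, (if (j : ℕ) < i then (M - 1) * M ^ (j : ℕ) else 0) -
      M ^ (i : ℕ) := by
    have : M ^ (i : ℕ) = ∑ j : Fin d, if j = i then M ^ (j : ℕ) else 0 := by simp
    rw [this, ← Finset.sum_sub_distrib]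
    refine Finset.sum_le_sum fun j _ => ?_
    have hp : 0 < M ^ (j : ℕ) := pow_pos hM _
    rcases lt_trichotomy j i with hj | rfl | hj
    · rw [if_pos (by exact hj), if_neg hj.ne, sub_zero]
      exact mul_le_mul_of_nonneg_right (by have := (le_abs_self _).trans_lt (hv j); omega) hp.le
    · simp only [lt_irrefl, if_false, if_true, zero_sub]
      nlinarith
    · rw [h0 j hj, if_neg (by exact not_lt.2 hj.le), if_neg hj.ne']
      simp
  have h2 : ∑ j : Fin d, (if (j : ℕ) < i then (M - 1) * M ^ (j : ℕ) else 0) = M ^ (i : ℕ) - 1 := by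
    rw [Fin.sum_univ_eq_sum_range (fun j => if j < (i : ℕ) then (M - 1) * M ^ j else 0) d,
      ← Finset.sum_filter, ← key]
    congr 1
    ext j
    simp only [Finset.mem_filter, Finset.mem_range]
    have := i.2
    omega
  rw [h2] at h1
  linarith

theorem isPast_trichotomy (v : Site d) : IsPast v ∨ v = 0 ∨ IsPast (-v) := by
  by_cases h : v = 0
  · exact .inr (.inl h)
  have : (univ.filter fun i => v i ≠ 0).Nonempty := by
    obtain ⟨i, hi⟩ := Function.ne_iff.1 h
    exact ⟨i, by simpa using hi⟩
  set i := (univ.filter fun i => v i ≠ 0).max' this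
  have hi : v i ≠ 0 := (Finset.mem_filter.1 (Finset.max'_mem _ this)).2
  have hj : ∀ j, i < j → v j = 0 := fun j hj => by
    by_contra h0
    exact absurd (Finset.le_max' _ j (by simpa using h0)) (not_le.2 hj)
  rcases lt_or_gt_of_ne hi with h1 | h1
  · exact .inl ⟨i, h1, hj⟩
  · exact .inr (.inr ⟨i, by simpa using h1, fun j h => by simp [hj j h]⟩)

theorem isPast_iff {M : ℤ} {v : Site d} (hv : ∀ i, |v i| < M) : IsPast v ↔ lin M v < 0 := by
  refine ⟨lin_neg_of_isPast hv, fun h => ?_⟩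
  rcases isPast_trichotomy v with h1 | rfl | h1
  · exact h1
  · simp [lin] at h
  · have := lin_neg_of_isPast (v := -v) (by simpa using hv) h1
    rw [lin_neg] at this
    omega

theorem lin_eq_zero_iff {M : ℤ} {v : Site d} (hv : ∀ i, |v i| < M) : lin M v = 0 ↔ v = 0 := by
  refine ⟨fun h => ?_, by rintro rfl; simp [lin]⟩
  rcases isPast_trichotomy v with h1 | h1 | h1
  · exact absurd h (lin_neg_of_isPast hv h1).ne
  · exact h1
  · have := lin_neg_of_isPast (v := -v) (by simpa using hv) h1
    rw [lin_neg] at this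
    omega

theorem not_isPast_zero : ¬ IsPast (0 : Site d) := fun ⟨_, h, _⟩ => lt_irrefl _ h

theorem abs_lt_side {n : ℕ} {v : Site d} (hv : v ∈ cube d (n + 1)) (i : Fin d) :
    |v i| < (side n : ℤ) := by
  have := mem_cube.1 hv i
  rw [abs_lt]
  unfold side
  push_cast at *
  omega

theorem numOf_lt_mid {n : ℕ} {v : Site d} (hv : v ∈ cube d (n + 1)) :
    numOf n v < mid d n ↔ IsPast v := by
  rw [isPast_iff (abs_lt_side hv), ← Nat.cast_lt (α := ℤ), numOf_eq_lin hv]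
  omega

theorem zero_mem_cube (k : ℕ) : (0 : Site d) ∈ cube d k := mem_cube.2 fun i => by simp

theorem numOf_zero (n : ℕ) : numOf n (0 : Site d) = mid d n := by
  have h := numOf_eq_lin (zero_mem_cube (d := d) (n + 1))
  have h0 : lin (side n : ℤ) (0 : Site d) = 0 := by simp [lin]
  rw [h0] at h
  exact_mod_cast h

theorem interior_ne_zero {n : ℕ} {v : Site d} (hv : v ∈ cube d (n + 1)) :
    interior d n (numOf n v) ≠ 0 ↔ v ∈ cube d n := by
  unfold interior
  rw [Finset.prod_ne_zero_iff, mem_cube]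
  simp only [Finset.mem_univ, true_imp_iff]
  refine forall_congr' fun i => ?_
  have h1 := digit_numOf hv i
  have h2 := mem_cube.1 hv i
  rw [mul_ne_zero_iff]
  unfold side
  push_cast at h2
  omega

theorem lin_unitVec (M : ℤ) (i : Fin d) : lin M (unitVec i) = M ^ (i : ℕ) := by
  unfold lin unitVec
  rw [Finset.sum_eq_single i]
  · simp
  · intro j _ hj
    simp [hj]
  · simp

theorem sub_unitVec_mem {n : ℕ} {v : Site d} (hv : v ∈ cube d (n + 1)) (i : Fin d) :
    v - unitVec i ∈ cube d (n + 1) ↔ digit n i (numOf n v) ≠ 0 := by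
  have h1 := digit_numOf hv i
  rw [mem_cube] at *
  constructor
  · intro h
    have h2 := h i
    simp only [Pi.sub_apply, unitVec, Pi.single_eq_same] at h2
    push_cast at h2
    omega
  · intro h j
    have h2 := hv j
    by_cases hj : j = i
    · subst hj
      simp only [Pi.sub_apply, unitVec, Pi.single_eq_same]
      push_cast at h2 ⊢
      omega
    · simpa [unitVec, hj] using h2

theorem numOf_sub_unitVec {n : ℕ} {v : Site d} (hv : v ∈ cube d (n + 1)) {i : Fin d}
    (h : v - unitVec i ∈ cube d (n + 1)) :
    numOf n (v - unitVec i) + side n ^ (i : ℕ) = numOf n v := by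
  have h1 := numOf_eq_lin hv
  have h2 := numOf_eq_lin h
  rw [lin_sub, lin_unitVec] at h2
  zify
  omega

theorem dist1_eq_one {v w : Site d} (h : dist1 v w = 1) :
    ∃ i, v = w + unitVec i ∨ w = v + unitVec i := by
  unfold dist1 at h
  obtain ⟨i, -, hi⟩ : ∃ i ∈ univ, (v i - w i).natAbs ≠ 0 := by
    by_contra hc
    push Not at hc
    rw [Finset.sum_eq_zero hc] at h
    omega
  rw [← Finset.add_sum_erase _ _ (Finset.mem_univ i)] at h
  have h0 : ∀ j, j ≠ i → v j = w j := fun j hj => by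
    have := Finset.single_le_sum (f := fun i => (v i - w i).natAbs) (fun _ _ => Nat.zero_le _)
      (Finset.mem_erase.2 ⟨hj, Finset.mem_univ j⟩)
    omega
  have hi1 : (v i - w i).natAbs = 1 := by omega
  refine ⟨i, ?_⟩
  rcases Int.natAbs_eq_iff.1 hi1 with h | h
  · refine .inl (funext fun j => ?_)
    by_cases hj : j = i
    · subst hj; simp [unitVec]; push_cast at h; omega
    · simp [unitVec, hj, h0 j hj]
  · refine .inr (funext fun j => ?_)
    by_cases hj : j = i
    · subst hj; simp [unitVec]; push_cast at h; omega
    · simp [unitVec, hj, h0 j hj]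

/-- A step in direction i changes the number by `side n ^ i`, at most one layer. For this reason a
single layer of near past shields the future from the earlier sites of the cube. -/
theorem numOf_le_of_adj {n : ℕ} {v w : Site d} (hv : v ∈ cube d (n + 1))
    (hw : w ∈ cube d (n + 1)) (h : dist1 v w = 1) : numOf n w ≤ numOf n v + layer d n := by
  obtain ⟨i, hi⟩ := dist1_eq_one h
  have hs : side n ^ (i : ℕ) ≤ layer d n :=
    Nat.pow_le_pow_right (by unfold side; omega) (by omega)
  rcases hi with rfl | rfl
  · have := numOf_sub_unitVec hv (i := i) (by simpa using hw)
    simp only [add_sub_cancel_right] at this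
    omega
  · have := numOf_sub_unitVec hw (i := i) (by simpa using hv)
    simp only [add_sub_cancel_right] at this
    omega

theorem card_nearPast (n T : ℕ) : #{t ∈ range T | nearPast d n t ≠ 0} ≤ layer d n + 1 := by
  have : ({t ∈ range T | nearPast d n t ≠ 0} : Finset ℕ) ⊆
      Finset.Icc (mid d n - layer d n) (mid d n) := by
    intro t ht
    have := (Finset.mem_filter.1 ht).2
    unfold nearPast at this
    rw [Finset.mem_Icc]
    split_ifs at this with h1 h2
    · omega
    · exact absurd rfl this
    · exact absurd rfl this
  refine (Finset.card_le_card this).trans ?_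
  rw [Nat.card_Icc]
  omega

/-- A site of the faces has some coordinate equal to ±(n+1), so 2d boxes of `layer d n` sites cover
them. With this count the code of the faces fits below `cap`. -/
theorem card_faces (n : ℕ) :
    #{t ∈ range (side n ^ d) | 1 - interior d n t ≠ 0} ≤ 2 * d * layer d n := by
  classical
  let B : Fin d × Bool → Finset (Site d) := fun p => Fintype.piFinset fun j =>
    if j = p.1 then {if p.2 then (n + 1 : ℤ) else -(n + 1 : ℤ)}
    else Finset.Icc (-(n + 1 : ℤ)) (n + 1)
  have hB : ∀ p, #(B p) = layer d n := fun p => by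
    rw [Fintype.card_piFinset]
    have e : ∀ j, #(if j = p.1 then {if p.2 then (n + 1 : ℤ) else -(n + 1 : ℤ)}
        else Finset.Icc (-(n + 1 : ℤ)) (n + 1)) = if j = p.1 then 1 else side n := fun j => by
      split_ifs
      · simp
      · simp
      · rw [Int.card_Icc]; unfold side; omega
    rw [Finset.prod_congr rfl fun j _ => e j, Finset.prod_ite, Finset.prod_const_one, one_mul,
      Finset.prod_const, Finset.filter_ne', Finset.card_erase_of_mem (Finset.mem_univ _)]
    simp [layer]
  calc _ ≤ #(univ.biUnion B) := by
        refine Finset.card_le_card_of_injOn (siteOf d n) (fun t ht => ?_) fun t ht t' ht' h => ?_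
        · simp only [Finset.coe_filter, Set.mem_ofPred_eq, Finset.mem_range] at ht
          have hm := siteOf_mem (d := d) n t
          have h2 : ¬ siteOf d n t ∈ cube d n := by
            rw [← interior_ne_zero hm, numOf_siteOf ht.1]
            omega
          rw [mem_cube] at h2 hm
          push Not at h2
          obtain ⟨i, hi⟩ := h2
          simp only [Finset.coe_biUnion, Set.mem_iUnion, Finset.mem_coe, Finset.mem_univ,
            exists_prop, true_and]
          push_cast at hm
          by_cases hs : siteOf d n t i = n + 1
          · refine ⟨(i, true), Fintype.mem_piFinset.2 fun j => ?_⟩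
            by_cases hj : j = i
            · subst hj; simp [hs]
            · simpa [hj] using hm j
          · refine ⟨(i, false), Fintype.mem_piFinset.2 fun j => ?_⟩
            by_cases hj : j = i
            · subst hj
              have := hm j
              simp
              omega
            · simpa [hj] using hm j
        · simp only [Finset.coe_filter, Set.mem_ofPred_eq, Finset.mem_range] at ht ht'
          rw [← numOf_siteOf ht.1, h, numOf_siteOf ht'.1]
    _ ≤ ∑ p, #(B p) := Finset.card_biUnion_le
    _ = 2 * d * layer d n := by
        simp only [hB, Finset.sum_const, Finset.card_univ, Fintype.card_prod, Fintype.card_fin,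
          Fintype.card_bool, smul_eq_mul]
        ring

end

end GibbsEntropy

namespace GibbsEntropy
open Finset

/-! ### Weights of configurations on the whole lattice -/

section Weights

variable {d : ℕ} {A : Type u} {R : Type v} [CommSemiring R]

/-- The weight of the restriction of `x` to `S`. -/
def gw (γ : A → R) (β : Fin d → A → A → R) (S : Finset (Site d)) (x : Site d → A) : R :=
  (∏ v ∈ S, γ (x v)) *
    ∏ i : Fin d, ∏ v ∈ S, if v + unitVec i ∈ S then β i (x v) (x (v + unitVec i)) else 1

theorem weight_eq (G : Interactions d A) {S : Finset (Site d)} (w : Config A S)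
    {x : Site d → A} (h : ∀ v : S, x v = w v) : G.weight w = gw G.γ G.β S x := by
  unfold Interactions.weight gw
  congr 1
  · rw [← Finset.prod_coe_sort S fun v => G.γ (x v)]
    exact Finset.prod_congr rfl fun v _ => by rw [h]
  · refine Finset.prod_congr rfl fun i _ => ?_
    rw [← Finset.prod_coe_sort S fun v =>
      if v + unitVec i ∈ S then G.β i (x v) (x (v + unitVec i)) else 1]
    refine Finset.prod_congr rfl fun v _ => ?_
    by_cases hv : v.1 + unitVec i ∈ S
    · rw [dif_pos hv, if_pos hv, h v, ← h ⟨_, hv⟩]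
    · rw [dif_neg hv, if_neg hv]

variable {γ : A → R} {β : Fin d → A → A → R}

theorem gw_congr {S : Finset (Site d)} {x y : Site d → A} (h : ∀ v ∈ S, x v = y v) :
    gw γ β S x = gw γ β S y := by
  unfold gw
  congr 1
  · exact Finset.prod_congr rfl fun v hv => by rw [h v hv]
  · refine Finset.prod_congr rfl fun i _ => Finset.prod_congr rfl fun v hv => ?_
    split_ifs with h1
    · rw [h v hv, h _ h1]
    · rfl

/-- Each edge is assigned to its later endpoint, the form in which the factors appear when the sites
are read in order. -/
theorem gw_eq_backward (S : Finset (Site d)) (x : Site d → A) :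
    gw γ β S x = ∏ v ∈ S, (γ (x v) *
      ∏ i : Fin d, if v - unitVec i ∈ S then β i (x (v - unitVec i)) (x v) else 1) := by
  rw [Finset.prod_mul_distrib, gw]
  congr 1
  symm
  rw [Finset.prod_comm]
  refine Finset.prod_congr rfl fun i _ => ?_
  symm
  rw [← Finset.prod_filter, ← Finset.prod_filter]
  refine Finset.prod_nbij' (fun v => v + unitVec i) (fun v => v - unitVec i) ?_ ?_ ?_ ?_ ?_
  · intro v hv
    simpa [and_comm] using hv
  · intro v hv
    simpa [and_comm] using hv
  · intro v _; simp
  · intro v _; simp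
  · intro v _; simp

/-- The configuration that agrees with `w` on `S` and with `x` elsewhere. -/
def glue {S : Finset (Site d)} (w : Config A S) (x : Site d → A) : Site d → A :=
  fun v => if h : v ∈ S then w ⟨v, h⟩ else x v

theorem glue_mem {S : Finset (Site d)} (w : Config A S) (x : Site d → A) {v : Site d}
    (h : v ∈ S) : glue w x v = w ⟨v, h⟩ := dif_pos h

theorem glue_notMem {S : Finset (Site d)} (w : Config A S) (x : Site d → A) {v : Site d}
    (h : v ∉ S) : glue w x v = x v := dif_neg h

variable [Fintype A]

/-- Total weight of the configurations on `Q` that agree with `x` outside `V`. -/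
def pf (γ : A → R) (β : Fin d → A → A → R) (Q V : Finset (Site d)) (x : Site d → A) : R :=
  ∑ w : Config A V, gw γ β Q (glue w x)

-- Restriction to `V` is a bijection from the configurations on `Q` that agree with `x` off `V`. The
-- configuration `x₀` is a dummy outside `Q`, and the hypothesis on `F` says just that replacing it
-- by `x` does not matter.
open Classical in
theorem sum_agreeing_of {F : (Site d → A) → R} {Q V : Finset (Site d)} (hV : V ⊆ Q)
    (x₀ x : Site d → A)
    (hF : ∀ w : Config A V, F (glue (fun v : Q => glue w x v.1) x₀) = F (glue w x)) :
    ∑ y : Config A Q, (if ∀ v ∈ Q, v ∉ V → glue y x₀ v = x v then F (glue y x₀) else 0) =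
      ∑ w : Config A V, F (glue w x) := by
  rw [← Finset.sum_filter]
  symm
  refine Finset.sum_nbij (fun w v => glue w x v.1) ?_ ?_ ?_ fun w _ => (hF w).symm
  · intro w _
    rw [Finset.mem_filter]
    refine ⟨Finset.mem_univ _, fun v hv hvV => ?_⟩
    rw [glue_mem _ _ hv, glue_notMem _ _ hvV]
  · intro w _ w' _ h
    funext v
    have := congrFun h ⟨v.1, hV v.2⟩
    simpa [glue] using this
  · intro y hy
    simp only [Finset.coe_filter, Finset.mem_univ, true_and] at hy
    refine ⟨fun v => y ⟨v.1, hV v.2⟩, by simp, ?_⟩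
    funext v
    by_cases hv : v.1 ∈ V
    · simp [glue, hv]
    · have := hy v.1 v.2 hv
      rw [glue_mem _ _ v.2] at this
      rw [this]
      exact glue_notMem _ _ hv

open Classical in
theorem sum_agreeing (F : (Site d → A) → R) {Q V : Finset (Site d)} (hV : V ⊆ Q)
    (hF : ∀ x y, (∀ v ∈ Q, x v = y v) → F x = F y) (x₀ x : Site d → A) :
    ∑ y : Config A Q, (if ∀ v ∈ Q, v ∉ V → glue y x₀ v = x v then F (glue y x₀) else 0) =
      ∑ w : Config A V, F (glue w x) :=
  sum_agreeing_of hV x₀ x fun w => hF _ _ fun v hv => by rw [glue_mem _ _ hv]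

end Weights

/-! ### Codes of configurations -/

section Codes

variable {d : ℕ} {A : Type u} [Fintype A]

noncomputable def word (n : ℕ) (x : Site d → A) (t : ℕ) : ℕ := code (x (siteOf d n t))

theorem code_injective : Function.Injective (code : A → ℕ) := fun a b h =>
  (Fintype.equivFin A).injective (Fin.ext h)

theorem code_lt (a : A) : code a < Fintype.card A := Fin.is_lt _

theorem word_lt (n : ℕ) (x : Site d → A) (t : ℕ) : word n x t < Fintype.card A := code_lt _

variable (Z : Fin d → A → A → Prop) (φ : Param d A → ℕ → ℕ) (n : ℕ)

noncomputable def gamApprox (a : A) : ℕ := pval Z φ n (.inl a)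

noncomputable def betApprox (i : Fin d) (a b : A) : ℕ := pval Z φ n (.inr (i, a, b))

variable {Z φ n}

theorem gamN_code (a : A) : gamN Z φ n (code a) = gamApprox Z φ n a := by
  classical
  unfold gamN
  rw [Finset.sum_congr rfl fun a' _ => if_congr code_injective.eq_iff rfl rfl]
  simp [gamApprox]

theorem betN_code (i : Fin d) (a b : A) :
    betN Z φ n i (code a) (code b) = betApprox Z φ n i a b := by
  classical
  unfold betN
  rw [Finset.sum_congr rfl fun a' _ => Finset.sum_congr rfl fun b' _ =>
    if_congr code_injective.eq_iff (if_congr code_injective.eq_iff rfl rfl) rfl]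
  simp [betApprox]

theorem pow_le_layer (i : Fin d) : side n ^ (i : ℕ) ≤ layer d n :=
  Nat.pow_le_pow_right (by unfold side; omega) (by omega)

theorem layer_pos : 0 < layer d n := pow_pos (by unfold side; omega) _

variable [Nonempty A]

/-- The window reaches back at least one layer, so every earlier neighbour in the cube is still in
it when its edge is weighed. -/
theorem wordWt_word (x : Site d → A) :
    wordWt Z φ n (word n x) (side n ^ d) =
      gw (gamApprox Z φ n) (betApprox Z φ n) (cube d (n + 1)) x := by
  rw [gw_eq_backward, wordWt]
  symm
  refine Finset.prod_nbij' (numOf n) (siteOf d n) (fun v hv => Finset.mem_range.2 (numOf_lt hv))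
    (fun t _ => siteOf_mem n t) (fun v hv => siteOf_numOf hv)
    (fun t ht => numOf_siteOf (Finset.mem_range.1 ht)) fun v hv => ?_
  have hw : word n x (numOf n v) = code (x v) := by rw [word, siteOf_numOf hv]
  rw [fac, hw, gamN_code]
  congr 1
  refine Finset.prod_congr rfl fun i _ => ?_
  by_cases h : v - unitVec i ∈ cube d (n + 1)
  · rw [if_pos h, if_neg ((sub_unitVec_mem hv i).1 h), cap]
    have h1 := numOf_sub_unitVec hv h
    have h2 : 0 < side n ^ (i : ℕ) := pow_pos (by unfold side; omega) _
    rw [window_digit (T := side n ^ d) Fintype.card_pos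
      (s := fun t => state d (Fintype.card A) n (word n x) t %
        Fintype.card A ^ ((2 * d + 2) * layer d n)) (w := word n x)
      (fun t => window_succ _ t) (fun t _ => word_lt _ _ _) (numOf_lt hv).le (by omega)]
    · rw [show numOf n v - 1 - (side n ^ (i : ℕ) - 1) = numOf n (v - unitVec i) by omega,
        word, siteOf_numOf h, betN_code]
    · have := pow_le_layer (n := n) i
      have := Nat.le_mul_of_pos_left (layer d n) (show 0 < 2 * d + 2 by omega)
      omega
  · rw [if_neg h, if_pos (by by_contra hc; exact h ((sub_unitVec_mem hv i).2 hc))]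

variable (n) in
/-- Code of the configuration on the faces of the cube. -/
noncomputable def faceOf (x : Site d → A) : ℕ :=
  faceCode d (Fintype.card A) n (word n x) (side n ^ d)

variable (n) in
/-- Code of the configuration on the near past and at the centre. -/
noncomputable def pastOf (x : Site d → A) : ℕ :=
  pastCode d (Fintype.card A) n (word n x) (side n ^ d)

/-- The interior sites that precede the centre by at most one layer. -/
noncomputable def nearPastSites (d n : ℕ) : Finset (Site d) :=
  (cube d n).filter fun v => numOf n v < mid d n ∧ mid d n ≤ numOf n v + layer d n

omit [Nonempty A] in
theorem faceOf_lt [Nonempty A] (x : Site d → A) : faceOf n x < cap d (Fintype.card A) n :=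
  Nat.mod_lt _ (cap_pos Fintype.card_pos)

theorem pastOf_lt (x : Site d → A) : pastOf n x < cap d (Fintype.card A) n := by
  unfold pastOf pastCode
  rw [Nat.div_lt_iff_lt_mul (pow_pos (cap_pos Fintype.card_pos) _)]
  have := state_lt (A := A) (d := d) (n := n) (w := word n x) (side n ^ d)
  rwa [pow_succ' _ 2] at this

theorem faceOf_eq_iff (x y : Site d → A) :
    faceOf n x = faceOf n y ↔ ∀ v ∈ cube d (n + 1), v ∉ cube d n → x v = y v := by
  have hE : Fintype.card A ^ #{t ∈ range (side n ^ d) | 1 - interior d n t ≠ 0} ≤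
      cap d (Fintype.card A) n :=
    Nat.pow_le_pow_right Fintype.card_pos ((card_faces n).trans
      (Nat.mul_le_mul_right _ (by omega)))
  have := (code_spec Fintype.card_pos hE (k := faceCode d (Fintype.card A) n (word n x))
    (k' := faceCode d (Fintype.card A) n (word n y)) (by simp [faceCode, state])
    (by simp [faceCode, state]) (faceCode_succ _) (faceCode_succ _)
    (fun t _ => word_lt n x t) (fun t _ => word_lt n y t) le_rfl).2.2
  unfold faceOf
  rw [this]
  constructor
  · intro h v hv hv'
    have h1 := h (numOf n v) (numOf_lt hv) (by
      rw [← interior_ne_zero hv] at hv'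
      omega)
    rw [word, word, siteOf_numOf hv] at h1
    exact code_injective h1
  · intro h t ht h1
    rw [word, word, h _ (siteOf_mem n t) fun h2 => ?_]
    rw [← interior_ne_zero (siteOf_mem n t), numOf_siteOf ht] at h2
    omega

theorem nearPast_numOf {v : Site d} (hv : v ∈ cube d (n + 1)) (h : numOf n v < mid d n) :
    nearPast d n (numOf n v) ≠ 0 ↔ v ∈ nearPastSites d n := by
  unfold nearPast nearPastSites
  rw [Finset.mem_filter, if_pos h.le, ← interior_ne_zero hv]
  split_ifs with h1
  · simp [h, h1]
  · simp [h1]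

theorem nearPastSites_subset : nearPastSites d n ⊆ cube d n := Finset.filter_subset _ _

/-- The centre is the last site pushed onto this code, so it is the lowest digit and the remaining
digits encode the near past. -/
theorem pastOf_spec (x y : Site d → A) : pastOf n x % Fintype.card A = code (x 0) ∧
    (pastOf n x / Fintype.card A = pastOf n y / Fintype.card A ↔
      ∀ v ∈ nearPastSites d n, x v = y v) := by
  have hq : 0 < Fintype.card A := Fintype.card_pos
  have h0 := zero_mem_cube (d := d) (n + 1)
  have hT : mid d n < side n ^ d := by
    rw [← numOf_zero]
    exact numOf_lt h0
  have hE : Fintype.card A ^ #{t ∈ range (side n ^ d) | nearPast d n t ≠ 0} ≤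
      cap d (Fintype.card A) n :=
    Nat.pow_le_pow_right hq ((card_nearPast n _).trans (by
      nlinarith [layer_pos (d := d) (n := n)]))
  have spec := fun x y : Site d → A => fun t ht => code_spec hq hE
    (k := pastCode d (Fintype.card A) n (word n x))
    (k' := pastCode d (Fintype.card A) n (word n y)) (by simp [pastCode, state])
    (by simp [pastCode, state]) (pastCode_succ _) (pastCode_succ _)
    (fun t _ => word_lt n x t) (fun t _ => word_lt n y t) (t := t) ht
  have hmid : nearPast d n (mid d n) ≠ 0 := by
    rw [nearPast, if_pos le_rfl, if_pos (Nat.le_add_right _ _), ← numOf_zero,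
      interior_ne_zero h0]
    exact zero_mem_cube n
  -- `nearPast` vanishes after the centre, so the code stays constant from there on.
  have hlast : ∀ x : Site d → A, pastOf n x =
      pastCode d (Fintype.card A) n (word n x) (mid d n + 1) := by
    intro x
    have : ∀ k, pastCode d (Fintype.card A) n (word n x) (mid d n + 1 + k) =
        pastCode d (Fintype.card A) n (word n x) (mid d n + 1) := by
      intro k
      induction k with
      | zero => rfl
      | succ k ih =>
        rw [← add_assoc, pastCode_succ, nearPast, if_neg (by omega), push, if_pos rfl, ih]
    have h1 := this (side n ^ d - (mid d n + 1))
    rw [Nat.add_sub_cancel' hT] at h1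
    exact h1
  -- The last push is not reduced: the near past together with the centre still fits below `cap`.
  have hstep : ∀ x : Site d → A, pastOf n x = Fintype.card A *
      pastCode d (Fintype.card A) n (word n x) (mid d n) + code (x 0) := by
    intro x
    have hc : code (x 0) = word n x (mid d n) := by rw [word, ← numOf_zero, siteOf_numOf h0]
    have h1 := (spec x x (mid d n) hT.le).1
    have h2 : #{j ∈ range (mid d n) | nearPast d n j ≠ 0} + 1 ≤
        #{t ∈ range (side n ^ d) | nearPast d n t ≠ 0} := by
      rw [← Finset.card_insert_of_notMem (a := mid d n) (by simp)]
      refine Finset.card_le_card fun t ht => ?_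
      rw [Finset.mem_insert, Finset.mem_filter, Finset.mem_range] at ht
      rw [Finset.mem_filter, Finset.mem_range]
      rcases ht with rfl | ht
      · exact ⟨hT, hmid⟩
      · exact ⟨ht.1.trans hT, ht.2⟩
    rw [hlast, pastCode_succ, push, if_neg hmid, hc, Nat.mod_eq_of_lt]
    refine lt_of_lt_of_le ?_ ((Nat.pow_le_pow_right hq h2).trans hE)
    rw [pow_succ', add_comm]
    exact add_mul_lt (word_lt _ _ _) h1
  have hdiv : ∀ x : Site d → A, pastOf n x / Fintype.card A =
      pastCode d (Fintype.card A) n (word n x) (mid d n) := fun x => by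
    rw [hstep, Nat.mul_add_div hq, Nat.div_eq_of_lt (code_lt _), add_zero]
  refine ⟨by rw [hstep, Nat.mul_add_mod, Nat.mod_eq_of_lt (code_lt _)], ?_⟩
  rw [hdiv, hdiv, (spec x y (mid d n) hT.le).2.2]
  constructor
  · intro h v hv
    have hv1 := cube_mono (Nat.le_succ n) (nearPastSites_subset hv)
    have hv2 := (Finset.mem_filter.1 hv).2.1
    have h1 := h (numOf n v) hv2 ((nearPast_numOf hv1 hv2).2 hv)
    rw [word, word, siteOf_numOf hv1] at h1
    exact code_injective h1
  · intro h t ht h1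
    have hm := siteOf_mem (d := d) n t
    have ht' := numOf_siteOf (d := d) (n := n) (ht.trans hT)
    rw [word, word, h]
    rw [← nearPast_numOf hm (by rwa [ht']), ht']
    exact h1

/-! ### Weights with given codes -/

variable {R : Type v} [CommSemiring R]

/-- A configuration on the lattice that extends the given one. -/
noncomputable def extendConfig {S : Finset (Site d)} (y : Config A S) : Site d → A :=
  glue y fun _ => Classical.arbitrary A

variable (n) in
/-- Total weight of the configurations with given codes. -/
noncomputable def codeWt (γ : A → R) (β : Fin d → A → A → R) (e g : ℕ) : R :=
  ∑ y : Config A (cube d (n + 1)),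
    if faceOf n (extendConfig y) = e ∧ pastOf n (extendConfig y) = g
    then gw γ β (cube d (n + 1)) (extendConfig y) else 0

variable (d n) in
noncomputable def cubeEquiv : cube d (n + 1) ≃ Fin (side n ^ d) where
  toFun v := ⟨numOf n v.1, numOf_lt v.2⟩
  invFun t := ⟨siteOf d n t, siteOf_mem n t⟩
  left_inv v := Subtype.ext (siteOf_numOf v.2)
  right_inv t := Fin.ext (numOf_siteOf t.2)

theorem wt_eq_codeWt {e : ℕ} (he : e < cap d (Fintype.card A) n) (g : ℕ) :
    wt Z φ n e g = codeWt n (gamApprox Z φ n) (betApprox Z φ n) e g := by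
  rw [wt_eq he, codeWt]
  refine (Fintype.sum_equiv ((cubeEquiv d n).arrowCongr (Fintype.equivFin A)) _ _ fun y => ?_).symm
  have h : ∀ t < side n ^ d, seqOf ((cubeEquiv d n).arrowCongr (Fintype.equivFin A) y) t =
      word n (extendConfig y) t := by
    intro t ht
    simp only [seqOf, ht, dif_pos, Equiv.arrowCongr_apply, Function.comp, word, code,
      extendConfig, glue_mem _ _ (siteOf_mem n t)]
    rfl
  rw [wordWt_congr h, wordWt_word, faceCode, pastCode, state_congr h]
  rfl

variable {γ : A → R} {β : Fin d → A → A → R}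

/-- Prescribing both codes is prescribing the symbols on the faces, on the near past and at 0; the
rest of the interior remains free. Lowering the information step by step gives `wtPast_faceOf` and
`wtFace_faceOf`. -/
theorem codeWt_faceOf_pastOf (x : Site d → A) :
    codeWt n γ β (faceOf n x) (pastOf n x) =
      pf γ β (cube d (n + 1)) ((cube d n \ nearPastSites d n).erase 0) x := by
  classical
  unfold codeWt pf
  rw [← sum_agreeing (gw γ β (cube d (n + 1))) _ (fun _ _ => gw_congr)
    (fun _ => Classical.arbitrary A)]
  · refine Finset.sum_congr rfl fun y _ => if_congr ?_ rfl rfl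
    change faceOf n (extendConfig y) = _ ∧ _ ↔ ∀ v ∈ _, _ → extendConfig y v = x v
    generalize extendConfig y = y
    have h0 := zero_mem_cube (d := d) n
    have hp : pastOf n y = pastOf n x ↔ y 0 = x 0 ∧ ∀ v ∈ nearPastSites d n, y v = x v := by
      rw [← (pastOf_spec y x).2, ← (code_injective (A := A)).eq_iff, ← (pastOf_spec y x).1,
        ← (pastOf_spec x x).1]
      constructor
      · intro h; rw [h]; exact ⟨rfl, rfl⟩
      · rintro ⟨h1, h2⟩
        rw [← Nat.div_add_mod (pastOf n y) (Fintype.card A), h1, h2, Nat.div_add_mod]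
    rw [faceOf_eq_iff, hp]
    simp only [Finset.mem_erase, Finset.mem_sdiff]
    constructor
    · rintro ⟨h1, h2, h3⟩ v hv hv'
      by_cases hc : v ∈ cube d n
      · by_cases hz : v = 0
        · rw [hz, h2]
        · exact h3 v (by tauto)
      · exact h1 v hv hc
    · intro h
      refine ⟨fun v hv hv' => h v hv (by tauto), h 0 (zero_mem_cube _) (by tauto), fun v hv => ?_⟩
      exact h v (cube_mono (Nat.le_succ n) (nearPastSites_subset hv)) (by tauto)
  · exact fun v hv => cube_mono (Nat.le_succ n)
      (Finset.mem_sdiff.1 (Finset.mem_of_mem_erase hv)).1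

theorem wtPast_codeWt (e f : ℕ) : wtPast (Fintype.card A) (codeWt n γ β) e f =
    ∑ y : Config A (cube d (n + 1)),
    if faceOf n (extendConfig y) = e ∧ pastOf n (extendConfig y) / Fintype.card A = f
    then gw γ β (cube d (n + 1)) (extendConfig y) else 0 := by
  unfold wtPast codeWt
  rw [Finset.sum_comm]
  refine Finset.sum_congr rfl fun y _ => ?_
  generalize extendConfig y = y
  have hq : 0 < Fintype.card A := Fintype.card_pos
  have key : ∀ x ∈ range (Fintype.card A), (faceOf n y = e ∧ pastOf n y = Fintype.card A * f + x)
      ↔ (pastOf n y % Fintype.card A = x ∧ (faceOf n y = e ∧ pastOf n y / Fintype.card A = f)) := by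
    intro x hx
    rw [Finset.mem_range] at hx
    constructor
    · rintro ⟨h1, h2⟩
      refine ⟨?_, h1, ?_⟩
      · rw [h2, Nat.mul_add_mod, Nat.mod_eq_of_lt hx]
      · rw [h2, Nat.mul_add_div hq, Nat.div_eq_of_lt hx, add_zero]
    · rintro ⟨rfl, h1, rfl⟩
      exact ⟨h1, (Nat.div_add_mod _ _).symm⟩
  rw [Finset.sum_congr rfl fun x hx => if_congr (key x hx) rfl rfl]
  simp only [ite_and]
  rw [Finset.sum_ite_eq, if_pos (Finset.mem_range.2 (Nat.mod_lt _ hq))]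

theorem wtPast_faceOf (x : Site d → A) :
    wtPast (Fintype.card A) (codeWt n γ β) (faceOf n x) (pastOf n x / Fintype.card A) =
      pf γ β (cube d (n + 1)) (cube d n \ nearPastSites d n) x := by
  classical
  unfold pf
  rw [wtPast_codeWt, ← sum_agreeing (gw γ β (cube d (n + 1))) _ (fun _ _ => gw_congr)
    (fun _ => Classical.arbitrary A)]
  · refine Finset.sum_congr rfl fun y _ => if_congr ?_ rfl rfl
    change faceOf n (extendConfig y) = _ ∧ _ ↔ ∀ v ∈ _, _ → extendConfig y v = x v
    generalize extendConfig y = y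
    rw [faceOf_eq_iff, (pastOf_spec y x).2]
    simp only [Finset.mem_sdiff]
    constructor
    · rintro ⟨h1, h3⟩ v hv hv'
      by_cases hc : v ∈ cube d n
      · exact h3 v (by tauto)
      · exact h1 v hv hc
    · intro h
      refine ⟨fun v hv hv' => h v hv (by tauto), fun v hv => ?_⟩
      exact h v (cube_mono (Nat.le_succ n) (nearPastSites_subset hv)) (by tauto)
  · exact fun v hv => cube_mono (Nat.le_succ n) (Finset.mem_sdiff.1 hv).1

theorem wtFace_codeWt (e : ℕ) :
    wtFace (Fintype.card A) (cap d (Fintype.card A) n) (codeWt n γ β) e =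
    ∑ y : Config A (cube d (n + 1)), if faceOf n (extendConfig y) = e
    then gw γ β (cube d (n + 1)) (extendConfig y) else 0 := by
  unfold wtFace
  simp only [wtPast_codeWt]
  rw [Finset.sum_comm]
  refine Finset.sum_congr rfl fun y _ => ?_
  simp only [and_comm (a := faceOf n (extendConfig y) = e), ite_and]
  rw [Finset.sum_ite_eq, if_pos (Finset.mem_range.2
    ((Nat.div_le_self _ _).trans_lt (pastOf_lt _)))]

theorem wtFace_faceOf (x : Site d → A) :
    wtFace (Fintype.card A) (cap d (Fintype.card A) n) (codeWt n γ β) (faceOf n x) =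
      pf γ β (cube d (n + 1)) (cube d n) x := by
  classical
  unfold pf
  rw [wtFace_codeWt, ← sum_agreeing (gw γ β (cube d (n + 1))) _ (fun _ _ => gw_congr)
    (fun _ => Classical.arbitrary A)]
  · refine Finset.sum_congr rfl fun y _ => if_congr ?_ rfl rfl
    exact faceOf_eq_iff _ _
  · exact cube_mono (Nat.le_succ n)

end Codes

end GibbsEntropy

namespace GibbsEntropy
open Finset

/-! ### Dependence of weights on the region -/

section Local

variable {d : ℕ} {A : Type u}

theorem dist1_comm (v w : Site d) : dist1 v w = dist1 w v := by
  unfold dist1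
  exact Finset.sum_congr rfl fun i _ => by omega

theorem dist1_add_unitVec (v : Site d) (i : Fin d) : dist1 (v + unitVec i) v = 1 := by
  unfold dist1
  rw [Finset.sum_eq_single i]
  · simp [unitVec]
  · intro j _ hj
    simp [unitVec, hj]
  · simp

theorem mem_union_boundary_of_adj {V : Finset (Site d)} {v w : Site d} (hv : v ∈ V)
    (h : dist1 w v = 1) : w ∈ V ∪ boundary V := by
  rw [Finset.mem_union, mem_boundary]
  by_cases hw : w ∈ V
  · exact .inl hw
  · exact .inr ⟨hw, v, hv, h⟩

theorem disjoint_boundary (V : Finset (Site d)) : Disjoint V (boundary V) := by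
  rw [Finset.disjoint_left]
  exact fun v hv hv' => ((mem_boundary _ _).1 hv').1 hv

variable {γ : A → ℝ} {β : Fin d → A → A → ℝ}

/-- The part of the weight on `Q` that is not contained in the weight on `S`. -/
def gwRest (γ : A → ℝ) (β : Fin d → A → A → ℝ) (Q S : Finset (Site d)) (x : Site d → A) : ℝ :=
  (∏ v ∈ Q \ S, γ (x v)) * ∏ i : Fin d, ∏ v ∈ Q,
    if v + unitVec i ∈ Q ∧ ¬ (v ∈ S ∧ v + unitVec i ∈ S) then β i (x v) (x (v + unitVec i)) else 1

theorem gw_eq_mul_rest {Q S : Finset (Site d)} (hS : S ⊆ Q) (x : Site d → A) :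
    gw γ β Q x = gw γ β S x * gwRest γ β Q S x := by
  unfold gw gwRest
  rw [mul_mul_mul_comm]
  congr 1
  · rw [mul_comm, Finset.prod_sdiff hS]
  · rw [← Finset.prod_mul_distrib]
    refine Finset.prod_congr rfl fun i _ => ?_
    have h1 : ∏ v ∈ S, (if v + unitVec i ∈ S then β i (x v) (x (v + unitVec i)) else 1) =
        ∏ v ∈ Q, if v ∈ S then
          (if v + unitVec i ∈ S then β i (x v) (x (v + unitVec i)) else 1) else 1 := by
      rw [Finset.prod_ite_mem, Finset.inter_eq_right.2 hS]
    rw [h1, ← Finset.prod_mul_distrib]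
    refine Finset.prod_congr rfl fun v _ => ?_
    by_cases h2 : v ∈ S
    · by_cases h3 : v + unitVec i ∈ S
      · simp [h2, h3, hS h3]
      · simp [h2, h3]
    · simp [h2]

/-- Every edge that meets `V` lies in `V ∪ boundary V`, hence is already accounted for in the weight
on `S`. -/
theorem gwRest_congr {Q S V : Finset (Site d)} (hV : V ∪ boundary V ⊆ S) {x y : Site d → A}
    (h : ∀ v, v ∉ V → x v = y v) : gwRest γ β Q S x = gwRest γ β Q S y := by
  unfold gwRest
  congr 1
  · refine Finset.prod_congr rfl fun v hv => ?_
    rw [h v fun hc => (Finset.mem_sdiff.1 hv).2 (hV (Finset.mem_union_left _ hc))]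
  · refine Finset.prod_congr rfl fun i _ => Finset.prod_congr rfl fun v _ => ?_
    split_ifs with h1
    · have h2 := dist1_add_unitVec v i
      rw [h v, h (v + unitVec i)]
      · intro hc
        exact h1.2 ⟨hV (mem_union_boundary_of_adj hc (by rwa [dist1_comm])),
          hV (Finset.mem_union_left _ hc)⟩
      · intro hc
        exact h1.2 ⟨hV (Finset.mem_union_left _ hc), hV (mem_union_boundary_of_adj hc h2)⟩
    · rfl

variable (G : Interactions d A)

theorem gw_nonneg (S : Finset (Site d)) (x : Site d → A) : 0 ≤ gw G.γ G.β S x := by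
  unfold gw
  refine mul_nonneg (Finset.prod_nonneg fun v _ => (G.γ_pos _).le)
    (Finset.prod_nonneg fun i _ => Finset.prod_nonneg fun v _ => ?_)
  split_ifs
  exacts [G.β_nonneg _ _ _, zero_le_one]

theorem gwRest_nonneg (Q S : Finset (Site d)) (x : Site d → A) :
    0 ≤ gwRest G.γ G.β Q S x := by
  unfold gwRest
  refine mul_nonneg (Finset.prod_nonneg fun v _ => (G.γ_pos _).le)
    (Finset.prod_nonneg fun i _ => Finset.prod_nonneg fun v _ => ?_)
  split_ifs
  exacts [G.β_nonneg _ _ _, zero_le_one]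

variable [Fintype A]

theorem pf_nonneg (Q V : Finset (Site d)) (x : Site d → A) : 0 ≤ pf G.γ G.β Q V x :=
  Finset.sum_nonneg fun _ _ => gw_nonneg G _ _

omit [Fintype A] in
theorem glue_self {V : Finset (Site d)} (x : Site d → A) : glue (fun v : V => x v) x = x := by
  funext v
  unfold glue
  split_ifs <;> rfl

theorem gw_le_pf (Q V : Finset (Site d)) (x : Site d → A) :
    gw G.γ G.β Q x ≤ pf G.γ G.β Q V x := by
  have := Finset.single_le_sum (f := fun w : Config A V => gw G.γ G.β Q (glue w x))
    (fun _ _ => gw_nonneg G _ _) (Finset.mem_univ fun v : V => x v)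
  rwa [glue_self] at this

/-- Up to a factor, the weight as a function of the configuration on `V` depends only on the
sites adjacent to `V`. -/
theorem gw_eq_const_mul {Q S V : Finset (Site d)} (hV : V ∪ boundary V ⊆ S) (hS : S ⊆ Q)
    {x : Site d → A} (h : 0 < pf G.γ G.β Q V x) :
    ∃ c > 0, ∀ y : Site d → A, (∀ v, v ∉ V → y v = x v) →
      gw G.γ G.β Q y = c * gw G.γ G.β S y := by
  refine ⟨gwRest G.γ G.β Q S x, ?_, fun y hy => ?_⟩
  · refine (gwRest_nonneg G Q S x).lt_of_ne fun h0 => h.ne' ?_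
    refine Finset.sum_eq_zero fun w _ => ?_
    rw [gw_eq_mul_rest hS, gwRest_congr hV (y := x) fun v hv => glue_notMem _ _ hv, ← h0, mul_zero]
  · rw [gw_eq_mul_rest hS, gwRest_congr hV hy, mul_comm]

theorem pf_eq_const_mul {Q S V : Finset (Site d)} (hV : V ∪ boundary V ⊆ S) (hS : S ⊆ Q)
    {x : Site d → A} (h : 0 < pf G.γ G.β Q V x) :
    ∃ c > 0, (∀ y : Site d → A, (∀ v, v ∉ V → y v = x v) →
      gw G.γ G.β Q y = c * gw G.γ G.β S y) ∧
      ∀ V' ⊆ V, pf G.γ G.β Q V' x = c * pf G.γ G.β S V' x := by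
  obtain ⟨c, hc, H⟩ := gw_eq_const_mul G hV hS h
  refine ⟨c, hc, H, fun V' hV' => ?_⟩
  unfold pf
  rw [Finset.mul_sum]
  exact Finset.sum_congr rfl fun w _ => H _ fun v hv => glue_notMem _ _ fun hc => hv (hV' hc)

theorem pf_congr {Q V : Finset (Site d)} {x y : Site d → A}
    (h : ∀ v ∈ Q, v ∉ V → x v = y v) : pf G.γ G.β Q V x = pf G.γ G.β Q V y := by
  refine Finset.sum_congr rfl fun w _ => gw_congr fun v hv => ?_
  unfold glue
  split_ifs with h1
  exacts [rfl, h v hv h1]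

open Classical in
theorem sum_eq_at {R : Type v} [CommSemiring R] {F : (Site d → A) → R} {V : Finset (Site d)}
    {u : Site d} (hu : u ∈ V) (x : Site d → A) :
    ∑ w : Config A V, (if w ⟨u, hu⟩ = x u then F (glue w x) else 0) =
      ∑ w : Config A (V.erase u), F (glue w x) := by
  rw [← sum_agreeing_of (F := F) (Finset.erase_subset u V) x x]
  · refine Finset.sum_congr rfl fun w _ => if_congr ⟨fun h v hv hv' => ?_, fun h => ?_⟩ rfl rfl
    · have : v = u := by
        by_contra hc
        exact hv' (Finset.mem_erase.2 ⟨hc, hv⟩)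
      subst this
      rw [glue_mem _ _ hv, h]
    · rw [← h u hu (Finset.notMem_erase u V), glue_mem _ _ hu]
  · intro w
    congr 1
    funext v
    by_cases hv : v ∈ V
    · rw [glue_mem _ _ hv]
    · rw [glue_notMem _ _ hv, glue_notMem _ _ fun hc => hv (Finset.mem_of_mem_erase hc)]

end Local

/-! ### Specifications and configurations on the whole lattice -/

section Spec

variable {d : ℕ} {A : Type u} [Fintype A] (G : Interactions d A)

/-- The boundary condition given by a configuration on the lattice. -/
def bdry (V : Finset (Site d)) (x : Site d → A) : Config A (boundary V) := fun v => x v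

omit [Fintype A] in
theorem concat_bdry {V : Finset (Site d)} (w : Config A V) (x : Site d → A)
    (v : (V ∪ boundary V : Finset (Site d))) : concat w (bdry V x) v = glue w x v := by
  unfold concat glue bdry
  split_ifs <;> rfl

theorem weight_concat {V : Finset (Site d)} (w : Config A V) (x : Site d → A) :
    G.weight (concat w (bdry V x)) = gw G.γ G.β (V ∪ boundary V) (glue w x) :=
  weight_eq G _ fun v => (concat_bdry w x v).symm

theorem spec_eq {V : Finset (Site d)} (w : Config A V) (x : Site d → A) :
    G.spec (bdry V x) w = gw G.γ G.β (V ∪ boundary V) (glue w x) /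
      pf G.γ G.β (V ∪ boundary V) V x := by
  unfold Interactions.spec pf
  rw [weight_concat]
  congr 1
  exact Finset.sum_congr rfl fun w _ => weight_concat G w x

theorem admissible_of_pf_pos {V : Finset (Site d)} {x : Site d → A}
    (h : 0 < pf G.γ G.β (V ∪ boundary V) V x) : G.Admissible (bdry V x) := by
  by_contra hc
  refine h.ne' (Finset.sum_eq_zero fun w _ => ?_)
  refine le_antisymm (not_lt.1 fun hw => hc ⟨w, ?_⟩) (gw_nonneg G _ _)
  rwa [weight_concat]

theorem concat_mem_agree {V : Finset (Site d)} (w : Config A V) (x : Site d → A) :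
    concat w (bdry V x) ∈ agree (Finset.subset_union_right (s₁ := V)) (bdry V x) := by
  funext v
  have hv : v.1 ∉ V := fun hc => Finset.disjoint_left.1 (disjoint_boundary V) hc v.2
  exact (concat_bdry w x ⟨v.1, Finset.mem_union_right _ v.2⟩).trans (glue_notMem _ _ hv)

theorem specProb_agree {V : Finset (Site d)} {x : Site d → A}
    (h : 0 < pf G.γ G.β (V ∪ boundary V) V x) :
    G.specProb (bdry V x) (agree (Finset.subset_union_right (s₁ := V)) (bdry V x)) = 1 := by
  unfold Interactions.specProb
  rw [Finset.sum_congr rfl fun w _ => if_pos (concat_mem_agree w x)]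
  simp only [spec_eq]
  rw [← Finset.sum_div]
  exact div_self h.ne'

theorem specProb_at {V : Finset (Site d)} {u : Site d} (hu : u ∈ V) (x : Site d → A) :
    G.specProb (bdry V x) ({c | c ⟨u, Finset.mem_union_left _ hu⟩ = x u} ∩
      agree (Finset.subset_union_right (s₁ := V)) (bdry V x)) =
      pf G.γ G.β (V ∪ boundary V) (V.erase u) x / pf G.γ G.β (V ∪ boundary V) V x := by
  classical
  unfold Interactions.specProb
  have h : ∀ w : Config A V, (concat w (bdry V x) ∈
      ({c | c ⟨u, Finset.mem_union_left _ hu⟩ = x u} ∩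
      agree (Finset.subset_union_right (s₁ := V)) (bdry V x))) ↔ w ⟨u, hu⟩ = x u := fun w => by
    have h1 := concat_bdry w x ⟨u, Finset.mem_union_left _ hu⟩
    rw [glue_mem _ _ hu] at h1
    constructor
    · rintro ⟨h2, -⟩
      exact h1.symm.trans h2
    · intro h2
      exact ⟨h1.trans h2, concat_mem_agree w x⟩
  rw [pf, ← sum_eq_at hu x, Finset.sum_div]
  refine Finset.sum_congr rfl fun w _ => ?_
  rw [spec_eq]
  by_cases hw : w ⟨u, hu⟩ = x u
  · rw [if_pos ((h w).2 hw), if_pos hw]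
  · rw [if_neg fun hc => hw ((h w).1 hc), if_neg hw, zero_div]

/-- Strong spatial mixing in terms of configurations on the lattice. -/
theorem Interactions.SSM.lattice {G : Interactions d A} (h : G.SSM) :
    ∃ C > (0 : ℝ), ∃ α > (0 : ℝ), ∀ (Q V : Finset (Site d)), V ∪ boundary V ⊆ Q →
      ∀ u ∈ V, ∀ (x x' : Site d → A) (r : ℕ), x u = x' u →
      (∀ v ∈ Q, v ∉ V → dist1 u v < r → x v = x' v) →
      0 < pf G.γ G.β Q V x → 0 < pf G.γ G.β Q V x' →
      |pf G.γ G.β Q (V.erase u) x / pf G.γ G.β Q V x -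
        pf G.γ G.β Q (V.erase u) x' / pf G.γ G.β Q V x'| ≤ C * Real.exp (-α * r) := by
  obtain ⟨C, hC, α, hα, H⟩ := h
  refine ⟨C, hC, α, hα, fun Q V hV u hu x x' r hxu hx hp hp' => ?_⟩
  have red : ∀ y : Site d → A, 0 < pf G.γ G.β Q V y →
      0 < pf G.γ G.β (V ∪ boundary V) V y ∧
      pf G.γ G.β Q (V.erase u) y / pf G.γ G.β Q V y =
      pf G.γ G.β (V ∪ boundary V) (V.erase u) y / pf G.γ G.β (V ∪ boundary V) V y := by
    intro y hy
    obtain ⟨c, hc, -, h2⟩ := pf_eq_const_mul G le_rfl hV hy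
    rw [h2 _ le_rfl] at hy ⊢
    rw [h2 _ (Finset.erase_subset u V)]
    exact ⟨pos_of_mul_pos_right hy hc.le, mul_div_mul_left _ _ hc.ne'⟩
  obtain ⟨hp, e⟩ := red x hp
  obtain ⟨hp', e'⟩ := red x' hp'
  rw [e, e']
  -- If the boundary conditions coincide, `diffDist` is the infimum of the empty set, 0, and mixing
  -- would give no decay; but then the two ratios are equal.
  by_cases heq : bdry V x = bdry V x'
  · have hb : ∀ v ∈ boundary V, x v = x' v := fun v hv => congrFun heq ⟨v, hv⟩
    have h1 : pf G.γ G.β (V ∪ boundary V) (V.erase u) x =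
        pf G.γ G.β (V ∪ boundary V) (V.erase u) x' := by
      refine pf_congr G fun v hv hv' => ?_
      rcases Finset.mem_union.1 hv with h1 | h1
      · have : v = u := by
          by_contra hc
          exact hv' (Finset.mem_erase.2 ⟨hc, h1⟩)
        rw [this, hxu]
      · exact hb v h1
    have h2 : pf G.γ G.β (V ∪ boundary V) V x = pf G.γ G.β (V ∪ boundary V) V x' := by
      refine pf_congr G fun v hv hv' => ?_
      exact hb v ((Finset.mem_union.1 hv).resolve_left hv')
    rw [h1, h2, sub_self, abs_zero]
    positivity
  -- Known sites have been left out of `V`, so conditioning on the boundary alone suffices; that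
  -- event has probability one and the quotients disappear.
  · have h1 := H V (boundary V) le_rfl Finset.subset_union_right u hu (x u) (bdry V x) (bdry V x')
      (bdry V x) (bdry V x') rfl rfl (admissible_of_pf_pos G hp) (admissible_of_pf_pos G hp')
      (by rw [specProb_agree G hp]; exact one_pos) (by rw [specProb_agree G hp']; exact one_pos)
    rw [specProb_agree G hp, specProb_agree G hp', div_one, div_one, specProb_at G hu] at h1
    rw [hxu, specProb_at G hu] at h1
    refine h1.trans ?_
    have hr : r ≤ diffDist u (bdry V x) (bdry V x') := by
      obtain ⟨w, hw⟩ := Function.ne_iff.1 heq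
      refine le_csInf ⟨_, w, hw, rfl⟩ ?_
      rintro k ⟨w, hw, rfl⟩
      by_contra hc
      refine hw (hx w.1 (hV (Finset.mem_union_right _ w.2)) ?_ (not_le.1 hc))
      exact fun hc => Finset.disjoint_left.1 (disjoint_boundary V) hc w.2
    have hr' : (r : ℝ) ≤ (diffDist u (bdry V x) (bdry V x') : ℕ) := by exact_mod_cast hr
    gcongr C * Real.exp ?_
    nlinarith

end Spec

end GibbsEntropy

namespace GibbsEntropy
open Finset MeasureTheory

/-! ### Marginals of Gibbs measures -/

section Marginals

variable {d : ℕ} {A : Type u} [MeasurableSpace A] [MeasurableSingletonClass A]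
  (μ : Measure (Site d → A))

/-- Probability of agreeing with `x` on `S`. -/
noncomputable def mg (S : Finset (Site d)) (x : Site d → A) : ℝ := μ.real (cyl fun v : S => x v)

theorem measurableSet_cyl {S : Finset (Site d)} (w : Config A S) : MeasurableSet (cyl w) := by
  have : cyl w = ⋂ v : S, (fun x : Site d → A => x v.1) ⁻¹' {w v} := by
    ext x
    simp [cyl]
  rw [this]
  exact MeasurableSet.iInter fun v => measurable_pi_apply _ (measurableSet_singleton _)

omit [MeasurableSpace A] [MeasurableSingletonClass A] in
theorem cyl_inter (S T : Finset (Site d)) (x : Site d → A) :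
    cyl (fun v : S => x v) ∩ cyl (fun v : T => x v) =
      cyl fun v : (T ∪ S : Finset (Site d)) => x v := by
  ext y
  simp only [cyl, Set.mem_inter_iff, Set.mem_ofPred_eq, Subtype.forall, Finset.mem_union]
  constructor
  · rintro ⟨h1, h2⟩ v (hv | hv)
    exacts [h2 v hv, h1 v hv]
  · exact fun h => ⟨fun v hv => h v (.inr hv), fun v hv => h v (.inl hv)⟩

variable {μ}

omit [MeasurableSingletonClass A] in
theorem mg_nonneg (S : Finset (Site d)) (x : Site d → A) : 0 ≤ mg μ S x := measureReal_nonneg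

omit [MeasurableSingletonClass A] in
theorem mg_congr {S : Finset (Site d)} {x y : Site d → A} (h : ∀ v ∈ S, x v = y v) :
    mg μ S x = mg μ S y := by
  unfold mg
  congr 2
  funext v
  exact h v v.2

variable [IsProbabilityMeasure μ]

omit [MeasurableSingletonClass A] in
theorem mg_mono {S T : Finset (Site d)} (h : S ⊆ T) (x : Site d → A) : mg μ T x ≤ mg μ S x :=
  measureReal_mono fun _ hy v => hy ⟨v.1, h v.2⟩

omit [MeasurableSingletonClass A] in
theorem measure_cyl_pos {S : Finset (Site d)} {x : Site d → A} (h : 0 < mg μ S x) :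
    0 < μ (cyl fun v : S => x v) := by
  rw [pos_iff_ne_zero]
  intro h0
  rw [mg, measureReal_def, h0] at h
  simp at h

open Classical in
theorem measure_event_eq_sum [Fintype A] {Q : Finset (Site d)} {E : Set (Site d → A)}
    (hE : ∀ x y, (∀ v ∈ Q, x v = y v) → (x ∈ E ↔ y ∈ E)) (x₀ : Site d → A) :
    μ.real E = ∑ y : Config A Q, if glue y x₀ ∈ E then mg μ Q (glue y x₀) else 0 := by
  have h1 : E = ⋃ y ∈ (univ.filter fun y : Config A Q => glue y x₀ ∈ E), cyl y := by
    ext x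
    simp only [Finset.mem_filter, Finset.mem_univ, true_and, Set.mem_iUnion, exists_prop]
    constructor
    · intro hx
      refine ⟨fun v => x v, (hE _ _ fun v hv => ?_).1 hx, fun v => rfl⟩
      rw [glue_mem _ _ hv]
    · rintro ⟨y, hy, hxy⟩
      refine (hE _ _ fun v hv => ?_).1 hy
      rw [glue_mem _ _ hv]
      exact (hxy ⟨v, hv⟩).symm
  conv_lhs => rw [h1]
  rw [measureReal_biUnion_finset, Finset.sum_filter]
  · refine Finset.sum_congr rfl fun y _ => ?_
    have : mg μ Q (glue y x₀) = μ.real (cyl y) := by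
      unfold mg
      congr 2
      funext v
      exact glue_mem _ _ v.2
    rw [this]
  · intro y _ y' _ hne
    refine Set.disjoint_left.2 fun x hx hx' => hne ?_
    funext v
    rw [← hx v, hx' v]
  · exact fun y _ => measurableSet_cyl y

theorem mg_eq_sum [Fintype A] (V T : Finset (Site d)) (hVT : Disjoint V T) (x : Site d → A) :
    mg μ T x = ∑ w : Config A V, mg μ (V ∪ T) (glue w x) := by
  classical
  rw [← sum_agreeing (mg μ (V ∪ T)) Finset.subset_union_left (fun _ _ => mg_congr) x x, mg,
    measure_event_eq_sum (Q := V ∪ T) (fun y z h => ?_) x]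
  · refine Finset.sum_congr rfl fun y _ => if_congr ⟨fun h v hv hv' => ?_, fun h v => ?_⟩ rfl rfl
    · exact h ⟨v, (Finset.mem_union.1 hv).resolve_left hv'⟩
    · exact h v.1 (Finset.mem_union_right _ v.2) fun hc => Finset.disjoint_left.1 hVT hc v.2
  · exact forall_congr' fun v => by rw [h v (Finset.mem_union_right _ v.2)]

open ProbabilityTheory in
omit [MeasurableSpace A] [MeasurableSingletonClass A] in
theorem cond_real_apply {Ω : Type*} [MeasurableSpace Ω] (μ : Measure Ω) {s : Set Ω}
    (hs : MeasurableSet s) (t : Set Ω) : μ[|s].real t = (μ.real s)⁻¹ * μ.real (s ∩ t) := by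
  rw [measureReal_def, cond_apply hs, ENNReal.toReal_mul, ENNReal.toReal_inv, measureReal_def,
    measureReal_def]

-- The Markov property after clearing denominators, the form that can be summed over configurations.
open ProbabilityTheory in
theorem IsMRF.mul_eq (h : IsMRF μ) {V T : Finset (Site d)} (hT : boundary V ⊆ T)
    (hVT : Disjoint V T) {x : Site d → A} (hx : 0 < mg μ T x) :
    mg μ (V ∪ boundary V) x * mg μ T x = mg μ (V ∪ T) x * mg μ (boundary V) x := by
  have h1 := h V T hT hVT (fun v => x v) (fun v => x v) (measure_cyl_pos hx)
  have h2 := congrArg ENNReal.toReal h1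
  rw [← measureReal_def, ← measureReal_def, cond_real_apply μ (measurableSet_cyl _),
    cond_real_apply μ (measurableSet_cyl _)] at h2
  change (mg μ (boundary V) x)⁻¹ * μ.real (cyl (fun v : boundary V => x v) ∩ _) =
    (mg μ T x)⁻¹ * _ at h2
  rw [cyl_inter, cyl_inter] at h2
  change (mg μ (boundary V) x)⁻¹ * mg μ (V ∪ boundary V) x =
    (mg μ T x)⁻¹ * mg μ (V ∪ T) x at h2
  have hb : 0 < mg μ (boundary V) x := hx.trans_le (mg_mono hT x)
  field_simp at h2
  linarith [h2]

variable [Fintype A] {G : Interactions d A}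

open ProbabilityTheory in
theorem Interactions.IsGibbs.mul_eq (h : G.IsGibbs μ) {V : Finset (Site d)} {x : Site d → A}
    (hx : 0 < mg μ (boundary V) x) :
    0 < pf G.γ G.β (V ∪ boundary V) V x ∧
    mg μ (V ∪ boundary V) x * pf G.γ G.β (V ∪ boundary V) V x =
      mg μ (boundary V) x * gw G.γ G.β (V ∪ boundary V) x := by
  have hpos : 0 < pf G.γ G.β (V ∪ boundary V) V x := by
    obtain ⟨w, hw⟩ := h.admissible V (bdry V x) (measure_cyl_pos hx)
    rw [weight_concat] at hw
    exact Finset.sum_pos' (fun _ _ => gw_nonneg G _ _) ⟨w, Finset.mem_univ _, hw⟩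
  refine ⟨hpos, ?_⟩
  have h1 := h.cond_eq V (bdry V x) (measure_cyl_pos hx) fun v => x v
  rw [spec_eq, glue_self, cond_real_apply μ (measurableSet_cyl _)] at h1
  change (mg μ (boundary V) x)⁻¹ * μ.real (cyl (fun v : boundary V => x v) ∩ _) = _ at h1
  rw [cyl_inter] at h1
  change (mg μ (boundary V) x)⁻¹ * mg μ (V ∪ boundary V) x = _ at h1
  field_simp at h1
  linarith [h1]

/-- The Gibbs condition speaks of a set together with its boundary. Some extension of `x` to
`boundary Q` has positive probability; its weight is then positive, and the weight on `Q` is a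
factor of it. -/
theorem Interactions.IsGibbs.gw_pos (h : G.IsGibbs μ) {Q : Finset (Site d)} {x : Site d → A}
    (hx : 0 < mg μ Q x) : 0 < gw G.γ G.β Q x := by
  rw [mg_eq_sum (boundary Q) Q (disjoint_boundary Q).symm x] at hx
  obtain ⟨w, -, hw⟩ := Finset.exists_lt_of_sum_lt (s := univ) (f := fun _ => (0 : ℝ))
    (by simpa using hx)
  rw [Finset.union_comm] at hw
  have hb : 0 < mg μ (boundary Q) (glue w x) :=
    hw.trans_le (mg_mono Finset.subset_union_right _)
  obtain ⟨h1, h2⟩ := h.mul_eq hb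
  have h3 : gw G.γ G.β (Q ∪ boundary Q) (glue w x) ≠ 0 := by
    intro h0
    rw [h0, mul_zero] at h2
    exact (mul_pos hw h1).ne' h2
  rw [gw_eq_mul_rest Finset.subset_union_left] at h3
  have h4 := (gw_nonneg G Q (glue w x)).lt_of_ne (left_ne_zero_of_mul h3).symm
  rwa [gw_congr fun v hv => glue_notMem w x fun hc =>
    Finset.disjoint_left.1 (disjoint_boundary Q) hv hc] at h4

/-- By the Markov property only `boundary V` matters among the sites of `T`, and for fixed symbols
outside `V` the weights on `V ∪ T` and on `V ∪ boundary V` are proportional. -/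
theorem Interactions.IsGibbs.mul_eq_of_boundary_subset (h : G.IsGibbs μ) {V T : Finset (Site d)}
    (hT : boundary V ⊆ T) (hVT : Disjoint V T) {x : Site d → A} (hx : 0 < mg μ T x) :
    0 < pf G.γ G.β (V ∪ T) V x ∧
      mg μ (V ∪ T) x * pf G.γ G.β (V ∪ T) V x = mg μ T x * gw G.γ G.β (V ∪ T) x := by
  have hpos : 0 < pf G.γ G.β (V ∪ T) V x := by
    have hx' := hx
    rw [mg_eq_sum V T hVT x] at hx'
    obtain ⟨w, -, hw⟩ := Finset.exists_lt_of_sum_lt (s := univ) (f := fun _ => (0 : ℝ))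
      (by simpa using hx')
    exact Finset.sum_pos' (fun _ _ => gw_nonneg G _ _) ⟨w, Finset.mem_univ _, h.gw_pos hw⟩
  refine ⟨hpos, ?_⟩
  obtain ⟨c, hc, H1, H2⟩ := pf_eq_const_mul G le_rfl (Finset.union_subset_union_right hT) hpos
  have hb : 0 < mg μ (boundary V) x := hx.trans_le (mg_mono hT x)
  obtain ⟨-, h2⟩ := h.mul_eq hb
  have h3 := h.isMRF.mul_eq hT hVT hx
  rw [H1 x fun _ _ => rfl, H2 V le_rfl]
  have : mg μ (boundary V) x * (mg μ (V ∪ T) x * pf G.γ G.β (V ∪ boundary V) V x) =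
      mg μ (boundary V) x * (mg μ T x * gw G.γ G.β (V ∪ boundary V) x) := by
    linear_combination (-pf G.γ G.β (V ∪ boundary V) V x) * h3 + mg μ T x * h2
  linear_combination c * mul_left_cancel₀ hb.ne' this

end Marginals

/-! ### Law of the codes -/

section CodeLaw

variable {d : ℕ} {A : Type u} [Fintype A] [Nonempty A] [MeasurableSpace A]
  [MeasurableSingletonClass A] {μ : Measure (Site d → A)} {G : Interactions d A}

theorem boundary_cube_subset (n : ℕ) : boundary (cube d n) ⊆ cube d (n + 1) \ cube d n := by
  intro v hv
  obtain ⟨h1, w, hw, hvw⟩ := (mem_boundary _ _).1 hv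
  refine Finset.mem_sdiff.2 ⟨?_, h1⟩
  rw [mem_cube] at *
  intro i
  have h2 := hw i
  have h3 : (v i - w i).natAbs ≤ 1 := by
    rw [← hvw]
    exact Finset.single_le_sum (f := fun i => (v i - w i).natAbs) (fun _ _ => Nat.zero_le _)
      (Finset.mem_univ i)
  push_cast
  omega

theorem cube_union_sdiff (n : ℕ) : cube d n ∪ (cube d (n + 1) \ cube d n) = cube d (n + 1) :=
  Finset.union_sdiff_of_subset (cube_mono (Nat.le_succ n))

omit [MeasurableSpace A] [MeasurableSingletonClass A] in
theorem faceOf_congr {n : ℕ} {x y : Site d → A} (h : ∀ v ∈ cube d (n + 1), x v = y v) :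
    faceOf n x = faceOf n y :=
  (faceOf_eq_iff x y).2 fun v hv _ => h v hv

omit [MeasurableSpace A] [MeasurableSingletonClass A] in
theorem pastOf_congr {n : ℕ} {x y : Site d → A} (h : ∀ v ∈ cube d (n + 1), x v = y v) :
    pastOf n x = pastOf n y := by
  have h1 := (pastOf_spec (n := n) x y).2.2 fun v hv =>
    h v (cube_mono (Nat.le_succ n) (nearPastSites_subset hv))
  rw [← Nat.div_add_mod (pastOf n x) (Fintype.card A), h1, (pastOf_spec x y).1,
    h 0 (zero_mem_cube _), ← (pastOf_spec y y).1, Nat.div_add_mod]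

variable (μ) in
/-- Distribution of the configuration on the faces. -/
noncomputable def faceLaw (n e : ℕ) : ℝ := μ.real {x | faceOf n x = e}

theorem faceLaw_faceOf (n : ℕ) (x : Site d → A) :
    faceLaw μ n (faceOf n x) = mg μ (cube d (n + 1) \ cube d n) x := by
  unfold faceLaw mg
  congr 1
  ext y
  change faceOf n y = faceOf n x ↔ ∀ v : (cube d (n + 1) \ cube d n : Finset _), y v = x v
  rw [faceOf_eq_iff]
  simp only [Subtype.forall, Finset.mem_sdiff, and_imp]

variable [IsProbabilityMeasure μ]

theorem exists_of_faceLaw_pos {n e : ℕ} (h : 0 < faceLaw μ n e) :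
    ∃ x : Site d → A, faceOf n x = e ∧ 0 < mg μ (cube d (n + 1) \ cube d n) x := by
  have : {x : Site d → A | faceOf n x = e}.Nonempty := by
    by_contra hc
    rw [Set.not_nonempty_iff_eq_empty] at hc
    rw [faceLaw, hc] at h
    simp at h
  obtain ⟨x, rfl⟩ := this
  exact ⟨x, rfl, by rwa [← faceLaw_faceOf]⟩

theorem wtFace_pos_of_faceLaw_pos (h : G.IsGibbs μ) {n e : ℕ} (he : 0 < faceLaw μ n e) :
    0 < wtFace (Fintype.card A) (cap d (Fintype.card A) n) (codeWt n G.γ G.β) e := by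
  obtain ⟨x, rfl, hx⟩ := exists_of_faceLaw_pos he
  have h1 := (h.mul_eq_of_boundary_subset (boundary_cube_subset n) Finset.disjoint_sdiff hx).1
  rwa [cube_union_sdiff, ← wtFace_faceOf] at h1

/-- Given the faces, the interior has the normalised weights as its law. The law of the faces is the
only trace of `μ` that is left. -/
theorem law_mul_wtFace (h : G.IsGibbs μ) (n e g : ℕ) :
    μ.real {x | faceOf n x = e ∧ pastOf n x = g} *
      wtFace (Fintype.card A) (cap d (Fintype.card A) n) (codeWt n G.γ G.β) e =
    faceLaw μ n e * codeWt n G.γ G.β e g := by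
  classical
  rw [measure_event_eq_sum (Q := cube d (n + 1)) (fun x y hxy => ?_)
    fun _ => Classical.arbitrary A, codeWt, Finset.sum_mul, Finset.mul_sum]
  · have key : ∀ y : Site d → A, faceOf n y = e → mg μ (cube d (n + 1)) y *
        wtFace (Fintype.card A) (cap d (Fintype.card A) n) (codeWt n G.γ G.β) e =
        faceLaw μ n e * gw G.γ G.β (cube d (n + 1)) y := by
      rintro y rfl
      rw [faceLaw_faceOf, wtFace_faceOf]
      rcases (mg_nonneg (μ := μ) (cube d (n + 1) \ cube d n) y).eq_or_lt with h0 | h0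
      · have h1 : mg μ (cube d (n + 1)) y = 0 :=
          le_antisymm ((mg_mono Finset.sdiff_subset y).trans h0.ge) (mg_nonneg _ _)
        rw [h1, ← h0, zero_mul, zero_mul]
      · have h1 := (h.mul_eq_of_boundary_subset (boundary_cube_subset n)
          Finset.disjoint_sdiff h0).2
        rwa [cube_union_sdiff] at h1
    refine Finset.sum_congr rfl fun y _ => ?_
    by_cases hc : faceOf n (extendConfig y) = e ∧ pastOf n (extendConfig y) = g
    · rw [if_pos hc, if_pos (show glue y _ ∈ {x | faceOf n x = e ∧ pastOf n x = g} from hc)]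
      exact key _ hc.1
    · rw [if_neg hc, if_neg (show ¬ glue y _ ∈ {x | faceOf n x = e ∧ pastOf n x = g} from hc),
        zero_mul, mul_zero]
  · change _ ∧ _ ↔ _ ∧ _
    rw [faceOf_congr hxy, pastOf_congr hxy]

end CodeLaw

end GibbsEntropy

namespace GibbsEntropy
open Finset MeasureTheory Real

/-! ### Conditional entropy of finite partitions -/

section NegMulLog

theorem negMulLog_le_one_sub {x : ℝ} (hx : 0 ≤ x) : negMulLog x ≤ 1 - x := by
  rcases hx.eq_or_lt with rfl | hx
  · simp
  · have h := Real.one_sub_inv_le_log_of_pos hx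
    have : x * (1 - x⁻¹) ≤ x * log x := mul_le_mul_of_nonneg_left h hx.le
    rw [mul_sub, mul_inv_cancel₀ hx.ne'] at this
    rw [negMulLog]
    linarith

/-- Write x = √x · √x: then -x log x = 2√x (-√x log √x), and the bracket is at most 1. -/
theorem negMulLog_le_two_sqrt {x : ℝ} (hx : 0 ≤ x) : negMulLog x ≤ 2 * √x := by
  have h1 : negMulLog x = 2 * (√x * negMulLog √x) := by
    conv_lhs => rw [← Real.mul_self_sqrt hx]
    rw [negMulLog_mul]
    ring
  have h2 := negMulLog_le_one_sub (Real.sqrt_nonneg x)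
  have h3 := Real.sqrt_nonneg x
  rw [h1]
  nlinarith

theorem negMulLog_add_le {x y : ℝ} (hx : 0 ≤ x) (hy : 0 ≤ y) :
    negMulLog (x + y) ≤ negMulLog x + negMulLog y := by
  rcases hx.eq_or_lt with rfl | hx
  · simp
  rcases hy.eq_or_lt with rfl | hy
  · simp
  have h1 : log x ≤ log (x + y) := Real.log_le_log hx (by linarith)
  have h2 : log y ≤ log (x + y) := Real.log_le_log hy (by linarith)
  simp only [negMulLog]
  nlinarith

theorem negMulLog_sub_le {x y : ℝ} (hx : 0 ≤ x) (hxy : x ≤ y) (hy : y ≤ 1) :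
    negMulLog x - negMulLog y ≤ y - x := by
  rcases hx.eq_or_lt with rfl | hx
  · have := negMulLog_nonneg hxy hy
    simp only [negMulLog_zero]
    linarith
  have hy0 : 0 < y := hx.trans_le hxy
  have h1 : log y - log x ≤ y / x - 1 := by
    rw [← Real.log_div hy0.ne' hx.ne']
    exact Real.log_le_sub_one_of_pos (by positivity)
  have h2 : x * (log y - log x) ≤ y - x := by
    have := mul_le_mul_of_nonneg_left h1 hx.le
    rwa [show x * (y / x - 1) = y - x by field_simp] at this
  have h3 : log y ≤ 0 := Real.log_nonpos hy0.le hy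
  simp only [negMulLog]
  nlinarith

/-- -p log p is not Lipschitz at 0, but subadditivity gives it a Hölder modulus of order 1/2. All
square roots in the accuracy estimates stem from here. -/
theorem abs_negMulLog_sub_le {x y : ℝ} (hx : 0 ≤ x) (hx1 : x ≤ 1) (hy : 0 ≤ y) (hy1 : y ≤ 1) :
    |negMulLog x - negMulLog y| ≤ 2 * √|x - y| := by
  wlog h : x ≤ y generalizing x y
  · rw [abs_sub_comm, abs_sub_comm x]
    exact this hy hy1 hx hx1 (le_of_not_ge h)
  have h0 : 0 ≤ y - x := sub_nonneg.2 h
  rw [abs_sub_comm x, abs_of_nonneg h0, abs_le]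
  constructor
  · have h1 := negMulLog_add_le hx h0
    rw [add_sub_cancel] at h1
    linarith [negMulLog_le_two_sqrt h0]
  · have h1 := negMulLog_sub_le hx h hy1
    have h2 : y - x ≤ √(y - x) := Real.le_sqrt_of_sq_le (by nlinarith)
    linarith [Real.sqrt_nonneg (y - x)]

end NegMulLog

section CE

variable {α : Type u} {ζ : Type v} {ξ : Type w} [Fintype α] [Fintype ζ] [Fintype ξ]

/-- Conditional entropy of the first coordinate given the second one under the weights `p`. -/
noncomputable def CE (p : α → ζ → ℝ) : ℝ :=
  ∑ z, ∑ a, (∑ b, p b z) * negMulLog (p a z / ∑ b, p b z)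

/-- Image of weights under a map of the second coordinate. -/
noncomputable def pushSnd (g : ζ → ξ) (p : α → ζ → ℝ) : α → ξ → ℝ :=
  fun a y => by classical exact ∑ z ∈ univ.filter (g · = y), p a z

variable {p : α → ζ → ℝ} {g : ζ → ξ}

omit [Fintype ξ] in
theorem sum_pushSnd (y : ξ) : ∑ a, pushSnd g p a y =
    by classical exact ∑ z ∈ univ.filter (g · = y), ∑ a, p a z := Finset.sum_comm

theorem div_sum_mem (hp : ∀ a z, 0 ≤ p a z) (a : α) (z : ζ) :
    0 ≤ p a z / ∑ b, p b z ∧ p a z / ∑ b, p b z ≤ 1 := by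
  have h : p a z ≤ ∑ b, p b z :=
    Finset.single_le_sum (f := fun b => p b z) (fun b _ => hp b z) (Finset.mem_univ a)
  exact ⟨div_nonneg (hp a z) (Finset.sum_nonneg fun b _ => hp b z),
    div_le_one_of_le₀ h (Finset.sum_nonneg fun b _ => hp b z)⟩

theorem CE_eq (hp : ∀ a z, 0 ≤ p a z) :
    CE p = ∑ z, ∑ a, negMulLog (p a z) - ∑ z, negMulLog (∑ a, p a z) := by
  rw [CE, ← Finset.sum_sub_distrib]
  refine Finset.sum_congr rfl fun z _ => ?_
  rcases (Finset.sum_nonneg fun a (_ : a ∈ univ) => hp a z).eq_or_lt with h0 | h0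
  · rw [← h0]
    have : ∀ a, p a z = 0 := fun a =>
      (Finset.sum_eq_zero_iff_of_nonneg fun a _ => hp a z).1 h0.symm a (Finset.mem_univ a)
    simp [this]
  · set m := ∑ a, p a z
    have h1 : negMulLog m = ∑ a, -(p a z * log m) := by
      rw [Finset.sum_neg_distrib, ← Finset.sum_mul, negMulLog, neg_mul]
    rw [h1, ← Finset.sum_sub_distrib]
    refine Finset.sum_congr rfl fun a _ => ?_
    rcases (hp a z).eq_or_lt with ha | ha
    · rw [← ha]
      simp
    · rw [negMulLog, negMulLog, Real.log_div ha.ne' h0.ne']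
      field_simp
      ring

theorem CE_nonneg (hp : ∀ a z, 0 ≤ p a z) : 0 ≤ CE p :=
  Finset.sum_nonneg fun z _ => Finset.sum_nonneg fun a _ =>
    mul_nonneg (Finset.sum_nonneg fun b _ => hp b z)
      (negMulLog_nonneg (div_sum_mem hp a z).1 (div_sum_mem hp a z).2)

theorem CE_le (hp : ∀ a z, 0 ≤ p a z) : CE p ≤ Fintype.card α * ∑ z, ∑ a, p a z := by
  rw [CE, Finset.mul_sum]
  refine Finset.sum_le_sum fun z _ => ?_
  have h0 : 0 ≤ ∑ b, p b z := Finset.sum_nonneg fun b _ => hp b z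
  calc ∑ a, (∑ b, p b z) * negMulLog (p a z / ∑ b, p b z)
      ≤ ∑ _a : α, (∑ b, p b z) := Finset.sum_le_sum fun a _ => by
        have := negMulLog_le_one_sub (div_sum_mem hp a z).1
        have h1 := (div_sum_mem hp a z).1
        nlinarith
    _ = _ := by simp

theorem sum_fiber (f : ζ → ℝ) : ∑ z, f z =
    ∑ y, by classical exact ∑ z ∈ univ.filter (g · = y), f z := by
  classical
  exact (Finset.sum_fiberwise univ g f).symm

/-- Jensen's inequality on each fibre: the conditional probability given the image is a weighted
mean of those on the fibre, and -p log p is concave. -/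
theorem CE_le_pushSnd (hp : ∀ a z, 0 ≤ p a z) : CE p ≤ CE (pushSnd g p) := by
  classical
  rw [CE, CE, sum_fiber (g := g)]
  refine Finset.sum_le_sum fun y _ => ?_
  rw [Finset.sum_comm]
  refine Finset.sum_le_sum fun a _ => ?_
  rw [sum_pushSnd]
  set s := univ.filter (g · = y)
  have hm : ∀ z ∈ s, 0 ≤ ∑ b, p b z := fun z _ => Finset.sum_nonneg fun b _ => hp b z
  rcases (Finset.sum_nonneg hm).eq_or_lt with h0 | h0
  · rw [← h0]
    have := (Finset.sum_eq_zero_iff_of_nonneg hm).1 h0.symm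
    simp only [zero_mul]
    exact (Finset.sum_eq_zero fun z hz => by rw [this z hz, zero_mul]).le
  · have h1 := Real.concaveOn_negMulLog.le_map_sum (t := s)
      (w := fun z => (∑ b, p b z) / ∑ z ∈ s, ∑ b, p b z) (p := fun z => p a z / ∑ b, p b z)
      (fun z hz => div_nonneg (hm z hz) h0.le)
      (by rw [← Finset.sum_div, div_self h0.ne'])
      (fun z _ => (div_sum_mem hp a z).1)
    have h2 : ∑ z ∈ s, ((∑ b, p b z) / ∑ z ∈ s, ∑ b, p b z) • (p a z / ∑ b, p b z) =
        pushSnd g p a y / ∑ z ∈ s, ∑ b, p b z := by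
      rw [pushSnd, Finset.sum_div]
      refine Finset.sum_congr rfl fun z hz => ?_
      rcases (hm z hz).eq_or_lt with hz0 | hz0
      · have : p a z = 0 := (Finset.sum_eq_zero_iff_of_nonneg fun b _ => hp b z).1 hz0.symm a
          (Finset.mem_univ a)
        rw [this]
        simp
      · rw [smul_eq_mul]
        field_simp
    rw [h2] at h1
    have h3 := mul_le_mul_of_nonneg_left h1 h0.le
    refine le_trans (le_of_eq ?_) h3
    rw [Finset.mul_sum]
    refine Finset.sum_congr rfl fun z hz => ?_
    rw [smul_eq_mul]
    field_simp

/-- If the conditional probabilities vary by at most `ε` on the fibres of `g`, little entropy is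
gained by conditioning on the image under `g` only. -/
theorem CE_pushSnd_le (hp : ∀ a z, 0 ≤ p a z) {ε : ℝ}
    (h : ∀ a z z', g z = g z' → 0 < ∑ b, p b z → 0 < ∑ b, p b z' →
      |p a z / ∑ b, p b z - p a z' / ∑ b, p b z'| ≤ ε) :
    CE (pushSnd g p) ≤ CE p + Fintype.card α * (2 * √ε) * ∑ z, ∑ a, p a z := by
  classical
  have hpp : ∀ a y, 0 ≤ pushSnd g p a y := fun a y => Finset.sum_nonneg fun z _ => hp a z
  -- A mean of numbers that are within `ε` of each other is within `ε` of each of them; points of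
  -- weight zero do not take part in the mean.
  have key : ∀ y, ∀ z, g z = y → 0 < ∑ b, p b z → ∀ a,
      |pushSnd g p a y / ∑ b, pushSnd g p b y - p a z / ∑ b, p b z| ≤ ε := by
    intro y z hz hz0 a
    set s := univ.filter (g · = y)
    have hm : ∀ z ∈ s, 0 ≤ ∑ b, p b z := fun z _ => Finset.sum_nonneg fun b _ => hp b z
    have hsum : ∑ b, pushSnd g p b y = ∑ z ∈ s, ∑ b, p b z := sum_pushSnd y
    have h0 : 0 < ∑ z ∈ s, ∑ b, p b z :=
      Finset.sum_pos' hm ⟨z, by simp [s, hz], hz0⟩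
    rw [hsum]
    have h1 : pushSnd g p a y / ∑ z ∈ s, ∑ b, p b z - p a z / ∑ b, p b z =
        (∑ z' ∈ s, (p a z' - (∑ b, p b z') * (p a z / ∑ b, p b z))) /
          ∑ z ∈ s, ∑ b, p b z := by
      rw [Finset.sum_sub_distrib, ← Finset.sum_mul, sub_div, mul_div_right_comm, div_self h0.ne',
        one_mul]
      rfl
    rw [h1, abs_div, abs_of_pos h0, div_le_iff₀ h0, Finset.mul_sum]
    refine (Finset.abs_sum_le_sum_abs _ _).trans (Finset.sum_le_sum fun z' hz' => ?_)
    have hz'' : g z' = y := by simpa [s] using hz'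
    rcases (hm z' hz').eq_or_lt with hz0' | hz0'
    · have : p a z' = 0 := (Finset.sum_eq_zero_iff_of_nonneg fun b _ => hp b z').1 hz0'.symm a
        (Finset.mem_univ a)
      rw [this, ← hz0']
      simp
    · have h2 := h a z' z (hz''.trans hz.symm) hz0' hz0
      have h3 : p a z' - (∑ b, p b z') * (p a z / ∑ b, p b z) =
          (∑ b, p b z') * (p a z' / ∑ b, p b z' - p a z / ∑ b, p b z) := by
        field_simp
      rw [h3, abs_mul, abs_of_pos hz0', mul_comm ε]
      exact mul_le_mul_of_nonneg_left h2 hz0'.le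
  have h1 : CE (pushSnd g p) = ∑ z, ∑ a, (∑ b, p b z) *
      negMulLog (pushSnd g p a (g z) / ∑ b, pushSnd g p b (g z)) := by
    rw [CE, sum_fiber (g := g)]
    refine Finset.sum_congr rfl fun y _ => ?_
    rw [Finset.sum_comm' (t' := univ) (s' := fun _ => univ.filter (g · = y)) (by simp)]
    refine Finset.sum_congr rfl fun a _ => ?_
    rw [sum_pushSnd, Finset.sum_mul]
    refine Finset.sum_congr rfl fun z hz => ?_
    rw [← (Finset.mem_filter.1 hz).2, sum_pushSnd]
  rw [h1, CE, Finset.mul_sum, ← Finset.sum_add_distrib]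
  refine Finset.sum_le_sum fun z _ => ?_
  rcases (Finset.sum_nonneg fun b (_ : b ∈ univ) => hp b z).eq_or_lt with h0 | h0
  · rw [← h0]
    simp
  · have : (Fintype.card α : ℝ) * (2 * √ε) * ∑ a, p a z =
        ∑ _a : α, (∑ b, p b z) * (2 * √ε) := by
      rw [Finset.sum_const, Finset.card_univ, nsmul_eq_mul]
      ring
    rw [this, ← Finset.sum_add_distrib]
    refine Finset.sum_le_sum fun a _ => ?_
    rw [← mul_add]
    refine mul_le_mul_of_nonneg_left ?_ h0.le
    have h2 := abs_negMulLog_sub_le (div_sum_mem hpp a (g z)).1 (div_sum_mem hpp a (g z)).2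
      (div_sum_mem hp a z).1 (div_sum_mem hp a z).2
    have h3 := Real.sqrt_le_sqrt (key (g z) z rfl h0 a)
    linarith [(abs_le.1 h2).2]

end CE

section CondEnt

variable {Ω : Type*} [MeasurableSpace Ω] (μ : Measure Ω)
  {α : Type u} {ζ : Type v} {ξ : Type w} [Fintype α] [Fintype ζ] [Fintype ξ]

/-- Conditional entropy of `X` given `Z`. -/
noncomputable def condEnt (X : Ω → α) (Z : Ω → ζ) : ℝ :=
  CE fun a z => μ.real {ω | X ω = a ∧ Z ω = z}

/-- Maps all of whose fibres are measurable. -/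
def Fib {ζ : Type*} (Z : Ω → ζ) : Prop := ∀ z, MeasurableSet {ω | Z ω = z}

theorem Fib.comp {Z : Ω → ζ} (h : Fib Z) (g : ζ → ξ) : Fib fun ω => g (Z ω) := fun y => by
  have : {ω | g (Z ω) = y} = ⋃ z ∈ {z | g z = y}, {ω | Z ω = z} := by
    ext ω
    simp
  rw [this]
  exact MeasurableSet.biUnion (Set.to_countable _) fun z _ => h z

theorem Fib.and {X : Ω → α} {Z : Ω → ζ} (hX : Fib X) (hZ : Fib Z) (a : α) (z : ζ) :
    MeasurableSet {ω | X ω = a ∧ Z ω = z} := (hX a).inter (hZ z)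

variable {μ} {X : Ω → α} {Z : Ω → ζ}

variable [IsProbabilityMeasure μ]

open Classical in
theorem measureReal_eq_sum_fiber (hZ : Fib Z) (E : Ω → Prop) (s : Finset ζ) :
    ∑ z ∈ s, μ.real {ω | E ω ∧ Z ω = z} = μ.real {ω | E ω ∧ Z ω ∈ s} := by
  induction s using Finset.induction_on with
  | empty => simp
  | insert a s ha ih =>
    rw [Finset.sum_insert ha, ih, ← measureReal_inter_add_sdiff
      (s := {ω | E ω ∧ Z ω ∈ insert a s}) (hZ a)]
    congr 2
    · ext ω
      simp only [Set.mem_ofPred_eq, Set.mem_inter_iff, Finset.mem_insert]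
      tauto
    · ext ω
      simp only [Set.mem_ofPred_eq, Set.mem_sdiff, Finset.mem_insert]
      constructor
      · rintro ⟨h1, h2⟩
        exact ⟨⟨h1, .inr h2⟩, fun h => ha (h ▸ h2)⟩
      · tauto

theorem pushSnd_law (hZ : Fib Z) (g : ζ → ξ) :
    pushSnd g (fun a z => μ.real {ω | X ω = a ∧ Z ω = z}) =
      fun a y => μ.real {ω | X ω = a ∧ g (Z ω) = y} := by
  classical
  funext a y
  rw [pushSnd]
  rw [measureReal_eq_sum_fiber hZ (X · = a)]
  simp

theorem sum_law (hX : Fib X) (E : Ω → Prop) :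
    ∑ a, μ.real {ω | X ω = a ∧ E ω} = μ.real {ω | E ω} := by
  classical
  have := measureReal_eq_sum_fiber (μ := μ) hX E univ
  simp only [Finset.mem_univ, and_true] at this
  simpa only [and_comm] using this

theorem sum_sum_law (hX : Fib X) (hZ : Fib Z) :
    ∑ z, ∑ a, μ.real {ω | X ω = a ∧ Z ω = z} = 1 := by
  have h1 : ∀ z, ∑ a, μ.real {ω | X ω = a ∧ Z ω = z} = μ.real {ω | Z ω = z ∧ True} :=
    fun z => by
      rw [sum_law hX (Z · = z)]
      simp
  simp_rw [h1]
  rw [sum_law hZ fun _ => True]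
  simp

theorem condEnt_nonneg : 0 ≤ condEnt μ X Z := CE_nonneg fun _ _ => measureReal_nonneg

theorem condEnt_le_card (hX : Fib X) (hZ : Fib Z) : condEnt μ X Z ≤ Fintype.card α := by
  have := CE_le (p := fun a z => μ.real {ω | X ω = a ∧ Z ω = z}) fun _ _ => measureReal_nonneg
  rwa [sum_sum_law hX hZ, mul_one] at this

/-- Conditioning on less increases the entropy. -/
theorem condEnt_mono {Y : Ω → ξ} (hZ : Fib Z) (h : ∀ ω ω', Z ω = Z ω' → Y ω = Y ω') :
    condEnt μ X Z ≤ condEnt μ X Y := by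
  have : Nonempty ξ := by
    obtain ⟨ω⟩ := μ.nonempty_of_neZero
    exact ⟨Y ω⟩
  obtain ⟨g, rfl⟩ := (Function.factorsThrough_iff (g := Y) (f := Z)).1 fun ω ω' h' => h ω ω' h'
  have := CE_le_pushSnd (g := g) (p := fun a z => μ.real {ω | X ω = a ∧ Z ω = z})
    fun _ _ => measureReal_nonneg
  rwa [pushSnd_law hZ] at this

theorem condEnt_le_add (hX : Fib X) (hZ : Fib Z) (g : ζ → ξ) {ε : ℝ}
    (h : ∀ a z z', g z = g z' → 0 < μ.real {ω | Z ω = z} → 0 < μ.real {ω | Z ω = z'} →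
      |μ.real {ω | X ω = a ∧ Z ω = z} / μ.real {ω | Z ω = z} -
        μ.real {ω | X ω = a ∧ Z ω = z'} / μ.real {ω | Z ω = z'}| ≤ ε) :
    condEnt μ X (fun ω => g (Z ω)) ≤ condEnt μ X Z + Fintype.card α * (2 * √ε) := by
  have hs : ∀ z, ∑ a, μ.real {ω | X ω = a ∧ Z ω = z} = μ.real {ω | Z ω = z} :=
    fun z => sum_law hX (Z · = z)
  have := CE_pushSnd_le (g := g) (p := fun a z => μ.real {ω | X ω = a ∧ Z ω = z})
    (ε := ε) (fun _ _ => measureReal_nonneg) (by simpa only [hs] using h)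
  rwa [pushSnd_law hZ, sum_sum_law hX hZ, mul_one] at this

/-- Conditional independence given `g ∘ Z`. -/
theorem condEnt_eq_of_mul_eq (hX : Fib X) (hZ : Fib Z) (g : ζ → ξ)
    (h : ∀ a z, μ.real {ω | X ω = a ∧ Z ω = z} * μ.real {ω | g (Z ω) = g z} =
      μ.real {ω | X ω = a ∧ g (Z ω) = g z} * μ.real {ω | Z ω = z}) :
    condEnt μ X Z = condEnt μ X fun ω => g (Z ω) := by
  refine le_antisymm (condEnt_mono hZ fun _ _ h => by rw [h]) ?_
  have key : ∀ a z, 0 < μ.real {ω | Z ω = z} →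
      μ.real {ω | X ω = a ∧ Z ω = z} / μ.real {ω | Z ω = z} =
      μ.real {ω | X ω = a ∧ g (Z ω) = g z} / μ.real {ω | g (Z ω) = g z} := fun a z hz => by
    have h1 : 0 < μ.real {ω | g (Z ω) = g z} :=
      hz.trans_le (measureReal_mono fun ω (hω : Z ω = z) => by
        change g (Z ω) = g z
        rw [hω])
    rw [div_eq_div_iff hz.ne' h1.ne', h]
  have := condEnt_le_add (μ := μ) hX hZ g (ε := 0) fun a z z' hg hz hz' => by
    rw [key a z hz, key a z' hz', hg]
    simp
  simpa using this

theorem condEnt_comp {T : Ω → Ω} (hT : MeasurePreserving T μ μ) (hX : Fib X) (hZ : Fib Z) :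
    condEnt μ (fun ω => X (T ω)) (fun ω => Z (T ω)) = condEnt μ X Z := by
  unfold condEnt
  congr 1
  funext a z
  exact hT.measureReal_preimage (hX.and hZ a z).nullMeasurableSet

end CondEnt

/-! ### Entropy of boxes -/

section Boxes

variable {d : ℕ} {A : Type u} [Fintype A] [MeasurableSpace A] [MeasurableSingletonClass A]
  (μ : Measure (Site d → A))

/-- The restriction of a configuration. -/
def restr (S : Finset (Site d)) (x : Site d → A) : Config A S := fun v => x v

omit [Fintype A] in
theorem fib_restr (S : Finset (Site d)) : Fib (restr (A := A) S) := fun z => by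
  convert measurableSet_cyl z
  ext x
  simp [restr, cyl, funext_iff]

omit [Fintype A] in
theorem fib_at (v : Site d) : Fib fun x : Site d → A => x v := fun a =>
  show MeasurableSet ((fun x : Site d → A => x v) ⁻¹' {a}) from
    measurable_pi_apply v (measurableSet_singleton a)

omit [Fintype A] [MeasurableSpace A] [MeasurableSingletonClass A] in
theorem restr_eq_iff {S : Finset (Site d)} {x y : Site d → A} :
    restr S x = restr S y ↔ ∀ v ∈ S, x v = y v := by
  simp [restr, funext_iff]

/-- Entropy of the symbol at `v` given the symbols on `S`. -/
noncomputable def siteEnt (v : Site d) (S : Finset (Site d)) : ℝ :=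
  condEnt μ (fun x : Site d → A => x v) (restr S)

variable {μ} [IsProbabilityMeasure μ]

theorem siteEnt_mono (v : Site d) {S T : Finset (Site d)} (h : S ⊆ T) :
    siteEnt μ v T ≤ siteEnt μ v S :=
  condEnt_mono (fib_restr T) fun x y hxy => by
    rw [restr_eq_iff] at *
    exact fun w hw => hxy w (h hw)

theorem shapeEntropy_insert {S : Finset (Site d)} {v : Site d} (hv : v ∉ S) :
    shapeEntropy μ (insert v S) = siteEnt μ v S + shapeEntropy μ S := by
  classical
  rw [siteEnt, condEnt, CE_eq fun _ _ => measureReal_nonneg]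
  have hcyl : ∀ {S : Finset (Site d)} (z : Config A S), {x | restr S x = z} = cyl z := by
    intro S z
    ext x
    simp [restr, cyl, funext_iff]
  have h1 : ∀ z : Config A S, ∑ a, μ.real {x : Site d → A | x v = a ∧ restr S x = z} =
      μ.real (cyl z) := fun z => by
    rw [← hcyl]
    exact sum_law (fib_at v) (restr S · = z)
  simp_rw [h1]
  have h2 : ∑ z : Config A S, ∑ a, negMulLog (μ.real {x : Site d → A | x v = a ∧ restr S x = z}) =
      shapeEntropy μ (insert v S) := by
    rw [← Fintype.sum_prod_type', shapeEntropy]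
    let e : Config A S × A ≃ Config A (insert v S) :=
      { toFun := fun p w => if h : w.1 = v then p.2
          else p.1 ⟨w, (Finset.mem_insert.1 w.2).resolve_left h⟩
        invFun := fun y => (fun w => y ⟨w, Finset.mem_insert_of_mem w.2⟩,
          y ⟨v, Finset.mem_insert_self _ _⟩)
        left_inv := fun p => by
          ext w
          · have : w.1 ≠ v := fun h => hv (h ▸ w.2)
            simp [this]
          · simp
        right_inv := fun y => by
          funext ⟨w, hw⟩
          by_cases h : w = v
          · subst h
            simp
          · simp [h] }
    refine Fintype.sum_equiv e _ _ fun p => ?_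
    congr 2
    ext x
    simp only [Set.mem_ofPred_eq, cyl]
    constructor
    · rintro ⟨h, h'⟩ ⟨w, hw⟩
      by_cases hwv : w = v
      · subst hwv
        simp [e, h]
      · simp [e, hwv, ← h', restr]
    · intro h
      refine ⟨by simpa [e] using h ⟨v, Finset.mem_insert_self _ _⟩, ?_⟩
      funext w
      have : w.1 ≠ v := fun h => hv (h ▸ w.2)
      have h3 := h ⟨w.1, Finset.mem_insert_of_mem w.2⟩
      simpa [e, this, restr] using h3
  rw [h2, shapeEntropy, shapeEntropy]
  ring

/-- The chain rule. -/
theorem shapeEntropy_eq_sum (k : Site d → ℤ) (S : Finset (Site d)) (hk : Set.InjOn k S) :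
    shapeEntropy μ S = ∑ v ∈ S, siteEnt μ v (S.filter (k · < k v)) := by
  classical
  induction S using Finset.induction_on_max_value k with
  | empty => simp [shapeEntropy, cyl]
  | insert a s ha hmax ih =>
    have hinj : ∀ x ∈ s, k x < k a := fun x hx => (hmax x hx).lt_of_ne fun h => ha (by
      rwa [← hk (Finset.mem_insert_of_mem hx) (Finset.mem_insert_self _ _) h])
    rw [shapeEntropy_insert ha, Finset.sum_insert ha,
      ih (hk.mono (by simp))]
    congr 1
    · congr 1
      rw [Finset.filter_insert, if_neg (lt_irrefl _), Finset.filter_true_of_mem hinj]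
    · refine Finset.sum_congr rfl fun x hx => ?_
      rw [Finset.filter_insert, if_neg (not_lt.2 (hmax x hx))]

theorem siteEnt_shift (hμ : IsStationary μ) (v : Site d) (S : Finset (Site d)) :
    siteEnt μ v S = siteEnt μ 0 (S.image (· - v)) := by
  have h1 := condEnt_comp (hμ v) (fib_at (A := A) (0 : Site d)) (fib_restr (S.image (· - v)))
  rw [siteEnt, siteEnt, ← h1]
  have h2 : (fun x : Site d → A => shift v x 0) = fun x => x v := by
    funext x
    simp [shift]
  rw [h2]
  have h3 : ∀ x y : Site d → A, restr S x = restr S y ↔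
      restr (S.image (· - v)) (shift v x) = restr (S.image (· - v)) (shift v y) := by
    intro x y
    simp only [restr_eq_iff, Finset.forall_mem_image, shift, sub_add_cancel]
  refine le_antisymm (condEnt_mono (fib_restr S) fun x y => (h3 x y).1) (condEnt_mono ?_ fun x y => (h3 x y).2)
  intro z
  exact (hμ v).measurable (fib_restr _ z)

/-- The chain rule along the lexicographic order and stationarity turn the entropy of a box into a
sum of entropies of the symbol at 0 given finite sets of past sites. Every term is at least `L n`,
and a term is at most `U n` unless its site is within `n` of the edge of the box. Such sites are a
vanishing proportion, so the limit exists without any subadditivity argument. -/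
theorem HasEntropy.exists_of_bounds (hμ : IsStationary μ) {L U : ℕ → ℝ}
    (hL : ∀ n B, (∀ v ∈ B, IsPast v) → L n ≤ siteEnt μ 0 B)
    (hU : ∀ n B, (∀ v ∈ B, IsPast v) → (∀ v ∈ cube d n, IsPast v → v ∈ B) → siteEnt μ 0 B ≤ U n)
    (hlim : ∀ ε > 0, ∃ n, U n - L n < ε) :
    ∃ h, HasEntropy μ h ∧ ∀ n, L n ≤ h ∧ h ≤ U n := by
  classical
  have chain : ∀ j : Fin d → ℕ, ∃ B : Site d → Finset (Site d),
      (∀ v ∈ box j, ∀ w, w ∈ B v ↔ IsPast w ∧ w + v ∈ box j) ∧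
      shapeEntropy μ (box j) = ∑ v ∈ box j, siteEnt μ 0 (B v) := by
    intro j
    -- Exceeds all coordinate differences in the box, so `lin M` is injective there and orders it
    -- lexicographically.
    let M : ℤ := 1 + ∑ i, (j i : ℤ)
    have hM : ∀ v ∈ box j, ∀ w ∈ box j, ∀ i, |(w - v) i| < M := by
      intro v hv w hw i
      rw [box, Finset.mem_Icc] at hv hw
      have h1 := hv.1 i
      have h2 := hv.2 i
      have h3 := hw.1 i
      have h4 := hw.2 i
      have h5 : (j i : ℤ) ≤ ∑ i, (j i : ℤ) :=
        Finset.single_le_sum (f := fun i => (j i : ℤ)) (fun _ _ => by positivity)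
          (Finset.mem_univ i)
      simp only [Pi.sub_apply, abs_lt, M]
      simp only at h1 h2 h3 h4
      omega
    refine ⟨fun v => ((box j).filter (lin M · < lin M v)).image (· - v), fun v hv w => ?_, ?_⟩
    · simp only [Finset.mem_image, Finset.mem_filter]
      constructor
      · rintro ⟨x, ⟨hx, hlt⟩, rfl⟩
        rw [sub_add_cancel, isPast_iff (hM v hv x hx), lin_sub]
        exact ⟨by omega, hx⟩
      · rintro ⟨h1, h2⟩
        refine ⟨w + v, ⟨h2, ?_⟩, add_sub_cancel_right _ _⟩
        have h3 := hM v hv _ h2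
        rw [add_sub_cancel_right] at h3
        have h4 := (isPast_iff h3).1 h1
        rw [lin_add]
        omega
    · rw [shapeEntropy_eq_sum (lin M) (box j) fun v hv w hw h => ?_]
      · exact Finset.sum_congr rfl fun v _ => siteEnt_shift hμ _ _
      · have h1 := hM w hw v hv
        rw [← sub_eq_zero]
        rw [← lin_eq_zero_iff h1, lin_sub, h, sub_self]
  have hcard : ∀ j : Fin d → ℕ, ((box j).card : ℝ) = ∏ i, (j i : ℝ) := fun j => by
    rw [box, Pi.card_Icc]
    simp
  have hev : ∀ m : ℕ, ∀ᶠ j : Fin d → ℕ in Filter.atTop, ∀ i, m ≤ j i := fun m =>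
    (Filter.eventually_ge_atTop fun _ => m).mono fun j hj i => hj i
  have lower : ∀ n, ∀ᶠ j : Fin d → ℕ in Filter.atTop,
      L n ≤ shapeEntropy μ (box j) / ∏ i, (j i : ℝ) := fun n => by
    filter_upwards [hev 1] with j hj
    obtain ⟨B, hB, hs⟩ := chain j
    have h0 : 0 < ∏ i, (j i : ℝ) := Finset.prod_pos fun i _ => by exact_mod_cast hj i
    rw [le_div_iff₀ h0, hs, ← hcard, mul_comm, ← nsmul_eq_mul]
    exact Finset.card_nsmul_le_sum _ _ _ fun v hv => hL n _ fun w hw => ((hB v hv w).1 hw).1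
  -- Needed because `U n` will also be counted, superfluously, at the sites near the edge of the
  -- box.
  have hU0 : ∀ n, 0 ≤ U n := fun n => condEnt_nonneg.trans
    (hU n ((cube d n).filter IsPast) (fun v hv => (Finset.mem_filter.1 hv).2)
      fun v hv hp => Finset.mem_filter.2 ⟨hv, hp⟩)
  have upper : ∀ n, ∀ᶠ j : Fin d → ℕ in Filter.atTop,
      shapeEntropy μ (box j) / ∏ i, (j i : ℝ) ≤
        -- The bracket is the proportion of sites within `n` of the edge, where only the trivial
        -- bound is used.
        U n + Fintype.card A * (1 - ∏ i, ((j i : ℝ) - 2 * n) / j i) := fun n => by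
    filter_upwards [hev (2 * n + 1)] with j hj
    obtain ⟨B, hB, hs⟩ := chain j
    have h0 : 0 < ∏ i, (j i : ℝ) := Finset.prod_pos fun i _ => by
      have := hj i
      exact_mod_cast (by omega : 0 < j i)
    let I : Finset (Site d) := Finset.Icc (fun _ => (n : ℤ) + 1) (fun i => (j i : ℤ) - n)
    have hI : I ⊆ box j := by
      intro v hv
      simp only [I, box, Finset.mem_Icc, Pi.le_def] at hv ⊢
      exact ⟨fun i => by have := hv.1 i; omega, fun i => by have := hv.2 i; omega⟩
    have hIc : (I.card : ℝ) = ∏ i, ((j i : ℝ) - 2 * n) := by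
      rw [Pi.card_Icc]
      push_cast
      refine Finset.prod_congr rfl fun i _ => ?_
      rw [Int.card_Icc]
      have := hj i
      rw [show ((j i : ℤ) - n + 1 - (n + 1)).toNat = j i - 2 * n by omega,
        Nat.cast_sub (by omega)]
      push_cast
      ring
    have h1 : ∑ v ∈ box j, siteEnt μ 0 (B v) ≤ ∑ v ∈ box j, U n +
        ∑ v ∈ box j \ I, (Fintype.card A : ℝ) := by
      rw [← Finset.sum_sdiff hI, ← Finset.sum_sdiff (f := fun _ => U n) hI]
      have e1 : ∑ v ∈ I, siteEnt μ 0 (B v) ≤ ∑ v ∈ I, U n := Finset.sum_le_sum fun v hv => by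
        refine hU n _ (fun w hw => ((hB v (hI hv) w).1 hw).1) fun w hw hp =>
          (hB v (hI hv) w).2 ⟨hp, ?_⟩
        rw [mem_cube] at hw
        simp only [I, box, Finset.mem_Icc, Pi.le_def, Pi.add_apply] at hv ⊢
        exact ⟨fun i => by have := hv.1 i; have := hw i; omega,
          fun i => by have := hv.2 i; have := hw i; omega⟩
      have e2 : ∑ v ∈ box j \ I, siteEnt μ 0 (B v) ≤ ∑ v ∈ box j \ I, (Fintype.card A : ℝ) :=
        Finset.sum_le_sum fun v _ => condEnt_le_card (fib_at _) (fib_restr _)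
      have e3 : 0 ≤ ∑ v ∈ box j \ I, U n := Finset.sum_nonneg fun _ _ => hU0 n
      linarith
    rw [div_le_iff₀ h0, hs]
    refine h1.trans (le_of_eq ?_)
    rw [Finset.sum_const, Finset.sum_const, nsmul_eq_mul, nsmul_eq_mul,
      Finset.card_sdiff_of_subset hI, Nat.cast_sub (Finset.card_le_card hI), hcard, hIc,
      Finset.prod_div_distrib]
    field_simp
  have htend : ∀ n : ℕ, Filter.Tendsto (fun j : Fin d → ℕ => U n + Fintype.card A *
      (1 - ∏ i, ((j i : ℝ) - 2 * n) / j i)) Filter.atTop (nhds (U n)) := fun n => by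
    have h1 : ∀ i : Fin d, Filter.Tendsto (fun j : Fin d → ℕ => ((j i : ℝ) - 2 * n) / j i)
        Filter.atTop (nhds 1) := fun i => by
      have h2 : Filter.Tendsto (fun j : Fin d → ℕ => ((j i : ℕ) : ℝ)) Filter.atTop Filter.atTop :=
        tendsto_natCast_atTop_atTop.comp (Filter.tendsto_atTop.2 fun b =>
          (hev b).mono fun j hj => hj i)
      have h3 := (tendsto_const_nhds (x := (1 : ℝ))).sub
        ((tendsto_const_nhds (x := (2 * n : ℝ))).div_atTop h2)
      rw [sub_zero] at h3
      refine h3.congr' ?_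
      filter_upwards [hev 1] with j hj
      have : (0 : ℝ) < j i := by exact_mod_cast hj i
      field_simp
    have h4 := tendsto_finsetProd (univ : Finset (Fin d)) fun i _ => h1 i
    rw [Finset.prod_const_one] at h4
    have := ((h4.const_sub 1).const_mul (Fintype.card A : ℝ)).const_add (U n)
    simpa using this
  -- Lower and upper bounds with different parameters enclose the same sequence, so the supremum of
  -- `L` lies below every `U m`.
  have hLU : ∀ n m, L n ≤ U m := fun n m => ge_of_tendsto (htend m)
    ((lower n).and (upper m) |>.mono fun j hj => hj.1.trans hj.2)
  have hbdd : BddAbove (Set.range L) := ⟨U 0, by rintro _ ⟨n, rfl⟩; exact hLU n 0⟩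
  have hh : ∀ n, L n ≤ (⨆ n, L n) ∧ (⨆ n, L n) ≤ U n := fun n =>
    ⟨le_ciSup hbdd n, ciSup_le fun m => hLU m n⟩
  refine ⟨⨆ n, L n, ?_, hh⟩
  rw [HasEntropy, Metric.tendsto_nhds]
  intro ε hε
  obtain ⟨n, hn⟩ := hlim (ε / 2) (by positivity)
  filter_upwards [lower n, upper n, (htend n).eventually (eventually_lt_nhds
    (show U n < U n + ε / 2 by linarith))] with j h1 h2 h3
  rw [Real.dist_eq, abs_lt]
  have := hh n
  constructor <;> linarith

end Boxes

end GibbsEntropy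

namespace GibbsEntropy
open Finset MeasureTheory
open Real (negMulLog)

/-! ### The entropy and the entropies given the faces -/

/-- Conditional entropy of the centre given the near past, with the faces fixed. -/
noncomputable def faceEnt (q E : ℕ) (W : ℕ → ℕ → ℝ) (e : ℕ) : ℝ :=
  (∑ f ∈ range E, wtPast q W e f *
    ∑ x ∈ range q, negMulLog (W e (q * f + x) / wtPast q W e f)) / wtFace q E W e

section Cubes

variable {d : ℕ}

/-- The part of the cube that does not precede the centre. -/
noncomputable def futureSites (d n : ℕ) : Finset (Site d) := by
  classical exact (cube d n).filter fun v => ¬ IsPast v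

/-- The sites that the algorithm conditions on. -/
noncomputable def knownSites (d n : ℕ) : Finset (Site d) :=
  (cube d (n + 1) \ cube d n) ∪ nearPastSites d n

theorem isPast_of_mem_nearPastSites {n : ℕ} {v : Site d} (h : v ∈ nearPastSites d n) :
    IsPast v :=
  (numOf_lt_mid (cube_mono (Nat.le_succ n) (nearPastSites_subset h))).1 (Finset.mem_filter.1 h).2.1

theorem zero_mem_futureSites (n : ℕ) : (0 : Site d) ∈ futureSites d n := by
  classical
  exact Finset.mem_filter.2 ⟨zero_mem_cube n, not_isPast_zero⟩

/-- A neighbour of a future site that is not one itself is either outside the inner cube, hence on a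
face, or a past site of it; its number then differs from that of its neighbour by at most one layer
and so belongs to the near past. -/
theorem boundary_futureSites_subset (n : ℕ) : boundary (futureSites d n) ⊆ knownSites d n := by
  classical
  intro v hv
  obtain ⟨h1, w, hw, hvw⟩ := (mem_boundary _ _).1 hv
  obtain ⟨hw1, hw2⟩ := Finset.mem_filter.1 hw
  have hw' := cube_mono (Nat.le_succ n) hw1
  by_cases hv1 : v ∈ cube d n
  · refine Finset.mem_union_right _ (Finset.mem_filter.2 ⟨hv1, ?_, ?_⟩)
    · rw [numOf_lt_mid (cube_mono (Nat.le_succ n) hv1)]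
      by_contra hc
      exact h1 (Finset.mem_filter.2 ⟨hv1, hc⟩)
    · rw [← numOf_lt_mid hw', not_lt] at hw2
      exact hw2.trans (numOf_le_of_adj (cube_mono (Nat.le_succ n) hv1) hw' hvw)
  · refine Finset.mem_union_left _ ?_
    have : v ∈ boundary (cube d n) := (mem_boundary _ _).2 ⟨hv1, w, hw1, hvw⟩
    exact boundary_cube_subset n this

theorem disjoint_futureSites {n : ℕ} {B : Finset (Site d)} (hB : ∀ v ∈ B, IsPast v) :
    Disjoint (futureSites d n) (B ∪ knownSites d n) := by
  classical
  refine Finset.disjoint_left.2 fun v hv hv' => ?_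
  obtain ⟨h1, h2⟩ := Finset.mem_filter.1 hv
  rcases Finset.mem_union.1 hv' with h | h
  · exact h2 (hB v h)
  · rcases Finset.mem_union.1 h with h | h
    · exact (Finset.mem_sdiff.1 h).2 h1
    · exact h2 (isPast_of_mem_nearPastSites h)

end Cubes

section

variable {d : ℕ} {A : Type u} [Fintype A] [MeasurableSpace A] [MeasurableSingletonClass A]
  {μ : Measure (Site d → A)} [IsProbabilityMeasure μ]

/-- The Markov identity for full configurations on `U`, summed over the symbols at the other sites
of `U`. -/
theorem IsMRF.insert_mul_eq (h : IsMRF μ) {U T : Finset (Site d)} (hT : boundary U ⊆ T)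
    (hUT : Disjoint U T) {v : Site d} (hv : v ∈ U) {x : Site d → A} (hx : 0 < mg μ T x) :
    mg μ (insert v (boundary U)) x * mg μ T x = mg μ (insert v T) x * mg μ (boundary U) x := by
  have key : ∀ T : Finset (Site d), Disjoint U T →
      mg μ (insert v T) x = ∑ w : Config A (U.erase v), mg μ (U ∪ T) (glue w x) := by
    intro T hUT
    rw [mg_eq_sum (U.erase v) (insert v T) (Finset.disjoint_left.2 fun a ha ha' => ?_) x]
    · have hU : U.erase v ∪ insert v T = U ∪ T := by
        rw [Finset.union_insert, ← Finset.insert_union, Finset.insert_erase hv]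
      rw [hU]
    · rw [Finset.mem_erase] at ha
      rcases Finset.mem_insert.1 ha' with h1 | h1
      · exact ha.1 h1
      · exact Finset.disjoint_left.1 hUT ha.2 h1
  rw [key _ hUT, key _ (disjoint_boundary U), Finset.sum_mul, Finset.sum_mul]
  refine Finset.sum_congr rfl fun w _ => ?_
  have hc : ∀ T : Finset (Site d), Disjoint U T → mg μ T x = mg μ T (glue w x) := fun T hUT =>
    mg_congr fun a ha => (glue_notMem _ _ fun hc =>
      Finset.disjoint_left.1 hUT (Finset.mem_of_mem_erase hc) ha).symm
  rw [hc _ hUT] at hx ⊢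
  rw [hc _ (disjoint_boundary U)]
  exact h.mul_eq hT hUT hx

/-- Both conditioning sets contain `boundary U` and avoid `U`, so both conditional laws at `v` agree
with the one given `boundary U`. -/
theorem IsMRF.siteEnt_eq (h : IsMRF μ) {U T T' : Finset (Site d)} (hT' : boundary U ⊆ T')
    (hT : T' ⊆ T) (hUT : Disjoint U T) {v : Site d} (hv : v ∈ U) :
    siteEnt μ v T = siteEnt μ v T' := by
  classical
  refine condEnt_eq_of_mul_eq (fib_at v) (fib_restr T)
    (Finset.restrict₂ (π := fun _ => A) hT) fun a z => ?_
  have hvT : v ∉ T := Finset.disjoint_left.1 hUT hv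
  let x : Site d → A := glue z fun _ => a
  have hxv : x v = a := glue_notMem _ _ hvT
  have hxz : restr T x = z := funext fun w => glue_mem z (fun _ => a) w.2
  have e0 : ∀ S : Finset (Site d), μ.real {y | restr S y = restr S x} = mg μ S x := fun S => by
    unfold mg
    congr 1
    ext y
    simp [restr, cyl, funext_iff]
  have e1 : ∀ S : Finset (Site d), μ.real {y | y v = a ∧ restr S y = restr S x} =
      mg μ (insert v S) x := fun S => by
    unfold mg
    congr 1
    ext y
    simp only [restr_eq_iff, Set.mem_ofPred_eq, cyl, Subtype.forall, Finset.forall_mem_insert, hxv]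
  have e2 : Finset.restrict₂ (π := fun _ => A) hT z = restr T' x := by
    rw [← hxz]
    rfl
  have e3 : ∀ y : Site d → A, Finset.restrict₂ (π := fun _ => A) hT (restr T y) = restr T' y :=
    fun y => rfl
  simp only [e2, e3]
  rw [← hxz, e0, e0, e1, e1]
  rcases (mg_nonneg (μ := μ) T x).eq_or_lt with h0 | h0
  · have : mg μ (insert v T) x = 0 := le_antisymm
      ((mg_mono (Finset.subset_insert _ _) x).trans h0.ge) (mg_nonneg _ _)
    rw [this, ← h0]
    simp
  · have h1 := h.insert_mul_eq (hT'.trans hT) hUT hv h0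
    have h2 := h.insert_mul_eq hT' (Finset.disjoint_of_subset_right hT hUT) hv
      (h0.trans_le (mg_mono hT x))
    have h3 : 0 < mg μ (boundary U) x := h0.trans_le (mg_mono (hT'.trans hT) x)
    refine mul_right_cancel₀ h3.ne' ?_
    linear_combination (-mg μ T' x) * h1 + mg μ T x * h2

omit [IsProbabilityMeasure μ] [Fintype A] [MeasurableSingletonClass A] in
theorem Fib.of_eq_imp {Ω : Type*} [MeasurableSpace Ω] {ζ ξ : Type*} [Fintype ζ] [Nonempty Ω]
    {Z : Ω → ζ} {Y : Ω → ξ} (hZ : Fib Z) (h : ∀ ω ω', Z ω = Z ω' → Y ω = Y ω') : Fib Y := by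
  have : Nonempty ξ := ⟨Y (Classical.arbitrary Ω)⟩
  obtain ⟨g, rfl⟩ := (Function.factorsThrough_iff (g := Y) (f := Z)).1 fun ω ω' h' => h ω ω' h'
  intro y
  have : {ω | (g ∘ Z) ω = y} = ⋃ z ∈ {z | g z = y}, {ω | Z ω = z} := by
    ext ω
    simp
  rw [this]
  exact MeasurableSet.biUnion (Set.to_countable _) fun z _ => hZ z

variable [Nonempty A] {G : Interactions d A} {n : ℕ}

variable (n) in
/-- Codes of the faces and of the near past. -/
noncomputable def codes (x : Site d → A) :
    Fin (cap d (Fintype.card A) n) × Fin (cap d (Fintype.card A) n) :=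
  (⟨faceOf n x, faceOf_lt x⟩,
    ⟨pastOf n x / Fintype.card A, (Nat.div_le_self _ _).trans_lt (pastOf_lt x)⟩)

omit [MeasurableSpace A] [MeasurableSingletonClass A] in
theorem codes_eq_iff {x y : Site d → A} :
    codes n x = codes n y ↔ restr (knownSites d n) x = restr (knownSites d n) y := by
  simp only [codes, Prod.mk.injEq, Fin.mk.injEq, faceOf_eq_iff, (pastOf_spec x y).2,
    restr_eq_iff, knownSites, Finset.mem_union, Finset.mem_sdiff]
  constructor
  · rintro ⟨h1, h2⟩ v (hv | hv)
    exacts [h1 v hv.1 hv.2, h2 v hv]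
  · exact fun h => ⟨fun v hv hv' => h v (.inl ⟨hv, hv'⟩), fun v hv => h v (.inr hv)⟩

theorem fib_codes : Fib (codes (d := d) (A := A) n) :=
  (fib_restr (knownSites d n)).of_eq_imp fun _ _ h => codes_eq_iff.2 h

omit [IsProbabilityMeasure μ] in
theorem sum_code {R : Type*} [AddCommMonoid R] (F : ℕ → R) :
    ∑ a : A, F (code a) = ∑ x ∈ range (Fintype.card A), F x := by
  rw [← Fin.sum_univ_eq_sum_range]
  exact Fintype.sum_equiv (Fintype.equivFin A) _ _ fun a => rfl

theorem codes_law (h : G.IsGibbs μ) (a : A)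
    (z : Fin (cap d (Fintype.card A) n) × Fin (cap d (Fintype.card A) n)) :
    μ.real {x : Site d → A | x 0 = a ∧ codes n x = z} = faceLaw μ n z.1 *
      (codeWt n G.γ G.β z.1 (Fintype.card A * z.2 + code a) /
        wtFace (Fintype.card A) (cap d (Fintype.card A) n) (codeWt n G.γ G.β) z.1) := by
  have h1 := law_mul_wtFace h n z.1 (Fintype.card A * z.2 + code a)
  have h2 : {x : Site d → A | x 0 = a ∧ codes n x = z} =
      {x | faceOf n x = z.1 ∧ pastOf n x = Fintype.card A * z.2 + code a} := by
    ext x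
    have hs := (pastOf_spec (n := n) x x).1
    simp only [Set.mem_ofPred_eq, codes, Prod.ext_iff, Fin.ext_iff]
    rw [← (code_injective (A := A)).eq_iff, ← hs]
    constructor
    · rintro ⟨h1, h2, h3⟩
      exact ⟨h2, by rw [← h1, ← h3, Nat.div_add_mod]⟩
    · rintro ⟨h1, h2⟩
      have hc := code_lt a
      refine ⟨?_, h1, ?_⟩
      · rw [h2, Nat.mul_add_mod, Nat.mod_eq_of_lt hc]
      · rw [h2, Nat.mul_add_div Fintype.card_pos, Nat.div_eq_of_lt hc, add_zero]
  rw [h2]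
  rcases (measureReal_nonneg (μ := μ) (s := {x | faceOf n x = z.1})).eq_or_lt with h0 | h0
  · rw [faceLaw, ← h0, zero_mul]
    exact le_antisymm ((measureReal_mono fun x hx => hx.1).trans h0.ge) measureReal_nonneg
  · have h3 := wtFace_pos_of_faceLaw_pos h h0
    rw [← mul_div_assoc, eq_div_iff h3.ne']
    exact h1

theorem codes_law_sum (h : G.IsGibbs μ)
    (z : Fin (cap d (Fintype.card A) n) × Fin (cap d (Fintype.card A) n)) :
    μ.real {x : Site d → A | codes n x = z} = faceLaw μ n z.1 *
      (wtPast (Fintype.card A) (codeWt n G.γ G.β) z.1 z.2 /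
        wtFace (Fintype.card A) (cap d (Fintype.card A) n) (codeWt n G.γ G.β) z.1) := by
  rw [← sum_law (fib_at (A := A) (0 : Site d)) fun x => codes n x = z]
  simp_rw [codes_law h]
  rw [← Finset.mul_sum, ← Finset.sum_div,
    sum_code fun i => codeWt n G.γ G.β z.1 (Fintype.card A * z.2 + i)]
  rfl

/-- The probability of the faces cancels in every conditional probability and survives only as a
weight of the mean. Extremes of `faceEnt` therefore bound this entropy without knowledge of `μ`. -/
theorem condEnt_codes (h : G.IsGibbs μ) :
    condEnt μ (fun x : Site d → A => x 0) (codes n) =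
      ∑ e ∈ range (cap d (Fintype.card A) n), faceLaw μ n e *
        faceEnt (Fintype.card A) (cap d (Fintype.card A) n) (codeWt n G.γ G.β) e := by
  have hs : ∀ z, ∑ a, μ.real {x : Site d → A | x 0 = a ∧ codes n x = z} =
      μ.real {x : Site d → A | codes n x = z} := fun z =>
    sum_law (fib_at (A := A) (0 : Site d)) fun x => codes n x = z
  rw [condEnt, CE]
  simp_rw [hs, codes_law_sum h, codes_law h]
  rw [Fintype.sum_prod_type, ← Fin.sum_univ_eq_sum_range]
  refine Finset.sum_congr rfl fun e _ => ?_
  rcases (measureReal_nonneg (μ := μ) (s := {x | faceOf n x = e})).eq_or_lt with h0 | h0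
  · have h0' : faceLaw μ n e = 0 := h0.symm
    simp only [h0', zero_mul, Finset.sum_const_zero]
  · have h3 := wtFace_pos_of_faceLaw_pos h h0
    have h0' : faceLaw μ n e ≠ 0 := h0.ne'
    rw [faceEnt, Finset.sum_div, Finset.mul_sum, ← Fin.sum_univ_eq_sum_range]
    refine Finset.sum_congr rfl fun f _ => ?_
    rw [← Finset.mul_sum, ← sum_code fun x => negMulLog (codeWt n G.γ G.β e
      (Fintype.card A * f + x) / wtPast (Fintype.card A) (codeWt n G.γ G.β) e f)]
    simp_rw [mul_div_mul_left _ _ h0', div_div_div_cancel_right₀ h3.ne']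
    ring

/-- The entropy given sites of the past is at least the mean of the entropies given the faces. -/
theorem Interactions.IsGibbs.le_siteEnt (h : G.IsGibbs μ) {B : Finset (Site d)}
    (hB : ∀ v ∈ B, IsPast v) :
    condEnt μ (fun x : Site d → A => x 0) (codes n) ≤ siteEnt μ 0 B := by
  have h1 := h.isMRF.siteEnt_eq (boundary_futureSites_subset n) Finset.subset_union_right
    (disjoint_futureSites hB) (zero_mem_futureSites n)
  refine (condEnt_mono (Y := restr (knownSites d n)) fib_codes fun x y => codes_eq_iff.1).trans ?_
  exact h1.ge.trans (siteEnt_mono 0 Finset.subset_union_left)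

/-- `B` determines the near past, so the entropy given the near past is an upper bound. Compared
with `codes` this only forgets the faces, and for a fixed near past the conditional probabilities
vary by at most `ε` with the faces. -/
theorem Interactions.IsGibbs.siteEnt_le (h : G.IsGibbs μ) {B : Finset (Site d)}
    (hB : ∀ v ∈ cube d n, IsPast v → v ∈ B) {ε : ℝ}
    (hε : ∀ e e' f x, e < cap d (Fintype.card A) n → e' < cap d (Fintype.card A) n →
      f < cap d (Fintype.card A) n → x < Fintype.card A →
      0 < wtPast (Fintype.card A) (codeWt n G.γ G.β) e f →
      0 < wtPast (Fintype.card A) (codeWt n G.γ G.β) e' f →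
      |codeWt n G.γ G.β e (Fintype.card A * f + x) /
          wtPast (Fintype.card A) (codeWt n G.γ G.β) e f -
        codeWt n G.γ G.β e' (Fintype.card A * f + x) /
          wtPast (Fintype.card A) (codeWt n G.γ G.β) e' f| ≤ ε) :
    siteEnt μ 0 B ≤ condEnt μ (fun x : Site d → A => x 0) (codes n) +
      Fintype.card A * (2 * √ε) := by
  have h1 : siteEnt μ 0 B ≤ condEnt μ (fun x : Site d → A => x 0) fun x => (codes n x).2 := by
    refine condEnt_mono (fib_restr B) fun x y hxy => ?_
    simp only [codes, Fin.mk.injEq, (pastOf_spec x y).2]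
    rw [restr_eq_iff] at hxy
    exact fun v hv => hxy v (hB v (nearPastSites_subset hv) (isPast_of_mem_nearPastSites hv))
  refine h1.trans (condEnt_le_add (fib_at 0) fib_codes Prod.snd ?_)
  have key : ∀ z : Fin (cap d (Fintype.card A) n) × Fin (cap d (Fintype.card A) n),
      0 < μ.real {x : Site d → A | codes n x = z} →
      0 < wtPast (Fintype.card A) (codeWt n G.γ G.β) z.1 z.2 ∧
      ∀ a, μ.real {x : Site d → A | x 0 = a ∧ codes n x = z} /
        μ.real {x : Site d → A | codes n x = z} =
        codeWt n G.γ G.β z.1 (Fintype.card A * z.2 + code a) /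
          wtPast (Fintype.card A) (codeWt n G.γ G.β) z.1 z.2 := by
    intro z hz
    rw [codes_law_sum h] at hz
    have hl : 0 < faceLaw μ n z.1 := measureReal_nonneg.lt_of_ne fun hc => by
      change 0 = faceLaw μ n z.1 at hc
      rw [← hc, zero_mul] at hz
      exact hz.false
    have h3 := wtFace_pos_of_faceLaw_pos h hl
    refine ⟨?_, fun a => ?_⟩
    · have := pos_of_mul_pos_right hz hl.le
      exact (div_pos_iff_of_pos_right h3).1 this
    · rw [codes_law_sum h, codes_law h, mul_div_mul_left _ _ hl.ne',
        div_div_div_cancel_right₀ h3.ne']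
  rintro a ⟨e, f⟩ ⟨e', f'⟩ hf hz hz'
  obtain rfl : f = f' := hf
  obtain ⟨h2, h3⟩ := key _ hz
  obtain ⟨h2', h3'⟩ := key _ hz'
  rw [h3, h3']
  exact hε e e' f _ e.2 e'.2 f.2 (code_lt a) h2 h2'

theorem sum_faceLaw : ∑ e ∈ range (cap d (Fintype.card A) n), faceLaw μ n e = 1 := by
  rw [← Fin.sum_univ_eq_sum_range]
  have h1 := sum_law (μ := μ) (X := fun x => (codes (d := d) (A := A) n x).1)
    (fib_codes.comp Prod.fst) fun _ => True
  simp only [and_true] at h1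
  rw [show {ω : Site d → A | True} = Set.univ from rfl, probReal_univ] at h1
  rw [← h1]
  refine Finset.sum_congr rfl fun e _ => ?_
  simp [faceLaw, codes, Fin.ext_iff]

end

end GibbsEntropy

namespace GibbsEntropy
open Finset
open Real (negMulLog)

/-! ### Consequences of strong spatial mixing -/

section Abstract

/-- Two weights on a product are close if their first marginals and the conditional
probabilities are. -/
theorem sum_abs_sub_le_of_cond {ι : Type*} [Fintype ι] {b b' : ι → ℝ} (hb : ∀ a, 0 ≤ b a)
    (hb' : ∀ a, 0 ≤ b' a) {κ : ℝ} (hκ : 0 ≤ κ)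
    (h : 0 < ∑ a, b a → 0 < ∑ a, b' a → ∀ a, |b a / ∑ a, b a - b' a / ∑ a, b' a| ≤ κ) :
    ∑ a, |b a - b' a| ≤ |∑ a, b a - ∑ a, b' a| + (∑ a, b' a) * (Fintype.card ι * κ) := by
  have hp' : 0 ≤ ∑ a, b' a := Finset.sum_nonneg fun a _ => hb' a
  have hr : 0 ≤ (∑ a, b' a) * (Fintype.card ι * κ) := by positivity
  rcases (Finset.sum_nonneg fun a (_ : a ∈ univ) => hb a).eq_or_lt with h0 | h0
  · have := (Finset.sum_eq_zero_iff_of_nonneg fun a _ => hb a).1 h0.symm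
    have e1 : ∀ a, |b a - b' a| = b' a := fun a => by
      rw [this a (Finset.mem_univ a), zero_sub, abs_neg, abs_of_nonneg (hb' a)]
    simp_rw [e1]
    rw [← h0, zero_sub, abs_neg, abs_of_nonneg hp']
    linarith
  rcases hp'.eq_or_lt with h0' | h0'
  · have := (Finset.sum_eq_zero_iff_of_nonneg fun a _ => hb' a).1 h0'.symm
    have e1 : ∀ a, |b a - b' a| = b a := fun a => by
      rw [this a (Finset.mem_univ a), sub_zero, abs_of_nonneg (hb a)]
    simp_rw [e1]
    rw [← h0', sub_zero, abs_of_pos h0]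
    simp
  have h := h h0 h0'
  set p := ∑ a, b a with hpdef
  set p' := ∑ a, b' a with hpdef'
  have key : ∀ a, |b a - b' a| ≤ b a / p * |p - p'| + p' * κ := fun a => by
    have : b a - b' a = b a / p * (p - p') + p' * (b a / p - b' a / p') := by
      field_simp
      ring
    rw [this]
    refine (abs_add_le _ _).trans ?_
    rw [abs_mul, abs_mul, abs_of_nonneg (div_nonneg (hb a) h0.le), abs_of_pos h0']
    have := mul_le_mul_of_nonneg_left (h a) h0'.le
    linarith
  refine (Finset.sum_le_sum fun a _ => key a).trans (le_of_eq ?_)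
  rw [Finset.sum_add_distrib, ← Finset.sum_mul, ← Finset.sum_div, ← hpdef, div_self h0.ne',
    Finset.sum_const, Finset.card_univ, nsmul_eq_mul]
  ring

/-- Means of functions that are close wherever `π` and `π'` agree, for weights whose images
under `π` and `π'` are close. -/
theorem abs_mean_sub_mean_le {X X' Y : Type*} [Fintype X] [Fintype X'] [Fintype Y]
    [DecidableEq Y] {P ψ : X → ℝ} {P' ψ' : X' → ℝ} (π : X → Y) (π' : X' → Y) {κ M : ℝ}
    (hP : ∀ x, 0 ≤ P x) (hP' : ∀ x, 0 ≤ P' x) (hP1 : ∑ x, P x = 1)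
    (h0 : ∀ x, 0 ≤ ψ x ∧ ψ x ≤ M) (h0' : ∀ x, 0 ≤ ψ' x ∧ ψ' x ≤ M) (hκ : 0 ≤ κ)
    (h : ∀ x x', π x = π' x' → 0 < P x → 0 < P' x' → |ψ x - ψ' x'| ≤ κ) :
    |∑ x, P x * ψ x - ∑ x, P' x * ψ' x| ≤ κ + M * ∑ y,
      |∑ x with π x = y, P x - ∑ x with π' x = y, P' x| := by
  have key : ∀ y, |∑ x with π x = y, P x * ψ x - ∑ x with π' x = y, P' x * ψ' x| ≤
      κ * ∑ x with π x = y, P x + M * |∑ x with π x = y, P x - ∑ x with π' x = y, P' x| := by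
    intro y
    set s := univ.filter (π · = y) with hs
    set s' := univ.filter (π' · = y) with hs'
    set p := ∑ x ∈ s, P x with hp
    set p' := ∑ x ∈ s', P' x with hp'
    set I := ∑ x ∈ s, P x * ψ x with hI
    set I' := ∑ x ∈ s', P' x * ψ' x with hI'
    have p0 : 0 ≤ p := Finset.sum_nonneg fun x _ => hP x
    have p0' : 0 ≤ p' := Finset.sum_nonneg fun x _ => hP' x
    have I0 : 0 ≤ I := Finset.sum_nonneg fun x _ => mul_nonneg (hP x) (h0 x).1
    have I0' : 0 ≤ I' := Finset.sum_nonneg fun x _ => mul_nonneg (hP' x) (h0' x).1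
    have I1 : I ≤ M * p := by
      rw [hI, hp, Finset.mul_sum]
      exact Finset.sum_le_sum fun x _ => by
        rw [mul_comm]
        exact mul_le_mul_of_nonneg_right (h0 x).2 (hP x)
    have I1' : I' ≤ M * p' := by
      rw [hI', hp', Finset.mul_sum]
      exact Finset.sum_le_sum fun x _ => by
        rw [mul_comm]
        exact mul_le_mul_of_nonneg_right (h0' x).2 (hP' x)
    clear_value p p' I I'
    rcases p0'.eq_or_lt with hz | hz
    · rw [← hz, mul_zero] at I1'
      rw [le_antisymm I1' I0', ← hz, sub_zero, sub_zero, abs_of_nonneg I0, abs_of_nonneg p0]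
      have := mul_nonneg hκ p0
      linarith
    -- On a fibre all values are compared pairwise under the product weights, which avoids dividing
    -- by a mass that may vanish.
    · have e1 : I * p' - I' * p =
          ∑ x ∈ s, ∑ x' ∈ s', P x * P' x' * (ψ x - ψ' x') := by
        have e2 : ∀ x x', P x * P' x' * (ψ x - ψ' x') =
            P x * ψ x * P' x' - P x * (P' x' * ψ' x') := fun x x' => by ring
        simp_rw [e2, Finset.sum_sub_distrib, ← Finset.mul_sum, ← Finset.sum_mul]
        rw [← hI, ← hp', ← hI', ← hp, mul_comm I']
      have e3 : |I * p' - I' * p| ≤ κ * p * p' := by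
        rw [e1]
        refine (Finset.abs_sum_le_sum_abs _ _).trans ?_
        rw [hp, Finset.mul_sum, Finset.sum_mul]
        refine Finset.sum_le_sum fun x hx => (Finset.abs_sum_le_sum_abs _ _).trans ?_
        rw [hp', Finset.mul_sum]
        refine Finset.sum_le_sum fun x' hx' => ?_
        rw [abs_mul, abs_of_nonneg (mul_nonneg (hP x) (hP' x')), mul_assoc κ, mul_comm κ]
        rcases (hP x).eq_or_lt with hx0 | hx0
        · rw [← hx0]; simp
        rcases (hP' x').eq_or_lt with hx0' | hx0'
        · rw [← hx0']; simp
        refine mul_le_mul_of_nonneg_left (h x x' ?_ hx0 hx0') (mul_nonneg (hP x) (hP' x'))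
        rw [(Finset.mem_filter.1 hx).2, (Finset.mem_filter.1 hx').2]
      have e4 : p' * |I - I'| ≤ p' * (κ * p + M * |p - p'|) := by
        calc p' * |I - I'| = |p' * (I - I')| := by rw [abs_mul, abs_of_pos hz]
          _ = |(I * p' - I' * p) + I' * (p - p')| := by congr 1; ring
          _ ≤ |I * p' - I' * p| + I' * |p - p'| := by
            refine (abs_add_le _ _).trans ?_
            rw [abs_mul, abs_of_nonneg I0']
          _ ≤ κ * p * p' + M * p' * |p - p'| :=
            add_le_add e3 (mul_le_mul_of_nonneg_right I1' (abs_nonneg _))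
          _ = _ := by ring
      exact le_of_mul_le_mul_left e4 hz
  rw [← Finset.sum_fiberwise univ π, ← Finset.sum_fiberwise univ π' fun x => P' x * ψ' x,
    ← Finset.sum_sub_distrib]
  refine (Finset.abs_sum_le_sum_abs _ _).trans ((Finset.sum_le_sum fun y _ => key y).trans ?_)
  rw [Finset.sum_add_distrib, ← Finset.mul_sum, ← Finset.mul_sum, Finset.sum_fiberwise univ π P,
    hP1, mul_one]

end Abstract

/-! ### Influence of the faces -/

section Mixing

variable {d : ℕ} {A : Type u} [Fintype A]

/-- Strong spatial mixing with explicit constants, for configurations on the lattice. -/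
def Interactions.Mixing (G : Interactions d A) (C α : ℝ) : Prop :=
  ∀ (Q V : Finset (Site d)), V ∪ boundary V ⊆ Q →
      ∀ u ∈ V, ∀ (x x' : Site d → A) (r : ℕ), x u = x' u →
      (∀ v ∈ Q, v ∉ V → dist1 u v < r → x v = x' v) →
      0 < pf G.γ G.β Q V x → 0 < pf G.γ G.β Q V x' →
      |pf G.γ G.β Q (V.erase u) x / pf G.γ G.β Q V x -
        pf G.γ G.β Q (V.erase u) x' / pf G.γ G.β Q V x'| ≤ C * Real.exp (-α * r)

open Classical in
theorem sum_restrict_eq {F : (Site d → A) → ℝ} {S V : Finset (Site d)} (hS : S ⊆ V)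
    (δ : Config A S) (y : Site d → A) :
    ∑ w : Config A V, (if (fun v : S => w ⟨v, hS v.2⟩) = δ then F (glue w y) else 0) =
      ∑ w : Config A (V \ S), F (glue w (glue δ y)) := by
  rw [← sum_agreeing_of (F := F) Finset.sdiff_subset y (glue δ y)]
  · refine Finset.sum_congr rfl fun w _ => if_congr ?_ rfl rfl
    rw [funext_iff]
    constructor
    · intro h v hv hv'
      have hvS : v ∈ S := by
        by_contra hc
        exact hv' (Finset.mem_sdiff.2 ⟨hv, hc⟩)
      rw [glue_mem _ _ hv, glue_mem _ _ hvS, ← h ⟨v, hvS⟩]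
    · rintro h ⟨v, hvS⟩
      have := h v (hS hvS) fun hc => (Finset.mem_sdiff.1 hc).2 hvS
      rwa [glue_mem _ _ (hS hvS), glue_mem _ _ hvS] at this
  · intro w
    congr 1
    funext v
    by_cases hv : v ∈ V
    · rw [glue_mem _ _ hv]
    · rw [glue_notMem _ _ hv, glue_notMem _ _ fun hc => hv (Finset.mem_sdiff.1 hc).1,
        glue_notMem _ _ fun hc => hv (hS hc)]

theorem sum_pf_sdiff {G : Interactions d A} {Q S V : Finset (Site d)} (hS : S ⊆ V)
    (y : Site d → A) :
    ∑ δ : Config A S, pf G.γ G.β Q (V \ S) (glue δ y) = pf G.γ G.β Q V y := by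
  classical
  unfold pf
  simp_rw [← sum_restrict_eq (F := gw G.γ G.β Q) hS]
  rw [Finset.sum_comm]
  simp

theorem sum_pf_erase {G : Interactions d A} {Q V : Finset (Site d)} {u : Site d} (hu : u ∈ V)
    (y : Site d → A) :
    ∑ a, pf G.γ G.β Q (V.erase u) (Function.update y u a) = pf G.γ G.β Q V y := by
  classical
  unfold pf
  have h1 : ∀ a, ∑ w : Config A (V.erase u), gw G.γ G.β Q (glue w (Function.update y u a)) =
      ∑ w : Config A V, if w ⟨u, hu⟩ = a then gw G.γ G.β Q (glue w y) else 0 := by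
    intro a
    rw [← sum_eq_at hu (Function.update y u a)]
    refine Finset.sum_congr rfl fun w _ => ?_
    rw [Function.update_self]
    congr 2
    funext v
    by_cases hv : v ∈ V
    · rw [glue_mem _ _ hv, glue_mem _ _ hv]
    · rw [glue_notMem _ _ hv, glue_notMem _ _ hv,
        Function.update_of_ne fun hc : v = u => hv (hc ▸ hu)]
  simp_rw [h1]
  rw [Finset.sum_comm]
  simp

/-- Extension of a configuration by a symbol at a further site. -/
def insertEquiv {S : Finset (Site d)} {u : Site d} (hu : u ∉ S) :
    Config A S × A ≃ Config A (insert u S) where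
  toFun p w := if h : w.1 = u then p.2 else p.1 ⟨w, (Finset.mem_insert.1 w.2).resolve_left h⟩
  invFun y := (fun w => y ⟨w, Finset.mem_insert_of_mem w.2⟩, y ⟨u, Finset.mem_insert_self _ _⟩)
  left_inv p := by
    ext w
    · have : w.1 ≠ u := fun h => hu (h ▸ w.2)
      simp [this]
    · simp
  right_inv y := by
    funext ⟨w, hw⟩
    by_cases h : w = u
    · subst h
      simp
    · simp [h]

omit [Fintype A] in
theorem glue_insertEquiv {S : Finset (Site d)} {u : Site d} (hu : u ∉ S) (δ : Config A S) (a : A)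
    (y : Site d → A) : glue (insertEquiv hu (δ, a)) y = Function.update (glue δ y) u a := by
  funext v
  by_cases hv : v = u
  · subst hv
    rw [Function.update_self, glue_mem _ _ (Finset.mem_insert_self _ _)]
    simp [insertEquiv]
  · rw [Function.update_of_ne hv]
    by_cases hvS : v ∈ S
    · rw [glue_mem _ _ hvS, glue_mem _ _ (Finset.mem_insert_of_mem hvS)]
      simp [insertEquiv, hv]
    · rw [glue_notMem _ _ hvS, glue_notMem]
      simp [hv, hvS]

theorem union_boundary_subset {n : ℕ} {V : Finset (Site d)} (hV : V ⊆ cube d n) :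
    V ∪ boundary V ⊆ cube d (n + 1) := by
  intro v hv
  by_cases h : v ∈ cube d n
  · exact cube_mono (Nat.le_succ n) h
  · rcases Finset.mem_union.1 hv with h1 | h1
    · exact absurd (hV h1) h
    · obtain ⟨-, w, hw, hvw⟩ := (mem_boundary _ _).1 h1
      exact (Finset.mem_sdiff.1 (boundary_cube_subset n
        ((mem_boundary _ _).2 ⟨h, w, hV hw, hvw⟩))).1

theorem lt_dist1 {n m : ℕ} {u v : Site d} (hu : u ∈ cube d m) (hv : v ∉ cube d n) :
    n < m + dist1 u v := by
  rw [mem_cube] at hu hv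
  push Not at hv
  obtain ⟨i, hi⟩ := hv
  have h1 : (u i - v i).natAbs ≤ dist1 u v :=
    Finset.single_le_sum (f := fun i => (u i - v i).natAbs) (fun _ _ => Nat.zero_le _)
      (Finset.mem_univ i)
  have h2 := hu i
  by_cases h3 : -(n : ℤ) ≤ v i
  · have := hi h3
    omega
  · omega

variable {G : Interactions d A} {C α : ℝ} {n m : ℕ}

/-- The faces have little influence on the configuration near the centre. -/
theorem Interactions.Mixing.sum_abs_le (H : G.Mixing C α) (hC : 0 < C) (hm : m ≤ n)
    {y y' : Site d → A} (hy : 0 < pf G.γ G.β (cube d (n + 1)) (cube d n) y)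
    (hy' : 0 < pf G.γ G.β (cube d (n + 1)) (cube d n) y') (S : Finset (Site d)) :
    S ⊆ cube d m →
    ∑ δ : Config A S, |pf G.γ G.β (cube d (n + 1)) (cube d n \ S) (glue δ y) /
        pf G.γ G.β (cube d (n + 1)) (cube d n) y -
      pf G.γ G.β (cube d (n + 1)) (cube d n \ S) (glue δ y') /
        pf G.γ G.β (cube d (n + 1)) (cube d n) y'| ≤
      #S * (Fintype.card A * (C * Real.exp (-α * (n + 1 - m : ℕ)))) := by
  classical
  set κ := C * Real.exp (-α * (n + 1 - m : ℕ)) with hκdef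
  have hκ : 0 ≤ κ := by positivity
  -- The sites of `S` are exposed one at a time. Mixing bounds the change of each conditional law,
  -- so the distance of the two laws grows by at most card A · κ per site.
  induction S using Finset.induction_on with
  | empty =>
    intro _
    have : ∀ (δ : Config A (∅ : Finset (Site d))) (y : Site d → A), glue δ y = y := fun δ y => by
      funext v
      exact glue_notMem _ _ (Finset.notMem_empty v)
    simp [this, div_self hy.ne', div_self hy'.ne']
  | insert u S huS ih =>
    intro hS
    have hSm : S ⊆ cube d m := (Finset.subset_insert _ _).trans hS
    have hSn : S ⊆ cube d n := hSm.trans (cube_mono hm)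
    have hum : u ∈ cube d m := hS (Finset.mem_insert_self _ _)
    have huV : u ∈ cube d n \ S := Finset.mem_sdiff.2 ⟨cube_mono hm hum, huS⟩
    rw [← (insertEquiv huS).sum_comp, Fintype.sum_prod_type]
    simp_rw [glue_insertEquiv, Finset.sdiff_insert]
    set Z := pf G.γ G.β (cube d (n + 1)) (cube d n) y with hZ
    set Z' := pf G.γ G.β (cube d (n + 1)) (cube d n) y' with hZ'
    have sums : ∀ (y : Site d → A) (δ : Config A S) (Z : ℝ),
        ∑ a, pf G.γ G.β (cube d (n + 1)) ((cube d n \ S).erase u)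
          (Function.update (glue δ y) u a) / Z =
        pf G.γ G.β (cube d (n + 1)) (cube d n \ S) (glue δ y) / Z := fun y δ Z => by
      rw [← Finset.sum_div, sum_pf_erase huV]
    have upd : ∀ (y : Site d → A) (δ : Config A S) (a : A),
        pf G.γ G.β (cube d (n + 1)) (cube d n \ S) (Function.update (glue δ y) u a) =
        pf G.γ G.β (cube d (n + 1)) (cube d n \ S) (glue δ y) := fun y δ a =>
      pf_congr G fun v _ hv => Function.update_of_ne (fun hc : v = u => hv (hc ▸ huV)) _ _
    have step : ∀ δ : Config A S,
        ∑ a, |pf G.γ G.β (cube d (n + 1)) ((cube d n \ S).erase u)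
            (Function.update (glue δ y) u a) / Z -
          pf G.γ G.β (cube d (n + 1)) ((cube d n \ S).erase u)
            (Function.update (glue δ y') u a) / Z'| ≤
        |pf G.γ G.β (cube d (n + 1)) (cube d n \ S) (glue δ y) / Z -
          pf G.γ G.β (cube d (n + 1)) (cube d n \ S) (glue δ y') / Z'| +
        pf G.γ G.β (cube d (n + 1)) (cube d n \ S) (glue δ y') / Z' *
          (Fintype.card A * κ) := by
      intro δ
      have := sum_abs_sub_le_of_cond
        (b := fun a => pf G.γ G.β (cube d (n + 1)) ((cube d n \ S).erase u)
            (Function.update (glue δ y) u a) / Z)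
        (b' := fun a => pf G.γ G.β (cube d (n + 1)) ((cube d n \ S).erase u)
            (Function.update (glue δ y') u a) / Z')
        (fun a => div_nonneg (pf_nonneg G _ _ _) hy.le)
        (fun a => div_nonneg (pf_nonneg G _ _ _) hy'.le) hκ
      simp only [sums] at this
      refine this fun h1 h2 a => ?_
      rw [div_div_div_cancel_right₀ hy.ne', div_div_div_cancel_right₀ hy'.ne']
      have h1' := (div_pos_iff_of_pos_right hy).1 h1
      have h2' := (div_pos_iff_of_pos_right hy').1 h2
      -- The exposed symbols are the same on both sides, so all differences lie on the faces, at
      -- distance at least n + 1 - m from a site of the inner cube.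
      have := H (cube d (n + 1)) (cube d n \ S) (union_boundary_subset Finset.sdiff_subset) u huV
        (Function.update (glue δ y) u a) (Function.update (glue δ y') u a) (n + 1 - m)
        (by simp) (fun v hv hv' hd => ?_) (by rwa [upd]) (by rwa [upd])
      · rwa [upd, upd] at this
      · by_cases hvu : v = u
        · rw [hvu, Function.update_self, Function.update_self]
        · rw [Function.update_of_ne hvu, Function.update_of_ne hvu]
          have hvS : v ∈ S := by
            by_contra hc
            have := lt_dist1 (n := n) hum fun h => hv' (Finset.mem_sdiff.2 ⟨h, hc⟩)
            omega
          rw [glue_mem _ _ hvS, glue_mem _ _ hvS]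
    refine (Finset.sum_le_sum fun δ _ => step δ).trans ?_
    rw [Finset.sum_add_distrib, ← Finset.sum_mul, ← Finset.sum_div, sum_pf_sdiff hSn,
      div_self hy'.ne', Finset.card_insert_of_notMem huS]
    push_cast
    linarith [ih hSm]

variable [Nonempty A]

theorem exists_of_wtPast_pos {e f : ℕ}
    (h : 0 < wtPast (Fintype.card A) (codeWt n G.γ G.β) e f) :
    ∃ y : Site d → A, faceOf n y = e ∧ pastOf n y / Fintype.card A = f ∧
      0 < pf G.γ G.β (cube d (n + 1)) (cube d n \ nearPastSites d n) y := by
  rw [wtPast_codeWt] at h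
  obtain ⟨y, -, hy⟩ := Finset.exists_lt_of_sum_lt (s := univ) (f := fun _ => (0 : ℝ))
    (by simpa using h)
  split_ifs at hy with hc
  · exact ⟨_, hc.1, hc.2, hy.trans_le (gw_le_pf G _ _ _)⟩
  · exact absurd hy (lt_irrefl _)

theorem exists_of_wtFace_pos {e : ℕ}
    (h : 0 < wtFace (Fintype.card A) (cap d (Fintype.card A) n) (codeWt n G.γ G.β) e) :
    ∃ y : Site d → A, faceOf n y = e ∧ 0 < pf G.γ G.β (cube d (n + 1)) (cube d n) y := by
  rw [wtFace_codeWt] at h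
  obtain ⟨y, -, hy⟩ := Finset.exists_lt_of_sum_lt (s := univ) (f := fun _ => (0 : ℝ))
    (by simpa using h)
  split_ifs at hy with hc
  · exact ⟨_, hc, hy.trans_le (gw_le_pf G _ _ _)⟩
  · exact absurd hy (lt_irrefl _)

theorem zero_mem_sdiff_nearPastSites : (0 : Site d) ∈ cube d n \ nearPastSites d n :=
  Finset.mem_sdiff.2 ⟨zero_mem_cube n, fun h => not_isPast_zero (isPast_of_mem_nearPastSites h)⟩

/-- Mixing at the centre, with faces and near past prescribed. After both centres are set to the
symbol with code `x`, the prescribed symbols can differ only outside the cube of radius m, at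
distance at least m + 1. -/
theorem Interactions.Mixing.ratio_le (H : G.Mixing C α) {y y' : Site d → A}
    (hyy : ∀ v ∈ nearPastSites d n, v ∈ cube d m → y v = y' v) (hm : m ≤ n)
    (hy : 0 < pf G.γ G.β (cube d (n + 1)) (cube d n \ nearPastSites d n) y)
    (hy' : 0 < pf G.γ G.β (cube d (n + 1)) (cube d n \ nearPastSites d n) y') {x : ℕ}
    (hx : x < Fintype.card A) :
    |codeWt n G.γ G.β (faceOf n y) (Fintype.card A * (pastOf n y / Fintype.card A) + x) /
        wtPast (Fintype.card A) (codeWt n G.γ G.β) (faceOf n y) (pastOf n y / Fintype.card A) -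
      codeWt n G.γ G.β (faceOf n y') (Fintype.card A * (pastOf n y' / Fintype.card A) + x) /
        wtPast (Fintype.card A) (codeWt n G.γ G.β) (faceOf n y') (pastOf n y' / Fintype.card A)|
      ≤ C * Real.exp (-α * (m + 1 : ℕ)) := by
  obtain ⟨a, rfl⟩ : ∃ a : A, code a = x :=
    ⟨(Fintype.equivFin A).symm ⟨x, hx⟩, by simp [code]⟩
  have red : ∀ y : Site d → A,
      pf G.γ G.β (cube d (n + 1)) (cube d n \ nearPastSites d n) (Function.update y 0 a) =
        pf G.γ G.β (cube d (n + 1)) (cube d n \ nearPastSites d n) y ∧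
      codeWt n G.γ G.β (faceOf n y) (Fintype.card A * (pastOf n y / Fintype.card A) + code a) /
        wtPast (Fintype.card A) (codeWt n G.γ G.β) (faceOf n y) (pastOf n y / Fintype.card A) =
      pf G.γ G.β (cube d (n + 1)) ((cube d n \ nearPastSites d n).erase 0)
          (Function.update y 0 a) /
        pf G.γ G.β (cube d (n + 1)) (cube d n \ nearPastSites d n) (Function.update y 0 a) := by
    intro y
    have h1 : pf G.γ G.β (cube d (n + 1)) (cube d n \ nearPastSites d n) (Function.update y 0 a) =
        pf G.γ G.β (cube d (n + 1)) (cube d n \ nearPastSites d n) y :=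
      pf_congr G fun v _ hv =>
        Function.update_of_ne (fun hc : v = 0 => hv (hc ▸ zero_mem_sdiff_nearPastSites)) _ _
    have h2 : faceOf n (Function.update y 0 a) = faceOf n y :=
      (faceOf_eq_iff _ _).2 fun v _ hv =>
        Function.update_of_ne (fun hc : v = 0 => hv (hc ▸ zero_mem_cube n)) _ _
    have h3 := pastOf_spec (n := n) (Function.update y 0 a) y
    rw [Function.update_self] at h3
    have h4 := h3.2.2 fun v hv => Function.update_of_ne (fun hc =>
      not_isPast_zero (isPast_of_mem_nearPastSites (hc ▸ hv))) _ _
    refine ⟨h1, ?_⟩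
    rw [h1, ← codeWt_faceOf_pastOf, ← wtPast_faceOf, h2, ← h4, ← h3.1, Nat.div_add_mod]
  rw [(red y).2, (red y').2]
  refine H _ _ (union_boundary_subset Finset.sdiff_subset) 0 zero_mem_sdiff_nearPastSites _ _ _
    (by simp) (fun v hv hv' hd => ?_) (by rwa [(red y).1]) (by rwa [(red y').1])
  have hv0 : v ≠ 0 := fun hc => hv' (hc ▸ zero_mem_sdiff_nearPastSites)
  rw [Function.update_of_ne hv0, Function.update_of_ne hv0]
  have hvm : v ∈ cube d m := by
    by_contra hc
    have := lt_dist1 (zero_mem_cube (d := d) 0) hc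
    omega
  refine hyy v ?_ hvm
  by_contra hc
  exact hv' (Finset.mem_sdiff.2 ⟨cube_mono hm hvm, hc⟩)

theorem Interactions.Mixing.cond_le (H : G.Mixing C α) {e e' f x : ℕ} (hx : x < Fintype.card A)
    (h : 0 < wtPast (Fintype.card A) (codeWt n G.γ G.β) e f)
    (h' : 0 < wtPast (Fintype.card A) (codeWt n G.γ G.β) e' f) :
    |codeWt n G.γ G.β e (Fintype.card A * f + x) /
        wtPast (Fintype.card A) (codeWt n G.γ G.β) e f -
      codeWt n G.γ G.β e' (Fintype.card A * f + x) /
        wtPast (Fintype.card A) (codeWt n G.γ G.β) e' f| ≤ C * Real.exp (-α * (n + 1 : ℕ)) := by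
  obtain ⟨y, rfl, rfl, hy⟩ := exists_of_wtPast_pos h
  obtain ⟨y', rfl, hf, hy'⟩ := exists_of_wtPast_pos h'
  have := H.ratio_le (m := n) (fun v hv _ => ((pastOf_spec y y').2.1 hf.symm v hv)) le_rfl hy hy' hx
  rwa [hf] at this

/-- The mean over the configurations with given faces. -/
theorem faceEnt_faceOf (y : Site d → A) :
    faceEnt (Fintype.card A) (cap d (Fintype.card A) n) (codeWt n G.γ G.β) (faceOf n y) =
    ∑ w : Config A (cube d n), gw G.γ G.β (cube d (n + 1)) (glue w y) /
        pf G.γ G.β (cube d (n + 1)) (cube d n) y *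
      ∑ x ∈ range (Fintype.card A), negMulLog (codeWt n G.γ G.β (faceOf n y)
          (Fintype.card A * (pastOf n (glue w y) / Fintype.card A) + x) /
        wtPast (Fintype.card A) (codeWt n G.γ G.β) (faceOf n y)
          (pastOf n (glue w y) / Fintype.card A)) := by
  classical
  rw [faceEnt, wtFace_faceOf]
  simp_rw [div_mul_eq_mul_div]
  rw [← Finset.sum_div]
  congr 1
  set ψ : ℕ → ℝ := fun f => ∑ x ∈ range (Fintype.card A), negMulLog (codeWt n G.γ G.β (faceOf n y)
      (Fintype.card A * f + x) / wtPast (Fintype.card A) (codeWt n G.γ G.β) (faceOf n y) f)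
  change ∑ f ∈ _, _ * ψ f = ∑ w, _ * ψ _
  rw [← sum_agreeing (fun x => gw G.γ G.β (cube d (n + 1)) x * ψ (pastOf n x / Fintype.card A))
    (cube_mono (Nat.le_succ n)) (fun x z h => by
      rw [gw_congr h, pastOf_congr h]) (fun _ => Classical.arbitrary A)]
  simp_rw [wtPast_codeWt, Finset.sum_mul]
  rw [Finset.sum_comm]
  refine Finset.sum_congr rfl fun z _ => ?_
  change _ = if ∀ v ∈ cube d (n + 1), v ∉ cube d n → extendConfig z v = y v then
    gw G.γ G.β (cube d (n + 1)) (extendConfig z) *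
      ψ (pastOf n (extendConfig z) / Fintype.card A) else 0
  generalize hz : extendConfig z = z'
  simp only [← faceOf_eq_iff]
  simp only [and_comm (a := faceOf n z' = _), ite_and, ite_mul, zero_mul]
  rw [Finset.sum_ite_eq, if_pos (Finset.mem_range.2
    ((Nat.div_le_self _ _).trans_lt (pastOf_lt _)))]

theorem card_cube (m : ℕ) : #(cube d m) = (2 * m + 1) ^ d := by
  rw [cube, Pi.card_Icc]
  simp only [Int.card_Icc, Finset.prod_const, Finset.card_univ, Fintype.card_fin]
  congr 1
  omega

omit [Fintype A] [Nonempty A] in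
theorem cond_mem {q : ℕ} {W : ℕ → ℕ → ℝ} (hW : ∀ e g, 0 ≤ W e g) {e f x : ℕ} (hx : x < q) :
    0 ≤ W e (q * f + x) / wtPast q W e f ∧ W e (q * f + x) / wtPast q W e f ≤ 1 := by
  have h0 : 0 ≤ wtPast q W e f := Finset.sum_nonneg fun _ _ => hW _ _
  exact ⟨div_nonneg (hW _ _) h0, div_le_one_of_le₀ (Finset.single_le_sum
    (f := fun x => W e (q * f + x)) (fun _ _ => hW _ _) (Finset.mem_range.2 hx)) h0⟩

theorem codeWt_nonneg (e g : ℕ) : 0 ≤ codeWt n G.γ G.β e g :=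
  Finset.sum_nonneg fun y _ => by
    split_ifs
    exacts [gw_nonneg G _ _, le_rfl]

omit [Fintype A] [Nonempty A] in
theorem sum_negMulLog_mem {q : ℕ} {W : ℕ → ℕ → ℝ} (hW : ∀ e g, 0 ≤ W e g) (e f : ℕ) :
    0 ≤ ∑ x ∈ range q, negMulLog (W e (q * f + x) / wtPast q W e f) ∧
      ∑ x ∈ range q, negMulLog (W e (q * f + x) / wtPast q W e f) ≤ q := by
  have key := fun x (hx : x ∈ range q) => cond_mem hW (e := e) (f := f) (Finset.mem_range.1 hx)
  refine ⟨Finset.sum_nonneg fun x hx => Real.negMulLog_nonneg (key x hx).1 (key x hx).2, ?_⟩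
  have := Finset.sum_le_card_nsmul (range q)
    (fun x => negMulLog (W e (q * f + x) / wtPast q W e f)) 1 fun x hx =>
      (negMulLog_le_one_sub (key x hx).1).trans (by linarith [(key x hx).1])
  simpa using this

/-- The faces have little influence on the entropy. -/
theorem Interactions.Mixing.abs_faceEnt_sub_le (H : G.Mixing C α) (hC : 0 < C) (hm : m ≤ n)
    {e e' : ℕ}
    (h : 0 < wtFace (Fintype.card A) (cap d (Fintype.card A) n) (codeWt n G.γ G.β) e)
    (h' : 0 < wtFace (Fintype.card A) (cap d (Fintype.card A) n) (codeWt n G.γ G.β) e') :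
    |faceEnt (Fintype.card A) (cap d (Fintype.card A) n) (codeWt n G.γ G.β) e -
      faceEnt (Fintype.card A) (cap d (Fintype.card A) n) (codeWt n G.γ G.β) e'| ≤
      Fintype.card A * (2 * √(C * Real.exp (-α * (m + 1 : ℕ)))) +
        Fintype.card A * ((2 * m + 1 : ℕ) ^ d *
          (Fintype.card A * (C * Real.exp (-α * (n + 1 - m : ℕ))))) := by
  classical
  obtain ⟨y, rfl, hy⟩ := exists_of_wtFace_pos h
  obtain ⟨y', rfl, hy'⟩ := exists_of_wtFace_pos h'
  -- The entropy of the centre depends on the near past outside the inner cube only by an error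
  -- exponential in m, and the law of the symbols on `S` depends on the faces only by one
  -- exponential in n - m. The radius m will be n / 2.
  set S := nearPastSites d n ∩ cube d m with hSdef
  have hSm : S ⊆ cube d m := Finset.inter_subset_right
  have hSn : S ⊆ cube d n := hSm.trans (cube_mono hm)
  have marg : ∀ (y : Site d → A) (δ : Config A S),
      ∑ w : Config A (cube d n) with (fun v : S => w ⟨v, hSn v.2⟩) = δ,
        gw G.γ G.β (cube d (n + 1)) (glue w y) / pf G.γ G.β (cube d (n + 1)) (cube d n) y =
      pf G.γ G.β (cube d (n + 1)) (cube d n \ S) (glue δ y) /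
        pf G.γ G.β (cube d (n + 1)) (cube d n) y := by
    intro y δ
    rw [← Finset.sum_div, Finset.sum_filter, sum_restrict_eq (F := gw G.γ G.β _) hSn]
    rfl
  have hface : ∀ (y : Site d → A) (w : Config A (cube d n)), faceOf n (glue w y) = faceOf n y :=
    fun y w => (faceOf_eq_iff _ _).2 fun v _ hv => glue_notMem _ _ hv
  rw [faceEnt_faceOf, faceEnt_faceOf]
  refine (abs_mean_sub_mean_le (fun (w : Config A (cube d n)) (v : S) => w ⟨v, hSn v.2⟩)
    (fun (w : Config A (cube d n)) (v : S) => w ⟨v, hSn v.2⟩)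
    (κ := Fintype.card A * (2 * √(C * Real.exp (-α * (m + 1 : ℕ))))) (M := Fintype.card A)
    (fun w => div_nonneg (gw_nonneg G _ _) hy.le) (fun w => div_nonneg (gw_nonneg G _ _) hy'.le)
    ?_ (fun w => sum_negMulLog_mem codeWt_nonneg _ _) (fun w => sum_negMulLog_mem codeWt_nonneg _ _)
    (by positivity) ?_).trans ?_
  · rw [← Finset.sum_div]
    exact div_self hy.ne'
  · intro w w' hww hw hw'
    have hw1 := ((div_pos_iff_of_pos_right hy).1 hw).trans_le
      (gw_le_pf G _ (cube d n \ nearPastSites d n) _)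
    have hw1' := ((div_pos_iff_of_pos_right hy').1 hw').trans_le
      (gw_le_pf G _ (cube d n \ nearPastSites d n) _)
    rw [← Finset.sum_sub_distrib]
    refine (Finset.abs_sum_le_sum_abs _ _).trans ((Finset.sum_le_card_nsmul _ _
      (2 * √(C * Real.exp (-α * (m + 1 : ℕ)))) fun x hx => ?_).trans
        (le_of_eq (by rw [Finset.card_range, nsmul_eq_mul])))
    rw [Finset.mem_range] at hx
    have h1 := H.ratio_le (n := n) (m := m) (fun v hv hvm => ?_) hm hw1 hw1' hx
    · rw [hface, hface] at h1
      refine (abs_negMulLog_sub_le (cond_mem codeWt_nonneg hx).1 (cond_mem codeWt_nonneg hx).2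
        (cond_mem codeWt_nonneg hx).1 (cond_mem codeWt_nonneg hx).2).trans ?_
      have := Real.sqrt_le_sqrt h1
      linarith
    · have h2 := congrFun hww ⟨v, Finset.mem_inter.2 ⟨hv, hvm⟩⟩
      rw [glue_mem _ _ (cube_mono hm hvm), glue_mem _ _ (cube_mono hm hvm)]
      exact h2
  · simp_rw [marg]
    have h1 := H.sum_abs_le hC hm hy hy' S hSm
    have h2 : (#S : ℝ) ≤ ((2 * m + 1 : ℕ) : ℝ) ^ d := by
      exact_mod_cast (Finset.card_le_card hSm).trans_eq (card_cube m)
    have h3 : (#S : ℝ) * (Fintype.card A * (C * Real.exp (-α * (n + 1 - m : ℕ)))) ≤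
        ((2 * m + 1 : ℕ) : ℝ) ^ d * (Fintype.card A * (C * Real.exp (-α * (n + 1 - m : ℕ)))) :=
      mul_le_mul_of_nonneg_right h2 (by positivity)
    have h4 := mul_le_mul_of_nonneg_left (h1.trans h3) (Nat.cast_nonneg (α := ℝ) (Fintype.card A))
    linarith

end Mixing

end GibbsEntropy

namespace GibbsEntropy
open Finset
open Real (negMulLog)

/-! ### Accuracy of the integer arithmetic -/

/-- The logarithmic series converges slowly near p = 0, but the tail is at most p (1-p)^(S+1)/(S+1)
times ∑ (1-p)^k = 1/p. The prefactor p cancels, and the error is uniform in p. -/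
theorem negMulLog_series {p : ℝ} (h0 : 0 ≤ p) (h1 : p ≤ 1) (S : ℕ) :
    ∑ k ∈ range S, p * (1 - p) ^ (k + 1) / (k + 1) ≤ negMulLog p ∧
      negMulLog p ≤ ∑ k ∈ range S, p * (1 - p) ^ (k + 1) / (k + 1) + 1 / (S + 1) := by
  rcases h0.eq_or_lt with rfl | hp
  · have : (0 : ℝ) ≤ 1 / ((S : ℝ) + 1) := by positivity
    simpa using this
  have hx0 : 0 ≤ 1 - p := by linarith
  have hx1 : 1 - p < 1 := by linarith
  have hs := (Real.hasSum_pow_div_log_of_abs_lt_one (by rwa [abs_of_nonneg hx0])).mul_left p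
  rw [sub_sub_cancel, show p * -Real.log p = negMulLog p by rw [negMulLog]; ring] at hs
  have e1 : ∑ k ∈ range S, p * (1 - p) ^ (k + 1) / ((k : ℝ) + 1) =
      ∑ k ∈ range S, p * ((1 - p) ^ (k + 1) / ((k : ℝ) + 1)) :=
    Finset.sum_congr rfl fun k _ => by rw [mul_div_assoc]
  rw [e1]
  refine ⟨sum_le_hasSum _ (fun k _ => by positivity) hs, ?_⟩
  have ht := (hasSum_nat_add_iff' S).2 hs
  have hg := (hasSum_geometric_of_lt_one hx0 hx1).mul_left (p * (1 - p) ^ (S + 1) / (S + 1))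
  have hle := hasSum_le (fun k => ?_) ht hg
  · have h2 : p * (1 - p) ^ (S + 1) / (S + 1) * (1 - (1 - p))⁻¹ ≤ 1 / (S + 1) := by
      rw [sub_sub_cancel]
      have : p * (1 - p) ^ (S + 1) / (S + 1) * p⁻¹ = (1 - p) ^ (S + 1) / (S + 1) := by
        field_simp
      rw [this]
      gcongr
      exact pow_le_one₀ hx0 hx1.le
    linarith
  · have h3 : (1 - p) ^ (k + S + 1) = (1 - p) ^ (S + 1) * (1 - p) ^ k := by ring
    rw [h3, mul_div_assoc p, mul_assoc p, div_mul_eq_mul_div]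
    refine mul_le_mul_of_nonneg_left ?_ h0
    push_cast
    gcongr
    linarith [(Nat.cast_nonneg k : (0 : ℝ) ≤ k)]

theorem natDiv_bounds (a b : ℕ) :
    (a : ℝ) / b - 1 ≤ (a / b : ℕ) ∧ ((a / b : ℕ) : ℝ) ≤ (a : ℝ) / b := by
  refine ⟨?_, Nat.cast_div_le⟩
  rcases Nat.eq_zero_or_pos b with rfl | hb
  · simp
  · have h : a < b * (a / b) + b := by
      have := Nat.div_add_mod a b
      have := Nat.mod_lt a hb
      omega
    have h' : (a : ℝ) < b * (a / b : ℕ) + b := by exact_mod_cast h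
    have hb' : (0 : ℝ) < b := by exact_mod_cast hb
    rw [sub_le_iff_le_add, div_le_iff₀ hb']
    nlinarith

/-- Truncation costs at most S² / (S+1) ≤ S and the S roundings at most 1 each. -/
theorem entTerm_bounds {S a b : ℕ} (hab : a ≤ b) :
    (S : ℝ) ^ 2 * negMulLog (a / b) - 2 * S ≤ entTerm S a b ∧
      (entTerm S a b : ℝ) ≤ (S : ℝ) ^ 2 * negMulLog (a / b) := by
  rcases Nat.eq_zero_or_pos b with rfl | hb
  · obtain rfl : a = 0 := by omega
    simp [entTerm]
  have hb' : (0 : ℝ) < b := by exact_mod_cast hb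
  have hab' : (a : ℝ) ≤ b := by exact_mod_cast hab
  obtain ⟨h1, h2⟩ := negMulLog_series (p := (a : ℝ) / b) (by positivity)
    (div_le_one_of_le₀ hab' hb'.le) S
  set R := ∑ k ∈ range S, (a : ℝ) / b * (1 - a / b) ^ (k + 1) / (k + 1) with hR
  have e : ∀ k : ℕ, ((S ^ 2 * a * (b - a) ^ (k + 1) : ℕ) : ℝ) / ((b ^ (k + 2) * (k + 1) : ℕ) : ℝ) =
      (S : ℝ) ^ 2 * ((a : ℝ) / b * (1 - a / b) ^ (k + 1) / (k + 1)) := by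
    intro k
    have : (1 : ℝ) - a / b = (b - a) / b := by field_simp
    rw [this]
    push_cast [Nat.cast_sub hab]
    rw [div_pow, pow_succ _ (k + 1)]
    field_simp
  have u : (entTerm S a b : ℝ) ≤ (S : ℝ) ^ 2 * R := by
    rw [entTerm, hR, Finset.mul_sum]
    push_cast
    refine Finset.sum_le_sum fun k _ => ?_
    rw [← e]
    exact_mod_cast (natDiv_bounds _ _).2
  have l : (S : ℝ) ^ 2 * R - S ≤ entTerm S a b := by
    have h3 : (S : ℝ) ^ 2 * R - S = ∑ k ∈ range S,
        ((S : ℝ) ^ 2 * ((a : ℝ) / b * (1 - a / b) ^ (k + 1) / (k + 1)) - 1) := by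
      rw [Finset.sum_sub_distrib, ← Finset.mul_sum, ← hR]
      simp
    rw [h3, entTerm]
    push_cast
    refine Finset.sum_le_sum fun k _ => ?_
    rw [← e]
    exact_mod_cast (natDiv_bounds _ _).1
  have h4 : (S : ℝ) ^ 2 * (1 / (S + 1)) ≤ S := by
    rw [mul_one_div, div_le_iff₀ (by positivity)]
    nlinarith [(Nat.cast_nonneg S : (0 : ℝ) ≤ S)]
  have h5 : (0 : ℝ) ≤ (S : ℝ) ^ 2 := by positivity
  constructor <;> nlinarith

theorem ceilSqrt_eq (y : ℕ) : ceilSqrt y = ⌈√(y : ℝ)⌉₊ := by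
  have key : ∀ i : ℕ, i ^ 2 < y ↔ i < ⌈√(y : ℝ)⌉₊ := fun i => by
    rw [Nat.lt_ceil, Real.lt_sqrt (Nat.cast_nonneg i)]
    exact_mod_cast Iff.rfl
  rw [ceilSqrt, ← Finset.sum_filter, Finset.sum_const, smul_eq_mul, mul_one]
  have : (range y).filter (fun i => i ^ 2 < y) = range ⌈√(y : ℝ)⌉₊ := by
    ext i
    rw [Finset.mem_filter, Finset.mem_range, Finset.mem_range, key]
    refine ⟨fun h => h.2, fun h => ⟨?_, h⟩⟩
    have := (key i).2 h
    nlinarith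
  rw [this, Finset.card_range]

theorem ceilSqrt_bounds (y : ℕ) : √(y : ℝ) ≤ ceilSqrt y ∧ (ceilSqrt y : ℝ) ≤ √(y : ℝ) + 1 := by
  rw [ceilSqrt_eq]
  exact ⟨Nat.le_ceil _, (Nat.ceil_lt_add_one (Real.sqrt_nonneg _)).le⟩

/-! ### Integer entropies with fixed faces -/

section Face

variable {q E : ℕ} (W : ℕ → ℕ → ℕ)

/-- Real-valued copy of a table of weights. -/
def castWt (W : ℕ → ℕ → ℕ) : ℕ → ℕ → ℝ := fun e g => W e g

theorem wtPast_cast (e f : ℕ) : wtPast q (castWt W) e f = (wtPast q W e f : ℕ) := by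
  simp [wtPast, castWt]

theorem wtFace_cast (e : ℕ) : wtFace q E (castWt W) e = (wtFace q E W e : ℕ) := by
  simp [wtFace, wtPast_cast]

variable {W}

theorem castWt_nonneg (e g : ℕ) : 0 ≤ castWt W e g := Nat.cast_nonneg _

theorem faceEnt_le {W : ℕ → ℕ → ℝ} (hW : ∀ e g, 0 ≤ W e g) (e : ℕ) : faceEnt q E W e ≤ q := by
  have h0 : ∀ f, 0 ≤ wtPast q W e f := fun f => Finset.sum_nonneg fun _ _ => hW _ _
  have h1 : 0 ≤ wtFace q E W e := Finset.sum_nonneg fun f _ => h0 f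
  refine div_le_of_le_mul₀ h1 (Nat.cast_nonneg q) ?_
  rw [wtFace, Finset.mul_sum]
  refine Finset.sum_le_sum fun f _ => ?_
  rw [mul_comm]
  exact mul_le_mul_of_nonneg_right (sum_negMulLog_mem hW e f).2 (h0 f)

/-- Each of the q terms loses at most 2E; averaging over the near past preserves this, and the final
division loses at most 1. -/
theorem entFace_bounds {e : ℕ} (he : 0 < wtFace q E W e) :
    (E : ℝ) ^ 2 * faceEnt q E (castWt W) e - 2 * q * E - 1 ≤ entFace q E W e ∧
      (entFace q E W e : ℝ) ≤ (E : ℝ) ^ 2 * faceEnt q E (castWt W) e := by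
  have he' : (0 : ℝ) < (wtFace q E W e : ℕ) := by exact_mod_cast he
  have key : ∀ f, (E : ℝ) ^ 2 * ∑ x ∈ range q, negMulLog (castWt W e (q * f + x) /
        wtPast q (castWt W) e f) - 2 * q * E ≤
        ((∑ x ∈ range q, entTerm E (W e (q * f + x)) (wtPast q W e f) : ℕ) : ℝ) ∧
      ((∑ x ∈ range q, entTerm E (W e (q * f + x)) (wtPast q W e f) : ℕ) : ℝ) ≤
        (E : ℝ) ^ 2 * ∑ x ∈ range q, negMulLog (castWt W e (q * f + x) /
        wtPast q (castWt W) e f) := by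
    intro f
    have h := fun x (hx : x ∈ range q) => entTerm_bounds (S := E)
      (show W e (q * f + x) ≤ wtPast q W e f from pos_of_mem_range_prod (h := W e) hx)
    rw [wtPast_cast, Finset.mul_sum]
    push_cast
    constructor
    · have : 2 * (q : ℝ) * E = ∑ _x ∈ range q, 2 * (E : ℝ) := by simp; ring
      rw [this, ← Finset.sum_sub_distrib]
      exact Finset.sum_le_sum fun x hx => (h x hx).1
    · exact Finset.sum_le_sum fun x hx => (h x hx).2
  obtain ⟨d1, d2⟩ := natDiv_bounds (∑ f ∈ range E, wtPast q W e f *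
    ∑ x ∈ range q, entTerm E (W e (q * f + x)) (wtPast q W e f)) (wtFace q E W e)
  change _ ≤ (entFace q E W e : ℝ) at d1
  change (entFace q E W e : ℝ) ≤ _ at d2
  set N := ∑ f ∈ range E, wtPast q W e f *
    ∑ x ∈ range q, entTerm E (W e (q * f + x)) (wtPast q W e f) with hN
  have u : (N : ℝ) ≤ (E : ℝ) ^ 2 * ∑ f ∈ range E, wtPast q (castWt W) e f *
      ∑ x ∈ range q, negMulLog (castWt W e (q * f + x) / wtPast q (castWt W) e f) := by
    rw [hN, Finset.mul_sum, Nat.cast_sum]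
    refine Finset.sum_le_sum fun f _ => ?_
    rw [Nat.cast_mul, ← wtPast_cast, mul_left_comm]
    exact mul_le_mul_of_nonneg_left (key f).2 (by rw [wtPast_cast]; positivity)
  have l : (E : ℝ) ^ 2 * ∑ f ∈ range E, wtPast q (castWt W) e f *
      ∑ x ∈ range q, negMulLog (castWt W e (q * f + x) / wtPast q (castWt W) e f) -
      2 * q * E * (wtFace q E W e : ℕ) ≤ N := by
    rw [hN, Finset.mul_sum, Nat.cast_sum, ← wtFace_cast, wtFace, Finset.mul_sum,
      ← Finset.sum_sub_distrib]
    refine Finset.sum_le_sum fun f _ => ?_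
    rw [Nat.cast_mul, ← wtPast_cast]
    have := mul_le_mul_of_nonneg_left (key f).1
      (show 0 ≤ wtPast q (castWt W) e f by rw [wtPast_cast]; positivity)
    linarith
  have l' := div_le_div_of_nonneg_right l he'.le
  have u' := div_le_div_of_nonneg_right u he'.le
  rw [sub_div, mul_div_cancel_right₀ _ he'.ne', mul_div_assoc, ← wtFace_cast] at l'
  rw [mul_div_assoc, ← wtFace_cast] at u'
  rw [← wtFace_cast] at d1 d2
  constructor
  · rw [faceEnt]
    linarith
  · rw [faceEnt]
    linarith

theorem minEnt_le {e : ℕ} (he : e < E) (hpos : 0 < wtFace q E W e) :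
    minEnt q E W ≤ entFace q E W e := by
  have h1 : entFace q E W e ≤ q * E ^ 2 := by
    have h := (entFace_bounds hpos).2
    have h2 := faceEnt_le (q := q) (E := E) (castWt_nonneg (W := W)) e
    have h3 : (entFace q E W e : ℝ) ≤ ((q * E ^ 2 : ℕ) : ℝ) := by
      push_cast
      nlinarith [sq_nonneg (E : ℝ)]
    exact_mod_cast h3
  have h2 := Finset.le_sup (f := fun e => if wtFace q E W e = 0 then 0 else
    q * E ^ 2 - entFace q E W e) (Finset.mem_range.2 he)
  simp only [hpos.ne', if_false] at h2
  unfold minEnt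
  omega

theorem exists_minEnt {e₀ : ℕ} (he₀ : e₀ < E) (hpos₀ : 0 < wtFace q E W e₀) :
    ∃ e < E, 0 < wtFace q E W e ∧ entFace q E W e ≤ minEnt q E W := by
  obtain ⟨e, he, h⟩ := Finset.exists_mem_eq_sup (range E) ⟨e₀, Finset.mem_range.2 he₀⟩
    fun e => if wtFace q E W e = 0 then 0 else q * E ^ 2 - entFace q E W e
  have h0 := Finset.le_sup (f := fun e => if wtFace q E W e = 0 then 0 else
    q * E ^ 2 - entFace q E W e) (Finset.mem_range.2 he₀)
  have hle : ∀ {e}, 0 < wtFace q E W e → entFace q E W e ≤ q * E ^ 2 := fun {e} hpos => by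
    have h := (entFace_bounds hpos).2
    have h2 := faceEnt_le (q := q) (E := E) (castWt_nonneg (W := W)) e
    have h3 : (entFace q E W e : ℝ) ≤ ((q * E ^ 2 : ℕ) : ℝ) := by
      push_cast
      nlinarith [sq_nonneg (E : ℝ)]
    exact_mod_cast h3
  rcases Nat.eq_zero_or_pos (wtFace q E W e) with hz | hz
  -- If the supremum is attained at a face of weight zero, it is 0, so every admissible face attains
  -- the maximal value q E² and `e₀` will do.
  · refine ⟨e₀, he₀, hpos₀, ?_⟩
    have := hle hpos₀
    simp only [hz, if_true] at h
    unfold minEnt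
    omega
  · refine ⟨e, Finset.mem_range.1 he, hz, ?_⟩
    have := hle hz
    simp only [hz.ne', if_false] at h
    unfold minEnt
    omega

theorem le_maxEnt {e : ℕ} (he : e < E) (hpos : 0 < wtFace q E W e) :
    entFace q E W e ≤ maxEnt q E W := by
  have h2 := Finset.le_sup (f := fun e => if wtFace q E W e = 0 then 0 else
    entFace q E W e) (Finset.mem_range.2 he)
  simp only [hpos.ne', if_false] at h2
  exact h2

theorem exists_maxEnt {e₀ : ℕ} (he₀ : e₀ < E) (hpos₀ : 0 < wtFace q E W e₀) :
    ∃ e < E, 0 < wtFace q E W e ∧ maxEnt q E W ≤ entFace q E W e := by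
  obtain ⟨e, he, h⟩ := Finset.exists_mem_eq_sup (range E) ⟨e₀, Finset.mem_range.2 he₀⟩
    fun e => if wtFace q E W e = 0 then 0 else entFace q E W e
  rcases Nat.eq_zero_or_pos (wtFace q E W e) with hz | hz
  · refine ⟨e₀, he₀, hpos₀, ?_⟩
    simp only [hz, if_true] at h
    unfold maxEnt
    omega
  · refine ⟨e, Finset.mem_range.1 he, hz, ?_⟩
    simp only [hz.ne', if_false] at h
    exact h.le

/-- Both quotients are rounded down by at most 1, so the errors partly cancel and the difference is
off by at most 1. -/
theorem discrepancy_bounds {e e' f x : ℕ} (h : 0 < wtPast q W e f) (h' : 0 < wtPast q W e' f) :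
    (E : ℝ) ^ 2 * |castWt W e (q * f + x) / wtPast q (castWt W) e f -
        castWt W e' (q * f + x) / wtPast q (castWt W) e' f| ≤ discrepancy q E W e e' f x + 1 ∧
    (discrepancy q E W e e' f x : ℝ) ≤
      (E : ℝ) ^ 2 * |castWt W e (q * f + x) / wtPast q (castWt W) e f -
        castWt W e' (q * f + x) / wtPast q (castWt W) e' f| + 1 := by
  have hd : (discrepancy q E W e e' f x : ℝ) =
      |((E ^ 2 * W e (q * f + x) / wtPast q W e f : ℕ) : ℝ) -
        ((E ^ 2 * W e' (q * f + x) / wtPast q W e' f : ℕ) : ℝ)| := by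
    rw [discrepancy, if_neg h.ne', if_neg h'.ne']
    generalize E ^ 2 * W e (q * f + x) / wtPast q W e f = a
    generalize E ^ 2 * W e' (q * f + x) / wtPast q W e' f = b
    rcases le_total a b with hab | hab
    · rw [Nat.sub_eq_zero_of_le hab, zero_add, Nat.cast_sub hab, abs_sub_comm,
        abs_of_nonneg (sub_nonneg.2 (Nat.cast_le.2 hab))]
    · rw [Nat.sub_eq_zero_of_le hab, add_zero, Nat.cast_sub hab,
        abs_of_nonneg (sub_nonneg.2 (Nat.cast_le.2 hab))]
  have hE2 : ∀ t : ℝ, (E : ℝ) ^ 2 * |t| = |(E : ℝ) ^ 2 * t| := fun t => by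
    rw [abs_mul, abs_of_nonneg (sq_nonneg (E : ℝ))]
  rw [hd, wtPast_cast, wtPast_cast, hE2, mul_sub, ← mul_div_assoc, ← mul_div_assoc]
  obtain ⟨a1, a2⟩ := natDiv_bounds (E ^ 2 * W e (q * f + x)) (wtPast q W e f)
  obtain ⟨b1, b2⟩ := natDiv_bounds (E ^ 2 * W e' (q * f + x)) (wtPast q W e' f)
  push_cast at a1 a2 b1 b2
  change _ ≤ (E : ℝ) ^ 2 * castWt W e (q * f + x) / _ at a2
  change (E : ℝ) ^ 2 * castWt W e (q * f + x) / _ - 1 ≤ _ at a1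
  change _ ≤ (E : ℝ) ^ 2 * castWt W e' (q * f + x) / _ at b2
  change (E : ℝ) ^ 2 * castWt W e' (q * f + x) / _ - 1 ≤ _ at b1
  set a := (E : ℝ) ^ 2 * castWt W e (q * f + x) / (wtPast q W e f : ℕ)
  set b := (E : ℝ) ^ 2 * castWt W e' (q * f + x) / (wtPast q W e' f : ℕ)
  set a' := ((E ^ 2 * W e (q * f + x) / wtPast q W e f : ℕ) : ℝ)
  set b' := ((E ^ 2 * W e' (q * f + x) / wtPast q W e' f : ℕ) : ℝ)
  have hab : |(a - b) - (a' - b')| ≤ 1 := by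
    rw [abs_le]
    constructor <;> linarith
  have t1 := abs_sub_abs_le_abs_sub (a - b) (a' - b')
  have t2 := abs_sub_abs_le_abs_sub (a' - b') (a - b)
  rw [abs_sub_comm (a' - b')] at t2
  constructor <;> linarith

theorem discrepancy_le_max {e e' f x : ℕ} (he : e < E) (he' : e' < E) (hf : f < E) (hx : x < q) :
    discrepancy q E W e e' f x ≤ maxDiscrepancy q E W := by
  have h4 := Finset.le_sup (f := fun x => discrepancy q E W e e' f x) (Finset.mem_range.2 hx)
  have h3 := Finset.le_sup (f := fun f => (range q).sup fun x => discrepancy q E W e e' f x)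
    (Finset.mem_range.2 hf)
  have h2 := Finset.le_sup (f := fun e' => (range E).sup fun f => (range q).sup fun x =>
    discrepancy q E W e e' f x) (Finset.mem_range.2 he')
  have h1 := Finset.le_sup (f := fun e => (range E).sup fun e' => (range E).sup fun f =>
    (range q).sup fun x => discrepancy q E W e e' f x) (Finset.mem_range.2 he)
  exact ((h4.trans h3).trans h2).trans h1

theorem maxDiscrepancy_le_of {B : ℝ} (hB : 0 ≤ B) (h : ∀ e e' f x, e < E → e' < E → f < E → x < q →
      0 < wtPast q W e f → 0 < wtPast q W e' f → (discrepancy q E W e e' f x : ℝ) ≤ B) :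
    (maxDiscrepancy q E W : ℝ) ≤ B := by
  rw [← Nat.le_floor_iff hB]
  refine Finset.sup_le fun e he => Finset.sup_le fun e' he' => Finset.sup_le fun f hf =>
    Finset.sup_le fun x hx => ?_
  rw [Nat.le_floor_iff hB]
  simp only [Finset.mem_range] at he he' hf hx
  rcases Nat.eq_zero_or_pos (wtPast q W e f) with h0 | h0
  · rw [discrepancy, if_pos h0]
    simpa using hB
  rcases Nat.eq_zero_or_pos (wtPast q W e' f) with h0' | h0'
  · rw [discrepancy, if_neg h0.ne', if_pos h0']
    simpa using hB
  exact h e e' f x he he' hf hx h0 h0'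

end Face

/-! ### Stability under relative errors of the weights -/

/-- `W'` approximates a multiple of `W` with relative error `1 / E ^ 2`. -/
structure Approximate (E : ℕ) (W W' : ℕ → ℕ → ℝ) : Prop where
  nonneg : ∀ e g, 0 ≤ W e g
  bound : ∃ κ > (0 : ℝ), ∀ e g, e < E → (1 - 1 / (E : ℝ) ^ 2) * (κ * W e g) ≤ W' e g ∧
    W' e g ≤ (1 + 1 / (E : ℝ) ^ 2) * (κ * W e g)

/-- The scale κ cancels, and (1+θ)/(1-θ) - 1 = 2θ/(1-θ) ≤ 3θ for θ ≤ 1/4. If b = 0 then b' = 0 and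
both quotients are 0 by convention. -/
theorem div_sub_div_le {θ κ a b a' b' : ℝ} (hθ : 0 ≤ θ) (hθ' : θ ≤ 1 / 4) (hκ : 0 < κ)
    (ha : 0 ≤ a) (hb : 0 ≤ b)
    (ha1 : (1 - θ) * (κ * a) ≤ a') (ha2 : a' ≤ (1 + θ) * (κ * a))
    (hb1 : (1 - θ) * (κ * b) ≤ b') (hb2 : b' ≤ (1 + θ) * (κ * b)) :
    |a' / b' - a / b| ≤ 3 * θ * (a / b) := by
  rcases hb.eq_or_lt with rfl | hb
  · have : b' = 0 := by
      rw [mul_zero, mul_zero] at hb1 hb2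
      exact le_antisymm hb2 hb1
    rw [this]
    simp
  have hκb : 0 < κ * b := by positivity
  have hκa : 0 ≤ κ * a := by positivity
  have hb' : 0 < b' := lt_of_lt_of_le (mul_pos (by linarith) hκb) hb1
  have key : a' / b' - a / b = (a' * b - a * b') / (b' * b) := by field_simp
  rw [key, abs_div, abs_of_pos (mul_pos hb' hb), div_le_iff₀ (mul_pos hb' hb)]
  have e1 : 3 * θ * (a / b) * (b' * b) = 3 * θ * (a * b') := by field_simp
  rw [e1]
  have h1 : a' * b ≤ (1 + θ) * (κ * a) * b := mul_le_mul_of_nonneg_right ha2 hb.le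
  have h2 : (1 - θ) * (κ * a) * b ≤ a' * b := mul_le_mul_of_nonneg_right ha1 hb.le
  have h3 : a * ((1 - θ) * (κ * b)) ≤ a * b' := mul_le_mul_of_nonneg_left hb1 ha
  have h4 : a * b' ≤ a * ((1 + θ) * (κ * b)) := mul_le_mul_of_nonneg_left hb2 ha
  have h5 : 0 ≤ κ * a * b := by positivity
  have h6 : 0 ≤ θ * (κ * a * b) := by positivity
  have h7 : 3 * θ * (a * ((1 - θ) * (κ * b))) ≤ 3 * θ * (a * b') :=
    mul_le_mul_of_nonneg_left h3 (by positivity)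
  have h8 : θ * (θ * (κ * a * b)) ≤ 1 / 4 * (θ * (κ * a * b)) :=
    mul_le_mul_of_nonneg_right hθ' h6
  rw [abs_le]
  constructor <;> nlinarith

namespace Approximate

variable {q E : ℕ} {W W' : ℕ → ℕ → ℝ}

theorem wtPast_bound {θ κ : ℝ} {e : ℕ} (h : ∀ g, (1 - θ) * (κ * W e g) ≤ W' e g ∧
    W' e g ≤ (1 + θ) * (κ * W e g)) (f : ℕ) :
    (1 - θ) * (κ * wtPast q W e f) ≤ wtPast q W' e f ∧
      wtPast q W' e f ≤ (1 + θ) * (κ * wtPast q W e f) := by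
  unfold wtPast
  simp only [Finset.mul_sum]
  exact ⟨Finset.sum_le_sum fun x _ => (h _).1, Finset.sum_le_sum fun x _ => (h _).2⟩

theorem wtFace_bound {θ κ : ℝ} {e : ℕ} (h : ∀ g, (1 - θ) * (κ * W e g) ≤ W' e g ∧
    W' e g ≤ (1 + θ) * (κ * W e g)) :
    (1 - θ) * (κ * wtFace q E W e) ≤ wtFace q E W' e ∧
      wtFace q E W' e ≤ (1 + θ) * (κ * wtFace q E W e) := by
  unfold wtFace
  simp only [Finset.mul_sum]
  exact ⟨Finset.sum_le_sum fun x _ => (wtPast_bound h _).1,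
    Finset.sum_le_sum fun x _ => (wtPast_bound h _).2⟩

variable (hE : 2 ≤ E) (h : Approximate E W W')
include hE

theorem theta_le : (0 : ℝ) ≤ 1 / (E : ℝ) ^ 2 ∧ 1 / (E : ℝ) ^ 2 ≤ 1 / 4 := by
  have : (2 : ℝ) ≤ E := by exact_mod_cast hE
  refine ⟨by positivity, ?_⟩
  exact one_div_le_one_div_of_le (by norm_num) (by nlinarith)

/-- A relative error below 1 preserves zeros, so the algorithm considers exactly the faces and near
pasts that are possible for the true weights. -/
theorem pos_iff {κ a a' : ℝ} (hκ : 0 < κ) (h1 : (1 - 1 / (E : ℝ) ^ 2) * (κ * a) ≤ a')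
    (h2 : a' ≤ (1 + 1 / (E : ℝ) ^ 2) * (κ * a)) : 0 < a' ↔ 0 < a := by
  obtain ⟨t1, t2⟩ := theta_le hE
  constructor
  · intro h0
    have := h0.trans_le h2
    exact pos_of_mul_pos_right (pos_of_mul_pos_right this (by linarith)) hκ.le
  · intro h0
    exact (mul_pos (by linarith) (mul_pos hκ h0)).trans_le h1

include h

theorem wtPast_pos_iff {e : ℕ} (he : e < E) (f : ℕ) :
    0 < wtPast q W' e f ↔ 0 < wtPast q W e f := by
  obtain ⟨κ, hκ, H⟩ := h.bound
  obtain ⟨h1, h2⟩ := wtPast_bound (q := q) (fun g => H e g he) f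
  exact pos_iff hE hκ h1 h2

theorem wtFace_pos_iff {e : ℕ} (he : e < E) :
    0 < wtFace q E W' e ↔ 0 < wtFace q E W e := by
  obtain ⟨κ, hκ, H⟩ := h.bound
  obtain ⟨h1, h2⟩ := wtFace_bound (q := q) (E := E) (fun g => H e g he)
  exact pos_iff hE hκ h1 h2

theorem cond_le {e f x : ℕ} (he : e < E) (hx : x < q) :
    |W' e (q * f + x) / wtPast q W' e f - W e (q * f + x) / wtPast q W e f| ≤
      3 / (E : ℝ) ^ 2 := by
  obtain ⟨κ, hκ, H⟩ := h.bound
  obtain ⟨h1, h2⟩ := wtPast_bound (q := q) (fun g => H e g he) f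
  obtain ⟨t1, t2⟩ := theta_le hE
  have := div_sub_div_le t1 t2 hκ (h.nonneg e (q * f + x))
    (Finset.sum_nonneg fun _ _ => h.nonneg _ _) (H _ _ he).1 (H _ _ he).2 h1 h2
  refine this.trans ?_
  have h3 := (cond_mem h.nonneg (e := e) (f := f) hx).2
  rw [show (3 : ℝ) / (E : ℝ) ^ 2 = 3 * (1 / (E : ℝ) ^ 2) * 1 by ring]
  exact mul_le_mul_of_nonneg_left h3 (by positivity)

theorem nonneg' {e : ℕ} (he : e < E) (g : ℕ) : 0 ≤ W' e g := by
  obtain ⟨κ, hκ, H⟩ := h.bound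
  obtain ⟨t1, t2⟩ := theta_le hE
  exact (mul_nonneg (by linarith) (mul_nonneg hκ.le (h.nonneg e g))).trans (H e g he).1

/-- The weights of the mean have relative error 3/E² and multiply entropies of at most q: this gives
3q. The conditional probabilities are off by at most 3/E², so each of the q terms -p log p by at
most 2√3/E ≤ 4/E: this gives 4qE. -/
theorem faceEnt_le {e : ℕ} (he : e < E) (hpos : 0 < wtFace q E W e) :
    (E : ℝ) ^ 2 * |faceEnt q E W' e - faceEnt q E W e| ≤ 3 * q + 4 * q * E := by
  obtain ⟨κ, hκ, H⟩ := h.bound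
  obtain ⟨t1, t2⟩ := theta_le hE
  have hE' : (0 : ℝ) < E := by
    have : (2 : ℝ) ≤ E := by exact_mod_cast hE
    linarith
  set θ := 1 / (E : ℝ) ^ 2 with hθ
  have hWP : ∀ f, 0 ≤ wtPast q W e f := fun f => Finset.sum_nonneg fun _ _ => h.nonneg _ _
  have hW' : ∀ _e' g : ℕ, 0 ≤ W' e g := fun _ g => h.nonneg' hE he g
  have hψ' : ∀ f, 0 ≤ ∑ x ∈ range q, negMulLog (W' e (q * f + x) / wtPast q W' e f) ∧
      ∑ x ∈ range q, negMulLog (W' e (q * f + x) / wtPast q W' e f) ≤ q := fun f =>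
    sum_negMulLog_mem (W := fun _ => W' e) hW' e f
  have hcond' : ∀ f x, x < q → 0 ≤ W' e (q * f + x) / wtPast q W' e f ∧
      W' e (q * f + x) / wtPast q W' e f ≤ 1 := fun f x hx => cond_mem (W := fun _ => W' e) hW' (e := e) hx
  have hψ : ∀ f, |∑ x ∈ range q, negMulLog (W' e (q * f + x) / wtPast q W' e f) -
      ∑ x ∈ range q, negMulLog (W e (q * f + x) / wtPast q W e f)| ≤ q * (4 / E) := by
    intro f
    rw [← Finset.sum_sub_distrib]
    refine (Finset.abs_sum_le_sum_abs _ _).trans ((Finset.sum_le_card_nsmul _ _ ((4 : ℝ) / E)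
      fun x hx => ?_).trans_eq (by simp))
    rw [Finset.mem_range] at hx
    refine (abs_negMulLog_sub_le (hcond' f x hx).1 (hcond' f x hx).2
      (cond_mem h.nonneg hx).1 (cond_mem h.nonneg hx).2).trans ?_
    have h1 := Real.sqrt_le_sqrt (h.cond_le hE (f := f) he hx)
    have h2 : √(3 / (E : ℝ) ^ 2) ≤ 2 / E := by
      rw [Real.sqrt_le_left (by positivity), div_pow]
      gcongr
      norm_num
    have : (4 : ℝ) / E = 2 * (2 / E) := by ring
    linarith
  have hP : ∀ f, |wtPast q W' e f / wtFace q E W' e - wtPast q W e f / wtFace q E W e| ≤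
      3 * θ * (wtPast q W e f / wtFace q E W e) := fun f => by
    obtain ⟨h1, h2⟩ := wtPast_bound (q := q) (fun g => H e g he) f
    obtain ⟨h3, h4⟩ := wtFace_bound (q := q) (E := E) (fun g => H e g he)
    exact div_sub_div_le t1 t2 hκ (hWP f) hpos.le h1 h2 h3 h4
  have hsum : ∑ f ∈ range E, wtPast q W e f / wtFace q E W e = 1 := by
    rw [← Finset.sum_div]
    exact div_self hpos.ne'
  have main : |faceEnt q E W' e - faceEnt q E W e| ≤ 3 * θ * q + q * (4 / E) := by
    have hform : ∀ W : ℕ → ℕ → ℝ, faceEnt q E W e = ∑ f ∈ range E,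
        wtPast q W e f / wtFace q E W e *
          ∑ x ∈ range q, negMulLog (W e (q * f + x) / wtPast q W e f) := fun W => by
      rw [faceEnt, Finset.sum_div]
      exact Finset.sum_congr rfl fun f _ => by ring
    rw [hform, hform, ← Finset.sum_sub_distrib]
    have : 3 * θ * q + q * (4 / E) = ∑ f ∈ range E, wtPast q W e f / wtFace q E W e *
        (3 * θ * q + q * (4 / E)) := by
      rw [← Finset.sum_mul, hsum, one_mul]
    rw [this]
    refine (Finset.abs_sum_le_sum_abs _ _).trans (Finset.sum_le_sum fun f _ => ?_)
    have hp0 : 0 ≤ wtPast q W e f / wtFace q E W e := div_nonneg (hWP f) hpos.le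
    set p := wtPast q W e f / wtFace q E W e
    set p' := wtPast q W' e f / wtFace q E W' e
    set a := ∑ x ∈ range q, negMulLog (W e (q * f + x) / wtPast q W e f)
    set a' := ∑ x ∈ range q, negMulLog (W' e (q * f + x) / wtPast q W' e f)
    have e1 : p' * a' - p * a = (p' - p) * a' + p * (a' - a) := by ring
    rw [e1]
    refine (abs_add_le _ _).trans ?_
    rw [abs_mul, abs_mul, abs_of_nonneg (hψ' f).1, abs_of_nonneg hp0]
    have e2 : |p' - p| * a' ≤ 3 * θ * p * q :=
      mul_le_mul (hP f) (hψ' f).2 (hψ' f).1 (by positivity)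
    have e3 : p * |a' - a| ≤ p * (q * (4 / E)) := mul_le_mul_of_nonneg_left (hψ f) hp0
    linarith
  calc (E : ℝ) ^ 2 * |faceEnt q E W' e - faceEnt q E W e|
      ≤ (E : ℝ) ^ 2 * (3 * θ * q + q * (4 / E)) :=
        mul_le_mul_of_nonneg_left main (by positivity)
    _ = 3 * q + 4 * q * E := by
      rw [hθ]
      field_simp

end Approximate

/-! ### The bounds computed by the algorithm -/

/-- The greatest difference of conditional probabilities with different faces. -/
noncomputable def condOsc (q E : ℕ) (W : ℕ → ℕ → ℝ) : ℝ :=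
  -- The inserted 0 keeps the set nonempty and the supremum nonnegative.
  sSup (insert 0 {t | ∃ e e' f x, e < E ∧ e' < E ∧ f < E ∧ x < q ∧ 0 < wtPast q W e f ∧
    0 < wtPast q W e' f ∧
    t = |W e (q * f + x) / wtPast q W e f - W e' (q * f + x) / wtPast q W e' f|})

section CondOsc

variable {q E : ℕ} {W : ℕ → ℕ → ℝ}

theorem condOsc_le {B : ℝ} (hB : 0 ≤ B)
    (h : ∀ e e' f x, e < E → e' < E → f < E → x < q → 0 < wtPast q W e f →
      0 < wtPast q W e' f →
      |W e (q * f + x) / wtPast q W e f - W e' (q * f + x) / wtPast q W e' f| ≤ B) :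
    condOsc q E W ≤ B := by
  refine csSup_le (Set.insert_nonempty _ _) fun t ht => ?_
  rcases ht with rfl | ⟨e, e', f, x, he, he', hf, hx, h1, h2, rfl⟩
  exacts [hB, h e e' f x he he' hf hx h1 h2]

theorem bddAbove_condOsc (hW : ∀ e g, 0 ≤ W e g) : BddAbove (insert 0 {t | ∃ e e' f x,
    e < E ∧ e' < E ∧ f < E ∧ x < q ∧ 0 < wtPast q W e f ∧ 0 < wtPast q W e' f ∧
    t = |W e (q * f + x) / wtPast q W e f - W e' (q * f + x) / wtPast q W e' f|}) := by
  refine ⟨1, fun t ht => ?_⟩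
  rcases ht with rfl | ⟨e, e', f, x, he, he', hf, hx, h1, h2, rfl⟩
  · exact zero_le_one
  · have a := cond_mem hW (e := e) (f := f) hx
    have b := cond_mem hW (e := e') (f := f) hx
    rw [abs_le]
    constructor <;> linarith

theorem condOsc_nonneg (hW : ∀ e g, 0 ≤ W e g) : 0 ≤ condOsc q E W :=
  le_csSup (bddAbove_condOsc hW) (Set.mem_insert _ _)

theorem le_condOsc (hW : ∀ e g, 0 ≤ W e g) {e e' f x : ℕ} (he : e < E) (he' : e' < E) (hf : f < E)
    (hx : x < q) (h : 0 < wtPast q W e f) (h' : 0 < wtPast q W e' f) :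
    |W e (q * f + x) / wtPast q W e f - W e' (q * f + x) / wtPast q W e' f| ≤ condOsc q E W :=
  le_csSup (bddAbove_condOsc hW)
    (Set.mem_insert_of_mem _ ⟨e, e', f, x, he, he', hf, hx, h, h', rfl⟩)

end CondOsc

namespace Approximate

variable {q E : ℕ} {W : ℕ → ℕ → ℝ} {W' : ℕ → ℕ → ℕ} (hq : 1 ≤ q) (hE : 2 ≤ E)
  (h : Approximate E W (castWt W'))
include hE h

theorem natFace_pos_iff {e : ℕ} (he : e < E) : 0 < wtFace q E W' e ↔ 0 < wtFace q E W e := by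
  rw [← h.wtFace_pos_iff hE he, wtFace_cast, Nat.cast_pos]

theorem natPast_pos_iff {e : ℕ} (he : e < E) (f : ℕ) :
    0 < wtPast q W' e f ↔ 0 < wtPast q W e f := by
  rw [← h.wtPast_pos_iff hE he, wtPast_cast, Nat.cast_pos]

/-- The 7 consists of 1 for rounding and 3 for the error of each of the two conditional
probabilities. -/
theorem sq_mul_condOsc_le : (E : ℝ) ^ 2 * condOsc q E W ≤ maxDiscrepancy q E W' + 7 := by
  have hE' : (0 : ℝ) < (E : ℝ) ^ 2 := by
    have : (2 : ℝ) ≤ E := by exact_mod_cast hE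
    positivity
  rw [mul_comm, ← le_div_iff₀ hE']
  refine condOsc_le (by positivity) fun e e' f x he he' hf hx h1 h2 => ?_
  rw [le_div_iff₀ hE', mul_comm]
  have d := (discrepancy_bounds (E := E) (x := x) ((h.natPast_pos_iff hE he f).2 h1)
    ((h.natPast_pos_iff hE he' f).2 h2)).1
  have dm : (discrepancy q E W' e e' f x : ℝ) ≤ maxDiscrepancy q E W' := by
    exact_mod_cast discrepancy_le_max he he' hf hx
  have c1 := abs_le.1 (h.cond_le hE (f := f) he hx)
  have c2 := abs_le.1 (h.cond_le hE (f := f) he' hx)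
  set a := W e (q * f + x) / wtPast q W e f
  set b := W e' (q * f + x) / wtPast q W e' f
  set a' := castWt W' e (q * f + x) / wtPast q (castWt W') e f
  set b' := castWt W' e' (q * f + x) / wtPast q (castWt W') e' f
  have : |a - b| ≤ |a' - b'| + 6 / (E : ℝ) ^ 2 := by
    have e6 : (6 : ℝ) / (E : ℝ) ^ 2 = 3 / (E : ℝ) ^ 2 + 3 / (E : ℝ) ^ 2 := by ring
    rw [abs_le, e6]
    have := neg_abs_le (a' - b')
    have := le_abs_self (a' - b')
    constructor <;> linarith
  have h6 := mul_le_mul_of_nonneg_left this hE'.le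
  rw [mul_add, mul_div_cancel₀ _ hE'.ne'] at h6
  linarith

theorem maxDiscrepancy_le : (maxDiscrepancy q E W' : ℝ) ≤ (E : ℝ) ^ 2 * condOsc q E W + 7 := by
  have hE' : (0 : ℝ) < (E : ℝ) ^ 2 := by
    have : (2 : ℝ) ≤ E := by exact_mod_cast hE
    positivity
  refine maxDiscrepancy_le_of (add_nonneg (mul_nonneg hE'.le (condOsc_nonneg h.nonneg))
    (by norm_num)) fun e e' f x he he' hf hx h1 h2 => ?_
  have d := (discrepancy_bounds (E := E) (x := x) h1 h2).2
  have o := le_condOsc h.nonneg he he' hf hx ((h.natPast_pos_iff hE he f).1 h1)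
    ((h.natPast_pos_iff hE he' f).1 h2)
  have c1 := abs_le.1 (h.cond_le hE (f := f) he hx)
  have c2 := abs_le.1 (h.cond_le hE (f := f) he' hx)
  set a := W e (q * f + x) / wtPast q W e f
  set b := W e' (q * f + x) / wtPast q W e' f
  set a' := castWt W' e (q * f + x) / wtPast q (castWt W') e f
  set b' := castWt W' e' (q * f + x) / wtPast q (castWt W') e' f
  have : |a' - b'| ≤ condOsc q E W + 6 / (E : ℝ) ^ 2 := by
    have e6 : (6 : ℝ) / (E : ℝ) ^ 2 = 3 / (E : ℝ) ^ 2 + 3 / (E : ℝ) ^ 2 := by ring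
    rw [abs_le, e6]
    have := neg_abs_le (a - b)
    have := le_abs_self (a - b)
    constructor <;> linarith
  have h6 := mul_le_mul_of_nonneg_left this hE'.le
  rw [mul_add, mul_div_cancel₀ _ hE'.ne'] at h6
  linarith

include hq

theorem lowerBd_le {e : ℕ} (he : e < E) (hpos : 0 < wtFace q E W e) :
    (lowerBd q E W' : ℝ) ≤ (E : ℝ) ^ 2 * faceEnt q E W e := by
  have hE' : (2 : ℝ) ≤ E := by exact_mod_cast hE
  have hq' : (1 : ℝ) ≤ q := by exact_mod_cast hq
  have hp := (h.natFace_pos_iff hE (q := q) he).2 hpos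
  have h1 : (minEnt q E W' : ℝ) ≤ entFace q E W' e := by exact_mod_cast minEnt_le he hp
  have h2 := (entFace_bounds hp).2
  have h3 := h.faceEnt_le hE he hpos
  have h4 := mul_le_mul_of_nonneg_left (le_abs_self (faceEnt q E (castWt W') e - faceEnt q E W e))
    (sq_nonneg (E : ℝ))
  have h5 : 0 ≤ faceEnt q E W e := div_nonneg (Finset.sum_nonneg fun f _ => mul_nonneg
    (Finset.sum_nonneg fun _ _ => h.nonneg _ _) (sum_negMulLog_mem h.nonneg e f).1) hpos.le
  rw [lowerBd]
  rcases le_total (minEnt q E W') (10 * q * E) with hc | hc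
  · rw [Nat.sub_eq_zero_of_le hc, Nat.cast_zero]
    positivity
  · rw [Nat.cast_sub hc]
    push_cast
    nlinarith

theorem le_upperBd {e : ℕ} (he : e < E) (hpos : 0 < wtFace q E W e) :
    (E : ℝ) ^ 2 * (faceEnt q E W e + q * (2 * √(condOsc q E W))) ≤ upperBd q E W' := by
  have hE' : (2 : ℝ) ≤ E := by exact_mod_cast hE
  have hq' : (1 : ℝ) ≤ q := by exact_mod_cast hq
  have hp := (h.natFace_pos_iff hE (q := q) he).2 hpos
  have h1 : (entFace q E W' e : ℝ) ≤ maxEnt q E W' := by exact_mod_cast le_maxEnt he hp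
  have h2 := (entFace_bounds hp).1
  have h3 := h.faceEnt_le hE he hpos
  have h4 := mul_le_mul_of_nonneg_left (neg_abs_le (faceEnt q E (castWt W') e - faceEnt q E W e))
    (sq_nonneg (E : ℝ))
  have h5 : (E : ℝ) * √(condOsc q E W) ≤ ceilSqrt (maxDiscrepancy q E W' + 7) := by
    refine le_trans ?_ (ceilSqrt_bounds _).1
    rw [← Real.sqrt_sq (show (0 : ℝ) ≤ E by linarith), ← Real.sqrt_mul (sq_nonneg _)]
    exact Real.sqrt_le_sqrt (by exact_mod_cast h.sq_mul_condOsc_le hE)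
  have h6 : 2 * (q : ℝ) * E * (E * √(condOsc q E W)) ≤
      2 * q * E * ceilSqrt (maxDiscrepancy q E W' + 7) :=
    mul_le_mul_of_nonneg_left h5 (by positivity)
  rw [upperBd]
  push_cast
  nlinarith

/-- The extreme integer entropies are attained at faces of positive weight, where `ω` applies. What
remains is safety margins and rounding, each a small multiple of qE; 50qE leaves room. -/
theorem upperBd_sub_lowerBd_le {e₀ : ℕ} (he₀ : e₀ < E) (hpos₀ : 0 < wtFace q E W e₀) {ω : ℝ}
    (hω : ∀ e e', e < E → e' < E → 0 < wtFace q E W e → 0 < wtFace q E W e' →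
      |faceEnt q E W e - faceEnt q E W e'| ≤ ω) :
    (upperBd q E W' : ℝ) - lowerBd q E W' ≤
      (E : ℝ) ^ 2 * (ω + q * (2 * √(condOsc q E W))) + 50 * q * E := by
  have hE' : (2 : ℝ) ≤ E := by exact_mod_cast hE
  have hq' : (1 : ℝ) ≤ q := by exact_mod_cast hq
  have hp₀ := (h.natFace_pos_iff hE (q := q) he₀).2 hpos₀
  obtain ⟨e, he, hp, h1⟩ := exists_maxEnt he₀ hp₀
  obtain ⟨e', he', hp', h1'⟩ := exists_minEnt he₀ hp₀
  have hpos := (h.natFace_pos_iff hE (q := q) he).1 hp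
  have hpos' := (h.natFace_pos_iff hE (q := q) he').1 hp'
  have h1r : (maxEnt q E W' : ℝ) ≤ entFace q E W' e := by exact_mod_cast h1
  have h1r' : (entFace q E W' e' : ℝ) ≤ minEnt q E W' := by exact_mod_cast h1'
  have h2 := (entFace_bounds hp).2
  have h2' := (entFace_bounds hp').1
  have h3 := h.faceEnt_le hE he hpos
  have h3' := h.faceEnt_le hE he' hpos'
  have h4 := mul_le_mul_of_nonneg_left (le_abs_self (faceEnt q E (castWt W') e - faceEnt q E W e))
    (sq_nonneg (E : ℝ))
  have h4' := mul_le_mul_of_nonneg_left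
    (neg_abs_le (faceEnt q E (castWt W') e' - faceEnt q E W e')) (sq_nonneg (E : ℝ))
  have h5 := mul_le_mul_of_nonneg_left ((le_abs_self _).trans (hω e e' he he' hpos hpos'))
    (sq_nonneg (E : ℝ))
  have h6 : (minEnt q E W' : ℝ) - 10 * q * E ≤ lowerBd q E W' := by
    rw [lowerBd]
    have : minEnt q E W' ≤ minEnt q E W' - 10 * q * E + 10 * q * E := by omega
    have := (Nat.cast_le (α := ℝ)).2 this
    push_cast at this
    linarith
  have hs0 := Real.sqrt_nonneg (condOsc q E W)
  have h7 : (ceilSqrt (maxDiscrepancy q E W' + 7) : ℝ) ≤ E * √(condOsc q E W) + 5 := by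
    refine (ceilSqrt_bounds _).2.trans ?_
    have : √((maxDiscrepancy q E W' + 7 : ℕ) : ℝ) ≤ E * √(condOsc q E W) + 4 := by
      refine Real.sqrt_le_left (by positivity) |>.2 ?_
      push_cast
      have h8 := h.maxDiscrepancy_le hE (q := q)
      have h9 := Real.sq_sqrt (condOsc_nonneg (q := q) (E := E) h.nonneg)
      have h10 : 0 ≤ (E : ℝ) * √(condOsc q E W) := by positivity
      nlinarith
    linarith
  have h8 : 2 * (q : ℝ) * E * ceilSqrt (maxDiscrepancy q E W' + 7) ≤
      2 * q * E * (E * √(condOsc q E W) + 5) := mul_le_mul_of_nonneg_left h7 (by positivity)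
  have hqE : (2 : ℝ) * q ≤ q * E := by nlinarith
  rw [upperBd]
  push_cast
  nlinarith

end Approximate

end GibbsEntropy

namespace GibbsEntropy
open Finset

/-! ### Accuracy of the tables of weights -/

section Approximation

variable {d : ℕ} {A : Type u} [Fintype A] {Z : Fin d → A → A → Prop} {G : Interactions d A}
  {φ : Param d A → ℕ → ℕ}

theorem prod_approx {ι : Type*} (s : Finset ι) {a a' c : ι → ℝ} {ρ : ℝ} (hρ : 0 ≤ ρ) (hρ' : ρ ≤ 1)
    (ha : ∀ i ∈ s, 0 ≤ a i) (hc : ∀ i ∈ s, 0 ≤ c i)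
    (h : ∀ i ∈ s, (1 - ρ) * (c i * a i) ≤ a' i ∧ a' i ≤ (1 + ρ) * (c i * a i)) :
    (1 - ρ) ^ #s * ((∏ i ∈ s, c i) * ∏ i ∈ s, a i) ≤ ∏ i ∈ s, a' i ∧
      ∏ i ∈ s, a' i ≤ (1 + ρ) ^ #s * ((∏ i ∈ s, c i) * ∏ i ∈ s, a i) := by
  have h0 : ∀ i ∈ s, 0 ≤ (1 - ρ) * (c i * a i) := fun i hi =>
    mul_nonneg (by linarith) (mul_nonneg (hc i hi) (ha i hi))
  rw [← Finset.prod_mul_distrib, ← Finset.prod_const, ← Finset.prod_const,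
    ← Finset.prod_mul_distrib, ← Finset.prod_mul_distrib]
  exact ⟨Finset.prod_le_prod h0 fun i hi => (h i hi).1,
    Finset.prod_le_prod (fun i hi => (h0 i hi).trans (h i hi).1) fun i hi => (h i hi).2⟩

theorem one_sub_mul_le_pow {ρ : ℝ} (hρ' : ρ ≤ 1) (N : ℕ) :
    1 - N * ρ ≤ (1 - ρ) ^ N := by
  have := one_add_mul_le_pow (show (-2 : ℝ) ≤ -ρ by linarith) N
  rw [← sub_eq_add_neg, mul_neg, ← sub_eq_add_neg] at this
  exact this

/-- Since (1+ρ)^N (1-ρ)^N ≤ 1, Bernoulli's inequality for (1-ρ)^N bounds (1+ρ)^N from above. -/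
theorem pow_le_one_add_mul {ρ : ℝ} (hρ : 0 ≤ ρ) {N : ℕ} (hN : N * ρ ≤ 1 / 2) (hρ' : ρ ≤ 1 / 2) :
    (1 + ρ) ^ N ≤ 1 + 2 * (N * ρ) := by
  have h1 := one_sub_mul_le_pow (show ρ ≤ 1 by linarith) N
  have h2 : (1 + ρ) ^ N * (1 - ρ) ^ N ≤ 1 := by
    rw [← mul_pow]
    exact pow_le_one₀ (by nlinarith) (by nlinarith)
  have h3 : 0 ≤ (1 + ρ) ^ N := by positivity
  have h4 : (1 + ρ) ^ N * (1 - N * ρ) ≤ 1 := (mul_le_mul_of_nonneg_left h1 h3).trans h2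
  have h5 : 0 ≤ N * ρ := by positivity
  have h6 : 1 ≤ (1 + 2 * (N * ρ)) * (1 - N * ρ) := by nlinarith
  exact le_of_mul_le_mul_right (h4.trans h6) (by linarith)

theorem val_pos_of_nonvanishing (hZ : ∀ i a b, G.β i a b = 0 ↔ Z i a b) {p : Param d A}
    (hp : Nonvanishing Z p) : 0 < G.val p := by
  rcases p with a | ⟨i, a, b⟩
  · exact G.γ_pos a
  · exact (G.β_nonneg i a b).lt_of_ne fun h => hp ((hZ i a b).1 h.symm)

theorem val_eq_zero_of_vanishing (hZ : ∀ i a b, G.β i a b = 0 ↔ Z i a b) {p : Param d A}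
    (hp : ¬ Nonvanishing Z p) : G.val p = 0 := by
  rcases p with a | ⟨i, a, b⟩
  · exact absurd trivial hp
  · exact (hZ i a b).2 (not_not.1 hp)

theorem Interactions.Approximates.abs_sub_le (h : G.Approximates φ) (p : Param d A) (k : ℕ) :
    |(φ p k : ℝ) - 2 ^ k * G.val p| ≤ 1 := by
  have h1 := h p k
  have h2 : (0 : ℝ) < 2 ^ k := by positivity
  have h3 : (φ p k : ℝ) / 2 ^ k - G.val p = ((φ p k : ℝ) - 2 ^ k * G.val p) / 2 ^ k := by
    field_simp
  rwa [h3, abs_div, abs_of_pos h2, div_le_div_iff_of_pos_right h2] at h1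

theorem deficit_eq_zero_iff (k : ℕ) :
    deficit Z φ k = 0 ↔ ∀ p, Nonvanishing Z p → 2 ≤ φ p k := by
  classical
  unfold deficit
  rw [Finset.sum_eq_zero_iff]
  refine ⟨fun h p hp => ?_, fun h p _ => ?_⟩
  · have := h p (Finset.mem_univ p)
    rw [if_pos hp] at this
    by_contra hc
    rw [if_neg hc] at this
    exact one_ne_zero this
  · split_ifs with h1 h2
    exacts [rfl, absurd (h p h1) h2, rfl]

/-- Once 2^k p ≥ 3, every admissible answer is at least 2. So the base precision is bounded in terms
of the interactions alone, and one constant serves all supplies. -/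
theorem exists_supply (hZ : ∀ i a b, G.β i a b = 0 ↔ Z i a b) :
    ∃ C, ∀ φ, G.Approximates φ → Supply Z φ C := by
  have h1 : ∀ p : Param d A, ∃ C : ℕ, G.val p + 1 ≤ C := fun p => exists_nat_ge _
  have h2 : ∀ p : Param d A, ∃ C : ℕ, Nonvanishing Z p → ∀ k, C ≤ k → 3 ≤ 2 ^ k * G.val p := by
    intro p
    by_cases hp : Nonvanishing Z p
    · have hv := val_pos_of_nonvanishing hZ hp
      obtain ⟨C, hC⟩ := pow_unbounded_of_one_lt (3 / G.val p) (one_lt_two (α := ℝ))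
      refine ⟨C, fun _ k hk => ?_⟩
      rw [div_lt_iff₀ hv] at hC
      have : (2 : ℝ) ^ C ≤ 2 ^ k := pow_le_pow_right₀ one_le_two hk
      nlinarith
    · exact ⟨0, fun h => absurd h hp⟩
  choose C1 hC1 using h1
  choose C2 hC2 using h2
  refine ⟨∑ p, C1 p + ∑ p, C2 p, fun φ hφ => ?_⟩
  have e1 : ∀ p, C1 p ≤ ∑ p, C1 p := fun p =>
    Finset.single_le_sum (fun _ _ => Nat.zero_le _) (Finset.mem_univ p)
  have e2 : ∀ p, C2 p ≤ ∑ p, C2 p := fun p =>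
    Finset.single_le_sum (fun _ _ => Nat.zero_le _) (Finset.mem_univ p)
  have hdef : deficit Z φ (∑ p, C2 p) = 0 := by
    rw [deficit_eq_zero_iff]
    intro p hp
    have h3 := hC2 p hp _ (e2 p)
    have h4 := (abs_le.1 (hφ.abs_sub_le p (∑ p, C2 p))).1
    have : (2 : ℝ) ≤ φ p (∑ p, C2 p) := by linarith
    exact_mod_cast this
  have hbase : basePrec Z φ ≤ ∑ p, C2 p := Nat.sInf_le hdef
  refine ⟨fun p k => ?_, hbase.trans (Nat.le_add_left _ _),
    Nat.sInf_mem (s := {k | deficit Z φ k = 0}) ⟨_, hdef⟩⟩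
  have h3 := (abs_le.1 (hφ.abs_sub_le p k)).2
  have h4 : (1 : ℝ) ≤ 2 ^ k := one_le_pow₀ one_le_two
  have h5 : (C1 p : ℝ) ≤ ((∑ p, C1 p + ∑ p, C2 p : ℕ) : ℝ) := by
    exact_mod_cast (e1 p).trans (Nat.le_add_right _ _)
  have h6 : (φ p k : ℝ) ≤ 2 ^ k * ((∑ p, C1 p + ∑ p, C2 p : ℕ) : ℝ) := by
    have := hC1 p
    have h7 : (2 : ℝ) ^ k * (G.val p + 1) ≤ 2 ^ k * ((∑ p, C1 p + ∑ p, C2 p : ℕ) : ℝ) :=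
      mul_le_mul_of_nonneg_left (this.trans h5) (by positivity)
    linarith
  exact_mod_cast h6

/-- The relative error of the approximations. -/
theorem pval_bound (hZ : ∀ i a b, G.β i a b = 0 ↔ Z i a b) (hφ : G.Approximates φ)
    (hb : deficit Z φ (basePrec Z φ) = 0) {n r : ℕ} (hr : precision Z φ n = basePrec Z φ + r)
    (p : Param d A) :
    (1 - (1 / 2 ^ r : ℝ)) * (2 ^ precision Z φ n * G.val p) ≤ pval Z φ n p ∧
      (pval Z φ n p : ℝ) ≤ (1 + (1 / 2 ^ r : ℝ)) * (2 ^ precision Z φ n * G.val p) := by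
  by_cases hp : Nonvanishing Z p
  · rw [pval, if_pos hp]
    have h1 := abs_le.1 (hφ.abs_sub_le p (precision Z φ n))
    have h2 := (abs_le.1 (hφ.abs_sub_le p (basePrec Z φ))).2
    have h3 : (2 : ℝ) ≤ φ p (basePrec Z φ) := by
      exact_mod_cast (deficit_eq_zero_iff _).1 hb p hp
    -- At the base precision the scaled parameter is at least 1, so r bits later the absolute error
    -- 1 is at most the fraction 2^(-r) of it.
    have h4 : 1 ≤ (1 / 2 ^ r : ℝ) * (2 ^ precision Z φ n * G.val p) := by
      rw [hr, pow_add]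
      have : (1 / 2 ^ r : ℝ) * (2 ^ basePrec Z φ * 2 ^ r * G.val p) =
          2 ^ basePrec Z φ * G.val p := by field_simp
      rw [this]
      linarith
    constructor <;> linarith
  · rw [pval, if_neg hp, val_eq_zero_of_vanishing hZ hp]
    simp

theorem gw_bound (hZ : ∀ i a b, G.β i a b = 0 ↔ Z i a b) (hφ : G.Approximates φ)
    (hb : deficit Z φ (basePrec Z φ) = 0) {n r : ℕ} (hr : precision Z φ n = basePrec Z φ + r)
    (Q : Finset (Site d)) : ∃ κ > (0 : ℝ), ∀ x : Site d → A,
    (1 - (1 / 2 ^ r : ℝ)) ^ ((d + 1) * #Q) * (κ * gw G.γ G.β Q x) ≤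
        (gw (gamApprox Z φ n) (betApprox Z φ n) Q x : ℕ) ∧
      ((gw (gamApprox Z φ n) (betApprox Z φ n) Q x : ℕ) : ℝ) ≤
        (1 + (1 / 2 ^ r : ℝ)) ^ ((d + 1) * #Q) * (κ * gw G.γ G.β Q x) := by
  set ρ : ℝ := 1 / 2 ^ r with hρdef
  have hρ : 0 ≤ ρ := by positivity
  have hρ' : ρ ≤ 1 := by
    rw [hρdef, div_le_one (by positivity)]
    exact one_le_pow₀ one_le_two
  set B : ℝ := 2 ^ precision Z φ n with hB
  have hB0 : 0 < B := by positivity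
  -- One factor 2^precision for each site and each edge inside `Q`. This does not depend on the
  -- configuration, so it cancels in all ratios.
  refine ⟨(∏ _v ∈ Q, B) * ∏ p ∈ (univ : Finset (Fin d)) ×ˢ Q,
    if p.2 + unitVec p.1 ∈ Q then B else 1, ?_, fun x => ?_⟩
  · refine mul_pos (Finset.prod_pos fun _ _ => hB0) (Finset.prod_pos fun p _ => ?_)
    split_ifs
    exacts [hB0, one_pos]
  · have h1 := prod_approx Q (a := fun v => G.γ (x v)) (a' := fun v => gamApprox Z φ n (x v))
      (c := fun _ => B) hρ hρ' (fun v _ => (G.γ_pos _).le) (fun _ _ => hB0.le)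
      fun v _ => pval_bound hZ hφ hb hr (.inl (x v))
    have h2 := prod_approx ((univ : Finset (Fin d)) ×ˢ Q)
      (a := fun p => if p.2 + unitVec p.1 ∈ Q then G.β p.1 (x p.2) (x (p.2 + unitVec p.1)) else 1)
      (a' := fun p => if p.2 + unitVec p.1 ∈ Q then
        (betApprox Z φ n p.1 (x p.2) (x (p.2 + unitVec p.1)) : ℝ) else 1)
      (c := fun p => if p.2 + unitVec p.1 ∈ Q then B else 1) hρ hρ'
      (fun p _ => by
        split_ifs
        exacts [G.β_nonneg _ _ _, zero_le_one])
      (fun p _ => by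
        split_ifs
        exacts [hB0.le, zero_le_one])
      (fun p _ => by
        split_ifs
        · exact pval_bound hZ hφ hb hr (.inr (p.1, x p.2, x (p.2 + unitVec p.1)))
        · constructor <;> linarith)
    have e1 : ((gw (gamApprox Z φ n) (betApprox Z φ n) Q x : ℕ) : ℝ) =
        (∏ v ∈ Q, (gamApprox Z φ n (x v) : ℝ)) * ∏ p ∈ (univ : Finset (Fin d)) ×ˢ Q,
          if p.2 + unitVec p.1 ∈ Q then
            (betApprox Z φ n p.1 (x p.2) (x (p.2 + unitVec p.1)) : ℝ) else 1 := by
      rw [gw, Finset.prod_product]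
      push_cast
      rfl
    have e2 : gw G.γ G.β Q x = (∏ v ∈ Q, G.γ (x v)) * ∏ p ∈ (univ : Finset (Fin d)) ×ˢ Q,
          if p.2 + unitVec p.1 ∈ Q then G.β p.1 (x p.2) (x (p.2 + unitVec p.1)) else 1 := by
      rw [gw, Finset.prod_product]
    have hcard : #((univ : Finset (Fin d)) ×ˢ Q) = d * #Q := by simp
    rw [hcard] at h2
    set g := ∏ v ∈ Q, G.γ (x v)
    set b := ∏ p ∈ (univ : Finset (Fin d)) ×ˢ Q,
          if p.2 + unitVec p.1 ∈ Q then G.β p.1 (x p.2) (x (p.2 + unitVec p.1)) else 1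
    set g' := ∏ v ∈ Q, (gamApprox Z φ n (x v) : ℝ)
    set b' := ∏ p ∈ (univ : Finset (Fin d)) ×ˢ Q, if p.2 + unitVec p.1 ∈ Q then
            (betApprox Z φ n p.1 (x p.2) (x (p.2 + unitVec p.1)) : ℝ) else 1
    set cg := ∏ _v ∈ Q, B
    set cb := ∏ p ∈ (univ : Finset (Fin d)) ×ˢ Q, if p.2 + unitVec p.1 ∈ Q then B else 1
    have hg0 : 0 ≤ g := Finset.prod_nonneg fun v _ => (G.γ_pos _).le
    have hcg0 : 0 ≤ cg := Finset.prod_nonneg fun v _ => hB0.le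
    have hb0 : 0 ≤ b := Finset.prod_nonneg fun p _ => by
      split_ifs
      exacts [G.β_nonneg _ _ _, zero_le_one]
    have hcb0 : 0 ≤ cb := Finset.prod_nonneg fun p _ => by
      split_ifs
      exacts [hB0.le, zero_le_one]
    have hg0' : 0 ≤ g' := Finset.prod_nonneg fun v _ => Nat.cast_nonneg _
    have hb0' : 0 ≤ b' := Finset.prod_nonneg fun p _ => by
      split_ifs
      exacts [Nat.cast_nonneg _, zero_le_one]
    have hm : 0 ≤ 1 - ρ := by linarith
    rw [e1, e2, add_mul, one_mul, pow_add, pow_add]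
    constructor
    · refine le_trans (le_of_eq ?_) (mul_le_mul h1.1 h2.1 (by positivity) hg0')
      ring
    · refine (mul_le_mul h1.2 h2.2 hb0' (by positivity)).trans (le_of_eq ?_)
      ring

variable [Nonempty A]

theorem approximate_wt (hA : 2 ≤ cap d (Fintype.card A) 0)
    (hZ : ∀ i a b, G.β i a b = 0 ↔ Z i a b) (hφ : G.Approximates φ)
    (hb : deficit Z φ (basePrec Z φ) = 0) (n : ℕ) :
    Approximate (cap d (Fintype.card A) n) (codeWt n G.γ G.β) (castWt (wt Z φ n)) := by
  set E := cap d (Fintype.card A) n with hEdef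
  have hE : 2 ≤ E := hA.trans (cap_mono Fintype.card_pos (Nat.zero_le n))
  set T := side n ^ d with hT
  set r := 8 * (d + 1) * T * E ^ 2 with hr
  set N := (d + 1) * T with hN
  have hcard : #(cube d (n + 1)) = T := by
    rw [card_cube, hT, side]
    ring
  obtain ⟨κ, hκ, H⟩ := gw_bound hZ hφ hb (r := r) (n := n) rfl (cube d (n + 1))
  rw [hcard] at H
  set ρ : ℝ := 1 / 2 ^ r with hρdef
  have hρ : 0 ≤ ρ := by positivity
  have hE' : (2 : ℝ) ≤ E := by exact_mod_cast hE
  have hT0 : 0 < T := pow_pos (by unfold side; omega) _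
  have hN0 : 1 ≤ N := Nat.mul_pos (by omega) hT0
  have hN0' : (1 : ℝ) ≤ N := by exact_mod_cast hN0
  -- The number of extra bits was chosen so that already r, and a fortiori 2^r, exceeds 2NE².
  have hNρ : 2 * (N * ρ) ≤ 1 / (E : ℝ) ^ 2 := by
    have h1 : 2 * N * E ^ 2 ≤ 2 ^ r := by
      refine le_trans ?_ Nat.lt_two_pow_self.le
      rw [hr, hN]
      nlinarith [Nat.zero_le ((d + 1) * T * E ^ 2)]
    have h2 : 2 * (N : ℝ) * (E : ℝ) ^ 2 ≤ 2 ^ r := by exact_mod_cast h1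
    rw [hρdef, mul_one_div, ← mul_div_assoc, div_le_div_iff₀ (by positivity) (by positivity)]
    linarith
  have hθ : 1 / (E : ℝ) ^ 2 ≤ 1 / 4 := (Approximate.theta_le hE).2
  have hρN : ρ ≤ N * ρ := le_mul_of_one_le_left hρ hN0'
  have hl : 1 - 1 / (E : ℝ) ^ 2 ≤ (1 - ρ) ^ N := by
    have := one_sub_mul_le_pow (show ρ ≤ 1 by linarith) N
    linarith
  have hu : (1 + ρ) ^ N ≤ 1 + 1 / (E : ℝ) ^ 2 := by
    have := pow_le_one_add_mul hρ (N := N) (by linarith) (by linarith)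
    linarith
  refine ⟨fun e g => codeWt_nonneg e g, κ, hκ, fun e g he => ?_⟩
  rw [castWt, wt_eq_codeWt he, codeWt, codeWt]
  push_cast
  simp only [Finset.mul_sum]
  constructor
  · refine Finset.sum_le_sum fun y _ => ?_
    split_ifs
    · refine le_trans (mul_le_mul_of_nonneg_right hl ?_) (H (extendConfig y)).1
      exact mul_nonneg hκ.le (gw_nonneg G _ _)
    · simp
  · refine Finset.sum_le_sum fun y _ => ?_
    split_ifs
    · refine (H (extendConfig y)).2.trans (mul_le_mul_of_nonneg_right hu ?_)
      exact mul_nonneg hκ.le (gw_nonneg G _ _)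
    · simp

end Approximation

end GibbsEntropy

namespace GibbsEntropy
open Finset MeasureTheory
open Real (negMulLog)

/-! ### Bounds for the entropy -/

theorem two_pow_le_cap {d q : ℕ} (hd : 2 ≤ d) (hq : 2 ≤ q) (n : ℕ) : 2 ^ n ≤ cap d q n := by
  have h1 : side n ≤ layer d n := Nat.le_self_pow (by omega) _
  have h2 : n ≤ (2 * d + 2) * layer d n := by
    have : n ≤ side n := by unfold side; omega
    exact (this.trans h1).trans (Nat.le_mul_of_pos_left _ (by omega))
  exact (Nat.pow_le_pow_right (by omega) h2).trans (Nat.pow_le_pow_left hq _)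

theorem sqrt_mul_exp_le {C x y : ℝ} (hC : 0 ≤ C) (h : x ≤ 2 * y) :
    √(C * Real.exp x) ≤ √C * Real.exp y := by
  rw [Real.sqrt_mul hC, ← Real.exp_half]
  exact mul_le_mul_of_nonneg_left (Real.exp_le_exp.2 (by linarith)) (Real.sqrt_nonneg _)

/-- The summands are, in order, the influence of the outer near past on the entropy, the influence
of the faces on the inner near past, the oscillation of the conditional probabilities, and the
numerical error. -/
theorem exists_rate (d q : ℕ) {C α : ℝ} (hC : 0 < C) (hα : 0 < α) :
    ∃ c > (0 : ℝ), ∃ N : ℕ, ∀ n ≥ N, ∀ E : ℕ, 2 ^ n ≤ E →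
      q * (2 * √(C * Real.exp (-α * (n / 2 + 1 : ℕ)))) +
        q * ((2 * (n / 2) + 1 : ℕ) ^ d * (q * (C * Real.exp (-α * (n + 1 - n / 2 : ℕ))))) +
        q * (2 * √(C * Real.exp (-α * (n + 1 : ℕ)))) + 50 * q / E ≤ Real.exp (-c * n) := by
  -- Halving the radius and taking a square root each cost a factor 2 in the rate; 1/2 is below log
  -- 2, for the numerical error.
  set c := min (α / 4) (1 / 2) with hc
  have hc0 : 0 < c := lt_min (by positivity) (by norm_num)
  have hcα : c ≤ α / 4 := min_le_left _ _
  have hc2 : c ≤ 1 / 2 := min_le_right _ _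
  set K : ℝ := q * (2 * √C) + q * (q * C) + q * (2 * √C) + 50 * q with hK
  have hK0 : 0 ≤ K := by positivity
  have main : ∀ n E : ℕ, 2 ^ n ≤ E →
      q * (2 * √(C * Real.exp (-α * (n / 2 + 1 : ℕ)))) +
        q * ((2 * (n / 2) + 1 : ℕ) ^ d * (q * (C * Real.exp (-α * (n + 1 - n / 2 : ℕ))))) +
        q * (2 * √(C * Real.exp (-α * (n + 1 : ℕ)))) + 50 * q / E ≤
        K * ((n + 1 : ℝ) ^ d * Real.exp (-c * n)) := by
    intro n E hE
    have hn0 : (0 : ℝ) ≤ n := Nat.cast_nonneg n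
    set P : ℝ := (n + 1 : ℝ) ^ d with hP
    have hP1 : 1 ≤ P := one_le_pow₀ (by linarith)
    set X := Real.exp (-c * n) with hX
    have hX0 : 0 < X := Real.exp_pos _
    have hXP : X ≤ P * X := le_mul_of_one_le_left hX0.le hP1
    have half : (n : ℝ) ≤ 2 * ((n / 2 + 1 : ℕ) : ℝ) := by
      exact_mod_cast (by omega : n ≤ 2 * (n / 2 + 1))
    have half' : (n : ℝ) ≤ 2 * ((n + 1 - n / 2 : ℕ) : ℝ) := by
      exact_mod_cast (by omega : n ≤ 2 * (n + 1 - n / 2))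
    have full : (n : ℝ) ≤ ((n + 1 : ℕ) : ℝ) := by exact_mod_cast Nat.le_succ n
    have b1 : √(C * Real.exp (-α * (n / 2 + 1 : ℕ))) ≤ √C * (P * X) :=
      (sqrt_mul_exp_le hC.le (y := -c * n) (by nlinarith)).trans
        (mul_le_mul_of_nonneg_left hXP (Real.sqrt_nonneg _))
    have b3 : √(C * Real.exp (-α * (n + 1 : ℕ))) ≤ √C * (P * X) :=
      (sqrt_mul_exp_le hC.le (y := -c * n) (by nlinarith)).trans
        (mul_le_mul_of_nonneg_left hXP (Real.sqrt_nonneg _))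
    have b2 : ((2 * (n / 2) + 1 : ℕ) : ℝ) ^ d * (q * (C * Real.exp (-α * (n + 1 - n / 2 : ℕ)))) ≤
        q * C * (P * X) := by
      have e1 : ((2 * (n / 2) + 1 : ℕ) : ℝ) ^ d ≤ P := by
        refine pow_le_pow_left₀ (Nat.cast_nonneg _) ?_ d
        exact_mod_cast (by omega : 2 * (n / 2) + 1 ≤ n + 1)
      have e2 : Real.exp (-α * (n + 1 - n / 2 : ℕ)) ≤ X := Real.exp_le_exp.2 (by nlinarith)
      calc _ ≤ P * (q * (C * X)) := by gcongr
        _ = _ := by ring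
    have b4 : 50 * (q : ℝ) / E ≤ 50 * q * (P * X) := by
      have hE' : Real.exp (n / 2) ≤ E := by
        have h1 : ((2 ^ n : ℕ) : ℝ) ≤ E := by exact_mod_cast hE
        refine le_trans ?_ h1
        rw [Nat.cast_pow, Nat.cast_ofNat, ← Real.rpow_natCast,
          Real.rpow_def_of_pos (by norm_num : (0 : ℝ) < 2)]
        refine Real.exp_le_exp.2 ?_
        have := Real.log_two_gt_d9
        nlinarith
      have h2 : (1 : ℝ) / E ≤ X := by
        rw [hX, show -c * (n : ℝ) = -(c * n) by ring, Real.exp_neg, ← one_div]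
        refine one_div_le_one_div_of_le (Real.exp_pos _) (le_trans (Real.exp_le_exp.2 ?_) hE')
        nlinarith
      rw [← mul_one_div]
      exact mul_le_mul_of_nonneg_left (h2.trans hXP) (by positivity)
    have hq0 : (0 : ℝ) ≤ q := Nat.cast_nonneg q
    have b1' := mul_le_mul_of_nonneg_left b1 hq0
    have b2' := mul_le_mul_of_nonneg_left b2 hq0
    have b3' := mul_le_mul_of_nonneg_left b3 hq0
    rw [hK]
    nlinarith
  have hr0 : 0 < Real.exp (-(c / 2)) := Real.exp_pos _
  have hr1 : Real.exp (-(c / 2)) < 1 := Real.exp_lt_one_iff.2 (by linarith)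
  have ht := (tendsto_pow_const_mul_const_pow_of_abs_lt_one d
    (show |Real.exp (-(c / 2))| < 1 by rwa [abs_of_pos hr0])).const_mul (K * 2 ^ d)
  rw [mul_zero] at ht
  obtain ⟨N, hN⟩ := Filter.eventually_atTop.1 (ht.eventually (eventually_le_nhds zero_lt_one))
  -- Half of the rate absorbs the constant and the polynomial factor (n+1)^d.
  refine ⟨c / 2, by positivity, N + 1, fun n hn E hE => (main n E hE).trans ?_⟩
  have h1 := hN n (by omega)
  have hn1 : (1 : ℝ) ≤ n := by exact_mod_cast (by omega : 1 ≤ n)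
  have h2 : ((n : ℝ) + 1) ^ d ≤ 2 ^ d * (n : ℝ) ^ d := by
    rw [← mul_pow]
    exact pow_le_pow_left₀ (by positivity) (by linarith) d
  have h3 : Real.exp (-(c / 2)) ^ n = Real.exp (-(c / 2) * n) := by
    rw [← Real.exp_nat_mul]
    ring_nf
  have h4 : Real.exp (-c * n) = Real.exp (-(c / 2) * n) * Real.exp (-(c / 2) * n) := by
    rw [← Real.exp_add]
    ring_nf
  rw [h3] at h1
  have h5 := Real.exp_pos (-(c / 2) * n)
  calc K * (((n : ℝ) + 1) ^ d * Real.exp (-c * n))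
      ≤ K * (2 ^ d * (n : ℝ) ^ d * Real.exp (-c * n)) := by gcongr
    _ = K * 2 ^ d * ((n : ℝ) ^ d * Real.exp (-(c / 2) * n)) * Real.exp (-(c / 2) * n) := by
      rw [h4]
      ring
    _ ≤ 1 * Real.exp (-(c / 2) * n) := by gcongr
    _ = _ := one_mul _

section Main

variable {d : ℕ} {A : Type u} [Fintype A] [Nontrivial A] [MeasurableSpace A]
  [MeasurableSingletonClass A] {Z : Fin d → A → A → Prop} {G : Interactions d A}
  {μ : Measure (Site d → A)}

-- Faces with positive probability have positive weight, and the others have coefficient 0, so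
-- comparisons are needed only for the faces that the algorithm considers.
omit [Nontrivial A] in
theorem sum_faceLaw_mul_le [Nonempty A] [IsProbabilityMeasure μ] (hμ : G.IsGibbs μ) {n : ℕ}
    {F F' : ℕ → ℝ}
    (h : ∀ e < cap d (Fintype.card A) n,
      0 < wtFace (Fintype.card A) (cap d (Fintype.card A) n) (codeWt n G.γ G.β) e → F e ≤ F' e) :
    ∑ e ∈ range (cap d (Fintype.card A) n), faceLaw μ n e * F e ≤
      ∑ e ∈ range (cap d (Fintype.card A) n), faceLaw μ n e * F' e := by
  refine Finset.sum_le_sum fun e he => ?_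
  rcases (measureReal_nonneg (μ := μ) (s := {x | faceOf n x = e})).eq_or_lt with h0 | h0
  · have h0' : faceLaw μ n e = 0 := h0.symm
    rw [h0', zero_mul, zero_mul]
  · exact mul_le_mul_of_nonneg_left
      (h e (Finset.mem_range.1 he) (wtFace_pos_of_faceLaw_pos hμ h0)) h0.le

/-- The algorithm computes bounds for the entropy, with exponential accuracy. -/
theorem exists_entropy_bounds (hd : 2 ≤ d) (hZ : ∀ i a b, G.β i a b = 0 ↔ Z i a b) (hG : G.SSM)
    (hμ : G.IsGibbs μ) :
    ∃ h, HasEntropy μ h ∧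
      (∀ φ, G.Approximates φ → ∀ n, (lowerOut Z φ n : ℝ) / denOut d A n ≤ h ∧
        h ≤ (upperOut Z φ n : ℝ) / denOut d A n) ∧
      ∃ c > (0 : ℝ), ∃ N : ℕ, ∀ φ, G.Approximates φ → ∀ n ≥ N,
        (upperOut Z φ n : ℝ) / denOut d A n - (lowerOut Z φ n : ℝ) / denOut d A n ≤
          Real.exp (-c * n) := by
  have := hμ.isProbability
  obtain ⟨C, hC, α, hα, hmix⟩ := hG.lattice
  replace hmix : G.Mixing C α := hmix
  set q := Fintype.card A with hqdef
  have hq2 : 2 ≤ q := Fintype.one_lt_card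
  have hq1 : 1 ≤ q := by omega
  have hE2 : ∀ n, 2 ≤ cap d q n := fun n => by
    have h1 := side_le_cap hd hq2 n
    have : 3 ≤ side n := by unfold side; omega
    omega
  have hE0 : ∀ n, (0 : ℝ) < (cap d q n : ℝ) := fun n => by
    have := hE2 n
    exact_mod_cast (by omega : 0 < cap d q n)
  -- The actual oscillation and not its mixing bound: the former is what the algorithm can estimate,
  -- the latter involves unknown constants and serves only to prove convergence.
  set ε : ℕ → ℝ := fun n => condOsc q (cap d q n) (codeWt n G.γ G.β) with hε
  set L : ℕ → ℝ := fun n => condEnt μ (fun x : Site d → A => x 0) (codes n) with hL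
  have hεle : ∀ n, ε n ≤ C * Real.exp (-α * (n + 1 : ℕ)) := fun n =>
    condOsc_le (by positivity) fun e e' f x _ _ _ hx h h' => hmix.cond_le hx h h'
  obtain ⟨h, hent, hbd⟩ := HasEntropy.exists_of_bounds hμ.stationary
    (L := L) (U := fun n => L n + q * (2 * √(ε n)))
    (fun n B hB => hμ.le_siteEnt hB)
    (fun n B _ hB' => hμ.siteEnt_le hB' fun e e' f x he he' hf hx h h' =>
      le_condOsc codeWt_nonneg he he' hf hx h h')
    (fun t ht => by
      obtain ⟨c, hc, N, hN⟩ := exists_rate d q hC hα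
      have h1 : Filter.Tendsto (fun n : ℕ => Real.exp (-c * n)) Filter.atTop (nhds 0) := by
        refine Real.tendsto_exp_atBot.comp ?_
        exact (Filter.tendsto_const_mul_atBot_of_neg (by linarith)).2 tendsto_natCast_atTop_atTop
      obtain ⟨n, hn1, hn2⟩ := ((h1.eventually (eventually_lt_nhds ht)).and
        (Filter.eventually_ge_atTop N)).exists
      refine ⟨n, ?_⟩
      rw [add_sub_cancel_left]
      refine lt_of_le_of_lt (le_trans ?_ (hN n hn2 _ (two_pow_le_cap hd hq2 n))) hn1
      have h3 := Real.sqrt_le_sqrt (hεle n)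
      have h4 : (q : ℝ) * (2 * √(ε n)) ≤ q * (2 * √(C * Real.exp (-α * (n + 1 : ℕ)))) := by
        gcongr
      refine h4.trans ?_
      have h5 : 0 ≤ 50 * (q : ℝ) / cap d q n := by positivity
      have h6 : 0 ≤ (q : ℝ) * (2 * √(C * Real.exp (-α * (n / 2 + 1 : ℕ)))) := by positivity
      have h7 : 0 ≤ (q : ℝ) * ((2 * (n / 2) + 1 : ℕ) ^ d *
        (q * (C * Real.exp (-α * (n + 1 - n / 2 : ℕ))))) := by positivity
      linarith)
  obtain ⟨C₁, hsup⟩ := exists_supply hZ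
  have happ : ∀ φ, G.Approximates φ → ∀ n,
      Approximate (cap d q n) (codeWt n G.γ G.β) (castWt (wt Z φ n)) := fun φ hφ n =>
    approximate_wt (hE2 0) hZ hφ (hsup φ hφ).base_spec n
  have hden : ∀ n, ((denOut d A n : ℕ) : ℝ) = (cap d q n : ℝ) ^ 2 := fun n => by
    rw [denOut]
    push_cast
    rfl
  have hmean : ∀ n, ∀ b : ℝ,
      ∑ e ∈ range (cap d q n), faceLaw μ n e * b = b := fun n b => by
    rw [← Finset.sum_mul, sum_faceLaw, one_mul]
  have hLform : ∀ n, L n = ∑ e ∈ range (cap d q n), faceLaw μ n e *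
      faceEnt q (cap d q n) (codeWt n G.γ G.β) e := fun n => condEnt_codes hμ
  refine ⟨h, hent, fun φ hφ n => ⟨?_, ?_⟩, ?_⟩
  · rw [hden, div_le_iff₀ (by have := hE0 n; positivity)]
    have h1 : (lowerOut Z φ n : ℝ) ≤ (cap d q n : ℝ) ^ 2 * L n := by
      rw [hLform, Finset.mul_sum, ← hmean n (lowerOut Z φ n)]
      refine (sum_faceLaw_mul_le hμ fun e he hp =>
        (happ φ hφ n).lowerBd_le hq1 (hE2 n) he hp).trans (le_of_eq ?_)
      exact Finset.sum_congr rfl fun e _ => by ring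
    have h2 := mul_le_mul_of_nonneg_left (hbd n).1 (sq_nonneg (cap d q n : ℝ))
    linarith
  · rw [hden, le_div_iff₀ (by have := hE0 n; positivity)]
    have h1 : (cap d q n : ℝ) ^ 2 * (L n + q * (2 * √(ε n))) ≤ upperOut Z φ n := by
      rw [hLform, ← hmean n (q * (2 * √(ε n))), ← hmean n (upperOut Z φ n),
        ← Finset.sum_add_distrib, Finset.mul_sum]
      refine le_trans (le_of_eq ?_) (sum_faceLaw_mul_le hμ fun e he hp =>
        (happ φ hφ n).le_upperBd hq1 (hE2 n) he hp)
      exact Finset.sum_congr rfl fun e _ => by ring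
    have h2 := mul_le_mul_of_nonneg_left (hbd n).2 (sq_nonneg (cap d q n : ℝ))
    linarith
  · obtain ⟨c, hc, N, hN⟩ := exists_rate d q hC hα
    refine ⟨c, hc, N, fun φ hφ n hn => ?_⟩
    -- Otherwise every face would have probability zero, while their probabilities add up to 1.
    obtain ⟨e₀, he₀, hp₀⟩ : ∃ e < cap d q n, 0 < wtFace q (cap d q n) (codeWt n G.γ G.β) e := by
      by_contra hc
      push Not at hc
      have h1 := sum_faceLaw_mul_le hμ (n := n) (F := fun _ => 1) (F' := fun _ => 0)
        fun e he hp => absurd hp (not_lt.2 (hc e he))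
      rw [hmean, hmean] at h1
      exact absurd h1 (by norm_num)
    have h1 := (happ φ hφ n).upperBd_sub_lowerBd_le hq1 (hE2 n) he₀ hp₀
      fun e e' he he' hp hp' => hmix.abs_faceEnt_sub_le hC (Nat.div_le_self n 2) hp hp'
    refine le_trans ?_ (hN n hn _ (two_pow_le_cap hd hq2 n))
    have hEp := hE0 n
    rw [← sub_div, hden, div_le_iff₀ (by positivity)]
    refine h1.trans ?_
    have h3 := Real.sqrt_le_sqrt (hεle n)
    have h4 : (q : ℝ) * (2 * √(ε n)) ≤ q * (2 * √(C * Real.exp (-α * (n + 1 : ℕ)))) := by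
      gcongr
    have h5 : 50 * (q : ℝ) / cap d q n * (cap d q n : ℝ) ^ 2 = 50 * q * cap d q n := by
      field_simp
    rw [add_mul, h5]
    have h6 := mul_le_mul_of_nonneg_left h4 (sq_nonneg (cap d q n : ℝ))
    simp only [hε] at h6
    nlinarith

end Main

/-! ### Time as a function of the parameter and of the accuracy -/

/-- The logarithm of `cap` is proportional to the number of sites of a layer, hence of order
n^(d-1), which is at most n^((d-1)²) for n ≥ 1. -/
theorem cap_time {d q : ℕ} (hq : 1 ≤ q) (C c : ℕ) : ∃ K : ℝ, ∀ n : ℕ, 1 ≤ n →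
    ((C + cap d q n + 2 : ℕ) : ℝ) ^ c ≤ Real.exp (K * (n : ℝ) ^ ((d - 1) ^ 2)) := by
  have hq' : (0 : ℝ) < q := by exact_mod_cast hq
  have hlq : 0 ≤ Real.log q := Real.log_nonneg (by exact_mod_cast hq)
  have hC : (0 : ℝ) < C + 3 := by positivity
  have hlC : 0 ≤ Real.log (C + 3) := Real.log_nonneg (by
    have : (0 : ℝ) ≤ C := Nat.cast_nonneg C
    linarith)
  refine ⟨c * (Real.log (C + 3) + (2 * d + 2) * 5 ^ (d - 1) * Real.log q), fun n hn => ?_⟩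
  have hn' : (1 : ℝ) ≤ n := by exact_mod_cast hn
  set X := (n : ℝ) ^ ((d - 1) ^ 2) with hX
  have hX1 : 1 ≤ X := one_le_pow₀ hn'
  have h1 : (layer d n : ℝ) ≤ 5 ^ (d - 1) * X := by
    have e1 : (side n : ℝ) ≤ 5 * n := by
      unfold side
      push_cast
      linarith
    have e2 : (n : ℝ) ^ (d - 1) ≤ X := pow_le_pow_right₀ hn' (Nat.le_self_pow two_ne_zero _)
    calc (layer d n : ℝ) = (side n : ℝ) ^ (d - 1) := by rw [layer]; push_cast; rfl
      _ ≤ (5 * n) ^ (d - 1) := pow_le_pow_left₀ (Nat.cast_nonneg _) e1 _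
      _ = 5 ^ (d - 1) * (n : ℝ) ^ (d - 1) := mul_pow _ _ _
      _ ≤ _ := by gcongr
  have h2 : (cap d q n : ℝ) = Real.exp ((2 * d + 2) * layer d n * Real.log q) := by
    rw [cap]
    push_cast
    rw [← Real.rpow_natCast, Real.rpow_def_of_pos hq', mul_comm]
    push_cast
    rfl
  have h3 : (1 : ℝ) ≤ cap d q n := by exact_mod_cast cap_pos (d := d) (n := n) hq
  have h4 : ((C + cap d q n + 2 : ℕ) : ℝ) ≤ Real.exp ((Real.log (C + 3) +
      (2 * d + 2) * 5 ^ (d - 1) * Real.log q) * X) := by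
    have e1 : ((C + cap d q n + 2 : ℕ) : ℝ) ≤ (C + 3) * cap d q n := by
      push_cast
      have : (0 : ℝ) ≤ C := Nat.cast_nonneg C
      nlinarith
    refine e1.trans ?_
    rw [h2]
    nth_rw 1 [← Real.exp_log hC]
    rw [← Real.exp_add]
    refine Real.exp_le_exp.2 ?_
    have e2 : Real.log (C + 3) ≤ Real.log (C + 3) * X := le_mul_of_one_le_right hlC hX1
    have e3 : (2 * (d : ℝ) + 2) * layer d n * Real.log q ≤
        (2 * d + 2) * (5 ^ (d - 1) * X) * Real.log q := by gcongr
    linarith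
  calc ((C + cap d q n + 2 : ℕ) : ℝ) ^ c ≤ _ := pow_le_pow_left₀ (Nat.cast_nonneg _) h4 c
    _ = _ := by
      rw [← Real.exp_nat_mul]
      ring_nf

/-- In dimension two the capacity grows exponentially in the parameter, hence polynomially in
the required accuracy. -/
theorem cap_two_le {q : ℕ} (hq : 1 ≤ q) {c : ℝ} (hc : 0 < c) (N : ℕ) :
    ∃ K r : ℕ, ∀ k : ℕ, 1 ≤ k → cap 2 q (N + ⌈Real.log k / c⌉₊) ≤ K * k ^ r := by
  have hq' : (0 : ℝ) < q := by exact_mod_cast hq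
  have hlq : 0 ≤ Real.log q := Real.log_nonneg (by exact_mod_cast hq)
  -- In dimension 2 the exponent of q is 6(2(N+m)+3) = 12N + 18 + 12m; the remaining 12 in 6(2N+5)
  -- pays for rounding m up.
  refine ⟨q ^ (6 * (2 * N + 5)), ⌈12 * Real.log q / c⌉₊, fun k hk => ?_⟩
  have hk' : (1 : ℝ) ≤ k := by exact_mod_cast hk
  have hlk : 0 ≤ Real.log k := Real.log_nonneg hk'
  set m := ⌈Real.log k / c⌉₊ with hm
  have h1 : (m : ℝ) ≤ Real.log k / c + 1 := (Nat.ceil_lt_add_one (by positivity)).le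
  have hexp : (2 * 2 + 2) * (2 * (N + m) + 3) ^ (2 - 1) = 12 * N + 18 + 12 * m := by
    norm_num
    ring
  have key : ((cap 2 q (N + m) : ℕ) : ℝ) ≤
      ((q ^ (6 * (2 * N + 5)) * k ^ ⌈12 * Real.log q / c⌉₊ : ℕ) : ℝ) := by
    rw [cap, layer, side, hexp]
    push_cast
    rw [← Real.rpow_natCast, ← Real.rpow_natCast (q : ℝ), ← Real.rpow_natCast (k : ℝ),
      Real.rpow_def_of_pos hq', Real.rpow_def_of_pos hq',
      Real.rpow_def_of_pos (show (0 : ℝ) < k by linarith), ← Real.exp_add]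
    refine Real.exp_le_exp.2 ?_
    have h3 : Real.log k * (12 * Real.log q / c) ≤ Real.log k * ⌈12 * Real.log q / c⌉₊ :=
      mul_le_mul_of_nonneg_left (Nat.le_ceil _) hlk
    have h4 : Real.log q * (12 * m) ≤ Real.log q * (12 * (Real.log k / c + 1)) := by gcongr
    have h5 : Real.log q * (12 * (Real.log k / c + 1)) =
        Real.log k * (12 * Real.log q / c) + 12 * Real.log q := by
      field_simp
    push_cast
    linarith
  exact_mod_cast key

end GibbsEntropy

open GibbsEntropy
theorem corollary4p2 {d : ℕ} (hd : 2 ≤ d) {A : Type u} [Fintype A] [Nontrivial A]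
    [MeasurableSpace A] [MeasurableSingletonClass A]
    (Z : Fin d → A → A → Prop) :
    ∃ M M' : BoundAlg (Param d A),
      ∀ G : Interactions d A, (∀ i a b, G.β i a b = 0 ↔ Z i a b) → G.SSM →
      ∀ μ : MeasureTheory.Measure (Site d → A), G.IsGibbs μ →
      ∃ h : ℝ, HasEntropy μ h ∧
        (∃ c > (0 : ℝ), ∃ K : ℝ, ∃ N : ℕ, ∀ φ, G.Approximates φ → ∀ n : ℕ,
          ∃ a b q t : ℕ, M.Outputs φ n a b q t ∧ 0 < q ∧
            (a : ℝ) / q ≤ h ∧ h ≤ (b : ℝ) / q ∧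
            (N ≤ n → (b : ℝ) / q - (a : ℝ) / q ≤ Real.exp (-c * n) ∧
              (t : ℝ) ≤ Real.exp (K * (n : ℝ) ^ ((d - 1) ^ 2)))) ∧
        (d = 2 → ∃ K r : ℕ, ∀ φ, G.Approximates φ → ∀ k : ℕ, 1 ≤ k →
          ∃ a b q t : ℕ, M'.Outputs φ k a b q t ∧ 0 < q ∧
            (a : ℝ) / q ≤ h ∧ h ≤ (b : ℝ) / q ∧
            (b : ℝ) / q - (a : ℝ) / q ≤ 1 / (k : ℝ) ∧ t ≤ K * k ^ r) := by
  obtain ⟨M, M', c₀, hM, hM'⟩ := exists_algorithms hd Z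
  refine ⟨M, M', fun G hZ hG μ hμ => ?_⟩
  obtain ⟨h, hent, hbd, c, hc, N, hN⟩ := exists_entropy_bounds hd hZ hG hμ
  obtain ⟨C, hC⟩ := exists_supply hZ
  have hq : 1 ≤ Fintype.card A := Fintype.card_pos
  have hden : ∀ n, 0 < denOut d A n := fun n => pow_pos (cap_pos hq) 2
  refine ⟨h, hent, ?_, fun hd2 => ?_⟩
  · obtain ⟨K, hK⟩ := cap_time (d := d) hq C c₀
    -- The shift by one ensures n ≥ 1, which the time bound needs.
    refine ⟨c, hc, K, N + 1, fun φ hφ n => ?_⟩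
    obtain ⟨t, ht, hout⟩ := hM φ C n (hC φ hφ)
    refine ⟨_, _, _, t, hout, hden n, (hbd φ hφ n).1, (hbd φ hφ n).2, fun hn =>
      ⟨hN φ hφ n (by omega), le_trans ?_ (hK n (by omega))⟩⟩
    exact_mod_cast ht
  · subst hd2
    obtain ⟨K₁, r₁, hcap⟩ := cap_two_le hq hc N
    refine ⟨(C + K₁ + 3) ^ c₀, (r₁ + 1) * c₀, fun φ hφ k hk => ?_⟩
    have hk' : (0 : ℝ) < k := by exact_mod_cast hk
    -- Here e^(-cn) ≤ 1/k, so the test succeeds. This parameter depends on the unknown constants `N`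
    -- and `c` and only bounds the search; the program stops at the first success, where the test
    -- itself certifies the accuracy.
    set n := N + ⌈Real.log k / c⌉₊ with hn
    have gap_iff : ∀ n, gapTest Z φ k n = 0 ↔
        (upperOut Z φ n - lowerOut Z φ n) * k ≤ denOut 2 A n := fun n =>
      Nat.sub_eq_zero_iff_le
    have hsub : ∀ n, (lowerOut Z φ n : ℝ) ≤ upperOut Z φ n := fun n => by
      have h1 := (hbd φ hφ n).1.trans (hbd φ hφ n).2
      have h2 : (0 : ℝ) < denOut 2 A n := by exact_mod_cast hden n
      exact (div_le_div_iff_of_pos_right h2).1 h1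
    have gap : ∀ n, gapTest Z φ k n = 0 ↔
        (upperOut Z φ n : ℝ) / denOut 2 A n - (lowerOut Z φ n : ℝ) / denOut 2 A n ≤ 1 / k := by
      intro n
      have h2 : (0 : ℝ) < denOut 2 A n := by exact_mod_cast hden n
      rw [gap_iff, ← sub_div, div_le_div_iff₀ h2 hk', one_mul,
        ← Nat.cast_sub (Nat.cast_le.1 (hsub n))]
      exact_mod_cast Iff.rfl
    have hgap : gapTest Z φ k n = 0 := by
      rw [gap]
      refine (hN φ hφ n (Nat.le_add_right _ _)).trans ?_
      have h1 : Real.log k / c ≤ n := (Nat.le_ceil _).trans (by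
        rw [hn]
        push_cast
        linarith [(Nat.cast_nonneg N : (0 : ℝ) ≤ N)])
      rw [div_le_iff₀ hc] at h1
      rw [one_div, ← Real.exp_log (inv_pos.2 hk'), Real.log_inv]
      exact Real.exp_le_exp.2 (by linarith)
    obtain ⟨t, ht, hout⟩ := hM' φ C k n (hC φ hφ) hgap
    have hfirst : gapTest Z φ k (firstGood (gapTest Z) φ k) = 0 :=
      Nat.sInf_mem (s := {n | gapTest Z φ k n = 0}) ⟨n, hgap⟩
    refine ⟨_, _, _, t, hout, hden _, (hbd φ hφ _).1, (hbd φ hφ _).2, (gap _).1 hfirst,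
      ht.trans ?_⟩
    rw [pow_mul, ← mul_pow]
    refine Nat.pow_le_pow_left ?_ c₀
    have h1 := hcap k hk
    have h2 : 1 ≤ k ^ r₁ := Nat.one_le_pow _ _ hk
    have h3 : k ^ r₁ ≤ k ^ (r₁ + 1) := Nat.pow_le_pow_right hk (Nat.le_succ _)
    have h4 : k ≤ k ^ (r₁ + 1) := Nat.le_self_pow (Nat.succ_ne_zero _) _
    have h5 : K₁ * k ^ r₁ ≤ K₁ * k ^ (r₁ + 1) := Nat.mul_le_mul_left _ h3
    have h6 : C ≤ C * k ^ (r₁ + 1) := Nat.le_mul_of_pos_right _ (by omega)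
    calc C + cap 2 (Fintype.card A) n + k + 2
        ≤ C * k ^ (r₁ + 1) + K₁ * k ^ (r₁ + 1) + k ^ (r₁ + 1) + 2 * k ^ (r₁ + 1) := by
          have h7 := (hcap k hk).trans h5
          have h8 := h2.trans h3
          linarith [h7, h8, h4, h6]
      _ = (C + K₁ + 3) * k ^ (r₁ + 1) := by ring
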